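/- **Notation.** Let $N\ge 2$ and $K\ge 1$ be integers, $q=e^{2\pi i/(N+K)}$, $q^{x}=e^{2\pi i x/(N+K)}$ for $x\in\mathbb Q$, $[j]=\frac{q^{j/2}-q^{-j/2}}{q^{1/2}-q^{-1/2}}$ and $[n]!=[1]\cdots[n]$. *Hecke algebras.* For $n\ge 0$ let $H_n$ be the quotient of the group algebra $\mathbb C[B_n]$ of the braid group $B_n$ (with standard generators $\sigma_1,\dots,\sigma_{n-1}$) by the relations $q^{1/2N}\sigma_i-q^{-1/2N}\sigma_i^{-1}=q^{1/2}-q^{-1/2}$, and let $H_\infty=\varinjlim H_n$ (the same generators and relations with all $\sigma_i$, $i\ge 1$). Put $e_i=\frac{q-q^{(N+1)/2N}\sigma_i}{1+q}$, and let $*$ be the conjugate-linear anti-automorphism with $e_i^*=e_i$ (equivalently $\sigma_i^*=\sigma_i^{-1}$). A *Markov trace* with parameter $\eta$ is a linear functional $\mathrm{Tr}$ on $H_\infty$ with $\mathrm{Tr}(xy)=\mathrm{Tr}(yx)$, $\mathrm{Tr}(1)=1$ and $\mathrm{Tr}(xe_n)=\eta\,\mathrm{Tr}(x)$ for all $n\ge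 1$ and $x\in H_n$ (more precisely, in the image of $H_n$ in $H_\infty$). *Skeins.* The Hecke category $H$ has as objects finite sequences of signs; its space of morphisms $H(\alpha,\beta)$ is the skein module of $D^2\times[0,1]$ with boundary $\alpha$ at the bottom and $\beta$ at the top: the complex vector space spanned by diagrams of oriented framed tangles with coupons that have either $N$ incoming or $N$ outgoing bands, modulo isotopy and the following local relations: (i) $q^{1/2N}X_+-q^{-1/2N}X_-=(q^{1/2}-q^{-1/2})\,\mathrm{id}$ for a positive crossing $X_+$ and a negative crossing $X_-$ of two strands; (ii) a curl of writhe $\pm1$ is $q^{\pm(N^2-1)/2N}$ times a strand; (iii) a circle is $[N]$; (iv) an incoming coupon below an outgoing coupon is the antisymmetrizer $\frac{q^{N(N-1)/4}}{[N]!}\sum_{\pi\in S_N}(-q^{(1-N)/2N})^{\ell(\pi)}w_\pi$, where $w_\pi$ is the positive braid of $\pi$ and $\ell(\pi)$ its length; (v) an outgoing coupon joined to an incoming coupon by all $N$ bands is $1$. Let $n$ also denote the object with $n$ positive points. There is a canonical algebra homomorphism $H_n\to H(n,n)$ that sends $\sigma_i$ to the positive crossing of the strands $i$ and $i+1$. Closing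 up a skein gives a linear map $f\mapsto\hat f$, $H(n,n)\to H(0,0)$. Let $\mathcal N_n=\{f\in H(n,n)\mid \widehat{fg}=0\text{ for all }g\in H(n,n)\}$ be the space of negligible skeins, and $H^{SU(N)}_K(n,n)$ the quotient of $H(n,n)$ by $\mathcal N_n$. *GNS construction.* For a linear functional $\mathrm{Tr}$ on $H_\infty$ let $\mathcal N_\infty=\{x\in H_\infty\mid \mathrm{Tr}(x^*x)=0\}$. If this is a left ideal, let $\tilde H_\infty=H_\infty/\mathcal N_\infty$, on which $H_\infty$ acts by left multiplication, let $\tilde H_n$ be the image of $H_n$ in $\tilde H_\infty$, and let $\pi_n^{N,K+N}:H_n\to B(\tilde H_n)$ be the resulting representation of $H_n$ on $\tilde H_n$. **Theorem.** There is a unique Markov trace $\mathrm{Tr}^{N,K}$ on $H_\infty$ with parameter $\eta_{N,K}=\frac{q-q^N}{(1+q)(1-q^N)}$. It is a state, $\mathrm{Tr}^{N,K}(x^*x)\ge 0$ for all $x\in H_\infty$, and its null set $\mathcal N_\infty$ is a left ideal. The algebra $H(0,0)$ is isomorphic to $\mathbb C$, and under this identification the closure of the image of $x\in H_n$ in $H(n,n)$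 is $[N]^n\,\mathrm{Tr}^{N,K}(x)$, for all $n\ge 0$. For every $n\ge 0$ the image of $x\in H_n$ in $H(n,n)$ is negligible if and only if $\mathrm{Tr}^{N,K}(x^*x)=0$; moreover $\mathcal N_n$ is a two-sided ideal of $H(n,n)$ (so that $H^{SU(N)}_K(n,n)$ is an algebra), and there is a unique isomorphism of complex algebras $$\Psi_n^{N,K}:H^{SU(N)}_K(n,n)\xrightarrow{\ \cong\ }\pi_n^{N,K+N}(H_n)$$ that is compatible with the canonical homomorphisms from $H_n$ to both sides: it sends the class of the image of $x\in H_n$ in $H(n,n)$ to $\pi_n^{N,K+N}(x)$. -/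

import Mathlib

noncomputable section

open CategoryTheory

namespace SkeinSU

/-! ### Quantum parameters -/

/-- The power `q ^ x` of `q = exp (2 π i / (N + K))`, for the branch
`q ^ x = exp (2 π i x / (N + K))`. -/
def qpow (N K : ℕ) (x : ℚ) : ℂ :=
  Complex.exp (2 * Real.pi * Complex.I * (x : ℂ) / ((N : ℂ) + (K : ℂ)))

/-- The quantum integer `[j]`. -/
def qint (N K j : ℕ) : ℂ :=
  (qpow N K ((j : ℚ) / 2) - qpow N K (-(j : ℚ) / 2)) / (qpow N K (1 / 2) - qpow N K (-1 / 2))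

/-- The quantum factorial `[n]!`. -/
def qfact (N K n : ℕ) : ℂ := ∏ j ∈ Finset.range n, qint N K (j + 1)

/-- `η = (q - q ^ N) / ((1 + q) (1 - q ^ N))`. -/
def eta (N K : ℕ) : ℂ :=
  (qpow N K 1 - qpow N K N) / ((1 + qpow N K 1) * (1 - qpow N K N))

lemma qpow_add (N K : ℕ) (x y : ℚ) : qpow N K (x + y) = qpow N K x * qpow N K y := by
  unfold qpow
  rw [← Complex.exp_add]
  congr 1
  push_cast
  ring

lemma qpow_zero (N K : ℕ) : qpow N K 0 = 1 := by simp [qpow]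

lemma conj_qpow (N K : ℕ) (x : ℚ) : (starRingEnd ℂ) (qpow N K x) = qpow N K (-x) := by
  unfold qpow
  rw [← Complex.exp_conj]
  congr 1
  simp [map_div₀, neg_div, Complex.conj_ofNat]

/-! ### Braid groups and Hecke algebras -/

/-- Indices of the standard generators of the braid group on `n` strands, counted from `0`:
the generator with index `i` braids the strands `i` and `i + 1`. For `n = ⊤` all natural numbers
are allowed. -/
abbrev BraidGen (n : ℕ∞) : Type := {i : ℕ // (i : ℕ∞) + 1 < n}

/-- The relators of the Artin presentation. -/
inductive BraidRel (n : ℕ∞) : FreeGroup (BraidGen n) → Prop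
  | far (i j : BraidGen n) (h : i.1 + 2 ≤ j.1) :
      BraidRel n (FreeGroup.of i * FreeGroup.of j * (FreeGroup.of j * FreeGroup.of i)⁻¹)
  | braid (i j : BraidGen n) (h : i.1 + 1 = j.1) :
      BraidRel n (FreeGroup.of i * FreeGroup.of j * FreeGroup.of i *
        (FreeGroup.of j * FreeGroup.of i * FreeGroup.of j)⁻¹)

/-- The braid group `B_n` on `n` strands; `B_∞` for `n = ⊤`. -/
abbrev BraidGroup (n : ℕ∞) : Type := PresentedGroup {w | BraidRel n w}

/-- The quadratic relation `q^{1/2N} σ_i - q^{-1/2N} σ_i⁻¹ = (q^{1/2} - q^{-1/2}) 1`. -/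
inductive HeckeRel (N K : ℕ) (n : ℕ∞) :
    MonoidAlgebra ℂ (BraidGroup n) → MonoidAlgebra ℂ (BraidGroup n) → Prop
  | quad (i : BraidGen n) : HeckeRel N K n
      (qpow N K (1 / (2 * N)) •
          MonoidAlgebra.of ℂ (BraidGroup n) (PresentedGroup.of i) -
        qpow N K (-(1 / (2 * N))) •
          MonoidAlgebra.of ℂ (BraidGroup n) (PresentedGroup.of i)⁻¹)
      ((qpow N K (1 / 2) - qpow N K (-1 / 2)) • 1)

/-- The Hecke algebra `H_n`, a quotient of the group ring of the braid group. The case `n = ⊤` is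
`H_∞`, the inductive limit of the `H_n`: it has the union of the generators and of the relations. -/
abbrev Hecke (N K : ℕ) (n : ℕ∞) : Type := RingQuot (HeckeRel N K n)

/-- The image of a braid in the Hecke algebra. -/
def Hecke.braid (N K : ℕ) (n : ℕ∞) : BraidGroup n →* Hecke N K n :=
  ((RingQuot.mkAlgHom ℂ (HeckeRel N K n) :
      MonoidAlgebra ℂ (BraidGroup n) →ₐ[ℂ] Hecke N K n) :
      MonoidAlgebra ℂ (BraidGroup n) →* Hecke N K n).comp (MonoidAlgebra.of ℂ (BraidGroup n))

/-- The generator `σ_i` of the Hecke algebra. -/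
def Hecke.sigma (N K : ℕ) {n : ℕ∞} (i : BraidGen n) : Hecke N K n :=
  Hecke.braid N K n (PresentedGroup.of i)

/-- The idempotent `e_i = (q - q^{(N+1)/2N} σ_i) / (1 + q)`. -/
def Hecke.e (N K : ℕ) {n : ℕ∞} (i : BraidGen n) : Hecke N K n :=
  (1 + qpow N K 1)⁻¹ • (qpow N K 1 • 1 - qpow N K ((N + 1) / (2 * N)) • Hecke.sigma N K i)

lemma Hecke.quad (N K : ℕ) {n : ℕ∞} (i : BraidGen n) :
    qpow N K (1 / (2 * N)) • Hecke.braid N K n (PresentedGroup.of i) -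
      qpow N K (-(1 / (2 * N))) • Hecke.braid N K n (PresentedGroup.of i)⁻¹ =
    (qpow N K (1 / 2) - qpow N K (-1 / 2)) • 1 := by
  have h := RingQuot.mkAlgHom_rel ℂ (HeckeRel.quad (N := N) (K := K) i)
  rw [map_sub, map_smul, map_smul, map_smul, map_one] at h
  exact h

/-- Ring homomorphisms out of a Hecke algebra, from a ring homomorphism on the scalars and images
of the generators that satisfy the defining relations. -/
def Hecke.liftRing (N K : ℕ) {n : ℕ∞} {A : Type} [Ring A] (c : ℂ →+* A)
    (hc : ∀ z a, Commute (c z) a) (u : BraidGen n → Aˣ)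
    (hfar : ∀ i j : BraidGen n, i.1 + 2 ≤ j.1 → u i * u j = u j * u i)
    (hbraid : ∀ i j : BraidGen n, i.1 + 1 = j.1 → u i * u j * u i = u j * u i * u j)
    (hquad : ∀ i : BraidGen n, c (qpow N K (1 / (2 * N))) * (u i : A) -
      c (qpow N K (-(1 / (2 * N)))) * ((u i)⁻¹ : Aˣ) =
        c (qpow N K (1 / 2) - qpow N K (-1 / 2))) : Hecke N K n →+* A :=
  RingQuot.lift ⟨MonoidAlgebra.liftNCRingHom c
    ((Units.coeHom A).comp (PresentedGroup.toGroup (f := u) (by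
      rintro _ (⟨i, j, h⟩ | ⟨i, j, h⟩)
      · simp only [map_mul, map_inv, FreeGroup.lift_apply_of]
        rw [hfar i j h, mul_inv_cancel]
      · simp only [map_mul, map_inv, FreeGroup.lift_apply_of]
        rw [hbraid i j h, mul_inv_cancel]))) (fun z g => hc z _), by
    rintro _ _ ⟨i⟩
    have h1 : (1 : MonoidAlgebra ℂ (BraidGroup n)) = MonoidAlgebra.single 1 1 := rfl
    simp only [map_sub, MonoidAlgebra.of_apply, h1, MonoidAlgebra.smul_single,
      MonoidAlgebra.liftNCRingHom_single, smul_eq_mul, mul_one, map_one,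
      MonoidHom.comp_apply, map_inv, PresentedGroup.toGroup.of]
    simpa using hquad i⟩

lemma Hecke.liftRing_sigma (N K : ℕ) {n : ℕ∞} {A : Type} [Ring A] (c : ℂ →+* A)
    (hc : ∀ z a, Commute (c z) a) (u : BraidGen n → Aˣ) (hfar) (hbraid) (hquad)
    (i : BraidGen n) :
    Hecke.liftRing N K c hc u hfar hbraid hquad (Hecke.sigma N K i) = u i := by
  unfold Hecke.liftRing Hecke.sigma Hecke.braid
  simp only [MonoidHom.comp_apply, MonoidHom.coe_coe]
  rw [← AlgHom.coe_toRingHom, RingQuot.mkAlgHom_coe, RingQuot.lift_mkRingHom_apply]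
  simp

lemma Hecke.liftRing_algebraMap (N K : ℕ) {n : ℕ∞} {A : Type} [Ring A] (c : ℂ →+* A)
    (hc : ∀ z a, Commute (c z) a) (u : BraidGen n → Aˣ) (hfar) (hbraid) (hquad) (z : ℂ) :
    Hecke.liftRing N K c hc u hfar hbraid hquad (algebraMap ℂ (Hecke N K n) z) = c z := by
  unfold Hecke.liftRing
  rw [← AlgHom.commutes (RingQuot.mkAlgHom ℂ (HeckeRel N K n)), ← AlgHom.coe_toRingHom,
    RingQuot.mkAlgHom_coe, RingQuot.lift_mkRingHom_apply]
  simp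

/-- The same for homomorphisms of complex algebras. -/
def Hecke.liftAlg (N K : ℕ) {n : ℕ∞} {A : Type} [Ring A] [Algebra ℂ A] (u : BraidGen n → Aˣ)
    (hfar : ∀ i j : BraidGen n, i.1 + 2 ≤ j.1 → u i * u j = u j * u i)
    (hbraid : ∀ i j : BraidGen n, i.1 + 1 = j.1 → u i * u j * u i = u j * u i * u j)
    (hquad : ∀ i : BraidGen n, qpow N K (1 / (2 * N)) • (u i : A) -
      qpow N K (-(1 / (2 * N))) • (((u i)⁻¹ : Aˣ) : A) =
        (qpow N K (1 / 2) - qpow N K (-1 / 2)) • 1) : Hecke N K n →ₐ[ℂ] A :=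
  { Hecke.liftRing N K (algebraMap ℂ A) (fun z a => Algebra.commutes z a) u hfar hbraid
      (fun i => by
        have h := hquad i
        rw [Algebra.smul_def, Algebra.smul_def, Algebra.smul_def, mul_one] at h
        exact h) with
    commutes' := fun z => Hecke.liftRing_algebraMap N K _ _ _ _ _ _ z }

lemma Hecke.liftAlg_sigma (N K : ℕ) {n : ℕ∞} {A : Type} [Ring A] [Algebra ℂ A]
    (u : BraidGen n → Aˣ) (hfar) (hbraid) (hquad) (i : BraidGen n) :
    Hecke.liftAlg N K u hfar hbraid hquad (Hecke.sigma N K i) = u i := by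
  unfold Hecke.liftAlg
  exact Hecke.liftRing_sigma N K (algebraMap ℂ A) (fun z a => Algebra.commutes z a) u hfar hbraid
    (fun i => by
      have h := hquad i
      rw [Algebra.smul_def, Algebra.smul_def, Algebra.smul_def, mul_one] at h
      exact h) i

/-- A braid, as an invertible element of the Hecke algebra. -/
def Hecke.unit (N K : ℕ) (n : ℕ∞) : BraidGroup n →* (Hecke N K n)ˣ :=
  (Hecke.braid N K n).toHomUnits

lemma BraidGroup.far {n : ℕ∞} (i j : BraidGen n) (h : i.1 + 2 ≤ j.1) :
    (PresentedGroup.of i : BraidGroup n) * PresentedGroup.of j =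
      PresentedGroup.of j * PresentedGroup.of i := by
  have := PresentedGroup.one_of_mem (rels := {w | BraidRel n w}) (BraidRel.far i j h)
  rw [map_mul, map_inv, mul_inv_eq_one, map_mul, map_mul] at this
  exact this

lemma BraidGroup.braid {n : ℕ∞} (i j : BraidGen n) (h : i.1 + 1 = j.1) :
    (PresentedGroup.of i : BraidGroup n) * PresentedGroup.of j * PresentedGroup.of i =
      PresentedGroup.of j * PresentedGroup.of i * PresentedGroup.of j := by
  have := PresentedGroup.one_of_mem (rels := {w | BraidRel n w}) (BraidRel.braid i j h)
  rw [map_mul, map_inv, mul_inv_eq_one, map_mul, map_mul, map_mul, map_mul] at this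
  exact this

/-- Every natural number is the index of a generator of `B_∞`. -/
def BraidGen.top (i : ℕ) : BraidGen ⊤ :=
  ⟨i, lt_top_iff_ne_top.2 (by exact_mod_cast ENat.natCast_ne_top (i + 1))⟩

/-- The canonical homomorphism `H_n → H_∞`. -/
def Hecke.incl (N K : ℕ) (n : ℕ) : Hecke N K n →ₐ[ℂ] Hecke N K ⊤ :=
  Hecke.liftAlg N K
    (fun i => Hecke.unit N K ⊤ (PresentedGroup.of (BraidGen.top i.1)))
    (fun i j h => by
      rw [← map_mul, ← map_mul, BraidGroup.far (BraidGen.top i.1) (BraidGen.top j.1) h])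
    (fun i j h => by
      rw [← map_mul, ← map_mul, ← map_mul, ← map_mul,
        BraidGroup.braid (BraidGen.top i.1) (BraidGen.top j.1) h])
    (fun i => by rw [← map_inv]; exact Hecke.quad N K _)

lemma Hecke.commute_conj (N K : ℕ) (n : ℕ∞) (z : ℂ) (a : (Hecke N K n)ᵐᵒᵖ) :
    Commute (((algebraMap ℂ (Hecke N K n)ᵐᵒᵖ).comp (starRingEnd ℂ)) z) a :=
  Algebra.commutes ((starRingEnd ℂ) z) a

/-- The `*`-structure, as a ring homomorphism to the opposite ring: the conjugate-linear
anti-homomorphism that sends every braid to its inverse. -/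
def Hecke.starHom (N K : ℕ) (n : ℕ∞) : Hecke N K n →+* (Hecke N K n)ᵐᵒᵖ :=
  Hecke.liftRing N K
    ((algebraMap ℂ (Hecke N K n)ᵐᵒᵖ).comp (starRingEnd ℂ))
    (Hecke.commute_conj N K n)
    (fun i => Units.opEquiv.symm (MulOpposite.op (Hecke.unit N K n (PresentedGroup.of i)⁻¹)))
    (fun i j h => by
      rw [← map_mul, ← map_mul, ← MulOpposite.op_mul, ← MulOpposite.op_mul, ← map_mul, ← map_mul,
        ← mul_inv_rev, ← mul_inv_rev, BraidGroup.far _ _ h])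
    (fun i j h => by
      simp only [← map_mul, ← MulOpposite.op_mul, ← mul_inv_rev]
      rw [BraidGroup.braid _ _ h])
    (fun i => by
      have h := congrArg MulOpposite.op (Hecke.quad N K i)
      have e1 : (-1 / 2 : ℚ) = -(1 / 2) := by norm_num
      rw [e1] at h ⊢
      simp only [RingHom.comp_apply, conj_qpow, neg_neg, map_sub]
      rw [← Algebra.smul_def, ← Algebra.smul_def, ← map_inv, ← MulOpposite.op_inv, ← map_inv,
        inv_inv]
      rw [← neg_inj, neg_sub, neg_sub, ← map_sub, Algebra.algebraMap_eq_smul_one]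
      exact h)

/-- The `*`-structure on the Hecke algebra. -/
def Hecke.adj {N K : ℕ} {n : ℕ∞} (x : Hecke N K n) : Hecke N K n :=
  (Hecke.starHom N K n x).unop

lemma Hecke.adj_sigma (N K : ℕ) {n : ℕ∞} (i : BraidGen n) :
    Hecke.adj (Hecke.sigma N K i) = Hecke.braid N K n (PresentedGroup.of i)⁻¹ := by
  unfold Hecke.adj Hecke.starHom
  rw [Hecke.liftRing_sigma]
  rfl

lemma Hecke.adj_smul (N K : ℕ) {n : ℕ∞} (z : ℂ) (x : Hecke N K n) :
    Hecke.adj (z • x) = (starRingEnd ℂ) z • Hecke.adj x := by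
  unfold Hecke.adj
  rw [Algebra.smul_def, map_mul]
  unfold Hecke.starHom
  rw [Hecke.liftRing_algebraMap, RingHom.comp_apply, ← Algebra.smul_def]
  rfl

lemma Hecke.adj_mul {N K : ℕ} {n : ℕ∞} (x y : Hecke N K n) :
    Hecke.adj (x * y) = Hecke.adj y * Hecke.adj x := by
  simp [Hecke.adj]

/-- The `*`-structure is the one with `e_i^* = e_i`. -/
lemma Hecke.adj_e (N K : ℕ) (hN : N ≠ 0) {n : ℕ∞} (i : BraidGen n) :
    Hecke.adj (Hecke.e N K i) = Hecke.e N K i := by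
  have hs := Hecke.adj_sigma N K i
  have hqd := Hecke.quad N K i
  have h0 : Hecke.adj (1 : Hecke N K n) = 1 := by simp [Hecke.adj]
  have hsub : ∀ x y : Hecke N K n, Hecke.adj (x - y) = Hecke.adj x - Hecke.adj y := by
    intro x y; simp [Hecke.adj]
  unfold Hecke.e
  rw [Hecke.adj_smul, hsub, Hecke.adj_smul, Hecke.adj_smul, h0, hs, map_inv₀, map_add, map_one,
    conj_qpow, conj_qpow]
  have hN' : (N : ℚ) ≠ 0 := by exact_mod_cast hN
  change _ = (1 + qpow N K 1)⁻¹ • (qpow N K 1 • 1 -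
    qpow N K ((N + 1) / (2 * N)) • Hecke.braid N K n (PresentedGroup.of i))
  have hA : qpow N K 1 * qpow N K (-1) = 1 := by
    rw [← qpow_add]; norm_num [qpow_zero]
  have hq1 : qpow N K 1 ≠ 0 := left_ne_zero_of_mul_eq_one hA
  have hc : (1 + qpow N K (-1))⁻¹ = (1 + qpow N K 1)⁻¹ * qpow N K 1 := by
    have h2 : qpow N K 1 * (1 + qpow N K (-1)) = 1 + qpow N K 1 := by
      rw [mul_add, hA]; ring
    rw [← h2]
    field_simp
  rw [hc, mul_smul]
  congr 1
  rw [smul_sub, smul_smul, smul_smul, hA, ← qpow_add]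
  have h3 := congrArg (fun y => qpow N K (1 / 2) • y) hqd
  simp only [smul_sub, smul_smul, mul_sub, ← qpow_add] at h3
  have a1 : (1 / 2 + 1 / (2 * N) : ℚ) = (N + 1) / (2 * N) := by field_simp
  have a2 : (1 / 2 + -(1 / (2 * N)) : ℚ) = 1 + -((N + 1) / (2 * N)) := by field_simp; ring
  have a3 : (1 / 2 + 1 / 2 : ℚ) = 1 := by norm_num
  have a4 : (1 / 2 + -1 / 2 : ℚ) = 0 := by norm_num
  rw [a1, a2, a3, a4, qpow_zero, sub_smul] at h3
  rw [sub_eq_sub_iff_add_eq_add] at h3 ⊢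
  rw [add_comm]
  exact h3

/-! ### Diagrams of special ribbon graphs in `D² × [0, 1]`

Diagrams are read from the bottom to the top and carry the blackboard framing. A boundary object is
a finite sequence of signs along a line; `true` is a strand oriented upwards and `false` a strand
oriented downwards. A diagram is a word of layers; a layer `(k, g)` is the elementary piece `g` with
`k` vertical strands to its left (and as many as fit to its right). -/

/-- The elementary pieces of diagrams. -/
inductive Piece : Type
  /-- The crossing of two upward strands; it is positive (the strand from bottom left to top right
  is over the other) for `true` and negative for `false`. -/
  | cross (positive : Bool)
  /-- The local minimum that creates the two strands `s, !s`. -/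
  | cup (s : Bool)
  /-- The local maximum that joins the two strands `s, !s`. -/
  | cap (s : Bool)
  /-- The coupon with `N` incoming bands. -/
  | couponIn
  /-- The coupon with `N` outgoing bands. -/
  | couponOut

/-- The signs at the bottom of a piece. -/
def Piece.bot (N : ℕ) : Piece → List Bool
  | .cross _ => [true, true]
  | .cup _ => []
  | .cap s => [s, !s]
  | .couponIn => List.replicate N true
  | .couponOut => []

/-- The signs at the top of a piece. -/
def Piece.top (N : ℕ) : Piece → List Bool
  | .cross _ => [true, true]
  | .cup s => [s, !s]
  | .cap _ => []
  | .couponIn => []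
  | .couponOut => List.replicate N true

/-- A layer of a diagram. -/
abbrev Layer : Type := ℕ × Piece

/-- The layer `x` leads from the boundary `a` to the boundary `b`. -/
def Layer.Leads (N : ℕ) (x : Layer) (a b : List Bool) : Prop :=
  ∃ l r : List Bool, l.length = x.1 ∧ a = l ++ x.2.bot N ++ r ∧ b = l ++ x.2.top N ++ r

/-- The word `w` is a diagram from the boundary `a` to the boundary `b`. -/
def Leads (N : ℕ) : List Layer → List Bool → List Bool → Prop
  | [], a, b => a = b
  | x :: w, a, b => ∃ c, Layer.Leads N x a c ∧ Leads N w c b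

lemma Leads.append {N : ℕ} {w v : List Layer} {a b c : List Bool}
    (hw : Leads N w a b) (hv : Leads N v b c) : Leads N (w ++ v) a c := by
  induction w generalizing a with
  | nil => cases hw; exact hv
  | cons x w ih =>
    obtain ⟨d, h1, h2⟩ := hw
    exact ⟨d, h1, ih h2⟩

lemma Leads.whisker {N : ℕ} {w : List Layer} {a b : List Bool}
    (hw : Leads N w a b) (s : List Bool) : Leads N w (a ++ s) (b ++ s) := by
  induction w generalizing a with
  | nil => cases hw; rfl
  | cons x w ih =>
    obtain ⟨d, ⟨l, r, h1, h2, h3⟩, h4⟩ := hw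
    exact ⟨d ++ s, ⟨l, r ++ s, h1, by simp [h2], by simp [h3]⟩, ih h4⟩

/-- Diagrams from `a` to `b`. -/
abbrev Diagram (N : ℕ) (a b : List Bool) : Type := {w : List Layer // Leads N w a b}

/-- The diagram of vertical strands. -/
def Diagram.id (N : ℕ) (a : List Bool) : Diagram N a a := ⟨[], rfl⟩

/-- The diagram `g` on top of the diagram `f`. -/
def Diagram.comp {N : ℕ} {a b c : List Bool} (f : Diagram N a b) (g : Diagram N b c) :
    Diagram N a c := ⟨f.1 ++ g.1, f.2.append g.2⟩

/-- The diagram `f` with vertical strands to its right. -/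
def Diagram.whisker {N : ℕ} {a b : List Bool} (f : Diagram N a b) (s : List Bool) :
    Diagram N (a ++ s) (b ++ s) := ⟨f.1, f.2.whisker s⟩

/-- A strand at position `k`, oriented upwards, crosses the `m` upward strands to its right. -/
def pass (k m : ℕ) (positive : Bool) : List Layer :=
  (List.range m).map fun i => (k + i, Piece.cross positive)

/-- The crossing of an upward strand on the left and a downward strand on the right, by rotation of
a crossing of upward strands. -/
def crossUD (k : ℕ) (positive : Bool) : List Layer :=
  [(k, .cup false), (k + 1, .cross positive), (k + 2, .cap true)]

/-- The crossing of a downward strand on the left and an upward strand on the right, by rotation of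
a crossing of upward strands. -/
def crossDU (k : ℕ) (positive : Bool) : List Layer :=
  [(k + 2, .cup true), (k + 1, .cross positive), (k, .cap false)]

/-- The isotopy moves for diagrams of special ribbon graphs, except for those that change the
number of curls. (That a coupon may be turned around by a full twist of its bands follows from these
moves and the local relations below, since the full twist acts on the antisymmetrizer as `1`.) -/
inductive Move (N : ℕ) : List Layer → List Layer → Prop
  /-- Two pieces next to each other can be moved up and down past each other. -/
  | far (k m : ℕ) (g h : Piece) :
      Move N [(k, g), (k + (g.top N).length + m, h)] [(k + (g.bot N).length + m, h), (k, g)]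
  /-- A cup and a cap cancel (for each orientation). -/
  | zigzag (k : ℕ) (s : Bool) : Move N [(k, .cup s), (k + 1, .cap !s)] []
  | zagzig (k : ℕ) (s : Bool) : Move N [(k + 1, .cup s), (k, .cap !s)] []
  /-- The second Reidemeister move. -/
  | reidemeister2 (k : ℕ) (p : Bool) : Move N [(k, .cross p), (k, .cross !p)] []
  /-- The second Reidemeister move for strands of opposite directions. -/
  | reidemeister2UD (k : ℕ) (p : Bool) : Move N (crossUD k p ++ crossDU k !p) []
  | reidemeister2DU (k : ℕ) (p : Bool) : Move N (crossDU k p ++ crossUD k !p) []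
  /-- The third Reidemeister move. -/
  | reidemeister3 (k : ℕ) :
      Move N [(k, .cross true), (k + 1, .cross true), (k, .cross true)]
        [(k + 1, .cross true), (k, .cross true), (k + 1, .cross true)]
  /-- The two rotations of a crossing to a crossing of downward strands agree. -/
  | rotate (k : ℕ) (p : Bool) :
      Move N
        [(k, .cup false), (k + 1, .cup false), (k + 2, .cross p), (k + 3, .cap true),
          (k + 2, .cap true)]
        [(k + 2, .cup true), (k + 3, .cup true), (k + 2, .cross p), (k + 1, .cap false),
          (k, .cap false)]
  /-- A strand passes over or under a coupon. -/
  | passIn (k : ℕ) (p : Bool) : Move N (pass k N p ++ [(k, .couponIn)]) [(k + 1, .couponIn)]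
  | passOut (k : ℕ) (p : Bool) : Move N ([(k + 1, .couponOut)] ++ pass k N p) [(k, .couponOut)]

/-- The transposition of `i` and `i + 1`. -/
def adjSwap (N : ℕ) (i : {i : ℕ // i + 1 < N}) : Equiv.Perm (Fin N) :=
  Equiv.swap ⟨i.1, Nat.lt_of_succ_lt i.2⟩ ⟨i.1 + 1, i.2⟩

/-- `u` is a reduced expression of the permutation `π`; its length is the length of `π`. -/
def IsReduced {N : ℕ} (π : Equiv.Perm (Fin N)) (u : List {i : ℕ // i + 1 < N}) : Prop :=
  (u.map (adjSwap N)).prod = π ∧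
    ∀ v : List {i : ℕ // i + 1 < N}, (v.map (adjSwap N)).prod = π → u.length ≤ v.length

/-- The positive braid of an expression of a permutation, with `k` strands to its left. -/
def positiveBraid {N : ℕ} (k : ℕ) (u : List {i : ℕ // i + 1 < N}) : List Layer :=
  u.map fun i => (k + i.1, Piece.cross true)

/-- The basis element of a diagram in the free vector space. -/
abbrev diag {N : ℕ} {a b : List Bool} (f : Diagram N a b) : Diagram N a b →₀ ℂ :=
  Finsupp.single f 1

/-- The local relations; each says that a linear combination of diagrams is zero. -/
inductive LocalRel (N K : ℕ) :
    ∀ {a b : List Bool}, (Diagram N a b →₀ ℂ) → Prop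
  /-- Isotopic diagrams are equal. -/
  | move {a b : List Bool} (f g : Diagram N a b) (h : Move N f.1 g.1) :
      LocalRel N K (diag f - diag g)
  /-- `q^{1/2N} X₊ - q^{-1/2N} X₋ = (q^{1/2} - q^{-1/2}) ‖`. -/
  | skein {a b : List Bool} (k : ℕ) (f g h : Diagram N a b) (hf : f.1 = [(k, .cross true)])
      (hg : g.1 = [(k, .cross false)]) (hh : h.1 = []) :
      LocalRel N K (qpow N K (1 / (2 * N)) • diag f - qpow N K (-(1 / (2 * N))) • diag g -
        (qpow N K (1 / 2) - qpow N K (-1 / 2)) • diag h)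
  /-- A positive curl is `q^{(N²-1)/2N}`, a negative one `q^{-(N²-1)/2N}`, on either side. -/
  | curlRight {a b : List Bool} (k : ℕ) (p : Bool) (f g : Diagram N a b)
      (hf : f.1 = [(k + 1, .cup true), (k, .cross p), (k + 1, .cap true)])
      (hg : g.1 = []) :
      LocalRel N K (diag f -
        qpow N K ((if p then 1 else -1) * (((N : ℚ) ^ 2 - 1) / (2 * N))) • diag g)
  | curlLeft {a b : List Bool} (k : ℕ) (p : Bool) (f g : Diagram N a b)
      (hf : f.1 = [(k, .cup false), (k + 1, .cross p), (k, .cap false)])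
      (hg : g.1 = []) :
      LocalRel N K (diag f -
        qpow N K ((if p then 1 else -1) * (((N : ℚ) ^ 2 - 1) / (2 * N))) • diag g)
  /-- A circle, of either orientation, is `[N]`. -/
  | circle {a b : List Bool} (k : ℕ) (s : Bool) (f g : Diagram N a b)
      (hf : f.1 = [(k, .cup s), (k, .cap s)]) (hg : g.1 = []) :
      LocalRel N K (diag f - qint N K N • diag g)
  /-- A coupon with `N` incoming bands below one with `N` outgoing bands is the antisymmetrizer
  `g_N = q^{N(N-1)/4} / [N]! * ∑_π (-q^{(1-N)/2N})^{ℓ(π)} w_π`. -/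
  | couponInOut {a b : List Bool} (k : ℕ) (u : Equiv.Perm (Fin N) → List {i : ℕ // i + 1 < N})
      (hu : ∀ π, IsReduced π (u π)) (f : Diagram N a b) (g : Equiv.Perm (Fin N) → Diagram N a b)
      (hf : f.1 = [(k, .couponIn), (k, .couponOut)])
      (hg : ∀ π, (g π).1 = positiveBraid k (u π)) :
      LocalRel N K (diag f - (qpow N K ((N : ℚ) * (N - 1) / 4) / qfact N K N) •
        ∑ π, (-qpow N K ((1 - N) / (2 * N))) ^ (u π).length • diag (g π))
  /-- A coupon with `N` outgoing bands that all run into one with `N` incoming bands is `1`. -/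
  | couponOutIn {a b : List Bool} (k : ℕ) (f g : Diagram N a b)
      (hf : f.1 = [(k, .couponOut), (k, .couponIn)]) (hg : g.1 = []) :
      LocalRel N K (diag f - diag g)

/-! ### The Hecke category -/

/-- Bilinear stacking of linear combinations of diagrams. -/
def stack (N : ℕ) (a b c : List Bool) :
    (Diagram N a b →₀ ℂ) →ₗ[ℂ] (Diagram N b c →₀ ℂ) →ₗ[ℂ] (Diagram N a c →₀ ℂ) :=
  Finsupp.lift ((Diagram N b c →₀ ℂ) →ₗ[ℂ] (Diagram N a c →₀ ℂ)) ℂ (Diagram N a b)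
    (fun f => Finsupp.lmapDomain ℂ ℂ (fun g => f.comp g))

lemma stack_single {N : ℕ} {a b c : List Bool} (f : Diagram N a b) (g : Diagram N b c)
    (r s : ℂ) : stack N a b c (Finsupp.single f r) (Finsupp.single g s) =
      Finsupp.single (f.comp g) (r * s) := by
  simp only [stack, Finsupp.lift_apply, Finsupp.sum_single_index, zero_smul,
    LinearMap.smul_apply, Finsupp.lmapDomain_apply, Finsupp.mapDomain_single, Finsupp.smul_single,
    smul_eq_mul]

lemma stack_diag {N : ℕ} {a b c : List Bool} (f : Diagram N a b) (g : Diagram N b c) :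
    stack N a b c (diag f) (diag g) = diag (f.comp g) := by
  rw [stack_single, mul_one]

/-- The linear combinations of diagrams that vanish because of the local relations. -/
def relations (N K : ℕ) (a b : List Bool) : Submodule ℂ (Diagram N a b →₀ ℂ) :=
  Submodule.span ℂ {x | ∃ (c d : List Bool) (f : Diagram N a c) (y : Diagram N c d →₀ ℂ)
    (g : Diagram N d b), LocalRel N K y ∧
      x = stack N a d b (stack N a c d (diag f) y) (diag g)}

/-- The skein module of `D² × [0, 1]` with boundary `a` at the bottom and `b` at the top. -/
abbrev Skein (N K : ℕ) (a b : List Bool) : Type := (Diagram N a b →₀ ℂ) ⧸ relations N K a b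

/-- The class of a diagram in the skein module. -/
def Skein.of {N : ℕ} (K : ℕ) {a b : List Bool} (f : Diagram N a b) : Skein N K a b :=
  (relations N K a b).mkQ (diag f)

lemma stack_assoc {N : ℕ} {a b c d : List Bool} (x : Diagram N a b →₀ ℂ)
    (y : Diagram N b c →₀ ℂ) (z : Diagram N c d →₀ ℂ) :
    stack N a c d (stack N a b c x y) z = stack N a b d x (stack N b c d y z) := by
  induction x using Finsupp.induction_linear with
  | zero => simp
  | add x x' hx hx' => simp [hx, hx']
  | single f r =>
    induction y using Finsupp.induction_linear with
    | zero => simp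
    | add y y' hy hy' => simp [hy, hy']
    | single g s =>
      induction z using Finsupp.induction_linear with
      | zero => simp
      | add z z' hz hz' => simp [hz, hz']
      | single h t =>
        simp only [stack_single, mul_assoc, Diagram.comp, List.append_assoc]

lemma stack_id_left {N : ℕ} {a b : List Bool} (x : Diagram N a b →₀ ℂ) :
    stack N a a b (diag (Diagram.id N a)) x = x := by
  induction x using Finsupp.induction_linear with
  | zero => simp
  | add x x' hx hx' => rw [map_add, hx, hx']
  | single f r => simp [stack_single, Diagram.comp, Diagram.id]

lemma stack_id_right {N : ℕ} {a b : List Bool} (x : Diagram N a b →₀ ℂ) :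
    stack N a b b x (diag (Diagram.id N b)) = x := by
  induction x using Finsupp.induction_linear with
  | zero => simp
  | add x x' hx hx' => rw [map_add, LinearMap.add_apply, hx, hx']
  | single f r => simp [stack_single, Diagram.comp, Diagram.id]

lemma stack_mem_left {N K : ℕ} {a b c : List Bool} {x : Diagram N a b →₀ ℂ}
    (hx : x ∈ relations N K a b) (y : Diagram N b c →₀ ℂ) :
    stack N a b c x y ∈ relations N K a c := by
  induction y using Finsupp.induction_linear with
  | zero => simp
  | add y y' hy hy' => rw [map_add]; exact Submodule.add_mem _ hy hy'
  | single h r =>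
    rw [← mul_one r, ← smul_eq_mul, ← Finsupp.smul_single, map_smul]
    refine Submodule.smul_mem _ _ ?_
    induction hx using Submodule.span_induction with
    | mem x hx =>
      obtain ⟨p, d, f, y, g, hy, rfl⟩ := hx
      refine Submodule.subset_span ⟨p, d, f, y, g.comp h, hy, ?_⟩
      rw [stack_assoc, stack_diag]
    | zero => simp
    | add x y _ _ hx hy => rw [map_add]; exact Submodule.add_mem _ hx hy
    | smul z x _ hx => rw [map_smul]; exact Submodule.smul_mem _ _ hx

lemma stack_mem_right {N K : ℕ} {a b c : List Bool} (x : Diagram N a b →₀ ℂ)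
    {y : Diagram N b c →₀ ℂ} (hy : y ∈ relations N K b c) :
    stack N a b c x y ∈ relations N K a c := by
  induction x using Finsupp.induction_linear with
  | zero => simp
  | add x x' hx hx' => rw [map_add]; exact Submodule.add_mem _ hx hx'
  | single h r =>
    rw [← mul_one r, ← smul_eq_mul, ← Finsupp.smul_single, map_smul]
    refine Submodule.smul_mem _ _ ?_
    induction hy using Submodule.span_induction with
    | mem x hx =>
      obtain ⟨p, d, f, y, g, hy, rfl⟩ := hx
      refine Submodule.subset_span ⟨p, d, h.comp f, y, g, hy, ?_⟩
      rw [← stack_assoc, ← stack_assoc, stack_diag]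
    | zero => simp
    | add x y _ _ hx hy => rw [map_add]; exact Submodule.add_mem _ hx hy
    | smul z x _ hx => rw [map_smul]; exact Submodule.smul_mem _ _ hx

/-- Composition of skeins: the second one is put on top of the first one. -/
def Skein.comp (N K : ℕ) (a b c : List Bool) :
    Skein N K a b →ₗ[ℂ] Skein N K b c →ₗ[ℂ] Skein N K a c :=
  ((relations N K b c).liftQ
    ((relations N K a b).liftQ ((stack N a b c).compr₂ (relations N K a c).mkQ) (by
      intro x hx
      refine LinearMap.ext fun y => ?_
      exact (Submodule.Quotient.mk_eq_zero _).2 (stack_mem_left hx y))).flip (by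
    intro y hy
    refine LinearMap.ext fun x => ?_
    obtain ⟨x, rfl⟩ := Submodule.mkQ_surjective _ x
    exact (Submodule.Quotient.mk_eq_zero _).2 (stack_mem_right x hy))).flip

lemma Skein.comp_mk {N K : ℕ} {a b c : List Bool} (x : Diagram N a b →₀ ℂ)
    (y : Diagram N b c →₀ ℂ) :
    Skein.comp N K a b c ((relations N K a b).mkQ x) ((relations N K b c).mkQ y) =
      (relations N K a c).mkQ (stack N a b c x y) := rfl

/-- The Hecke category `H`. Its objects are finite sequences of signs. -/
structure HeckeCat (N K : ℕ) : Type where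
  signs : List Bool

/-- The morphisms of the Hecke category are skeins. -/
instance heckeCategory (N K : ℕ) : Category (HeckeCat N K) where
  Hom a b := Skein N K a.signs b.signs
  id a := Skein.of K (Diagram.id N a.signs)
  comp {a b c} f g := Skein.comp N K a.signs b.signs c.signs f g
  id_comp {a b} f := by
    obtain ⟨x, rfl⟩ := Submodule.mkQ_surjective _ f
    exact congrArg (relations N K a.signs b.signs).mkQ (stack_id_left x)
  comp_id {a b} f := by
    obtain ⟨x, rfl⟩ := Submodule.mkQ_surjective _ f
    exact congrArg (relations N K a.signs b.signs).mkQ (stack_id_right x)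
  assoc {a b c d} f g h := by
    obtain ⟨x, rfl⟩ := Submodule.mkQ_surjective _ f
    obtain ⟨y, rfl⟩ := Submodule.mkQ_surjective _ g
    obtain ⟨z, rfl⟩ := Submodule.mkQ_surjective _ h
    exact congrArg (relations N K a.signs d.signs).mkQ (stack_assoc x y z)

instance heckePreadditive (N K : ℕ) : Preadditive (HeckeCat N K) where
  homGroup a b := inferInstanceAs (AddCommGroup (Skein N K a.signs b.signs))
  add_comp a b c f f' g :=
    LinearMap.map_add₂ (Skein.comp N K a.signs b.signs c.signs) f f' g
  comp_add a b c f g g' :=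
    LinearMap.map_add (Skein.comp N K a.signs b.signs c.signs f) g g'

instance heckeLinear (N K : ℕ) : Linear ℂ (HeckeCat N K) where
  homModule a b := inferInstanceAs (Module ℂ (Skein N K a.signs b.signs))
  smul_comp a b c r f g :=
    LinearMap.map_smul₂ (Skein.comp N K a.signs b.signs c.signs) r f g
  comp_smul a b c f r g :=
    LinearMap.map_smul (Skein.comp N K a.signs b.signs c.signs f) r g

/-! ### The action of the Hecke algebra on skeins -/

lemma Skein.of_eq_of_move {N K : ℕ} {a b : List Bool} (f g : Diagram N a b)
    (h : Move N f.1 g.1) : Skein.of K f = Skein.of K g := by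
  refine (Submodule.Quotient.eq _).2 (Submodule.subset_span
    ⟨a, b, Diagram.id N a, _, Diagram.id N b, LocalRel.move f g h, ?_⟩)
  rw [stack_id_right, stack_id_left]

lemma Skein.of_comp {N K : ℕ} {a b c : List Bool} (f : Diagram N a b) (g : Diagram N b c) :
    Skein.comp N K a b c (Skein.of K f) (Skein.of K g) = Skein.of K (f.comp g) := by
  unfold Skein.of
  rw [Skein.comp_mk, stack_diag]

/-- The object `n` of the Hecke category: `n` points in a row, all with positive sign. -/
def obj (N K n : ℕ) : HeckeCat N K := ⟨List.replicate n true⟩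

/-- The skein algebra `H(n, n)`. The product `x * y` is `x` on top of `y`. -/
abbrev SkeinAlg (N K n : ℕ) : Type := End (obj N K n)

/-- The diagram of `n` upward strands with one crossing, of the strands `i` and `i + 1`. -/
def crossing (N : ℕ) {n : ℕ} (i : BraidGen n) (positive : Bool) :
    Diagram N (List.replicate n true) (List.replicate n true) :=
  ⟨[(i.1, .cross positive)], List.replicate n true, by
    have h : i.1 + 1 < n := by exact_mod_cast i.2
    have h2 : List.replicate n true =
        List.replicate i.1 true ++ [true, true] ++ List.replicate (n - i.1 - 2) true := by
      have e : [true, true] = List.replicate 2 true := rfl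
      rw [e, List.replicate_append_replicate, List.replicate_append_replicate]
      congr 1
      omega
    exact ⟨List.replicate i.1 true, List.replicate (n - i.1 - 2) true, by simp, h2, h2⟩, rfl⟩

/-- The skein of a diagram from `n` to `n`. -/
def SkeinAlg.of {N : ℕ} (K : ℕ) {n : ℕ}
    (f : Diagram N (List.replicate n true) (List.replicate n true)) : SkeinAlg N K n :=
  Skein.of K f

lemma SkeinAlg.of_mul {N K n : ℕ}
    (f g : Diagram N (List.replicate n true) (List.replicate n true)) :
    SkeinAlg.of K f * SkeinAlg.of K g = SkeinAlg.of K (g.comp f) :=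
  Skein.of_comp g f

/-- The crossing of the strands `i` and `i + 1` is invertible. -/
def crossingUnit (N K : ℕ) {n : ℕ} (i : BraidGen n) : (SkeinAlg N K n)ˣ where
  val := SkeinAlg.of K (crossing N i true)
  inv := SkeinAlg.of K (crossing N i false)
  val_inv := by
    rw [SkeinAlg.of_mul]
    exact Skein.of_eq_of_move _ (Diagram.id N _) (Move.reidemeister2 i.1 false)
  inv_val := by
    rw [SkeinAlg.of_mul]
    exact Skein.of_eq_of_move _ (Diagram.id N _) (Move.reidemeister2 i.1 true)

/-- The canonical homomorphism `H_n → H(n, n)`, which sends `σ_i` to the positive crossing of the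
strands `i` and `i + 1`. -/
def toSkein (N K n : ℕ) : Hecke N K n →ₐ[ℂ] SkeinAlg N K n :=
  Hecke.liftAlg N K (fun i => crossingUnit N K i)
    (fun i j h => by
      refine Units.ext ?_
      change SkeinAlg.of K (crossing N i true) * SkeinAlg.of K (crossing N j true) =
        SkeinAlg.of K (crossing N j true) * SkeinAlg.of K (crossing N i true)
      rw [SkeinAlg.of_mul, SkeinAlg.of_mul]
      refine (Skein.of_eq_of_move _ _ ?_).symm
      obtain ⟨m, hm⟩ := Nat.exists_eq_add_of_le h
      have := Move.far (N := N) i.1 m (.cross true) (.cross true)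
      simpa [Piece.bot, Piece.top, crossing, Diagram.comp, hm] using this)
    (fun i j h => by
      refine Units.ext ?_
      change SkeinAlg.of K (crossing N i true) * SkeinAlg.of K (crossing N j true) *
          SkeinAlg.of K (crossing N i true) =
        SkeinAlg.of K (crossing N j true) * SkeinAlg.of K (crossing N i true) *
          SkeinAlg.of K (crossing N j true)
      rw [SkeinAlg.of_mul, SkeinAlg.of_mul, SkeinAlg.of_mul, SkeinAlg.of_mul]
      refine Skein.of_eq_of_move _ _ ?_
      have := Move.reidemeister3 (N := N) i.1
      simpa [crossing, Diagram.comp, ← h] using this)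
    (fun i => by
      have h := (Submodule.Quotient.mk_eq_zero (relations N K _ _)).2 (Submodule.subset_span
        ⟨_, _, Diagram.id N _, _, Diagram.id N _,
          LocalRel.skein (K := K) i.1 (crossing N i true) (crossing N i false)
            (Diagram.id N (List.replicate n true)) rfl rfl rfl, rfl⟩)
      rw [stack_id_right, stack_id_left] at h
      exact sub_eq_zero.1 h)

lemma toSkein_sigma (N K : ℕ) {n : ℕ} (i : BraidGen n) :
    toSkein N K n (Hecke.sigma N K i) = SkeinAlg.of K (crossing N i true) :=
  Hecke.liftAlg_sigma N K _ _ _ _ i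

/-! ### Closure of skeins, negligible skeins and purification -/

/-- The dual boundary. -/
def dual (a : List Bool) : List Bool := (a.map not).reverse

/-- Nested cups that create the boundary `a` followed by its dual, at position `k`. -/
def cups (k : ℕ) : List Bool → List Layer
  | [] => []
  | s :: a => (k, .cup s) :: cups (k + 1) a

/-- Nested caps that join the boundary `a` to its dual, at position `k`. -/
def caps (k : ℕ) : List Bool → List Layer
  | [] => []
  | s :: a => caps (k + 1) a ++ [(k, .cap s)]

lemma leads_cups (N : ℕ) (a l r : List Bool) :
    Leads N (cups l.length a) (l ++ r) (l ++ a ++ dual a ++ r) := by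
  induction a generalizing l r with
  | nil => simp [cups, dual, Leads]
  | cons s a ih =>
    refine ⟨l ++ [s, !s] ++ r, ⟨l, r, rfl, by simp [Piece.bot], rfl⟩, ?_⟩
    have h := ih (l ++ [s]) ((!s) :: r)
    simpa [dual] using h

lemma leads_caps (N : ℕ) (a l r : List Bool) :
    Leads N (caps l.length a) (l ++ a ++ dual a ++ r) (l ++ r) := by
  induction a generalizing l r with
  | nil => simp [caps, dual, Leads]
  | cons s a ih =>
    have h := ih (l ++ [s]) ((!s) :: r)
    refine Leads.append (b := l ++ [s, !s] ++ r) ?_ ?_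
    · simpa [dual] using h
    · exact ⟨l ++ r, ⟨l, r, rfl, rfl, by simp [Piece.top]⟩, rfl⟩

/-- The nested cups as a diagram. -/
def cupsDiagram (N : ℕ) (a : List Bool) : Diagram N [] (a ++ dual a) :=
  ⟨cups 0 a, by simpa using leads_cups N a [] []⟩

/-- The nested caps as a diagram. -/
def capsDiagram (N : ℕ) (a : List Bool) : Diagram N (a ++ dual a) [] :=
  ⟨caps 0 a, by simpa using leads_caps N a [] []⟩

/-- Linear combinations of diagrams with vertical strands to the right. -/
def whiskerLin (N : ℕ) (a b s : List Bool) :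
    (Diagram N a b →₀ ℂ) →ₗ[ℂ] (Diagram N (a ++ s) (b ++ s) →₀ ℂ) :=
  Finsupp.lmapDomain ℂ ℂ (fun f => f.whisker s)

lemma whiskerLin_single {N : ℕ} {a b : List Bool} (s : List Bool) (f : Diagram N a b) (r : ℂ) :
    whiskerLin N a b s (Finsupp.single f r) = Finsupp.single (f.whisker s) r := by
  simp [whiskerLin]

lemma LocalRel.whisker {N K : ℕ} {a b : List Bool} (s : List Bool) {y : Diagram N a b →₀ ℂ}
    (hy : LocalRel N K y) : LocalRel N K (whiskerLin N a b s y) := by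
  cases hy with
  | move f g h =>
    rw [map_sub, whiskerLin_single, whiskerLin_single]
    exact LocalRel.move (f.whisker s) (g.whisker s) h
  | skein k f g h hf hg hh =>
    simp only [map_sub, map_smul, whiskerLin_single]
    exact LocalRel.skein k (f.whisker s) (g.whisker s) (h.whisker s) hf hg hh
  | curlRight k p f g hf hg =>
    simp only [map_sub, map_smul, whiskerLin_single]
    exact LocalRel.curlRight k p (f.whisker s) (g.whisker s) hf hg
  | curlLeft k p f g hf hg =>
    simp only [map_sub, map_smul, whiskerLin_single]
    exact LocalRel.curlLeft k p (f.whisker s) (g.whisker s) hf hg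
  | circle k t f g hf hg =>
    simp only [map_sub, map_smul, whiskerLin_single]
    exact LocalRel.circle k t (f.whisker s) (g.whisker s) hf hg
  | couponInOut k u hu f g hf hg =>
    simp only [map_sub, map_smul, map_sum, whiskerLin_single]
    exact LocalRel.couponInOut k u hu (f.whisker s) (fun π => (g π).whisker s) hf hg
  | couponOutIn k f g hf hg =>
    simp only [map_sub, whiskerLin_single]
    exact LocalRel.couponOutIn k (f.whisker s) (g.whisker s) hf hg

lemma whiskerLin_stack {N : ℕ} {a b c : List Bool} (s : List Bool) (x : Diagram N a b →₀ ℂ)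
    (y : Diagram N b c →₀ ℂ) :
    whiskerLin N a c s (stack N a b c x y) =
      stack N (a ++ s) (b ++ s) (c ++ s) (whiskerLin N a b s x) (whiskerLin N b c s y) := by
  induction x using Finsupp.induction_linear with
  | zero => simp
  | add x x' hx hx' => simp [hx, hx']
  | single f r =>
    induction y using Finsupp.induction_linear with
    | zero => simp
    | add y y' hy hy' => simp [hy, hy']
    | single g t => simp only [stack_single, whiskerLin_single, Diagram.whisker, Diagram.comp]

lemma whiskerLin_mem {N K : ℕ} {a b : List Bool} (s : List Bool) {x : Diagram N a b →₀ ℂ}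
    (hx : x ∈ relations N K a b) : whiskerLin N a b s x ∈ relations N K (a ++ s) (b ++ s) := by
  induction hx using Submodule.span_induction with
  | mem x hx =>
    obtain ⟨p, d, f, y, g, hy, rfl⟩ := hx
    refine Submodule.subset_span ⟨p ++ s, d ++ s, f.whisker s, _, g.whisker s, hy.whisker s, ?_⟩
    rw [whiskerLin_stack, whiskerLin_stack, whiskerLin_single, whiskerLin_single]
  | zero => simp
  | add x y _ _ hx hy => rw [map_add]; exact Submodule.add_mem _ hx hy
  | smul z x _ hx => rw [map_smul]; exact Submodule.smul_mem _ _ hx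

/-- The closure of a skein from `a` to `a`: its top is joined to its bottom by parallel strands that
run around on the right. -/
def skeinClosure {N K : ℕ} (a : HeckeCat N K) : End a →ₗ[ℂ] SkeinAlg N K 0 :=
  (relations N K a.signs a.signs).liftQ
    ((relations N K [] []).mkQ ∘ₗ
      ((stack N [] (a.signs ++ dual a.signs) []).flip (diag (capsDiagram N a.signs))) ∘ₗ
      (stack N [] (a.signs ++ dual a.signs) (a.signs ++ dual a.signs)
        (diag (cupsDiagram N a.signs))) ∘ₗ
      whiskerLin N a.signs a.signs (dual a.signs))
    (fun _ hx => (Submodule.Quotient.mk_eq_zero _).2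
      (stack_mem_left (stack_mem_right _ (whiskerLin_mem _ hx)) _))

/-- The pairing of `H(a, b)` and `H(b, a)`, with values in the skein module of closed diagrams. -/
def pairing {N K : ℕ} {a b : HeckeCat N K} (f : a ⟶ b) (g : b ⟶ a) : SkeinAlg N K 0 :=
  skeinClosure a (f ≫ g)

/-- The negligible morphisms: those whose pairing with all morphisms is zero. -/
def negligible {N K : ℕ} (a b : HeckeCat N K) : Submodule ℂ (a ⟶ b) where
  carrier := {f | ∀ g : b ⟶ a, pairing f g = 0}
  add_mem' {f f'} hf hf' g := by
    have h1 := hf g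
    have h2 := hf' g
    unfold pairing at h1 h2 ⊢
    rw [Preadditive.add_comp]
    exact (map_add (skeinClosure a) _ _).trans (by rw [h1, h2, add_zero])
  zero_mem' g := by
    unfold pairing
    rw [Limits.zero_comp]
    exact map_zero (skeinClosure a)
  smul_mem' z f hf g := by
    have h1 := hf g
    unfold pairing at h1 ⊢
    rw [Linear.smul_comp]
    exact (map_smul (skeinClosure a) _ _).trans (by rw [h1, smul_zero])

/-- The purified skein algebra `H(n, n) / N(n, n)` of endomorphisms of the object `n`. -/
abbrev Purified (N K n : ℕ) : Type :=
  RingQuot (fun f g : SkeinAlg N K n => f - g ∈ negligible (obj N K n) (obj N K n))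

/-- The projection from the skein algebra to the purified skein algebra. -/
def purify (N K n : ℕ) : SkeinAlg N K n →ₐ[ℂ] Purified N K n := RingQuot.mkAlgHom ℂ _

/-! ### Markov traces and the GNS construction -/

/-- A Markov trace on `H_∞` with parameter `η`: a normalized trace with `Tr (x e_n) = η Tr x` for
all `n ≥ 1` and `x` in `H_n`. (The generators are counted from `0` here.) -/
structure IsMarkovTrace (N K : ℕ) (η : ℂ) (Tr : Hecke N K ⊤ →ₗ[ℂ] ℂ) : Prop where
  tracial : ∀ x y, Tr (x * y) = Tr (y * x)
  normalized : Tr 1 = 1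
  markov : ∀ (n : ℕ) (x : Hecke N K (n + 1 : ℕ)),
    Tr (Hecke.incl N K (n + 1) x * Hecke.e N K (BraidGen.top n)) =
      η * Tr (Hecke.incl N K (n + 1) x)

/-- The null set `{x | Tr (x^* x) = 0}` of a functional. -/
def nullSet {N K : ℕ} (Tr : Hecke N K ⊤ →ₗ[ℂ] ℂ) : Set (Hecke N K ⊤) :=
  {x | Tr (Hecke.adj x * x) = 0}

/-- The left ideal spanned by the null set. (For a state the null set is itself a left ideal.) -/
def nullIdeal {N K : ℕ} (Tr : Hecke N K ⊤ →ₗ[ℂ] ℂ) :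
    Submodule (Hecke N K ⊤) (Hecke N K ⊤) :=
  Submodule.span (Hecke N K ⊤) (nullSet Tr)

/-- The space of the GNS representation, on which `H_∞` acts from the left. -/
abbrev GNS {N K : ℕ} (Tr : Hecke N K ⊤ →ₗ[ℂ] ℂ) : Type := Hecke N K ⊤ ⧸ nullIdeal Tr

/-- The image of `H_n` in the space of the GNS representation. -/
def gnsSub {N K : ℕ} (Tr : Hecke N K ⊤ →ₗ[ℂ] ℂ) (n : ℕ) : Submodule ℂ (GNS Tr) :=
  LinearMap.range (((nullIdeal Tr).mkQ.restrictScalars ℂ) ∘ₗ (Hecke.incl N K n).toLinearMap)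

lemma gnsSub_stable {N K : ℕ} (Tr : Hecke N K ⊤ →ₗ[ℂ] ℂ) (n : ℕ) (x : Hecke N K n)
    (v : GNS Tr) (hv : v ∈ gnsSub Tr n) :
    Algebra.lsmul ℂ ℂ (GNS Tr) (Hecke.incl N K n x) v ∈ gnsSub Tr n := by
  obtain ⟨y, rfl⟩ := hv
  exact ⟨x * y, by simp; rfl⟩

/-- The representation `π_n` of `H_n` on the image of `H_n` in the space of the GNS
representation, by left multiplication. The image is finite-dimensional, so that all its linear
endomorphisms are bounded. -/
def gnsRep {N K : ℕ} (Tr : Hecke N K ⊤ →ₗ[ℂ] ℂ) (n : ℕ) :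
    Hecke N K n →ₐ[ℂ] Module.End ℂ (gnsSub Tr n) where
  toFun x := (Algebra.lsmul ℂ ℂ (GNS Tr) (Hecke.incl N K n x)).restrict (gnsSub_stable Tr n x)
  map_one' := by ext v; simp
  map_mul' x y := by ext v; simp
  map_zero' := by ext v; simp
  map_add' x y := by ext v; simp
  commutes' z := by ext v; simp

end SkeinSU

end

open SkeinSU

noncomputable section

open CategoryTheory

namespace SkeinSU

section

/-! ### Generalities on Hecke algebras -/

lemma Hecke.braid_inv (N K : ℕ) {n : ℕ∞} (i : BraidGen n) :
    Hecke.braid N K n (PresentedGroup.of i)⁻¹ =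
      qpow N K (1 / N) • Hecke.sigma N K i -
        (qpow N K (1 / (2 * N)) * (qpow N K (1 / 2) - qpow N K (-1 / 2))) • 1 := by
  have h := Hecke.quad N K i
  have h1 : qpow N K (1 / (2 * N)) * qpow N K (-(1 / (2 * N))) = 1 := by
    rw [← qpow_add, add_neg_cancel, qpow_zero]
  have h2 : qpow N K (1 / (2 * N)) * qpow N K (1 / (2 * N)) = qpow N K (1 / N) := by
    rw [← qpow_add]
    congr 1
    rcases eq_or_ne (N : ℚ) 0 with h0 | h0
    · simp [h0]
    · field_simp; norm_num
  have h3 := congrArg (fun y => qpow N K (1 / (2 * N)) • y) h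
  simp only [smul_sub, smul_smul, h1, h2, one_smul] at h3
  rw [← h3]
  unfold Hecke.sigma
  abel

lemma Hecke.sigma_mul_inv (N K : ℕ) {n : ℕ∞} (i : BraidGen n) :
    Hecke.sigma N K i * Hecke.braid N K n (PresentedGroup.of i)⁻¹ = 1 := by
  unfold Hecke.sigma
  rw [← map_mul, mul_inv_cancel, map_one]

lemma Hecke.sigma_sq (N K : ℕ) {n : ℕ∞} (i : BraidGen n) :
    ∃ c d : ℂ, Hecke.sigma N K i * Hecke.sigma N K i = c • 1 + d • Hecke.sigma N K i := by
  have h := Hecke.sigma_mul_inv N K i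
  rw [Hecke.braid_inv, mul_sub, mul_smul_comm, mul_smul_comm, mul_one, sub_eq_iff_eq_add] at h
  have h0 : qpow N K (1 / N) ≠ 0 := Complex.exp_ne_zero _
  refine ⟨(qpow N K (1 / N))⁻¹, (qpow N K (1 / N))⁻¹ * (qpow N K (1 / (2 * N)) *
    (qpow N K (1 / 2) - qpow N K (-1 / 2))), ?_⟩
  rw [mul_smul, ← smul_add, ← h, smul_smul, inv_mul_cancel₀ h0, one_smul]

lemma Hecke.sigma_far (N K : ℕ) {n : ℕ∞} (i j : BraidGen n) (h : i.1 + 2 ≤ j.1) :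
    Hecke.sigma N K i * Hecke.sigma N K j = Hecke.sigma N K j * Hecke.sigma N K i := by
  unfold Hecke.sigma
  rw [← map_mul, BraidGroup.far i j h, map_mul]

lemma Hecke.sigma_braid (N K : ℕ) {n : ℕ∞} (i j : BraidGen n) (h : i.1 + 1 = j.1) :
    Hecke.sigma N K i * Hecke.sigma N K j * Hecke.sigma N K i =
      Hecke.sigma N K j * Hecke.sigma N K i * Hecke.sigma N K j := by
  unfold Hecke.sigma
  rw [← map_mul, ← map_mul, BraidGroup.braid i j h, map_mul, map_mul]

/-- The Hecke algebra is generated by the `σ_i`. -/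
lemma Hecke.eq_top_of_sigma_mem (N K : ℕ) {n : ℕ∞} (S : Subalgebra ℂ (Hecke N K n))
    (h : ∀ i, Hecke.sigma N K i ∈ S) : S = ⊤ := by
  rw [eq_top_iff]
  rintro x -
  have hinv : ∀ i : BraidGen n, Hecke.braid N K n (PresentedGroup.of i)⁻¹ ∈ S := by
    intro i
    rw [Hecke.braid_inv]
    exact S.sub_mem (S.smul_mem (h i) _) (S.smul_mem S.one_mem _)
  have hb : ∀ g : BraidGroup n, Hecke.braid N K n g ∈ S := by
    intro g
    have hg : g ∈ Subgroup.closure (Set.range (PresentedGroup.of (rels := {w | BraidRel n w}))) := by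
      rw [PresentedGroup.closure_range_of]; trivial
    induction hg using Subgroup.closure_induction'' with
    | mem x hx => obtain ⟨i, rfl⟩ := hx; exact h i
    | inv_mem x hx => obtain ⟨i, rfl⟩ := hx; exact hinv i
    | one => rw [map_one]; exact S.one_mem
    | mul x y _ _ hx hy => rw [map_mul]; exact S.mul_mem hx hy
  obtain ⟨y, rfl⟩ := RingQuot.mkAlgHom_surjective ℂ (HeckeRel N K n) x
  induction y using MonoidAlgebra.induction_linear with
  | zero => rw [map_zero]; exact S.zero_mem
  | add x y hx hy => rw [map_add]; exact S.add_mem hx hy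
  | single g r =>
    have : MonoidAlgebra.single g r = r • MonoidAlgebra.of ℂ (BraidGroup n) g := by simp
    rw [this, map_smul]
    exact S.smul_mem (hb g) r

@[elab_as_elim]
lemma Hecke.induction {N K : ℕ} {n : ℕ∞} {P : Hecke N K n → Prop} (x : Hecke N K n)
    (one : P 1) (add : ∀ x y, P x → P y → P (x + y)) (smul : ∀ (c : ℂ) x, P x → P (c • x))
    (mul : ∀ i x, P x → P (Hecke.sigma N K i * x)) : P x := by
  let M : Submodule ℂ (Hecke N K n) :=
    { carrier := {x | P x}
      add_mem' := fun {a b} ha hb => add a b ha hb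
      zero_mem' := by have := smul 0 1 one; rwa [zero_smul] at this
      smul_mem' := fun c x hx => smul c x hx }
  let S : Subalgebra ℂ (Hecke N K n) :=
    { carrier := {a | ∀ x, P x → P (a * x)}
      mul_mem' := fun {a b} ha hb x hx => by rw [mul_assoc]; exact ha _ (hb _ hx)
      one_mem' := fun x hx => by rwa [one_mul]
      add_mem' := fun {a b} ha hb x hx => by rw [add_mul]; exact add _ _ (ha _ hx) (hb _ hx)
      zero_mem' := fun x hx => by rw [zero_mul]; exact M.zero_mem
      algebraMap_mem' := fun r x hx => by rw [← Algebra.smul_def]; exact smul r x hx }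
  have hS := Hecke.eq_top_of_sigma_mem N K S mul
  have : x ∈ S := by rw [hS]; trivial
  have h := this 1 one
  rwa [mul_one] at h

lemma Hecke.algHom_ext {N K : ℕ} {n : ℕ∞} {A : Type*} [Semiring A] [Algebra ℂ A]
    {f g : Hecke N K n →ₐ[ℂ] A} (h : ∀ i, f (Hecke.sigma N K i) = g (Hecke.sigma N K i)) :
    f = g := by
  refine AlgHom.ext fun x => ?_
  induction x using Hecke.induction with
  | one => rw [map_one, map_one]
  | add x y hx hy => rw [map_add, map_add, hx, hy]
  | smul c x hx => rw [map_smul, map_smul, hx]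
  | mul i x hx => rw [map_mul, map_mul, hx, h]

/-- The index of a generator in a larger braid group. -/
def BraidGen.castLE {n m : ℕ} (h : n ≤ m) (i : BraidGen n) : BraidGen m :=
  ⟨i.1, lt_of_lt_of_le i.2 (by exact_mod_cast h)⟩

/-- The homomorphism `H_n → H_m` for `n ≤ m`. -/
def Hecke.mapLE (N K : ℕ) {n m : ℕ} (h : n ≤ m) : Hecke N K n →ₐ[ℂ] Hecke N K m :=
  Hecke.liftAlg N K
    (fun i => Hecke.unit N K m (PresentedGroup.of (i.castLE h)))
    (fun i j h' => by
      rw [← map_mul, ← map_mul, BraidGroup.far (i.castLE h) (j.castLE h) h'])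
    (fun i j h' => by
      rw [← map_mul, ← map_mul, ← map_mul, ← map_mul,
        BraidGroup.braid (i.castLE h) (j.castLE h) h'])
    (fun i => by rw [← map_inv]; exact Hecke.quad N K _)

@[simp]
lemma Hecke.mapLE_sigma (N K : ℕ) {n m : ℕ} (h : n ≤ m) (i : BraidGen n) :
    Hecke.mapLE N K h (Hecke.sigma N K i) = Hecke.sigma N K (i.castLE h) :=
  Hecke.liftAlg_sigma N K _ _ _ _ i

@[simp]
lemma Hecke.incl_sigma (N K : ℕ) {n : ℕ} (i : BraidGen n) :
    Hecke.incl N K n (Hecke.sigma N K i) = Hecke.sigma N K (BraidGen.top i.1) :=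
  Hecke.liftAlg_sigma N K _ _ _ _ i

lemma Hecke.mapLE_mapLE (N K : ℕ) {n m k : ℕ} (h : n ≤ m) (h' : m ≤ k) (x : Hecke N K n) :
    Hecke.mapLE N K h' (Hecke.mapLE N K h x) = Hecke.mapLE N K (h.trans h') x := by
  have : (Hecke.mapLE N K h').comp (Hecke.mapLE N K h) = Hecke.mapLE N K (h.trans h') :=
    Hecke.algHom_ext fun i => by
      rw [AlgHom.comp_apply, Hecke.mapLE_sigma, Hecke.mapLE_sigma, Hecke.mapLE_sigma]; rfl
  exact DFunLike.congr_fun this x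

lemma Hecke.mapLE_self (N K : ℕ) {n : ℕ} (x : Hecke N K n) :
    Hecke.mapLE N K le_rfl x = x := by
  have : Hecke.mapLE N K (le_refl n) = AlgHom.id ℂ _ :=
    Hecke.algHom_ext fun i => by rw [Hecke.mapLE_sigma]; rfl
  exact DFunLike.congr_fun this x

@[simp]
lemma Hecke.incl_mapLE (N K : ℕ) {n m : ℕ} (h : n ≤ m) (x : Hecke N K n) :
    Hecke.incl N K m (Hecke.mapLE N K h x) = Hecke.incl N K n x := by
  have : (Hecke.incl N K m).comp (Hecke.mapLE N K h) = Hecke.incl N K n :=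
    Hecke.algHom_ext fun i => by
      rw [AlgHom.comp_apply, Hecke.mapLE_sigma, Hecke.incl_sigma, Hecke.incl_sigma]; rfl
  exact DFunLike.congr_fun this x

lemma Hecke.exists_incl (N K : ℕ) (x : Hecke N K ⊤) : ∃ n y, Hecke.incl N K n y = x := by
  induction x using Hecke.induction with
  | one => exact ⟨0, 1, map_one _⟩
  | add x y hx hy =>
    obtain ⟨n, x, rfl⟩ := hx
    obtain ⟨m, y, rfl⟩ := hy
    exact ⟨max n m, Hecke.mapLE N K (le_max_left n m) x + Hecke.mapLE N K (le_max_right n m) y,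
      by simp⟩
  | smul c x hx =>
    obtain ⟨n, x, rfl⟩ := hx
    exact ⟨n, c • x, by simp⟩
  | mul i x hx =>
    obtain ⟨n, x, rfl⟩ := hx
    refine ⟨max (i.1 + 2) n, Hecke.sigma N K ⟨i.1, ?_⟩ *
      Hecke.mapLE N K (le_max_right (i.1 + 2) n) x, ?_⟩
    · exact_mod_cast (show i.1 + 1 < max (i.1 + 2) n from lt_max_of_lt_left (by omega))
    · rw [map_mul, Hecke.incl_sigma, Hecke.incl_mapLE]; rfl

@[simp] lemma Hecke.adj_one (N K : ℕ) {n : ℕ∞} : Hecke.adj (1 : Hecke N K n) = 1 := by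
  simp [Hecke.adj]

lemma Hecke.adj_add {N K : ℕ} {n : ℕ∞} (x y : Hecke N K n) :
    Hecke.adj (x + y) = Hecke.adj x + Hecke.adj y := by
  simp [Hecke.adj]

lemma Hecke.map_braid_inv {N K : ℕ} {n : ℕ∞} {A : Type*} [Ring A] [Algebra ℂ A]
    (f : Hecke N K n →ₐ[ℂ] A) (i : BraidGen n) (y : A) (h : y * f (Hecke.sigma N K i) = 1) :
    f (Hecke.braid N K n (PresentedGroup.of i)⁻¹) = y := by
  have h' : f (Hecke.sigma N K i) * f (Hecke.braid N K n (PresentedGroup.of i)⁻¹) = 1 := by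
    rw [← map_mul, Hecke.sigma_mul_inv, map_one]
  exact (left_inv_eq_right_inv h h').symm

lemma Hecke.incl_adj (N K : ℕ) {n : ℕ} (x : Hecke N K n) :
    Hecke.incl N K n (Hecke.adj x) = Hecke.adj (Hecke.incl N K n x) := by
  induction x using Hecke.induction with
  | one => simp
  | add x y hx hy => simp only [Hecke.adj_add, map_add, hx, hy]
  | smul c x hx => simp only [Hecke.adj_smul, map_smul, hx]
  | mul i x hx =>
    rw [Hecke.adj_mul, map_mul, map_mul, Hecke.adj_mul, hx, Hecke.incl_sigma, Hecke.adj_sigma,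
      Hecke.adj_sigma]
    congr 1
    refine Hecke.map_braid_inv _ i _ ?_
    rw [Hecke.incl_sigma]
    unfold Hecke.sigma
    rw [← map_mul, inv_mul_cancel, map_one]

/-- The last generator of `H_{n+2}`. -/
def BraidGen.last (n : ℕ) : BraidGen ((n + 2 : ℕ) : ℕ∞) :=
  ⟨n, by exact_mod_cast (show n + 1 < n + 2 by omega)⟩

lemma Hecke.mapLE_comm_sigma (N K : ℕ) {n m : ℕ} (h : n ≤ m) (j : BraidGen m) (hj : n ≤ j.1)
    (x : Hecke N K n) : Hecke.sigma N K j * Hecke.mapLE N K h x =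
      Hecke.mapLE N K h x * Hecke.sigma N K j := by
  induction x using Hecke.induction with
  | one => simp
  | add x y hx hy => simp only [map_add, mul_add, add_mul, hx, hy]
  | smul c x hx => simp only [map_smul, mul_smul_comm, smul_mul_assoc, hx]
  | mul i x hx =>
    have hi : i.1 + 1 < n := by exact_mod_cast i.2
    rw [map_mul, mul_assoc, ← hx, ← mul_assoc, ← mul_assoc, Hecke.mapLE_sigma,
      Hecke.sigma_far N K (i.castLE h) j (by simp only [BraidGen.castLE]; omega)]

/-- `H_{n+2}` is spanned by `H_{n+1}` and `H_{n+1} σ_n H_{n+1}`. -/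
lemma Hecke.span_last (N K n : ℕ) :
    Submodule.span ℂ ({x : Hecke N K (n + 2 : ℕ) | ∃ a : Hecke N K (n + 1 : ℕ),
        x = Hecke.mapLE N K (Nat.le_succ _) a} ∪
      {x | ∃ a b : Hecke N K (n + 1 : ℕ), x = Hecke.mapLE N K (Nat.le_succ _) a *
        Hecke.sigma N K (BraidGen.last n) * Hecke.mapLE N K (Nat.le_succ _) b}) = ⊤ := by
  induction n with
  | zero =>
    rw [eq_top_iff]
    rintro x -
    have h1 : ∀ i : BraidGen ((0 + 2 : ℕ) : ℕ∞), i = BraidGen.last 0 := by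
      intro i
      have : i.1 + 1 < 2 := by exact_mod_cast i.2
      exact Subtype.ext (by simp only [BraidGen.last]; omega)
    have hone : (1 : Hecke N K (0 + 2 : ℕ)) ∈ Submodule.span ℂ
        ({x : Hecke N K (0 + 2 : ℕ) | ∃ a : Hecke N K (0 + 1 : ℕ),
        x = Hecke.mapLE N K (Nat.le_succ _) a} ∪
      {x | ∃ a b : Hecke N K (0 + 1 : ℕ), x = Hecke.mapLE N K (Nat.le_succ _) a *
        Hecke.sigma N K (BraidGen.last 0) * Hecke.mapLE N K (Nat.le_succ _) b}) :=
      Submodule.subset_span (Or.inl ⟨1, by simp⟩)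
    have hsig : Hecke.sigma N K (BraidGen.last 0) ∈ Submodule.span ℂ
        ({x : Hecke N K (0 + 2 : ℕ) | ∃ a : Hecke N K (0 + 1 : ℕ),
        x = Hecke.mapLE N K (Nat.le_succ _) a} ∪
      {x | ∃ a b : Hecke N K (0 + 1 : ℕ), x = Hecke.mapLE N K (Nat.le_succ _) a *
        Hecke.sigma N K (BraidGen.last 0) * Hecke.mapLE N K (Nat.le_succ _) b}) :=
      Submodule.subset_span (Or.inr ⟨1, 1, by simp⟩)
    suffices h : ∃ c d : ℂ, x = c • 1 + d • Hecke.sigma N K (BraidGen.last 0) by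
      obtain ⟨c, d, rfl⟩ := h
      exact Submodule.add_mem _ (Submodule.smul_mem _ _ hone) (Submodule.smul_mem _ _ hsig)
    induction x using Hecke.induction with
    | one => exact ⟨1, 0, by simp⟩
    | add x y hx hy =>
      obtain ⟨c, d, rfl⟩ := hx
      obtain ⟨c', d', rfl⟩ := hy
      exact ⟨c + c', d + d', by module⟩
    | smul r x hx =>
      obtain ⟨c, d, rfl⟩ := hx
      exact ⟨r * c, r * d, by module⟩
    | mul i x hx =>
      obtain ⟨c, d, rfl⟩ := hx
      obtain ⟨c', d', h⟩ := Hecke.sigma_sq N K (BraidGen.last 0)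
      refine ⟨d * c', c + d * d', ?_⟩
      rw [h1 i, mul_add, mul_smul_comm, mul_smul_comm, h, mul_one]
      module
  | succ n ih =>
    rw [eq_top_iff]
    rintro x -
    set S := Submodule.span ℂ ({x : Hecke N K (n + 1 + 2 : ℕ) | ∃ a : Hecke N K (n + 1 + 1 : ℕ),
        x = Hecke.mapLE N K (Nat.le_succ _) a} ∪
      {x | ∃ a b : Hecke N K (n + 1 + 1 : ℕ), x = Hecke.mapLE N K (Nat.le_succ _) a *
        Hecke.sigma N K (BraidGen.last (n + 1)) * Hecke.mapLE N K (Nat.le_succ _) b}) with hS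
    have hl : ∀ a, Hecke.mapLE N K (Nat.le_succ _) a ∈ S :=
      fun a => Submodule.subset_span (Or.inl ⟨a, rfl⟩)
    have hr : ∀ a b, Hecke.mapLE N K (Nat.le_succ _) a *
        Hecke.sigma N K (BraidGen.last (n + 1)) * Hecke.mapLE N K (Nat.le_succ _) b ∈ S :=
      fun a b => Submodule.subset_span (Or.inr ⟨a, b, rfl⟩)
    have key : ∀ a b : Hecke N K (n + 1 + 1 : ℕ), Hecke.sigma N K (BraidGen.last (n + 1)) *
        (Hecke.mapLE N K (Nat.le_succ _) a * Hecke.sigma N K (BraidGen.last (n + 1)) *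
          Hecke.mapLE N K (Nat.le_succ _) b) ∈ S := by
      intro a b
      have ha : a ∈ (⊤ : Submodule ℂ (Hecke N K (n + 2 : ℕ))) := trivial
      rw [← ih] at ha
      have hcomm : ∀ c : Hecke N K (n + 1 : ℕ), Hecke.sigma N K (BraidGen.last (n + 1)) *
          Hecke.mapLE N K (Nat.le_succ _) (Hecke.mapLE N K (Nat.le_succ _) c) =
          Hecke.mapLE N K (Nat.le_succ _) (Hecke.mapLE N K (Nat.le_succ _) c) *
          Hecke.sigma N K (BraidGen.last (n + 1)) := by
        intro c
        rw [Hecke.mapLE_mapLE]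
        exact Hecke.mapLE_comm_sigma N K _ _ (le_refl (n + 1)) c
      induction ha using Submodule.span_induction with
      | mem x hx =>
        rcases hx with ⟨c, rfl⟩ | ⟨c, d, rfl⟩
        · obtain ⟨u, v, h⟩ := Hecke.sigma_sq N K (BraidGen.last (n + 1))
          rw [← mul_assoc, ← mul_assoc, hcomm,
            mul_assoc (Hecke.mapLE N K _ (Hecke.mapLE N K _ c)) (Hecke.sigma _ _ _), h, mul_add,
            add_mul, mul_smul_comm, mul_smul_comm, mul_one, smul_mul_assoc, smul_mul_assoc]
          refine S.add_mem (S.smul_mem _ ?_) (S.smul_mem _ (hr _ _))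
          rw [← map_mul]
          exact hl _
        · have hb := Hecke.sigma_braid N K ((BraidGen.last n).castLE (Nat.le_succ _))
            (BraidGen.last (n + 1)) rfl
          have e : Hecke.sigma N K (BraidGen.last (n + 1)) *
            (Hecke.mapLE N K (Nat.le_succ _) (Hecke.mapLE N K (Nat.le_succ _) c *
              Hecke.sigma N K (BraidGen.last n) * Hecke.mapLE N K (Nat.le_succ _) d) *
              Hecke.sigma N K (BraidGen.last (n + 1)) * Hecke.mapLE N K (Nat.le_succ _) b) =
            Hecke.mapLE N K (Nat.le_succ _) (Hecke.mapLE N K (Nat.le_succ _) c *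
              Hecke.sigma N K (BraidGen.last n)) * Hecke.sigma N K (BraidGen.last (n + 1)) *
              Hecke.mapLE N K (Nat.le_succ _) (Hecke.sigma N K (BraidGen.last n) *
                Hecke.mapLE N K (Nat.le_succ _) d * b) := by
            simp only [map_mul, Hecke.mapLE_sigma]
            set C := Hecke.mapLE N K (Nat.le_succ _) (Hecke.mapLE N K (Nat.le_succ _) c)
            set D := Hecke.mapLE N K (Nat.le_succ _) (Hecke.mapLE N K (Nat.le_succ _) d) with hD
            set B := Hecke.mapLE N K (Nat.le_succ _) b
            set t := Hecke.sigma N K (BraidGen.last (n + 1))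
            set r := Hecke.sigma N K ((BraidGen.last n).castLE (Nat.le_succ _))
            have h1 : t * C = C * t := hcomm c
            have h2 : t * D = D * t := hcomm d
            calc t * (C * r * D * t * B) = (t * C) * r * (D * t) * B := by simp only [mul_assoc]
              _ = C * (t * r * t) * D * B := by rw [h1, ← h2]; simp only [mul_assoc]
              _ = _ := by rw [← hb]; simp only [mul_assoc]
          rw [e]
          exact hr _ _
      | zero => simp
      | add x y _ _ hx hy => simpa only [map_add, add_mul, mul_add] using S.add_mem hx hy
      | smul z x _ hx =>
        simpa only [map_smul, smul_mul_assoc, mul_smul_comm] using S.smul_mem z hx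
    induction x using Hecke.induction with
    | one => have := hl 1; rwa [map_one] at this
    | add x y hx hy => exact S.add_mem hx hy
    | smul c x hx => exact S.smul_mem c hx
    | mul i x hx =>
      have hi : i.1 + 1 < n + 1 + 2 := by exact_mod_cast i.2
      induction hx using Submodule.span_induction with
      | mem x hx =>
        by_cases hin : i.1 + 1 < n + 1 + 1
        · have : Hecke.sigma N K i = Hecke.mapLE N K (Nat.le_succ _)
              (Hecke.sigma N K (⟨i.1, by exact_mod_cast hin⟩ : BraidGen ((n + 1 + 1 : ℕ) : ℕ∞))) := by
            rw [Hecke.mapLE_sigma]; rfl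
          rw [this]
          rcases hx with ⟨a, rfl⟩ | ⟨a, b, rfl⟩
          · rw [← map_mul]; exact hl _
          · rw [← mul_assoc, ← mul_assoc, ← map_mul]; exact hr _ _
        · have : i = BraidGen.last (n + 1) := Subtype.ext (by simp only [BraidGen.last]; omega)
          subst this
          rcases hx with ⟨a, rfl⟩ | ⟨a, b, rfl⟩
          · have := hr 1 a
            rwa [map_one, one_mul] at this
          · exact key a b
      | zero => simp
      | add x y _ _ hx hy => rw [mul_add]; exact S.add_mem hx hy
      | smul z x _ hx => rw [mul_smul_comm]; exact S.smul_mem z hx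

/-- A compatible family of functionals on the `H_n` extends to `H_∞`. -/
lemma Hecke.exists_extension (N K : ℕ) (φ : ∀ n : ℕ, Hecke N K n →ₗ[ℂ] ℂ)
    (hφ : ∀ (n : ℕ) (x : Hecke N K n), φ (n + 1) (Hecke.mapLE N K (Nat.le_succ n) x) = φ n x) :
    ∃ Tr : Hecke N K ⊤ →ₗ[ℂ] ℂ, ∀ (n : ℕ) (x : Hecke N K n), Tr (Hecke.incl N K n x) = φ n x := by
  let f : ∀ i j : ℕ, i ≤ j → (Hecke N K i →ₐ[ℂ] Hecke N K j) := fun _ _ h => Hecke.mapLE N K h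
  have : DirectedSystem (fun n : ℕ => Hecke N K n) (f · · ·) :=
    ⟨fun i x => Hecke.mapLE_self N K x, fun {i j k} hij hjk x => Hecke.mapLE_mapLE N K hij hjk x⟩
  let of : ∀ n : ℕ, Hecke N K n →ₐ[ℂ] DirectLimit (fun n : ℕ => Hecke N K n) f :=
    fun n => DirectLimit.Algebra.of (fun n : ℕ => Hecke N K n) f n
  have hof : ∀ (n m : ℕ) (h : n ≤ m) (x : Hecke N K n), of m (Hecke.mapLE N K h x) = of n x :=
    fun n m h x => DirectLimit.Algebra.of_f (G := fun n : ℕ => Hecke N K n) (f := f) h x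
  let u : ∀ n : ℕ, BraidGen n → (DirectLimit (fun n : ℕ => Hecke N K n) f)ˣ := fun n i =>
    Units.map (of n : Hecke N K n →* _) (Hecke.unit N K n (PresentedGroup.of i))
  have hu : ∀ (n m : ℕ) (i : BraidGen n) (j : BraidGen m), i.1 = j.1 → u n i = u m j := by
    intro n m i j hij
    refine Units.ext ?_
    change of n (Hecke.sigma N K i) = of m (Hecke.sigma N K j)
    rw [← hof n (max n m) (le_max_left n m), ← hof m (max n m) (le_max_right n m),
      Hecke.mapLE_sigma, Hecke.mapLE_sigma]
    congr 2
    exact Subtype.ext hij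
  let v : BraidGen ⊤ → (DirectLimit (fun n : ℕ => Hecke N K n) f)ˣ := fun i =>
    u (i.1 + 2) (BraidGen.last i.1)
  have hv : ∀ (n : ℕ) (i : BraidGen ⊤) (h : i.1 + 1 < n),
      v i = u n ⟨i.1, by exact_mod_cast h⟩ := fun n i h => hu _ _ _ _ rfl
  let F : Hecke N K ⊤ →ₐ[ℂ] DirectLimit (fun n : ℕ => Hecke N K n) f :=
    Hecke.liftAlg N K v
      (fun i j h => by
        rw [hv (j.1 + 2) i (by omega), hv (j.1 + 2) j (by omega)]
        simp only [u, ← map_mul]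
        rw [BraidGroup.far]
        exact h)
      (fun i j h => by
        rw [hv (j.1 + 2) i (by omega), hv (j.1 + 2) j (by omega)]
        simp only [u, ← map_mul]
        rw [BraidGroup.braid]
        exact h)
      (fun i => by
        have := congrArg (of (i.1 + 2)) (Hecke.quad N K (BraidGen.last i.1))
        rw [map_sub, map_smul, map_smul, map_smul, map_one] at this
        simp only [v, u, ← map_inv]
        exact this)
  have hF : ∀ n : ℕ, F.comp (Hecke.incl N K n) = of n := fun n =>
    Hecke.algHom_ext fun i => by
      rw [AlgHom.comp_apply, Hecke.incl_sigma, Hecke.liftAlg_sigma]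
      exact congrArg Units.val (hu _ _ (BraidGen.last i.1) i rfl)
  have hφ' : ∀ (i j : ℕ) (h : i ≤ j) (x : Hecke N K i), φ j (f i j h x) = φ i x := by
    intro i j h
    induction h with
    | refl => intro x; exact congrArg (φ i) (Hecke.mapLE_self N K x)
    | step h ih =>
      intro x
      refine Eq.trans ?_ ((hφ _ _).trans (ih x))
      exact congrArg (φ _) (Hecke.mapLE_mapLE N K h (Nat.le_succ _) x).symm
  refine ⟨(DirectLimit.Module.lift ℂ ℕ (fun n : ℕ => Hecke N K n) f φ hφ') ∘ₗ F.toLinearMap,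
    fun n x => ?_⟩
  change DirectLimit.Module.lift ℂ ℕ (fun n : ℕ => Hecke N K n) f φ hφ'
    ((F.comp (Hecke.incl N K n)) x) = _
  rw [hF]
  rfl

end

section

/-! ### Calculus of diagrams -/

/-- The word `w` moved to the right by `k` strands. -/
def sh (k : ℕ) (w : List Layer) : List Layer := w.map fun x => (k + x.1, x.2)

@[simp] lemma sh_nil (k : ℕ) : sh k [] = [] := rfl

@[simp] lemma sh_cons (k : ℕ) (x : Layer) (w : List Layer) :
    sh k (x :: w) = (k + x.1, x.2) :: sh k w := rfl

@[simp] lemma sh_append (k : ℕ) (w v : List Layer) : sh k (w ++ v) = sh k w ++ sh k v := by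
  simp [sh]

lemma sh_sh (j k : ℕ) (w : List Layer) : sh j (sh k w) = sh (j + k) w := by
  simp [sh, add_assoc]

@[simp] lemma sh_zero (w : List Layer) : sh 0 w = w := by
  simp [sh]

lemma sh_pass (j k m : ℕ) (p : Bool) : sh j (pass k m p) = pass (j + k) m p := by
  simp [sh, pass, add_assoc]

lemma sh_crossUD (j k : ℕ) (p : Bool) : sh j (crossUD k p) = crossUD (j + k) p := rfl

lemma sh_positiveBraid {N : ℕ} (j k : ℕ) (u : List {i : ℕ // i + 1 < N}) :
    sh j (positiveBraid k u) = positiveBraid (j + k) u := by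
  simp [sh, positiveBraid, add_assoc]

lemma sh_cups (j k : ℕ) (a : List Bool) : sh j (cups k a) = cups (j + k) a := by
  induction a generalizing k with
  | nil => rfl
  | cons s a ih => simp only [cups, sh_cons, ih]; rfl

lemma sh_caps (j k : ℕ) (a : List Bool) : sh j (caps k a) = caps (j + k) a := by
  induction a generalizing k with
  | nil => rfl
  | cons s a ih => simp only [caps, sh_cons, sh_append, ih]; rfl

lemma Layer.leads_mk (N : ℕ) (l r : List Bool) (g : Piece) :
    Layer.Leads N (l.length, g) (l ++ g.bot N ++ r) (l ++ g.top N ++ r) :=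
  ⟨l, r, rfl, rfl, rfl⟩

lemma Layer.Leads.unique {N : ℕ} {x : Layer} {a b b' : List Bool} (h : Layer.Leads N x a b)
    (h' : Layer.Leads N x a b') : b = b' := by
  obtain ⟨l, r, h1, h2, h3⟩ := h
  obtain ⟨l', r', h1', h2', h3'⟩ := h'
  rw [h2, List.append_assoc, List.append_assoc] at h2'
  obtain ⟨e1, e2⟩ := List.append_inj h2' (h1.trans h1'.symm)
  rw [h3, h3', e1, List.append_cancel_left e2]

lemma leads_append_iff {N : ℕ} {w v : List Layer} {a c : List Bool} :
    Leads N (w ++ v) a c ↔ ∃ b, Leads N w a b ∧ Leads N v b c := by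
  refine ⟨fun h => ?_, fun ⟨b, h1, h2⟩ => h1.append h2⟩
  induction w generalizing a with
  | nil => exact ⟨a, rfl, h⟩
  | cons x w ih =>
    obtain ⟨d, h1, h2⟩ := h
    obtain ⟨b, h3, h4⟩ := ih h2
    exact ⟨b, ⟨d, h1, h3⟩, h4⟩

lemma leads_singleton_iff {N : ℕ} {x : Layer} {a b : List Bool} :
    Leads N [x] a b ↔ Layer.Leads N x a b :=
  ⟨fun ⟨_, h, e⟩ => e ▸ h, fun h => ⟨b, h, rfl⟩⟩

lemma Leads.unique {N : ℕ} {w : List Layer} {a b b' : List Bool} (h : Leads N w a b)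
    (h' : Leads N w a b') : b = b' := by
  induction w generalizing a with
  | nil => exact h.symm.trans h'
  | cons x w ih =>
    obtain ⟨d, h1, h2⟩ := h
    obtain ⟨d', h1', h2'⟩ := h'
    obtain rfl := h1.unique h1'
    exact ih h2 h2'

lemma Layer.Leads.shift {N : ℕ} {x : Layer} {a b : List Bool} (h : Layer.Leads N x a b)
    (l : List Bool) : Layer.Leads N (l.length + x.1, x.2) (l ++ a) (l ++ b) := by
  obtain ⟨l', r, h1, h2, h3⟩ := h
  exact ⟨l ++ l', r, by simp [h1], by simp [h2], by simp [h3]⟩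

lemma Leads.shift {N : ℕ} {w : List Layer} {a b : List Bool} (h : Leads N w a b)
    (l : List Bool) : Leads N (sh l.length w) (l ++ a) (l ++ b) := by
  induction w generalizing a with
  | nil => cases h; rfl
  | cons x w ih =>
    obtain ⟨d, h1, h2⟩ := h
    exact ⟨l ++ d, h1.shift l, ih h2⟩

/-- The diagram `f` with vertical strands to its left. -/
def Diagram.shift {N : ℕ} {a b : List Bool} (l : List Bool) (f : Diagram N a b) :
    Diagram N (l ++ a) (l ++ b) := ⟨sh l.length f.1, f.2.shift l⟩

/-- Linear combinations of diagrams with vertical strands to the left. -/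
def shiftLin (N : ℕ) (l a b : List Bool) :
    (Diagram N a b →₀ ℂ) →ₗ[ℂ] (Diagram N (l ++ a) (l ++ b) →₀ ℂ) :=
  Finsupp.lmapDomain ℂ ℂ (fun f => f.shift l)

lemma shiftLin_single {N : ℕ} {a b : List Bool} (l : List Bool) (f : Diagram N a b) (r : ℂ) :
    shiftLin N l a b (Finsupp.single f r) = Finsupp.single (f.shift l) r := by
  simp [shiftLin]

lemma Move.shift {N : ℕ} {w v : List Layer} (h : Move N w v) (j : ℕ) :
    Move N (sh j w) (sh j v) := by
  cases h with
  | far k m g h =>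
    have := Move.far (N := N) (j + k) m g h
    simpa only [sh_cons, sh_nil, ← add_assoc] using this
  | zigzag k s => exact Move.zigzag (j + k) s
  | zagzig k s => exact Move.zagzig (j + k) s
  | reidemeister2 k p => exact Move.reidemeister2 (j + k) p
  | reidemeister2UD k p => exact Move.reidemeister2UD (j + k) p
  | reidemeister2DU k p => exact Move.reidemeister2DU (j + k) p
  | reidemeister3 k => exact Move.reidemeister3 (j + k)
  | rotate k p => exact Move.rotate (j + k) p
  | passIn k p => rw [sh_append, sh_pass]; exact Move.passIn (j + k) p
  | passOut k p => rw [sh_append, sh_pass]; exact Move.passOut (j + k) p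

lemma LocalRel.shift {N K : ℕ} {a b : List Bool} (l : List Bool) {y : Diagram N a b →₀ ℂ}
    (hy : LocalRel N K y) : LocalRel N K (shiftLin N l a b y) := by
  cases hy with
  | move f g h =>
    rw [map_sub, shiftLin_single, shiftLin_single]
    exact LocalRel.move (f.shift l) (g.shift l) (h.shift _)
  | skein k f g h hf hg hh =>
    simp only [map_sub, map_smul, shiftLin_single]
    exact LocalRel.skein (l.length + k) (f.shift l) (g.shift l) (h.shift l)
      (by simp [Diagram.shift, hf]) (by simp [Diagram.shift, hg]) (by simp [Diagram.shift, hh])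
  | curlRight k p f g hf hg =>
    simp only [map_sub, map_smul, shiftLin_single]
    exact LocalRel.curlRight (l.length + k) p (f.shift l) (g.shift l)
      (by simp [Diagram.shift, hf, add_assoc]) (by simp [Diagram.shift, hg])
  | curlLeft k p f g hf hg =>
    simp only [map_sub, map_smul, shiftLin_single]
    exact LocalRel.curlLeft (l.length + k) p (f.shift l) (g.shift l)
      (by simp [Diagram.shift, hf, add_assoc]) (by simp [Diagram.shift, hg])
  | circle k t f g hf hg =>
    simp only [map_sub, map_smul, shiftLin_single]
    exact LocalRel.circle (l.length + k) t (f.shift l) (g.shift l)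
      (by simp [Diagram.shift, hf]) (by simp [Diagram.shift, hg])
  | couponInOut k u hu f g hf hg =>
    simp only [map_sub, map_smul, map_sum, shiftLin_single]
    exact LocalRel.couponInOut (l.length + k) u hu (f.shift l) (fun π => (g π).shift l)
      (by simp [Diagram.shift, hf]) (fun π => by simp [Diagram.shift, hg, sh_positiveBraid])
  | couponOutIn k f g hf hg =>
    simp only [map_sub, shiftLin_single]
    exact LocalRel.couponOutIn (l.length + k) (f.shift l) (g.shift l)
      (by simp [Diagram.shift, hf]) (by simp [Diagram.shift, hg])

lemma shiftLin_stack {N : ℕ} {a b c : List Bool} (l : List Bool) (x : Diagram N a b →₀ ℂ)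
    (y : Diagram N b c →₀ ℂ) :
    shiftLin N l a c (stack N a b c x y) =
      stack N (l ++ a) (l ++ b) (l ++ c) (shiftLin N l a b x) (shiftLin N l b c y) := by
  induction x using Finsupp.induction_linear with
  | zero => simp
  | add x x' hx hx' => simp [hx, hx']
  | single f r =>
    induction y using Finsupp.induction_linear with
    | zero => simp
    | add y y' hy hy' => simp [hy, hy']
    | single g t =>
      simp only [stack_single, shiftLin_single, Diagram.shift, Diagram.comp, sh_append]

lemma shiftLin_mem {N K : ℕ} {a b : List Bool} (l : List Bool) {x : Diagram N a b →₀ ℂ}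
    (hx : x ∈ relations N K a b) : shiftLin N l a b x ∈ relations N K (l ++ a) (l ++ b) := by
  induction hx using Submodule.span_induction with
  | mem x hx =>
    obtain ⟨p, d, f, y, g, hy, rfl⟩ := hx
    refine Submodule.subset_span ⟨l ++ p, l ++ d, f.shift l, _, g.shift l, hy.shift l, ?_⟩
    rw [shiftLin_stack, shiftLin_stack, shiftLin_single, shiftLin_single]
  | zero => simp
  | add x y _ _ hx hy => rw [map_add]; exact Submodule.add_mem _ hx hy
  | smul z x _ hx => rw [map_smul]; exact Submodule.smul_mem _ _ hx

/-- Skeins with vertical strands to the left. -/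
def Skein.shift (N K : ℕ) (l a b : List Bool) :
    Skein N K a b →ₗ[ℂ] Skein N K (l ++ a) (l ++ b) :=
  (relations N K a b).mapQ _ (shiftLin N l a b) (fun _ hx => shiftLin_mem l hx)

/-- Skeins with vertical strands to the right. -/
def Skein.whisker (N K : ℕ) (a b s : List Bool) :
    Skein N K a b →ₗ[ℂ] Skein N K (a ++ s) (b ++ s) :=
  (relations N K a b).mapQ _ (whiskerLin N a b s) (fun _ hx => whiskerLin_mem s hx)

lemma Skein.shift_of {N K : ℕ} {a b : List Bool} (l : List Bool) (f : Diagram N a b) :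
    Skein.shift N K l a b (Skein.of K f) = Skein.of K (f.shift l) := by
  unfold Skein.shift Skein.of
  rw [Submodule.mkQ_apply, Submodule.mapQ_apply, shiftLin_single]
  rfl

lemma Skein.whisker_of {N K : ℕ} {a b : List Bool} (s : List Bool) (f : Diagram N a b) :
    Skein.whisker N K a b s (Skein.of K f) = Skein.of K (f.whisker s) := by
  unfold Skein.whisker Skein.of
  rw [Submodule.mkQ_apply, Submodule.mapQ_apply, whiskerLin_single]
  rfl

/-- Two diagrams with bottom `a` have the same class up to a nonzero scalar. -/
def Sim (N K : ℕ) (a : List Bool) (w v : List Layer) : Prop :=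
  ∃ (b : List Bool) (hw : Leads N w a b) (hv : Leads N v a b) (c : ℂ), c ≠ 0 ∧
    Skein.of K ⟨w, hw⟩ = c • Skein.of K ⟨v, hv⟩

variable {N K : ℕ} {a b c d a' : List Bool} {u v w t : List Layer}

lemma Sim.of_eq (hw : Leads N w a b) (hv : Leads N v a b)
    (h : Skein.of K ⟨w, hw⟩ = Skein.of K ⟨v, hv⟩) : Sim N K a w v :=
  ⟨b, hw, hv, 1, one_ne_zero, by rw [one_smul, h]⟩

lemma Sim.refl (hw : Leads N w a b) : Sim N K a w w := Sim.of_eq hw hw rfl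

lemma Sim.symm (h : Sim N K a w v) : Sim N K a v w := by
  obtain ⟨b, hw, hv, c, hc, e⟩ := h
  exact ⟨b, hv, hw, c⁻¹, inv_ne_zero hc, by rw [e, smul_smul, inv_mul_cancel₀ hc, one_smul]⟩

lemma Sim.trans (h : Sim N K a u v) (h' : Sim N K a v w) : Sim N K a u w := by
  obtain ⟨b, hu, hv, c, hc, e⟩ := h
  obtain ⟨b', hv', hw, c', hc', e'⟩ := h'
  obtain rfl := hv.unique hv'
  exact ⟨b, hu, hw, c * c', mul_ne_zero hc hc', by rw [e, e', smul_smul]⟩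

instance : Trans (Sim N K a) (Sim N K a) (Sim N K a) := ⟨Sim.trans⟩

lemma Sim.leads (h : Sim N K a w v) (hw : Leads N w a b) : Leads N v a b := by
  obtain ⟨b', hw', hv, -⟩ := h
  obtain rfl := hw.unique hw'
  exact hv

lemma Sim.append_right (h : Sim N K a w v) (ht : Leads N (w ++ t) a c) :
    Sim N K a (w ++ t) (v ++ t) := by
  obtain ⟨b, hw, hv, z, hz, e⟩ := h
  obtain ⟨b', hw', ht⟩ := leads_append_iff.1 ht
  obtain rfl := hw.unique hw'
  refine ⟨c, hw.append ht, hv.append ht, z, hz, ?_⟩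
  have := congrArg (fun x => Skein.comp N K a b c x (Skein.of K ⟨t, ht⟩)) e
  simp only [map_smul, LinearMap.smul_apply, Skein.of_comp] at this
  exact this

lemma Sim.append_left (hu : Leads N u a' a) (h : Sim N K a w v) :
    Sim N K a' (u ++ w) (u ++ v) := by
  obtain ⟨b, hw, hv, z, hz, e⟩ := h
  refine ⟨b, hu.append hw, hu.append hv, z, hz, ?_⟩
  have := congrArg (fun x => Skein.comp N K a' a b (Skein.of K ⟨u, hu⟩) x) e
  simp only [map_smul, Skein.of_comp] at this
  exact this

lemma Sim.ctx (hu : Leads N u a' a) (h : Sim N K a w v) (ht : Leads N (u ++ w ++ t) a' c) :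
    Sim N K a' (u ++ w ++ t) (u ++ v ++ t) :=
  (h.append_left hu).append_right ht

lemma Sim.whisker (h : Sim N K a w v) (s : List Bool) : Sim N K (a ++ s) w v := by
  obtain ⟨b, hw, hv, z, hz, e⟩ := h
  refine ⟨b ++ s, hw.whisker s, hv.whisker s, z, hz, ?_⟩
  have := congrArg (Skein.whisker N K a b s) e
  simp only [map_smul, Skein.whisker_of] at this
  exact this

lemma Sim.shift (h : Sim N K a w v) (l : List Bool) :
    Sim N K (l ++ a) (sh l.length w) (sh l.length v) := by
  obtain ⟨b, hw, hv, z, hz, e⟩ := h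
  refine ⟨l ++ b, hw.shift l, hv.shift l, z, hz, ?_⟩
  have := congrArg (Skein.shift N K l a b) e
  simp only [map_smul, Skein.shift_of] at this
  exact this

/-- A local identity in a larger boundary. -/
lemma Sim.at (h : Sim N K a w v) (l r : List Bool) (ha : a' = l ++ a ++ r) :
    Sim N K a' (sh l.length w) (sh l.length v) := by
  subst ha
  exact (h.shift l).whisker r

lemma Sim.of_move (h : Move N w v) (hw : Leads N w a b) (hv : Leads N v a b) : Sim N K a w v :=
  Sim.of_eq hw hv (Skein.of_eq_of_move _ _ h)

lemma Skein.mk_localRel {y : Diagram N a b →₀ ℂ} (hy : LocalRel N K y) :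
    (relations N K a b).mkQ y = 0 :=
  (Submodule.Quotient.mk_eq_zero _).2 (Submodule.subset_span
    ⟨a, b, Diagram.id N a, y, Diagram.id N b, hy, by rw [stack_id_right, stack_id_left]⟩)

lemma Skein.of_curlRight (k : ℕ) (p : Bool) (f g : Diagram N a b)
    (hf : f.1 = [(k + 1, .cup true), (k, .cross p), (k + 1, .cap true)]) (hg : g.1 = []) :
    Skein.of K f =
      qpow N K ((if p then 1 else -1) * (((N : ℚ) ^ 2 - 1) / (2 * N))) • Skein.of K g := by
  have := Skein.mk_localRel (K := K) (LocalRel.curlRight k p f g hf hg)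
  rwa [map_sub, map_smul, sub_eq_zero] at this

lemma Skein.of_circle (k : ℕ) (s : Bool) (f g : Diagram N a b)
    (hf : f.1 = [(k, .cup s), (k, .cap s)]) (hg : g.1 = []) :
    Skein.of K f = qint N K N • Skein.of K g := by
  have := Skein.mk_localRel (K := K) (LocalRel.circle k s f g hf hg)
  rwa [map_sub, map_smul, sub_eq_zero] at this

lemma Sim.curlLeft (k : ℕ) (p : Bool)
    (hw : Leads N [(k, .cup false), (k + 1, .cross p), (k, .cap false)] a a) :
    Sim N K a [(k, .cup false), (k + 1, .cross p), (k, .cap false)] [] := by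
  have := Skein.mk_localRel (K := K) (LocalRel.curlLeft k p ⟨_, hw⟩ ⟨[], rfl⟩ rfl rfl)
  rw [map_sub, map_smul, sub_eq_zero] at this
  exact ⟨a, hw, rfl, _, Complex.exp_ne_zero _, this⟩

/-- Diagrams next to each other can be moved up and down past each other. -/
lemma Sim.interchange (hw : Leads N w a b) (hv : Leads N v c d) :
    Sim N K (a ++ c) (w ++ sh b.length v) (sh a.length v ++ w) := by
  have one : ∀ (x : Layer) (a b : List Bool), Layer.Leads N x a b →
      Sim N K (a ++ c) (x :: sh b.length v) (sh a.length v ++ [x]) := by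
    rintro ⟨k, g⟩ a b hx
    clear hw
    induction v generalizing c with
    | nil => exact Sim.refl ((leads_singleton_iff.2 hx).whisker c)
    | cons y v ih =>
      obtain ⟨c', hy, hv⟩ := hv
      obtain ⟨j, h⟩ := y
      have hb : Leads N [(k, g), (b.length + j, h)] (a ++ c) (b ++ c') :=
        ((leads_singleton_iff.2 hx).whisker c).append (leads_singleton_iff.2 (hy.shift b))
      have hb' : Leads N [(a.length + j, h), (k, g)] (a ++ c) (b ++ c') :=
        (leads_singleton_iff.2 (hy.shift a)).append ((leads_singleton_iff.2 hx).whisker c')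
      have h1 : Sim N K (a ++ c) [(k, g), (b.length + j, h)] [(a.length + j, h), (k, g)] := by
        obtain ⟨l, r, e1, e2, e3⟩ := hx
        refine Sim.of_move ?_ hb hb'
        have := Move.far (N := N) k (r.length + j) g h
        simp only at e1
        have ea : a.length + j = k + (g.bot N).length + (r.length + j) := by
          rw [e2, ← e1]; simp only [List.length_append]; omega
        have eb : b.length + j = k + (g.top N).length + (r.length + j) := by
          rw [e3, ← e1]; simp only [List.length_append]; omega
        rwa [ea, eb]
      calc Sim N K (a ++ c) ((k, g) :: sh b.length ((j, h) :: v))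
            ((a.length + j, h) :: (k, g) :: sh b.length v) :=
            Sim.append_right (t := sh b.length v) h1 (hb.append (hv.shift b))
        Sim N K (a ++ c) _ ((a.length + j, h) :: (sh a.length v ++ [(k, g)])) :=
            Sim.append_left (u := [(a.length + j, h)]) (leads_singleton_iff.2 (hy.shift a)) (ih hv)
  induction w generalizing a with
  | nil =>
    obtain rfl : a = b := hw
    simpa using Sim.refl (hv.shift a)
  | cons x w ih =>
    obtain ⟨a1, hx, hw⟩ := hw
    have h1 : Sim N K (a ++ c) (x :: (w ++ sh b.length v)) (x :: (sh a1.length v ++ w)) :=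
      Sim.append_left (u := [x]) ((leads_singleton_iff.2 hx).whisker c) (ih hw)
    have h2 := Sim.append_right (t := w) (one x a a1 hx)
      ((((leads_singleton_iff.2 hx).whisker c).append (hv.shift a1)).append (hw.whisker d))
    refine h1.trans ?_
    simpa using h2

/-! Evaluation of boundaries for diagrams without coupons. -/

/-- The top of a piece without coupons, at the left of the boundary. -/
def Piece.run : Piece → List Bool → Option (List Bool)
  | .cross _, true :: true :: r => some (true :: true :: r)
  | .cup s, r => some (s :: (!s) :: r)
  | .cap true, true :: false :: r => some r
  | .cap false, false :: true :: r => some r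
  | _, _ => none

/-- The top of a layer without coupons. -/
def runLayer : ℕ → Piece → List Bool → Option (List Bool)
  | 0, g, a => g.run a
  | k + 1, g, x :: a => (runLayer k g a).map (x :: ·)
  | _ + 1, _, [] => none

/-- The top of a diagram without coupons. -/
def runWord : List Layer → List Bool → Option (List Bool)
  | [], a => some a
  | x :: w, a => (runLayer x.1 x.2 a).bind (runWord w)

lemma leads_of_runLayer {k : ℕ} {g : Piece} (h : runLayer k g a = some b) :
    Layer.Leads N (k, g) a b := by
  induction k generalizing a b with
  | zero =>
    refine ⟨[], a.drop (g.bot N).length, rfl, ?_⟩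
    simp only [runLayer] at h
    unfold Piece.run at h
    split at h <;> simp only [Option.some.injEq, reduceCtorEq] at h <;> subst h <;>
      simp [Piece.bot, Piece.top]
  | succ k ih =>
    cases a with
    | nil => simp [runLayer] at h
    | cons x a =>
      simp only [runLayer, Option.map_eq_some_iff] at h
      obtain ⟨b, hb, rfl⟩ := h
      simpa [add_comm] using (ih hb).shift [x]

lemma leads_of_runWord (h : runWord w a = some b) : Leads N w a b := by
  induction w generalizing a with
  | nil => exact Option.some.inj h
  | cons x w ih =>
    simp only [runWord, Option.bind_eq_some_iff] at h
    obtain ⟨d, h1, h2⟩ := h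
    exact ⟨d, leads_of_runLayer h1, ih h2⟩

lemma Sim.run_move (u : List Layer) {t : List Layer} (h : Move N w v)
    (hw : runWord (u ++ w ++ t) a = some b)
    (hu : runWord u a = some c) (hw' : runWord w c = some d) (hv' : runWord v c = some d) :
    Sim N K a (u ++ w ++ t) (u ++ v ++ t) :=
  Sim.ctx (leads_of_runWord hu) (Sim.of_move h (leads_of_runWord hw') (leads_of_runWord hv'))
    (leads_of_runWord hw)

end

section

variable {N K : ℕ}

/-- The crossing of two downward strands. -/
def crossDown (k : ℕ) (p : Bool) : List Layer :=
  [(k, .cup false), (k + 1, .cup false), (k + 2, .cross p), (k + 3, .cap true), (k + 2, .cap true)]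

/-- A downward strand passes two upward strands. -/
lemma sim_crossUD_crossUD : Sim N K ([true, true, false]) (crossUD 1 true ++ crossUD 0 true)
    [(0, .cup false), (1, .cross true), (2, .cross true), (3, .cap true)] :=
  calc Sim N K ([true, true, false]) [(1, .cup false), (2, .cross true), (3, .cap true), (0,
      .cup false), (1, .cross true), (2, .cap true)] [(1, .cup false), (2, .cross true), (0, .cup
      false), (5, .cap true), (1, .cross true), (2, .cap true)] := (Sim.run_move [(1, .cup false),
      (2, .cross true)] (t := [(1, .cross true), (2, .cap true)]) (Move.far 0 3 (.cup false) (.cap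
      true)) rfl rfl rfl rfl).symm
    Sim N K ([true, true, false]) _ [(1, .cup false), (0, .cup false), (4, .cross true), (5,
        .cap true), (1, .cross true), (2, .cap true)] := (Sim.run_move [(1, .cup false)] (t :=
        [(5, .cap true), (1, .cross true), (2, .cap true)]) (Move.far 0 2 (.cup false) (.cross
        true)) rfl rfl rfl rfl).symm
    Sim N K ([true, true, false]) _ [(0, .cup false), (3, .cup false), (4, .cross true), (5,
        .cap true), (1, .cross true), (2, .cap true)] := (Sim.run_move [] (t := [(4, .cross true),
        (5, .cap true), (1, .cross true), (2, .cap true)]) (Move.far 0 1 (.cup false) (.cup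
        false)) rfl rfl rfl rfl).symm
    Sim N K ([true, true, false]) _ [(0, .cup false), (3, .cup false), (4, .cross true), (1,
        .cross true), (5, .cap true), (2, .cap true)] := (Sim.run_move [(0, .cup false), (3, .cup
        false), (4, .cross true)] (t := [(2, .cap true)]) (Move.far 1 2 (.cross true) (.cap true))
        rfl rfl rfl rfl).symm
    Sim N K ([true, true, false]) _ [(0, .cup false), (3, .cup false), (1, .cross true), (4,
        .cross true), (5, .cap true), (2, .cap true)] := (Sim.run_move [(0, .cup false), (3, .cup
        false)] (t := [(5, .cap true), (2, .cap true)]) (Move.far 1 1 (.cross true) (.cross true))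
        rfl rfl rfl rfl).symm
    Sim N K ([true, true, false]) _ [(0, .cup false), (1, .cross true), (3, .cup false), (4,
        .cross true), (5, .cap true), (2, .cap true)] := (Sim.run_move [(0, .cup false)] (t :=
        [(4, .cross true), (5, .cap true), (2, .cap true)]) (Move.far 1 0 (.cross true) (.cup
        false)) rfl rfl rfl rfl).symm
    Sim N K ([true, true, false]) _ [(0, .cup false), (1, .cross true), (3, .cup false), (4,
        .cross true), (2, .cap true), (3, .cap true)] := (Sim.run_move [(0, .cup false), (1,
        .cross true), (3, .cup false), (4, .cross true)] (t := []) (Move.far 2 1 (.cap true) (.cap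
        true)) rfl rfl rfl rfl).symm
    Sim N K ([true, true, false]) _ [(0, .cup false), (1, .cross true), (3, .cup false), (2,
        .cap true), (2, .cross true), (3, .cap true)] := (Sim.run_move [(0, .cup false), (1,
        .cross true), (3, .cup false)] (t := [(3, .cap true)]) (Move.far 2 0 (.cap true) (.cross
        true)) rfl rfl rfl rfl).symm
    Sim N K ([true, true, false]) _ [(0, .cup false), (1, .cross true), (2, .cross true), (3,
        .cap true)] := Sim.run_move [(0, .cup false), (1, .cross true)] (t := [(2, .cross true),
        (3, .cap true)]) (Move.zagzig 2 false) rfl rfl rfl rfl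

/-- A downward strand passes a crossing. -/
lemma sim_bent_cross : Sim N K ([true, true, false]) [(0, .cup false), (1, .cross true), (2,
    .cross true), (3, .cap true), (1, .cross true)] [(0, .cross true), (0, .cup false), (1, .cross
    true), (2, .cross true), (3, .cap true)] :=
  calc Sim N K ([true, true, false]) [(0, .cup false), (1, .cross true), (2, .cross true), (3,
      .cap true), (1, .cross true)] [(0, .cup false), (1, .cross true), (2, .cross true), (1,
      .cross true), (3, .cap true)] := (Sim.run_move [(0, .cup false), (1, .cross true), (2,
      .cross true)] (t := []) (Move.far 1 0 (.cross true) (.cap true)) rfl rfl rfl rfl).symm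
    Sim N K ([true, true, false]) _ [(0, .cup false), (2, .cross true), (1, .cross true), (2,
        .cross true), (3, .cap true)] := Sim.run_move [(0, .cup false)] (t := [(3, .cap true)])
        (Move.reidemeister3 1) rfl rfl rfl rfl
    Sim N K ([true, true, false]) _ [(0, .cross true), (0, .cup false), (1, .cross true), (2,
        .cross true), (3, .cap true)] := Sim.run_move [] (t := [(1, .cross true), (2, .cross
        true), (3, .cap true)]) (Move.far 0 0 (.cup false) (.cross true)) rfl rfl rfl rfl

/-- A cap passes an upward strand. -/
lemma sim_crossUD_cap : Sim N K ([true, true, false]) (crossUD 1 true ++ [(0, .cap true)])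
    [(0, .cross true), (1, .cap true)] :=
  calc Sim N K ([true, true, false]) [(1, .cup false), (2, .cross true), (3, .cap true), (0,
      .cap true)] [(1, .cup false), (2, .cross true), (0, .cap true), (1, .cap true)] :=
      (Sim.run_move [(1, .cup false), (2, .cross true)] (t := []) (Move.far 0 1 (.cap true) (.cap
      true)) rfl rfl rfl rfl).symm
    Sim N K ([true, true, false]) _ [(1, .cup false), (0, .cap true), (0, .cross true), (1,
        .cap true)] := (Sim.run_move [(1, .cup false)] (t := [(1, .cap true)]) (Move.far 0 0 (.cap
        true) (.cross true)) rfl rfl rfl rfl).symm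
    Sim N K ([true, true, false]) _ [(0, .cross true), (1, .cap true)] := Sim.run_move [] (t
        := [(0, .cross true), (1, .cap true)]) (Move.zagzig 0 false) rfl rfl rfl rfl

/-- A cap is turned around. -/
lemma sim_crossUD_cap_false : Sim N K ([true, false]) (crossUD 0 true ++ [(0, .cap false)])
    [(0, .cap true)] :=
  calc Sim N K ([true, false]) [(0, .cup false), (1, .cross true), (2, .cap true), (0, .cap
      false)] [(0, .cup false), (1, .cross true), (0, .cap false), (0, .cap true)] :=
      (Sim.run_move [(0, .cup false), (1, .cross true)] (t := []) (Move.far 0 0 (.cap false) (.cap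
      true)) rfl rfl rfl rfl).symm
    Sim N K ([true, false]) _ [(0, .cap true)] := Sim.ctx (u := []) (t := [(0, .cap true)])
        (leads_of_runWord rfl) (Sim.curlLeft 0 true (leads_of_runWord rfl)) (leads_of_runWord rfl)

/-- A cap passes a downward strand. -/
lemma sim_cross_down_cap : Sim N K ([true, false, false]) (crossDown 1 true ++ [(0, .cap
    true)]) (crossUD 0 true ++ [(1, .cap true)]) :=
  calc Sim N K ([true, false, false]) [(1, .cup false), (2, .cup false), (3, .cross true), (4,
      .cap true), (3, .cap true), (0, .cap true)] [(1, .cup false), (2, .cup false), (3, .cross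
      true), (4, .cap true), (0, .cap true), (1, .cap true)] := (Sim.run_move [(1, .cup false),
      (2, .cup false), (3, .cross true), (4, .cap true)] (t := []) (Move.far 0 1 (.cap true) (.cap
      true)) rfl rfl rfl rfl).symm
    Sim N K ([true, false, false]) _ [(1, .cup false), (2, .cup false), (3, .cross true), (0,
        .cap true), (2, .cap true), (1, .cap true)] := (Sim.run_move [(1, .cup false), (2, .cup
        false), (3, .cross true)] (t := [(1, .cap true)]) (Move.far 0 2 (.cap true) (.cap true))
        rfl rfl rfl rfl).symm
    Sim N K ([true, false, false]) _ [(1, .cup false), (2, .cup false), (0, .cap true), (1,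
        .cross true), (2, .cap true), (1, .cap true)] := (Sim.run_move [(1, .cup false), (2, .cup
        false)] (t := [(2, .cap true), (1, .cap true)]) (Move.far 0 1 (.cap true) (.cross true))
        rfl rfl rfl rfl).symm
    Sim N K ([true, false, false]) _ [(1, .cup false), (0, .cap true), (0, .cup false), (1,
        .cross true), (2, .cap true), (1, .cap true)] := (Sim.run_move [(1, .cup false)] (t :=
        [(1, .cross true), (2, .cap true), (1, .cap true)]) (Move.far 0 0 (.cap true) (.cup
        false)) rfl rfl rfl rfl).symm
    Sim N K ([true, false, false]) _ [(0, .cup false), (1, .cross true), (2, .cap true), (1,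
        .cap true)] := Sim.run_move [] (t := [(0, .cup false), (1, .cross true), (2, .cap true),
        (1, .cap true)]) (Move.zagzig 0 false) rfl rfl rfl rfl

/-- A cup passes an upward strand. -/
lemma sim_cup_cross : Sim N K ([true]) [(0, .cup true)] ([(1, .cup true), (0, .cross false)]
    ++ crossUD 1 true) :=
  calc Sim N K ([true]) [(0, .cup true)] [(0, .cup true), (3, .cup true), (2, .cross false),
      (1, .cap false), (1, .cup false), (2, .cross true), (3, .cap true)] := (Sim.run_move [(0,
      .cup true)] (t := []) (Move.reidemeister2DU 1 false) rfl rfl rfl rfl).symm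
    Sim N K ([true]) _ [(1, .cup true), (0, .cup true), (2, .cross false), (1, .cap false),
        (1, .cup false), (2, .cross true), (3, .cap true)] := Sim.run_move [] (t := [(2, .cross
        false), (1, .cap false), (1, .cup false), (2, .cross true), (3, .cap true)]) (Move.far 0 1
        (.cup true) (.cup true)) rfl rfl rfl rfl
    Sim N K ([true]) _ [(1, .cup true), (0, .cross false), (0, .cup true), (1, .cap false),
        (1, .cup false), (2, .cross true), (3, .cap true)] := Sim.run_move [(1, .cup true)] (t :=
        [(1, .cap false), (1, .cup false), (2, .cross true), (3, .cap true)]) (Move.far 0 0 (.cup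
        true) (.cross false)) rfl rfl rfl rfl
    Sim N K ([true]) _ [(1, .cup true), (0, .cross false), (1, .cup false), (2, .cross true),
        (3, .cap true)] := Sim.run_move [(1, .cup true), (0, .cross false)] (t := [(1, .cup
        false), (2, .cross true), (3, .cap true)]) (Move.zigzag 0 true) rfl rfl rfl rfl

/-- A cup is turned around. -/
lemma sim_cup_false : Sim N K ([]) [(0, .cup false)] ([(0, .cup true)] ++ crossUD 0 true) :=
  calc Sim N K ([]) [(0, .cup false)] [(0, .cup false), (2, .cup true), (1, .cross false), (0,
      .cap false), (0, .cup false), (1, .cross true), (2, .cap true)] := (Sim.run_move [(0, .cup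
      false)] (t := []) (Move.reidemeister2DU 0 false) rfl rfl rfl rfl).symm
    Sim N K ([]) _ [(0, .cup true), (0, .cup false), (1, .cross false), (0, .cap false), (0,
        .cup false), (1, .cross true), (2, .cap true)] := Sim.run_move [] (t := [(1, .cross
        false), (0, .cap false), (0, .cup false), (1, .cross true), (2, .cap true)]) (Move.far 0 0
        (.cup false) (.cup true)) rfl rfl rfl rfl
    Sim N K ([]) _ [(0, .cup true), (0, .cup false), (1, .cross true), (2, .cap true)] :=
        Sim.ctx (u := [(0, .cup true)]) (t := [(0, .cup false), (1, .cross true), (2, .cap true)])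
        (leads_of_runWord rfl) (Sim.curlLeft 0 false (leads_of_runWord rfl)) (leads_of_runWord
        rfl)

/-- A cup passes a downward strand. -/
lemma sim_cup_cross_down : Sim N K ([false]) ([(0, .cup true)] ++ crossDown 1 false ++ crossUD
    0 true) [(1, .cup true)] :=
  calc Sim N K ([false]) [(0, .cup true), (1, .cup false), (2, .cup false), (3, .cross false),
      (4, .cap true), (3, .cap true), (0, .cup false), (1, .cross true), (2, .cap true)] [(0, .cup
      true), (3, .cup true), (4, .cup true), (3, .cross false), (2, .cap false), (1, .cap false),
      (0, .cup false), (1, .cross true), (2, .cap true)] := Sim.run_move [(0, .cup true)] (t :=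
      [(0, .cup false), (1, .cross true), (2, .cap true)]) (Move.rotate 1 false) rfl rfl rfl rfl
    Sim N K ([false]) _ [(1, .cup true), (0, .cup true), (4, .cup true), (3, .cross false),
        (2, .cap false), (1, .cap false), (0, .cup false), (1, .cross true), (2, .cap true)] :=
        Sim.run_move [] (t := [(4, .cup true), (3, .cross false), (2, .cap false), (1, .cap
        false), (0, .cup false), (1, .cross true), (2, .cap true)]) (Move.far 0 1 (.cup true)
        (.cup true)) rfl rfl rfl rfl
    Sim N K ([false]) _ [(1, .cup true), (2, .cup true), (0, .cup true), (3, .cross false),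
        (2, .cap false), (1, .cap false), (0, .cup false), (1, .cross true), (2, .cap true)] :=
        Sim.run_move [(1, .cup true)] (t := [(3, .cross false), (2, .cap false), (1, .cap false),
        (0, .cup false), (1, .cross true), (2, .cap true)]) (Move.far 0 2 (.cup true) (.cup true))
        rfl rfl rfl rfl
    Sim N K ([false]) _ [(1, .cup true), (2, .cup true), (1, .cross false), (0, .cup true),
        (2, .cap false), (1, .cap false), (0, .cup false), (1, .cross true), (2, .cap true)] :=
        Sim.run_move [(1, .cup true), (2, .cup true)] (t := [(2, .cap false), (1, .cap false), (0,
        .cup false), (1, .cross true), (2, .cap true)]) (Move.far 0 1 (.cup true) (.cross false))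
        rfl rfl rfl rfl
    Sim N K ([false]) _ [(1, .cup true), (2, .cup true), (1, .cross false), (0, .cap false),
        (0, .cup true), (1, .cap false), (0, .cup false), (1, .cross true), (2, .cap true)] :=
        Sim.run_move [(1, .cup true), (2, .cup true), (1, .cross false)] (t := [(1, .cap false),
        (0, .cup false), (1, .cross true), (2, .cap true)]) (Move.far 0 0 (.cup true) (.cap
        false)) rfl rfl rfl rfl
    Sim N K ([false]) _ [(1, .cup true), (2, .cup true), (1, .cross false), (0, .cap false),
        (0, .cup false), (1, .cross true), (2, .cap true)] := Sim.run_move [(1, .cup true), (2,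
        .cup true), (1, .cross false), (0, .cap false)] (t := [(0, .cup false), (1, .cross true),
        (2, .cap true)]) (Move.zigzag 0 true) rfl rfl rfl rfl
    Sim N K ([false]) _ [(1, .cup true)] := Sim.run_move [(1, .cup true)] (t := [])
        (Move.reidemeister2DU 0 false) rfl rfl rfl rfl

/-- A crossing slides along two cups. -/
lemma sim_cups_cross_down (p : Bool) : Sim N K ([]) ([(0, .cup true), (1, .cup true)] ++
    crossDown 2 p) [(0, .cup true), (1, .cup true), (0, .cross p)] :=
  calc Sim N K ([]) [(0, .cup true), (1, .cup true), (2, .cup false), (3, .cup false), (4,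
      .cross p), (5, .cap true), (4, .cap true)] [(0, .cup true), (1, .cup true), (4, .cup true),
      (5, .cup true), (4, .cross p), (3, .cap false), (2, .cap false)] := Sim.run_move [(0, .cup
      true), (1, .cup true)] (t := []) (Move.rotate 2 p) rfl rfl rfl rfl
    Sim N K ([]) _ [(0, .cup true), (2, .cup true), (1, .cup true), (5, .cup true), (4, .cross
        p), (3, .cap false), (2, .cap false)] := Sim.run_move [(0, .cup true)] (t := [(5, .cup
        true), (4, .cross p), (3, .cap false), (2, .cap false)]) (Move.far 1 1 (.cup true) (.cup
        true)) rfl rfl rfl rfl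
    Sim N K ([]) _ [(0, .cup true), (2, .cup true), (3, .cup true), (1, .cup true), (4, .cross
        p), (3, .cap false), (2, .cap false)] := Sim.run_move [(0, .cup true), (2, .cup true)] (t
        := [(4, .cross p), (3, .cap false), (2, .cap false)]) (Move.far 1 2 (.cup true) (.cup
        true)) rfl rfl rfl rfl
    Sim N K ([]) _ [(0, .cup true), (2, .cup true), (3, .cup true), (2, .cross p), (1, .cup
        true), (3, .cap false), (2, .cap false)] := Sim.run_move [(0, .cup true), (2, .cup true),
        (3, .cup true)] (t := [(3, .cap false), (2, .cap false)]) (Move.far 1 1 (.cup true)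
        (.cross p)) rfl rfl rfl rfl
    Sim N K ([]) _ [(0, .cup true), (2, .cup true), (3, .cup true), (2, .cross p), (1, .cap
        false), (1, .cup true), (2, .cap false)] := Sim.run_move [(0, .cup true), (2, .cup true),
        (3, .cup true), (2, .cross p)] (t := [(2, .cap false)]) (Move.far 1 0 (.cup true) (.cap
        false)) rfl rfl rfl rfl
    Sim N K ([]) _ [(0, .cup true), (2, .cup true), (3, .cup true), (2, .cross p), (1, .cap
        false)] := Sim.run_move [(0, .cup true), (2, .cup true), (3, .cup true), (2, .cross p),
        (1, .cap false)] (t := []) (Move.zigzag 1 true) rfl rfl rfl rfl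
    Sim N K ([]) _ [(0, .cup true), (0, .cup true), (3, .cup true), (2, .cross p), (1, .cap
        false)] := Sim.run_move [] (t := [(3, .cup true), (2, .cross p), (1, .cap false)])
        (Move.far 0 0 (.cup true) (.cup true)) rfl rfl rfl rfl
    Sim N K ([]) _ [(0, .cup true), (1, .cup true), (0, .cup true), (2, .cross p), (1, .cap
        false)] := Sim.run_move [(0, .cup true)] (t := [(2, .cross p), (1, .cap false)]) (Move.far
        0 1 (.cup true) (.cup true)) rfl rfl rfl rfl
    Sim N K ([]) _ [(0, .cup true), (1, .cup true), (0, .cross p), (0, .cup true), (1, .cap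
        false)] := Sim.run_move [(0, .cup true), (1, .cup true)] (t := [(1, .cap false)])
        (Move.far 0 0 (.cup true) (.cross p)) rfl rfl rfl rfl
    Sim N K ([]) _ [(0, .cup true), (1, .cup true), (0, .cross p)] := Sim.run_move [(0, .cup
        true), (1, .cup true), (0, .cross p)] (t := []) (Move.zigzag 0 true) rfl rfl rfl rfl

lemma sim_cross_cross (k : ℕ) (p : Bool) {a : List Bool} (h : Leads N [(k, .cross p)] a a) :
    Sim N K a [(k, .cross p), (k, .cross !p)] [] :=
  Sim.of_move (Move.reidemeister2 k p) (h.append (v := [(k, .cross !p)]) (by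
    rw [leads_singleton_iff] at h ⊢; exact h)) rfl

/-- A downward strand passes a crossing. -/
lemma sim_crossUD_crossUD_cross (p : Bool) : Sim N K [true, true, false]
    (crossUD 1 true ++ crossUD 0 true ++ [(1, .cross p)])
    ([(0, .cross p)] ++ crossUD 1 true ++ crossUD 0 true) := by
  have h1 : Sim N K [true, true, false]
      (crossUD 1 true ++ crossUD 0 true ++ [(1, .cross true)])
      ([(0, .cross true)] ++ (crossUD 1 true ++ crossUD 0 true)) :=
    ((sim_crossUD_crossUD.append_right (t := [(1, .cross true)]) (leads_of_runWord rfl)).trans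
      sim_bent_cross).trans
      (sim_crossUD_crossUD.append_left (u := [(0, .cross true)]) (leads_of_runWord rfl)).symm
  cases p with
  | true => exact h1
  | false =>
    have h2 : Sim N K [true, true, false]
      ([(0, .cross false)] ++ [(0, .cross true)] ++ (crossUD 1 true ++ crossUD 0 true) ++
        [(1, .cross false)])
      (crossUD 1 true ++ crossUD 0 true ++ [(1, .cross false)]) :=
      Sim.ctx (u := []) (t := crossUD 1 true ++ crossUD 0 true ++ [(1, .cross false)])
        (leads_of_runWord rfl) (sim_cross_cross 0 false (leads_of_runWord rfl))
        (leads_of_runWord rfl)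
    have h3 : Sim N K [true, true, false]
      ([(0, .cross false)] ++ (crossUD 1 true ++ crossUD 0 true ++ [(1, .cross true)]) ++
        [(1, .cross false)])
      ([(0, .cross false)] ++ ([(0, .cross true)] ++ (crossUD 1 true ++ crossUD 0 true)) ++
        [(1, .cross false)]) :=
      Sim.ctx (leads_of_runWord rfl) h1 (leads_of_runWord rfl)
    have h4 : Sim N K [true, true, false]
      ([(0, .cross false)] ++ (crossUD 1 true ++ crossUD 0 true) ++ [(1, .cross true),
        (1, .cross false)] ++ [])
      ([(0, .cross false)] ++ (crossUD 1 true ++ crossUD 0 true) ++ [] ++ []) :=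
      Sim.ctx (leads_of_runWord rfl) (sim_cross_cross 1 true (leads_of_runWord rfl))
        (leads_of_runWord rfl)
    exact (h2.symm.trans h3.symm).trans h4

end

section

variable {N K : ℕ}

lemma Sim.ctx' {a a' b c : List Bool} {u v w t : List Layer} (hu : Leads N u a' a)
    (h : Sim N K a w v) (hw : Leads N w a b) (ht : Leads N t b c) :
    Sim N K a' (u ++ w ++ t) (u ++ v ++ t) :=
  Sim.ctx hu h ((hu.append hw).append ht)

/-! ### Sorting of boundaries -/

/-- `n` upward strands. -/
abbrev rep (n : ℕ) : List Bool := List.replicate n true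

/-- `n` downward strands. -/
abbrev repF (n : ℕ) : List Bool := List.replicate n false

/-- A downward strand passes `p` upward strands from right to left. -/
def mv : ℕ → List Layer
  | 0 => []
  | p + 1 => crossUD p true ++ mv p

/-- The upward strands of a boundary. -/
abbrev ups (b : List Bool) : ℕ := b.count true

/-- The downward strands of a boundary. -/
abbrev downs (b : List Bool) : ℕ := b.count false

/-- The sorted boundary of `p` upward strands followed by `m` downward strands. -/
abbrev srt (p m : ℕ) : List Bool := rep p ++ repF m

/-- A diagram that leads from the sorted boundary to the boundary `b`. -/
def unsort : List Bool → List Layer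
  | [] => []
  | true :: b => sh 1 (unsort b)
  | false :: b => mv (ups b) ++ sh 1 (unsort b)

lemma rep_succ' (n : ℕ) : rep (n + 1) = rep n ++ [true] := List.replicate_succ'

lemma rep_add (n m : ℕ) : rep (n + m) = rep n ++ rep m := List.replicate_add ..

lemma Leads.at' {a b a' b' : List Bool} {w w' : List Layer} (h : Leads N w a b)
    (l r : List Bool) (ha : a' = l ++ a ++ r) (hb : b' = l ++ b ++ r)
    (hw : w' = sh l.length w) : Leads N w' a' b' := by
  subst ha hb hw
  exact (h.shift l).whisker r

lemma Sim.at' {a a' : List Bool} {w v w' v' : List Layer} (h : Sim N K a w v) (l r : List Bool)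
    (ha : a' = l ++ a ++ r) (hw : w' = sh l.length w) (hv : v' = sh l.length v) :
    Sim N K a' w' v' := by
  subst hw hv
  exact h.at l r ha

lemma leads_crossUD (p : ℕ) (e : Bool) (r : List Bool) :
    Leads N (crossUD p e) (rep p ++ true :: false :: r) (rep p ++ false :: true :: r) :=
  Leads.at' (N := N) (w := crossUD 0 e) (a := [true, false]) (b := [false, true])
    (leads_of_runWord rfl) (rep p) r (by simp) (by simp) (by simp [sh_crossUD])

lemma leads_crossDown (l r : List Bool) (e : Bool) :
    Leads N (crossDown l.length e) (l ++ false :: false :: r) (l ++ false :: false :: r) :=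
  Leads.at' (N := N) (w := crossDown 0 e) (a := [false, false]) (b := [false, false])
    (leads_of_runWord rfl) l r (by simp) (by simp) (by simp [crossDown])

lemma leads_cross (l r : List Bool) (e : Bool) :
    Leads N [(l.length, .cross e)] (l ++ true :: true :: r) (l ++ true :: true :: r) :=
  Leads.at' (N := N) (w := [(0, .cross e)]) (a := [true, true]) (b := [true, true])
    (leads_of_runWord rfl) l r (by simp) (by simp) (by simp)

lemma leads_cup (l r : List Bool) (s : Bool) :
    Leads N [(l.length, .cup s)] (l ++ r) (l ++ s :: (!s) :: r) :=
  Leads.at' (N := N) (w := [(0, .cup s)]) (a := []) (b := [s, !s])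
    (leads_of_runWord rfl) l r (by simp) (by simp) (by simp)

lemma leads_cap (l r : List Bool) (s : Bool) :
    Leads N [(l.length, .cap s)] (l ++ s :: (!s) :: r) (l ++ r) :=
  Leads.at' (N := N) (w := [(0, .cap s)]) (a := [s, !s]) (b := [])
    (by cases s <;> exact leads_of_runWord rfl) l r (by simp) (by simp) (by simp)

lemma leads_mv (p : ℕ) : Leads N (mv p) (rep p ++ [false]) (false :: rep p) := by
  induction p with
  | zero => rfl
  | succ p ih =>
    refine Leads.append (b := rep p ++ [false, true]) ?_ ?_
    · have := leads_crossUD (N := N) p true []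
      rwa [rep_succ', List.append_assoc]
    · have := ih.whisker [true]
      rw [rep_succ']
      simpa using this

lemma leads_mv' (p : ℕ) (r : List Bool) :
    Leads N (mv p) (rep p ++ false :: r) (false :: (rep p ++ r)) := by
  simpa using (leads_mv (N := N) p).whisker r

lemma leads_unsort (b : List Bool) : Leads N (unsort b) (srt (ups b) (downs b)) b := by
  induction b with
  | nil => rfl
  | cons s b ih =>
    cases s with
    | true =>
      have := ih.shift [true]
      simpa [unsort, srt, List.replicate_succ] using this
    | false =>
      refine Leads.append (b := false :: srt (ups b) (downs b)) ?_ ?_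
      · simpa [srt, List.replicate_succ] using leads_mv' (N := N) (ups b) (repF (downs b))
      · exact ih.shift [false]

/-- A word of crossings of `p` upward strands. -/
def CrossWord (p : ℕ) (y : List Layer) : Prop := ∀ x ∈ y, ∃ i e, x = (i, Piece.cross e) ∧ i + 1 < p

lemma CrossWord.nil (p : ℕ) : CrossWord p [] := by simp [CrossWord]

lemma CrossWord.append {p : ℕ} {y y' : List Layer} (h : CrossWord p y) (h' : CrossWord p y') :
    CrossWord p (y ++ y') := by
  intro x hx
  rcases List.mem_append.1 hx with hx | hx
  exacts [h x hx, h' x hx]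

lemma CrossWord.single {p i : ℕ} (e : Bool) (h : i + 1 < p) : CrossWord p [(i, .cross e)] := by
  intro x hx
  exact ⟨i, e, by simpa using hx, h⟩

lemma CrossWord.mono {p p' : ℕ} (hp : p ≤ p') {y : List Layer} (h : CrossWord p y) :
    CrossWord p' y := fun x hx => by
  obtain ⟨i, e, h1, h2⟩ := h x hx
  exact ⟨i, e, h1, h2.trans_le hp⟩

lemma rep_split {i p : ℕ} (h : i + 1 < p) : rep p = rep i ++ true :: true :: rep (p - i - 2) := by
  have e : true :: true :: rep (p - i - 2) = rep (2 + (p - i - 2)) := by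
    rw [rep_add]; rfl
  rw [e, ← rep_add]
  congr 1
  omega

lemma leads_cross_rep {i p : ℕ} (e : Bool) (h : i + 1 < p) :
    Leads N [(i, .cross e)] (rep p) (rep p) := by
  rw [rep_split h]
  simpa using leads_cross (N := N) (rep i) (rep (p - i - 2)) e

lemma CrossWord.leads {p : ℕ} {y : List Layer} (h : CrossWord p y) : Leads N y (rep p) (rep p) := by
  induction y with
  | nil => rfl
  | cons x y ih =>
    obtain ⟨i, e, rfl, hi⟩ := h x (by simp)
    exact (leads_cross_rep e hi).append (ih fun x hx => h x (by simp [hx]))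

lemma CrossWord.leads' {p : ℕ} {y : List Layer} (h : CrossWord p y) (r : List Bool) :
    Leads N y (rep p ++ r) (rep p ++ r) := h.leads.whisker r

/-- Words of crossings of upward strands commute with diagrams to their right. -/
lemma CrossWord.comm {p : ℕ} {y : List Layer} (h : CrossWord p y) {v : List Layer}
    {c d : List Bool} (hv : Leads N v c d) (r : List Bool) :
    Sim N K (rep p ++ c ++ r) (y ++ sh p v) (sh p v ++ y) := by
  simpa using (Sim.interchange (K := K) (h.leads (N := N)) hv).whisker r

lemma mv_cross (p i : ℕ) (e : Bool) (h : i + 1 < p) : Sim N K (rep p ++ [false])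
    (mv p ++ [(i + 1, .cross e)]) ([(i, .cross e)] ++ mv p) := by
  induction p with
  | zero => omega
  | succ p ih =>
    have hX : Leads N (crossUD p true) (rep (p + 1) ++ [false]) (rep p ++ [false, true]) := by
      rw [rep_succ', List.append_assoc]; exact leads_crossUD p true []
    rcases Nat.lt_or_ge (i + 1) p with hp | hp
    · have h1 := ((ih hp).whisker [true]).append_left (u := crossUD p true) (a' := rep (p + 1) ++ [false])
        (by simpa using hX)
      have h2 : Sim N K (rep (p + 1) ++ [false]) ([(i, .cross e)] ++ crossUD p true)
          (crossUD p true ++ [(i, .cross e)]) := by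
        have := CrossWord.comm (K := K) (N := N) (CrossWord.single e hp) (v := crossUD 0 true)
          (c := [true, false]) (d := [false, true]) (leads_of_runWord rfl) []
        rw [sh_crossUD] at this
        rw [rep_succ']
        simpa using this
      have h3 := h2.symm.append_right (t := mv p) (c := false :: rep (p + 1)) (by
        rw [List.append_assoc]
        refine hX.append ((leads_singleton_iff.2 ?_).append (b := rep p ++ [false, true]) ?_)
        · exact leads_singleton_iff.1 ((leads_cross_rep e hp).whisker [false, true])
        · have := leads_mv' (N := N) p [true]
          rwa [← rep_succ'] at this)
      simp only [mv, List.append_assoc] at h1 h3 ⊢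
      exact h1.trans h3
    · obtain rfl : p = i + 1 := by omega
      have hm : Leads N (mv i) (rep i ++ [false] ++ [true, true]) (false :: rep i ++ [true, true]) :=
        (leads_mv i).whisker _
      have h1 : Sim N K (rep i ++ [false] ++ [true, true]) (mv i ++ [(i + 1, .cross e)])
          ([(i + 1, .cross e)] ++ mv i) := by
        have := Sim.interchange (K := K) (leads_mv (N := N) i) (v := [(0, .cross e)])
          (c := [true, true]) (d := [true, true]) (leads_of_runWord rfl)
        simpa using this
      have h2 : Sim N K (rep (i + 1 + 1) ++ [false])
          (crossUD (i + 1) true ++ crossUD i true ++ [(i + 1, .cross e)])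
          ([(i, .cross e)] ++ crossUD (i + 1) true ++ crossUD i true) :=
        (sim_crossUD_crossUD_cross e).at' (rep i) [] (by simp [rep_succ']) (by simp [sh_crossUD])
          (by simp [sh_crossUD])
      have hu : Leads N (crossUD (i + 1) true ++ crossUD i true) (rep (i + 1 + 1) ++ [false])
          (rep i ++ [false] ++ [true, true]) := by
        refine hX.append ?_
        rw [rep_succ']
        simpa using leads_crossUD (N := N) i true [true]
      have h3 := h1.append_left hu
      have h4 := h2.append_right (t := mv i) (c := false :: rep i ++ [true, true])
        (((hu.append (b := rep i ++ [false] ++ [true, true]) (by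
          simpa using leads_cross (N := N) (rep i ++ [false]) [] e))).append hm)
      simp only [mv, List.append_assoc] at h3 h4 ⊢
      exact h3.trans h4

/-! Caps and cups at the left end. -/

lemma cap_step {p : ℕ} {w A : List Layer} (hA : CrossWord (p + 1) A)
    (h : Sim N K (rep (p + 1) ++ [false]) w (A ++ [(p, .cap true)])) :
    Sim N K (rep (p + 2) ++ [false]) (crossUD (p + 1) true ++ w)
      (A ++ [(p, .cross true)] ++ [(p + 1, .cap true)]) := by
  have hX : Leads N (crossUD (p + 1) true) (rep (p + 2) ++ [false])
      (rep (p + 1) ++ [false] ++ [true]) := by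
    rw [rep_succ' (p + 1)]
    simpa using leads_crossUD (N := N) (p + 1) true []
  have hc : Leads N [(p, .cap true)] (rep (p + 1) ++ [false] ++ [true]) (rep p ++ [true]) := by
    rw [rep_succ' p]
    simpa using leads_cap (N := N) (rep p) [true] true
  have h1 := (h.whisker [true]).append_left hX
  have h2 := hA.comm (N := N) (K := K) (v := crossUD 0 true)
    (c := [true, false]) (d := [false, true]) (leads_of_runWord rfl) []
  have h3 := h2.symm.append_right (t := [(p, .cap true)]) (c := rep p ++ [true]) (by
    rw [List.append_assoc]
    refine Leads.append (b := rep (p + 1) ++ [false] ++ [true]) ?_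
      (Leads.append (b := rep (p + 1) ++ [false] ++ [true])
        (by simpa using hA.leads' (N := N) ([false] ++ [true])) hc)
    rw [sh_crossUD]
    rw [rep_succ' (p + 1)] at hX
    simpa using hX)
  have h4 : Sim N K (rep (p + 2) ++ [false]) (crossUD (p + 1) true ++ [(p, .cap true)])
      ([(p, .cross true)] ++ [(p + 1, .cap true)]) :=
    sim_crossUD_cap.at' (rep p) [] (by simp [rep_succ']) (by simp [sh_crossUD]) (by simp)
  have h5 := h4.append_left (u := A) (a' := rep (p + 2) ++ [false]) (by
    rw [rep_succ' (p + 1), List.append_assoc]; exact hA.leads' _)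
  have e : rep (p + 2) ++ [false] = rep (p + 1) ++ [true, false] ++ [] := by
    rw [rep_succ' (p + 1)]; simp
  rw [← e, sh_crossUD] at h3
  simp only [List.append_assoc, add_zero] at h1 h3 h5 ⊢
  exact (h1.trans h3).trans h5

lemma cap_true_left (p : ℕ) : ∃ A, CrossWord (p + 1) A ∧ Sim N K (rep (p + 1) ++ [false])
    (sh 1 (mv p) ++ [(0, .cap true)]) (A ++ [(p, .cap true)]) := by
  induction p with
  | zero => exact ⟨[], CrossWord.nil _, Sim.refl (leads_cap [] [] true)⟩
  | succ p ih =>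
    obtain ⟨A, hA, h⟩ := ih
    refine ⟨_, (hA.mono (by omega)).append (CrossWord.single (i := p) true (by omega)), ?_⟩
    have := cap_step hA h
    rw [mv, sh_append, sh_crossUD, add_comm 1 p]
    simpa using this

lemma cap_false_left (p : ℕ) : ∃ A, CrossWord (p + 1) A ∧ Sim N K (rep (p + 1) ++ [false])
    (mv (p + 1) ++ [(0, .cap false)]) (A ++ [(p, .cap true)]) := by
  induction p with
  | zero => exact ⟨[], CrossWord.nil _, sim_crossUD_cap_false⟩
  | succ p ih =>
    obtain ⟨A, hA, h⟩ := ih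
    refine ⟨_, (hA.mono (by omega)).append (CrossWord.single (i := p) true (by omega)), ?_⟩
    have := cap_step hA h
    rw [mv]
    simpa using this

lemma cup_step {p : ℕ} {w A v : List Layer} {d : List Bool} (hA : CrossWord (p + 1) A)
    (hv : Leads N v (rep (p + 1) ++ [false]) d)
    (h : Sim N K (rep p) w ([(p, .cup true)] ++ A ++ v)) :
    Sim N K (rep (p + 1)) w ([(p + 1, .cup true)] ++ ([(p, .cross false)] ++ A) ++
      (crossUD (p + 1) true ++ v)) := by
  have h1 : Sim N K (rep (p + 1)) w ([(p, .cup true)] ++ (A ++ v)) := by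
    have := h.whisker [true]
    rw [← rep_succ'] at this
    simpa using this
  have h2 : Sim N K (rep (p + 1)) [(p, .cup true)]
      ([(p + 1, .cup true), (p, .cross false)] ++ crossUD (p + 1) true) :=
    sim_cup_cross.at' (rep p) [] (by simp [rep_succ']) (by simp) (by simp [sh_crossUD])
  have hcup : Leads N [(p, .cup true)] (rep (p + 1)) (rep (p + 1) ++ [false] ++ [true]) := by
    have := leads_cup (N := N) (rep p) [true] true
    rw [← rep_succ'] at this
    simpa [rep_succ'] using this
  have hAv : Leads N (A ++ v) (rep (p + 1) ++ [false] ++ [true]) (d ++ [true]) :=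
    ((hA.leads' [false]).append hv).whisker [true]
  have h3 := h2.append_right (hcup.append hAv)
  have hu : Leads N [(p + 1, .cup true), (p, .cross false)] (rep (p + 1))
      (rep (p + 1) ++ [true, false]) := by
    refine Leads.append (w := [(p + 1, .cup true)]) (v := [(p, .cross false)])
      (b := rep (p + 1) ++ [true, false]) ?_ ?_
    · simpa using leads_cup (N := N) (rep (p + 1)) [] true
    · have := (leads_cross_rep (N := N) (i := p) (p := p + 2) false (by omega)).whisker [false]
      rw [rep_succ' (p + 1)] at this
      simpa using this
  have h4 := hA.comm (N := N) (K := K) (v := crossUD 0 true)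
    (c := [true, false]) (d := [false, true]) (leads_of_runWord rfl) []
  rw [sh_crossUD, List.append_nil, add_zero] at h4
  have hX : Leads N (crossUD (p + 1) true) (rep (p + 1) ++ [true, false])
      (rep (p + 1) ++ [false] ++ [true]) := by
    simpa using leads_crossUD (N := N) (p + 1) true []
  have h5 := Sim.ctx' hu h4.symm (hX.append (by simpa using hA.leads' [false, true]))
    (hv.whisker [true])
  simp only [List.append_assoc, List.cons_append, List.nil_append] at h1 h3 h5 ⊢
  exact (h1.trans h3).trans h5

lemma cup_true_left (p : ℕ) : ∃ A, CrossWord (p + 1) A ∧ Sim N K (rep p)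
    [(0, .cup true)] ([(p, .cup true)] ++ A ++ sh 1 (mv p)) := by
  induction p with
  | zero => exact ⟨[], CrossWord.nil _, Sim.refl (leads_cup [] [] true)⟩
  | succ p ih =>
    obtain ⟨A, hA, h⟩ := ih
    refine ⟨_, (CrossWord.single (i := p) false (by omega)).append (hA.mono (by omega)), ?_⟩
    have := cup_step hA (d := [true] ++ false :: rep p) ((leads_mv p).shift [true]) h
    simpa [mv, sh_crossUD, add_comm] using this

lemma cup_false_left (p : ℕ) : ∃ A, CrossWord (p + 1) A ∧ Sim N K (rep p)
    [(0, .cup false)] ([(p, .cup true)] ++ A ++ mv (p + 1)) := by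
  induction p with
  | zero => exact ⟨[], CrossWord.nil _, sim_cup_false⟩
  | succ p ih =>
    obtain ⟨A, hA, h⟩ := ih
    refine ⟨_, (CrossWord.single (i := p) false (by omega)).append (hA.mono (by omega)), ?_⟩
    have := cup_step hA (leads_mv (p + 1)) h
    rw [mv]
    simpa using this

lemma mv_cap (p : ℕ) : Sim N K (rep (p + 1) ++ [false, false])
    (mv (p + 1) ++ [(p + 1, .cap true)])
    (crossDown (p + 1) true ++ [(p, .cap true)] ++ mv p) := by
  have hX : Leads N (crossUD p true) (rep (p + 1) ++ [false, false])
      (rep p ++ [false] ++ [true, false]) := by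
    have := leads_crossUD (N := N) p true [false]
    rw [rep_succ']
    simpa using this
  have h1 : Sim N K (rep p ++ [false] ++ [true, false]) (mv p ++ [(p + 1, .cap true)])
      ([(p + 1, .cap true)] ++ mv p) := by
    have := Sim.interchange (K := K) (leads_mv (N := N) p) (v := [(0, .cap true)])
      (c := [true, false]) (d := []) (leads_of_runWord rfl)
    simpa using this
  have h2 := h1.append_left hX
  have h3 : Sim N K (rep (p + 1) ++ [false, false]) (crossDown (p + 1) true ++ [(p, .cap true)])
      (crossUD p true ++ [(p + 1, .cap true)]) :=
    sim_cross_down_cap.at' (rep p) [] (by simp [rep_succ']) (by simp [crossDown])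
      (by simp [sh_crossUD])
  have h4 := h3.symm.append_right (t := mv p) (c := false :: rep p) (by
    refine (hX.append ?_).append (leads_mv p)
    simpa using leads_cap (N := N) (rep p ++ [false]) [] true)
  simp only [mv, List.append_assoc] at h2 h4 ⊢
  exact h2.trans h4

lemma mv_cup (p : ℕ) : Sim N K (rep p ++ [false]) (mv p ++ [(p + 1, .cup true)])
    ([(p, .cup true)] ++ crossDown (p + 1) false ++ mv (p + 1)) := by
  have h1 : Sim N K (rep p ++ [false]) (mv p ++ [(p + 1, .cup true)])
      ([(p + 1, .cup true)] ++ mv p) := by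
    have := Sim.interchange (K := K) (leads_mv (N := N) p) (v := [(0, .cup true)])
      (c := []) (d := [true, false]) (leads_of_runWord rfl)
    simpa using this
  have h3 : Sim N K (rep p ++ [false])
      ([(p, .cup true)] ++ crossDown (p + 1) false ++ crossUD p true) [(p + 1, .cup true)] :=
    sim_cup_cross_down.at' (rep p) [] (by simp) (by simp [crossDown, sh_crossUD]) (by simp)
  have h4 := h3.symm.append_right (t := mv p) (c := false :: rep p ++ [true, false]) (by
    refine Leads.append (b := rep p ++ [false] ++ [true, false]) ?_ ((leads_mv p).whisker _)
    simpa using leads_cup (N := N) (rep p ++ [false]) [] true)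
  simp only [mv, List.append_assoc] at h1 h4 ⊢
  exact h1.trans h4

end

section

variable {N K : ℕ}

/-! ### Pieces next to a sorted boundary -/

/-- Words of crossings of the upward strands and of the downward strands of a sorted boundary. -/
inductive SortedWord (p m : ℕ) : List Layer → Prop
  | nil : SortedWord p m []
  | cross (i : ℕ) (e : Bool) (A : List Layer) (h : i + 1 < p) (hA : SortedWord p m A) :
      SortedWord p m ([(i, .cross e)] ++ A)
  | down (j : ℕ) (e : Bool) (A : List Layer) (h : j + 1 < m) (hA : SortedWord p m A) :
      SortedWord p m (crossDown (p + j) e ++ A)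

lemma leads_cross_srt {i p : ℕ} (m : ℕ) (e : Bool) (h : i + 1 < p) :
    Leads N [(i, .cross e)] (srt p m) (srt p m) := (leads_cross_rep e h).whisker _

lemma repF_split {i p : ℕ} (h : i + 1 < p) :
    repF p = repF i ++ false :: false :: repF (p - i - 2) := by
  have e : false :: false :: repF (p - i - 2) = repF (2 + (p - i - 2)) := by
    rw [repF, repF, List.replicate_add]; rfl
  rw [e, repF, repF, repF, ← List.replicate_add]
  congr 1
  omega

lemma leads_down_srt {j m : ℕ} (p : ℕ) (e : Bool) (h : j + 1 < m) :
    Leads N (crossDown (p + j) e) (srt p m) (srt p m) := by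
  have := leads_crossDown (N := N) (rep p ++ repF j) (repF (m - j - 2)) e
  simp only [srt]
  rw [repF_split h]
  simpa using this

lemma SortedWord.leads {p m : ℕ} {A : List Layer} (h : SortedWord p m A) :
    Leads N A (srt p m) (srt p m) := by
  induction h with
  | nil => rfl
  | cross i e A h _ ih => exact (leads_cross_srt m e h).append ih
  | down j e A h _ ih => exact (leads_down_srt p e h).append ih

lemma SortedWord.append {p m : ℕ} {A B : List Layer} (h : SortedWord p m A)
    (h' : SortedWord p m B) : SortedWord p m (A ++ B) := by
  induction h with
  | nil => exact h'
  | cross i e A h _ ih => rw [List.append_assoc]; exact .cross i e _ h ih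
  | down j e A h _ ih => rw [List.append_assoc]; exact .down j e _ h ih

lemma CrossWord.sorted {p : ℕ} (m : ℕ) {A : List Layer} (h : CrossWord p A) :
    SortedWord p m A := by
  induction A with
  | nil => exact .nil
  | cons x A ih =>
    obtain ⟨i, e, rfl, hi⟩ := h x (by simp)
    exact .cross i e A hi (ih fun x hx => h x (by simp [hx]))

lemma SortedWord.down_single {p m j : ℕ} (e : Bool) (h : j + 1 < m) :
    SortedWord p m (crossDown (p + j) e) := by
  simpa using SortedWord.down (p := p) j e [] h .nil

lemma sh_crossDown (j k : ℕ) (p : Bool) : sh j (crossDown k p) = crossDown (j + k) p := rfl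

lemma SortedWord.shift {p m : ℕ} {A : List Layer} (h : SortedWord p m A) :
    SortedWord (p + 1) m (sh 1 A) := by
  induction h with
  | nil => exact .nil
  | cross i e A h _ ih =>
    have := SortedWord.cross (i + 1) e _ (by omega) ih
    simpa [add_comm] using this
  | down j e A h _ ih =>
    have := SortedWord.down j e _ h ih
    rw [sh_append, sh_crossDown]
    rwa [show 1 + (p + j) = p + 1 + j by omega]

lemma srt_succ_right (p m : ℕ) : srt p (m + 1) = rep p ++ [false] ++ repF m := by
  simp [srt, List.replicate_succ]

lemma srt_succ_left (p m : ℕ) : srt (p + 1) m = true :: srt p m := by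
  simp [srt, List.replicate_succ]

lemma leads_mv_srt (p m : ℕ) : Leads N (mv p) (srt p (m + 1)) (false :: srt p m) := by
  rw [srt_succ_right]
  simpa using leads_mv' (N := N) p (repF m)

lemma SortedWord.mv {p m : ℕ} {A : List Layer} (h : SortedWord p m A) :
    ∃ A', SortedWord p (m + 1) A' ∧
      Sim N K (srt p (m + 1)) (mv p ++ sh 1 A) (A' ++ SkeinSU.mv p) := by
  induction h with
  | nil => exact ⟨[], .nil, by simpa using Sim.refl (leads_mv_srt p m)⟩
  | cross i e A h hA ih =>
    obtain ⟨A', hA', ih⟩ := ih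
    refine ⟨[(i, .cross e)] ++ A', .cross i e A' h hA', ?_⟩
    have h1 : Sim N K (srt p (m + 1)) (SkeinSU.mv p ++ [(i + 1, .cross e)])
        ([(i, .cross e)] ++ SkeinSU.mv p) := by
      rw [srt_succ_right]; exact (mv_cross p i e h).whisker _
    have h2 := h1.append_right (t := sh 1 A) (c := false :: srt p m) (by
      refine ((leads_mv_srt p m).append ?_).append (hA.leads.shift [false])
      simpa [add_comm] using (leads_cross_srt (N := N) m e h).shift [false])
    have h3 := ih.append_left (leads_cross_srt (N := N) (m + 1) e h)
    rw [sh_append]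
    simp only [List.append_assoc, sh_cons, sh_nil, add_comm 1 i] at h2 h3 ⊢
    exact h2.trans h3
  | down j e A h hA ih =>
    obtain ⟨A', hA', ih⟩ := ih
    refine ⟨crossDown (p + (j + 1)) e ++ A', .down (j + 1) e A' (by omega) hA', ?_⟩
    have h1 : Sim N K (srt p (m + 1)) (SkeinSU.mv p ++ crossDown (1 + (p + j)) e)
        (crossDown (p + (j + 1)) e ++ SkeinSU.mv p) := by
      have hd : Leads N (crossDown j e) (repF m) (repF m) := by
        simpa [srt] using leads_down_srt (N := N) (j := j) 0 e h
      have := Sim.interchange (K := K) (leads_mv (N := N) p) hd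
      rw [srt_succ_right]
      rw [sh_crossDown, sh_crossDown] at this
      simp only [List.length_cons, List.length_append, List.length_replicate, List.length_nil] at this
      rwa [show 1 + (p + j) = p + 1 + j by omega, show p + (j + 1) = p + (0 + 1) + j by omega]
    have h2 := h1.append_right (t := sh 1 A) (c := false :: srt p m) (by
      refine ((leads_mv_srt p m).append ?_).append (hA.leads.shift [false])
      simpa [sh_crossDown] using (leads_down_srt (N := N) p e h).shift [false])
    have h3 := ih.append_left (leads_down_srt (N := N) p (j := j + 1) (m := m + 1) e (by omega))
    rw [sh_append, sh_crossDown]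
    simp only [List.append_assoc] at h2 h3 ⊢
    exact h2.trans h3

lemma ups_cons_true (b : List Bool) : ups (true :: b) = ups b + 1 := by simp
lemma ups_cons_false (b : List Bool) : ups (false :: b) = ups b := by simp
lemma downs_cons_true (b : List Bool) : downs (true :: b) = downs b := by simp
lemma downs_cons_false (b : List Bool) : downs (false :: b) = downs b + 1 := by simp
lemma ups_insert (l r : List Bool) (s : Bool) : ups (l ++ s :: (!s) :: r) = ups (l ++ r) + 1 := by
  cases s <;> simp <;> omega
lemma downs_insert (l r : List Bool) (s : Bool) :
    downs (l ++ s :: (!s) :: r) = downs (l ++ r) + 1 := by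
  cases s <;> simp <;> omega

lemma unsort_cross (l r : List Bool) (e : Bool) :
    Sim N K (srt (ups (l ++ true :: true :: r)) (downs (l ++ true :: true :: r)))
      (unsort (l ++ true :: true :: r) ++ [(l.length, .cross e)])
      ([(ups l, .cross e)] ++ unsort (l ++ true :: true :: r)) := by
  induction l with
  | nil =>
    have := Sim.interchange (K := K) (w := [(0, .cross e)]) (a := [true, true])
      (b := [true, true]) (leads_of_runWord rfl) (leads_unsort (N := N) r)
    simp only [List.nil_append, ups_cons_true, downs_cons_true, srt_succ_left, unsort, sh_sh,
      List.length_nil]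
    simpa using this.symm
  | cons s l ih =>
    cases s with
    | true =>
      have := ih.shift [true]
      simp only [List.cons_append, ups_cons_true, downs_cons_true, srt_succ_left, unsort]
      simpa [add_comm] using this
    | false =>
      set b := l ++ true :: true :: r with hb
      have hi : ups l + 1 < ups b := by simp [hb]
      have h1 := (ih.shift [false]).append_left (u := mv (ups b))
        (a' := srt (ups b) (downs b + 1)) (leads_mv_srt _ _)
      have h2 : Sim N K (srt (ups b) (downs b + 1)) (mv (ups b) ++ [(ups l + 1, .cross e)])
          ([(ups l, .cross e)] ++ mv (ups b)) := by
        rw [srt_succ_right]; exact (mv_cross _ _ e hi).whisker _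
      have h3 := h2.append_right (t := sh 1 (unsort b)) (c := false :: b) (by
        refine ((leads_mv_srt _ _).append ?_).append ((leads_unsort b).shift [false])
        simpa [add_comm] using (leads_cross_srt (N := N) (downs b) e hi).shift [false])
      simp only [List.cons_append, ← hb, ups_cons_false, downs_cons_false, unsort]
      simp only [List.length_cons, List.length_nil, zero_add, sh_append, sh_cons, sh_nil,
        List.append_assoc, add_comm 1] at h1 h3 ⊢
      exact h1.trans h3

lemma leads_cap_srt (p m : ℕ) : Leads N [(p, .cap true)] (srt (p + 1) (m + 1)) (srt p m) := by
  have := leads_cap (N := N) (rep p) (repF m) true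
  simp only [srt]
  rw [rep_succ']
  simpa [List.replicate_succ] using this

lemma leads_cup_srt (p m : ℕ) : Leads N [(p, .cup true)] (srt p m) (srt (p + 1) (m + 1)) := by
  have := leads_cup (N := N) (rep p) (repF m) true
  simp only [srt]
  rw [rep_succ']
  simpa [List.replicate_succ] using this

lemma unsort_cap (l r : List Bool) (s : Bool) :
    ∃ A, SortedWord (ups (l ++ r) + 1) (downs (l ++ r) + 1) A ∧
      Sim N K (srt (ups (l ++ r) + 1) (downs (l ++ r) + 1))
        (unsort (l ++ s :: (!s) :: r) ++ [(l.length, .cap s)])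
        (A ++ [(ups (l ++ r), .cap true)] ++ unsort (l ++ r)) := by
  induction l with
  | nil =>
    simp only [List.nil_append, List.length_nil]
    have key : ∀ w A, CrossWord (ups r + 1) A → Leads N w (rep (ups r + 1) ++ [false])
        (s :: (!s) :: rep (ups r)) → Sim N K (rep (ups r + 1) ++ [false])
        (w ++ [(0, .cap s)]) (A ++ [(ups r, .cap true)]) →
        Sim N K (srt (ups r + 1) (downs r + 1)) (w ++ sh 2 (unsort r) ++ [(0, .cap s)])
        (A ++ [(ups r, .cap true)] ++ unsort r) := by
      intro w A hA hw h
      have h1 := Sim.interchange (K := K) (w := [(0, .cap s)]) (a := [s, !s]) (b := [])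
        (by simpa using leads_cap (N := N) [] [] s) (leads_unsort (N := N) r)
      have hw' : Leads N w (srt (ups r + 1) (downs r + 1))
          ([s, !s] ++ srt (ups r) (downs r)) := by
        rw [srt_succ_right]
        simpa [srt] using hw.whisker (repF (downs r))
      have h2 := h1.symm.append_left hw'
      have h3 := (h.whisker (repF (downs r))).append_right (t := unsort r) (c := r) (by
        refine Leads.append (b := srt (ups r) (downs r)) (Leads.append (hw.whisker _) ?_)
          (leads_unsort r)
        simpa [srt] using leads_cap (N := N) [] (srt (ups r) (downs r)) s)
      rw [← srt_succ_right] at h3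
      simp only [List.append_assoc, List.length_nil, sh_zero] at h2 h3 ⊢
      exact h2.trans h3
    cases s with
    | true =>
      obtain ⟨A, hA, h⟩ := cap_true_left (N := N) (K := K) (ups r)
      refine ⟨A, hA.sorted _, ?_⟩
      have := key (sh 1 (mv (ups r))) A hA ((leads_mv _).shift [true]) h
      simpa [unsort, sh_sh] using this
    | false =>
      obtain ⟨A, hA, h⟩ := cap_false_left (N := N) (K := K) (ups r)
      refine ⟨A, hA.sorted _, ?_⟩
      have := key (mv (ups r + 1)) A hA (leads_mv _) h
      simpa [unsort, sh_sh] using this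
  | cons t l ih =>
    obtain ⟨A, hA, h⟩ := ih
    cases t with
    | true =>
      refine ⟨sh 1 A, by simpa using hA.shift, ?_⟩
      have := h.shift [true]
      simp only [List.cons_append, ups_cons_true, downs_cons_true, srt_succ_left _ (_ + 1), unsort]
      simpa [add_comm, srt_succ_left] using this
    | false =>
      set b := l ++ r with hb
      obtain ⟨A', hA', h'⟩ := hA.mv (N := N) (K := K)
      have hbu : ups (l ++ s :: (!s) :: r) = ups b + 1 := ups_insert l r s
      refine ⟨A' ++ crossDown (ups b + 1 + 0) true,
        by simpa [← hb] using hA'.append (SortedWord.down_single (p := ups b + 1) (m := downs b + 1 + 1) (j := 0) true (by omega)), ?_⟩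
      have h1 := (h.shift [false]).append_left (u := mv (ups b + 1))
        (a' := srt (ups b + 1) (downs b + 1 + 1)) (leads_mv_srt _ _)
      have hc : Leads N [(ups b + 1, .cap true)] (false :: srt (ups b + 1) (downs b + 1))
          (false :: srt (ups b) (downs b)) := by
        simpa [add_comm] using (leads_cap_srt (N := N) (ups b) (downs b)).shift [false]
      have h2 := h'.append_right (t := [(ups b + 1, .cap true)] ++ sh 1 (unsort b))
        (c := false :: b) (((leads_mv_srt _ _).append (hA.leads.shift [false])).append
          (hc.append ((leads_unsort b).shift [false])))
      have h3 : Sim N K (srt (ups b + 1) (downs b + 1 + 1))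
          (mv (ups b + 1) ++ [(ups b + 1, .cap true)])
          (crossDown (ups b + 1) true ++ [(ups b, .cap true)] ++ mv (ups b)) := by
        have := (mv_cap (N := N) (K := K) (ups b)).whisker (repF (downs b))
        simpa [srt, List.replicate_succ] using this
      have h4 := Sim.ctx' (hA'.leads (N := N)) h3 ((leads_mv_srt _ _).append hc)
        ((leads_unsort b).shift [false])
      simp only [List.cons_append, ← hb, ups_cons_false, downs_cons_false, unsort, hbu]
      simp only [List.length_cons, List.length_nil, zero_add, sh_append, sh_cons, sh_nil,
        List.append_assoc, add_comm 1, add_zero] at h1 h2 h4 ⊢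
      exact (h1.trans h2).trans h4

lemma unsort_cup (l r : List Bool) (s : Bool) :
    ∃ A, SortedWord (ups (l ++ r) + 1) (downs (l ++ r) + 1) A ∧
      Sim N K (srt (ups (l ++ r)) (downs (l ++ r)))
        (unsort (l ++ r) ++ [(l.length, .cup s)])
        ([(ups (l ++ r), .cup true)] ++ A ++ unsort (l ++ s :: (!s) :: r)) := by
  induction l with
  | nil =>
    simp only [List.nil_append, List.length_nil]
    have key : ∀ w A, CrossWord (ups r + 1) A → Sim N K (rep (ups r))
        [(0, .cup s)] ([(ups r, .cup true)] ++ A ++ w) →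
        Sim N K (srt (ups r) (downs r)) (unsort r ++ [(0, .cup s)])
        ([(ups r, .cup true)] ++ A ++ (w ++ sh 2 (unsort r))) := by
      intro w A hA h
      have h1 := Sim.interchange (K := K) (w := [(0, .cup s)]) (a := []) (b := [s, !s])
        (by simpa using leads_cup (N := N) [] [] s) (leads_unsort (N := N) r)
      have h3 := (h.whisker (repF (downs r))).append_right (t := sh 2 (unsort r))
        (c := [s, !s] ++ r) (by
        refine Leads.append (b := [s, !s] ++ srt (ups r) (downs r)) ?_
          ((leads_unsort r).shift [s, !s])
        simpa using leads_cup (N := N) [] (srt (ups r) (downs r)) s)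
      simp only [List.append_assoc, List.length_nil, sh_zero, List.nil_append] at h1 h3 ⊢
      exact h1.symm.trans h3
    cases s with
    | true =>
      obtain ⟨A, hA, h⟩ := cup_true_left (N := N) (K := K) (ups r)
      refine ⟨A, hA.sorted _, ?_⟩
      have := key (sh 1 (mv (ups r))) A hA h
      simpa [unsort, sh_sh] using this
    | false =>
      obtain ⟨A, hA, h⟩ := cup_false_left (N := N) (K := K) (ups r)
      refine ⟨A, hA.sorted _, ?_⟩
      have := key (mv (ups r + 1)) A hA h
      simpa [unsort, sh_sh] using this
  | cons t l ih =>
    obtain ⟨A, hA, h⟩ := ih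
    cases t with
    | true =>
      refine ⟨sh 1 A, by simpa using hA.shift, ?_⟩
      have := h.shift [true]
      simp only [List.cons_append, ups_cons_true, downs_cons_true, srt_succ_left, unsort]
      simpa [add_comm] using this
    | false =>
      set b := l ++ r with hb
      obtain ⟨A', hA', h'⟩ := hA.mv (N := N) (K := K)
      have hbu : ups (l ++ s :: (!s) :: r) = ups b + 1 := ups_insert l r s
      have hbd : downs (l ++ s :: (!s) :: r) = downs b + 1 := downs_insert l r s
      set b' := l ++ s :: (!s) :: r with hb'
      refine ⟨crossDown (ups b + 1 + 0) false ++ A',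
        by simpa [← hb] using (SortedWord.down_single (p := ups b + 1) (m := downs b + 1 + 1) (j := 0) false (by omega)).append hA', ?_⟩
      have h1 := (h.shift [false]).append_left (u := mv (ups b))
        (a' := srt (ups b) (downs b + 1)) (leads_mv_srt _ _)
      have h3 : Sim N K (srt (ups b) (downs b + 1))
          (mv (ups b) ++ [(ups b + 1, .cup true)])
          ([(ups b, .cup true)] ++ crossDown (ups b + 1) false ++ mv (ups b + 1)) := by
        have := (mv_cup (N := N) (K := K) (ups b)).whisker (repF (downs b))
        rw [srt_succ_right]; exact this
      have hub : Leads N (sh 1 (unsort b')) (false :: srt (ups b + 1) (downs b + 1))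
          (false :: b') := by
        have := (leads_unsort (N := N) b').shift [false]
        rwa [hbu, hbd] at this
      have hc : Leads N [(ups b + 1, .cup true)] (false :: srt (ups b) (downs b))
          (false :: srt (ups b + 1) (downs b + 1)) := by
        simpa [add_comm] using (leads_cup_srt (N := N) (ups b) (downs b)).shift [false]
      have h4 := h3.append_right (t := sh 1 A ++ sh 1 (unsort b')) (c := false :: b')
        (((leads_mv_srt _ _).append hc).append ((hA.leads.shift [false]).append hub))
      have h5 := Sim.ctx' (u := [(ups b, .cup true)] ++ crossDown (ups b + 1 + 0) false)
        (a' := srt (ups b) (downs b + 1)) (t := sh 1 (unsort b'))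
        ((leads_cup_srt _ _).append (leads_down_srt _ _ (by omega))) h'
        ((leads_mv_srt _ _).append (hA.leads.shift [false])) hub
      simp only [List.cons_append, ← hb, ← hb', ups_cons_false, downs_cons_false, unsort, hbu]
      simp only [List.length_cons, List.length_nil, zero_add, sh_append, sh_cons, sh_nil,
        List.append_assoc, add_comm 1, add_zero, List.cons_append, List.nil_append] at h1 h4 h5 ⊢
      exact (h1.trans h4).trans h5

end

section

variable {N K : ℕ}

/-! ### Diagrams without coupons -/

lemma cups_append (k : ℕ) (a b : List Bool) :
    cups k (a ++ b) = cups k a ++ cups (k + a.length) b := by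
  induction a generalizing k with
  | nil => simp [cups]
  | cons s a ih => simp [cups, ih, add_comm, add_left_comm]

lemma dual_rep (m : ℕ) : dual (rep m) = repF m := by simp [dual]

lemma leads_cups_rep (n m : ℕ) (r : List Bool) :
    Leads N (cups n (rep m)) (rep n ++ r) (srt (n + m) m ++ r) := by
  have := leads_cups N (rep m) (rep n) r
  rw [dual_rep] at this
  simp only [srt]
  rw [rep_add]
  simpa using this

lemma leads_cups_rep' (n m : ℕ) : Leads N (cups n (rep m)) (rep n) (srt (n + m) m) := by
  simpa using leads_cups_rep (N := N) n m []

lemma cups_cross_down (n i j : ℕ) (e : Bool) : Sim N K (rep n)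
    (cups n (rep (i + 2 + j)) ++ crossDown (n + (i + 2 + j) + j) e)
    (cups n (rep (i + 2 + j)) ++ [(n + i, .cross e)]) := by
  have hsplit : cups n (rep (i + 2 + j)) = cups n (rep i) ++
      ([(n + i, .cup true), (n + i + 1, .cup true)] ++ cups (n + i + 2) (rep j)) := by
    rw [rep_add, rep_add, cups_append, cups_append, List.append_assoc]
    simp [cups, List.replicate_succ, add_assoc]
  have hc0 : Leads N (cups 0 (rep j)) [] (rep j ++ repF j) := by
    simpa [srt] using leads_cups_rep (N := N) 0 j []
  have hd0 : Leads N (crossDown 0 e) [false, false] [false, false] := leads_of_runWord rfl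
  have h1 : Sim N K (rep (n + i) ++ [true, true] ++ [false, false] ++ repF i)
      (cups (n + i + 2) (rep j) ++ crossDown (n + (i + 2 + j) + j) e)
      (crossDown (n + i + 2) e ++ cups (n + i + 2) (rep j)) := by
    refine (Sim.interchange (K := K) hc0 hd0).at' (rep (n + i) ++ [true, true]) (repF i)
      (by simp) ?_ ?_
    · simp only [sh_append, sh_cups, sh_crossDown, List.length_append, List.length_replicate,
        List.length_cons, List.length_nil]
      congr 2; omega
    · simp [sh_cups, sh_crossDown]
  have h2 : Sim N K (rep (n + i) ++ repF i)
      ([(n + i, .cup true), (n + i + 1, .cup true)] ++ crossDown (n + i + 2) e)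
      [(n + i, .cup true), (n + i + 1, .cup true), (n + i, .cross e)] :=
    (sim_cups_cross_down e).at' (rep (n + i)) (repF i) (by simp) (by simp [sh_crossDown])
      (by simp)
  have hx0 : Leads N [(0, .cross e)] [true, true] [true, true] := leads_of_runWord rfl
  have h3 : Sim N K (rep (n + i) ++ [true, true] ++ [false, false] ++ repF i)
      ([(n + i, .cross e)] ++ cups (n + i + 2) (rep j))
      (cups (n + i + 2) (rep j) ++ [(n + i, .cross e)]) :=
    (Sim.interchange (K := K) hx0 hc0).at' (rep (n + i)) ([false, false] ++ repF i)
      (by simp) (by simp [sh_cups, add_assoc]) (by simp [sh_cups, add_assoc])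
  have hu : Leads N (cups n (rep i)) (rep n) (rep (n + i) ++ repF i) := leads_cups_rep' n i
  have hcc : Leads N [(n + i, .cup true), (n + i + 1, .cup true)] (rep (n + i) ++ repF i)
      (rep (n + i) ++ [true, true] ++ [false, false] ++ repF i) :=
    Leads.at' (N := N) (w := [(0, .cup true), (1, .cup true)]) (a := [])
      (b := [true, true, false, false]) (leads_of_runWord rfl) (rep (n + i)) (repF i)
      (by simp) (by simp) (by simp)
  have hd : Leads N (crossDown (n + i + 2) e)
      (rep (n + i) ++ [true, true] ++ [false, false] ++ repF i)
      (rep (n + i) ++ [true, true] ++ [false, false] ++ repF i) :=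
    Leads.at' hd0 (rep (n + i) ++ [true, true]) (repF i) (by simp) (by simp)
      (by simp [sh_crossDown])
  have hcj : Leads N (cups (n + i + 2) (rep j))
      (rep (n + i) ++ [true, true] ++ [false, false] ++ repF i)
      (rep (n + i) ++ [true, true] ++ (rep j ++ repF j) ++ ([false, false] ++ repF i)) :=
    Leads.at' hc0 (rep (n + i) ++ [true, true]) ([false, false] ++ repF i) (by simp) (by simp)
      (by simp [sh_cups])
  have g1 := h1.append_left (hu.append hcc)
  have g2 := Sim.ctx' hu h2 (hcc.append hd) hcj
  have g3 := h3.append_left (hu.append hcc)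
  rw [hsplit]
  simp only [List.append_assoc, List.cons_append, List.nil_append] at g1 g2 g3 ⊢
  exact (g1.trans g2).trans g3

lemma absorb {n m : ℕ} {A : List Layer} (hA : SortedWord (n + m) m A) {y : List Layer}
    (hy : CrossWord (n + m) y) : ∃ y', CrossWord (n + m) y' ∧
      Sim N K (rep n) (cups n (rep m) ++ y ++ A) (cups n (rep m) ++ y') := by
  induction hA generalizing y with
  | nil =>
    refine ⟨y, hy, ?_⟩
    simpa using Sim.refl ((leads_cups_rep' n m).append (hy.leads' _))
  | cross i e A h hA ih =>
    obtain ⟨y', hy', h'⟩ := ih (hy.append (CrossWord.single e h))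
    exact ⟨y', hy', by simpa using h'⟩
  | down j e A h hA ih =>
    obtain ⟨i, rfl⟩ : ∃ i, m = i + 2 + j := ⟨m - 2 - j, by omega⟩
    obtain ⟨y', hy', h'⟩ := ih ((CrossWord.single (p := n + (i + 2 + j)) (i := n + i) e
      (by omega)).append hy)
    refine ⟨y', hy', ?_⟩
    have hd : Leads N (crossDown j e) (repF (i + 2 + j)) (repF (i + 2 + j)) := by
      simpa [srt] using leads_down_srt (N := N) (j := j) 0 e h
    have h1 := hy.comm (K := K) hd []
    rw [List.append_nil, sh_crossDown] at h1
    have h2 := Sim.ctx' (leads_cups_rep' n _) h1 ((hy.leads' _).append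
      (leads_down_srt _ e h)) hA.leads
    have h3 := (cups_cross_down (N := N) (K := K) n i j e).append_right (t := y ++ A)
      (c := srt (n + (i + 2 + j)) (i + 2 + j))
      (((leads_cups_rep' n _).append (leads_down_srt _ e h)).append
        ((hy.leads' _).append hA.leads))
    simp only [List.append_assoc] at h1 h2 h3 h' ⊢
    exact (h2.trans h3).trans h'

/-- The class of the word `w` belongs to a subspace of skeins. -/
def Mem {a b : List Bool} (S : Submodule ℂ (Skein N K a b)) (w : List Layer) : Prop :=
  ∃ h : Leads N w a b, Skein.of K ⟨w, h⟩ ∈ S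

lemma Mem.of_sim {a b : List Bool} {S : Submodule ℂ (Skein N K a b)} {w v : List Layer}
    (h : Sim N K a w v) (hv : Mem S v) : Mem S w := by
  obtain ⟨hv, hm⟩ := hv
  obtain ⟨b', hw, hv', c, hc, e⟩ := h
  obtain rfl := hv.unique hv'
  exact ⟨hw, e ▸ S.smul_mem c hm⟩

lemma leads_normal {n : ℕ} {b : List Bool} (hb : ups b = n + downs b) {y : List Layer}
    (hy : CrossWord (ups b) y) :
    Leads N (cups n (rep (downs b)) ++ y ++ unsort b) (rep n) b := by
  refine (Leads.append ?_ (hy.leads' _)).append (leads_unsort b)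
  rw [hb]; exact leads_cups_rep' n _

/-- The span of the diagrams that consist of nested cups, of a braid, and of a diagram that
rearranges the boundary. -/
def normalSpan (N K n : ℕ) (b : List Bool) : Submodule ℂ (Skein N K (rep n) b) :=
  Submodule.span ℂ {x | ∃ (y : List Layer) (hb : ups b = n + downs b) (hy : CrossWord (ups b) y),
    x = Skein.of K ⟨_, leads_normal hb hy⟩}

lemma mem_normalSpan {n : ℕ} {b : List Bool} (hb : ups b = n + downs b) {y : List Layer}
    (hy : CrossWord (ups b) y) : Mem (normalSpan N K n b)
      (cups n (rep (downs b)) ++ y ++ unsort b) :=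
  ⟨leads_normal hb hy, Submodule.subset_span ⟨y, hb, hy, rfl⟩⟩

/-- The span of the braids of the first `m` of `p` strands. -/
def braidSpan (N K p m : ℕ) : Submodule ℂ (Skein N K (rep p) (rep p)) :=
  Submodule.span ℂ {x | ∃ (y : List Layer) (_ : CrossWord m y) (h : Leads N y (rep p) (rep p)),
    x = Skein.of K ⟨y, h⟩}

lemma span_map_mem {M M' : Type*} [AddCommGroup M] [Module ℂ M] [AddCommGroup M'] [Module ℂ M']
    {X : Set M} {T : Submodule ℂ M'} (L : M →ₗ[ℂ] M') (h : ∀ x ∈ X, L x ∈ T) {x : M}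
    (hx : x ∈ Submodule.span ℂ X) : L x ∈ T :=
  (Submodule.span_le (p := T.comap L)).2 h hx

/-- The canonical homomorphism to the skein algebra, as a linear map to the skein module. -/
def toSkeinLin (N K n : ℕ) : Hecke N K n →ₗ[ℂ] Skein N K (rep n) (rep n) where
  toFun x := toSkein N K n x
  map_add' := map_add (toSkein N K n)
  map_smul' := map_smul (toSkein N K n)

lemma toSkeinLin_one (N K n : ℕ) : toSkeinLin N K n 1 = Skein.of K ⟨[], rfl⟩ :=
  map_one (toSkein N K n)

lemma toSkeinLin_mul {n : ℕ} (x y : Hecke N K n) :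
    toSkeinLin N K n (x * y) = Skein.comp N K _ _ _ (toSkeinLin N K n y) (toSkeinLin N K n x) :=
  map_mul (toSkein N K n) x y

lemma toSkeinLin_sigma {n : ℕ} (i : BraidGen n) :
    toSkeinLin N K n (Hecke.sigma N K i) = Skein.of K (crossing N i true) :=
  toSkein_sigma N K i

lemma toSkeinLin_braid_inv {n : ℕ} (i : BraidGen n) :
    toSkeinLin N K n (Hecke.braid N K n (PresentedGroup.of i)⁻¹) =
      Skein.of K (crossing N i false) := by
  refine left_inv_eq_right_inv (a := toSkein N K n (Hecke.sigma N K i)) ?_ ?_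
  · rw [toSkein_sigma]
    change toSkein N K n _ * _ = 1
    rw [← toSkein_sigma, ← map_mul, Hecke.sigma, ← map_mul, inv_mul_cancel, map_one, map_one]
  · rw [toSkein_sigma]; exact (crossingUnit N K i).mul_inv

lemma toSkein_mapLE_mem {m p : ℕ} (h : m ≤ p) (a : Hecke N K m) :
    toSkeinLin N K p (Hecke.mapLE N K h a) ∈ braidSpan N K p m := by
  induction a using Hecke.induction with
  | one =>
    rw [map_one, toSkeinLin_one]
    exact Submodule.subset_span ⟨[], CrossWord.nil _, rfl, rfl⟩
  | add x y hx hy => rw [map_add, map_add]; exact Submodule.add_mem _ hx hy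
  | smul c x hx => rw [map_smul, map_smul]; exact Submodule.smul_mem _ c hx
  | mul i x hx =>
    rw [map_mul, toSkeinLin_mul, Hecke.mapLE_sigma, toSkeinLin_sigma]
    refine span_map_mem
      ((Skein.comp N K (rep p) (rep p) (rep p)).flip (Skein.of K (crossing N (i.castLE h) true)))
      ?_ hx
    rintro _ ⟨y, hy, hl, rfl⟩
    have hi : i.1 + 1 < m := by exact_mod_cast i.2
    rw [LinearMap.flip_apply, Skein.of_comp]
    exact Submodule.subset_span ⟨_, hy.append (CrossWord.single true hi), _, rfl⟩

lemma crossWord_mem_range {p : ℕ} {y : List Layer} (hy : CrossWord p y) :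
    ∃ x, toSkeinLin N K p x = Skein.of K ⟨y, hy.leads⟩ := by
  induction y using List.reverseRecOn with
  | nil => exact ⟨1, toSkeinLin_one N K p⟩
  | append_singleton y z ih =>
    have hy' : CrossWord p y := fun x hx => hy x (by simp [hx])
    obtain ⟨x, hx⟩ := ih hy'
    obtain ⟨i, e, rfl, hi⟩ := hy z (by simp)
    let j : BraidGen p := ⟨i, by exact_mod_cast hi⟩
    have hj : ∃ x', toSkeinLin N K p x' = Skein.of K (crossing N j e) := by
      cases e with
      | true => exact ⟨_, toSkeinLin_sigma j⟩
      | false => exact ⟨_, toSkeinLin_braid_inv j⟩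
    obtain ⟨x', hx'⟩ := hj
    exact ⟨x' * x, by rw [toSkeinLin_mul, hx, hx', Skein.of_comp]; rfl⟩

/-- A linear condition on braids of `q + 2` strands has to be checked only for the braids in which
the last strand crosses the others at most once. -/
lemma braid_mem_of_last {M : Type*} [AddCommGroup M] [Module ℂ M] {q : ℕ} (T : Submodule ℂ M)
    (L : Skein N K (rep (q + 2)) (rep (q + 2)) →ₗ[ℂ] M)
    (h1 : ∀ y h, CrossWord (q + 1) y → L (Skein.of K ⟨y, h⟩) ∈ T)
    (h2 : ∀ y y' h, CrossWord (q + 1) y → CrossWord (q + 1) y' →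
      L (Skein.of K ⟨y ++ [(q, .cross true)] ++ y', h⟩) ∈ T)
    {y : List Layer} (hy : CrossWord (q + 2) y) : L (Skein.of K ⟨y, hy.leads⟩) ∈ T := by
  have hall : ∀ x : Hecke N K (q + 2 : ℕ), L (toSkeinLin N K (q + 2) x) ∈ T := by
    intro x
    have hx : x ∈ (⊤ : Submodule ℂ (Hecke N K (q + 2 : ℕ))) := trivial
    rw [← Hecke.span_last N K q] at hx
    refine span_map_mem (L ∘ₗ toSkeinLin N K (q + 2)) ?_ hx
    rintro x (⟨a, rfl⟩ | ⟨a, a', rfl⟩)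
    · refine span_map_mem L ?_ (toSkein_mapLE_mem _ a)
      rintro _ ⟨y, hy, h, rfl⟩
      exact h1 y h hy
    · have m1 := toSkein_mapLE_mem (Nat.le_succ _) a
      have m2 := toSkein_mapLE_mem (Nat.le_succ _) a'
      rw [LinearMap.comp_apply, toSkeinLin_mul, toSkeinLin_mul, toSkeinLin_sigma]
      refine span_map_mem (L ∘ₗ (Skein.comp N K _ _ _).flip _) ?_ m2
      rintro _ ⟨y', hy', h', rfl⟩
      refine span_map_mem (L ∘ₗ (Skein.comp N K _ _ _) _ ∘ₗ (Skein.comp N K _ _ _)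
        (Skein.of K (crossing N (BraidGen.last q) true))) ?_ m1
      rintro _ ⟨y, hy, h, rfl⟩
      simp only [LinearMap.comp_apply, Skein.of_comp]
      have h3 := h2 y' y (by
        exact (h'.append (leads_cross_rep true (by omega))).append h) hy' hy
      simp only [List.append_assoc] at h3
      exact h3
  obtain ⟨x, hx⟩ := crossWord_mem_range (N := N) (K := K) hy
  exact hx ▸ hall x

lemma Sim.curlRight {a : List Bool} (k : ℕ) (p : Bool)
    (hw : Leads N [(k + 1, .cup true), (k, .cross p), (k + 1, .cap true)] a a) :
    Sim N K a [(k + 1, .cup true), (k, .cross p), (k + 1, .cap true)] [] :=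
  ⟨a, hw, rfl, _, Complex.exp_ne_zero _, Skein.of_curlRight k p ⟨_, hw⟩ ⟨[], rfl⟩ rfl rfl⟩

lemma Mem.circle {a b c : List Bool} {S : Submodule ℂ (Skein N K a b)} {u t : List Layer}
    (k : ℕ) (s : Bool) (hu : Leads N u a c)
    (hc : Leads N [(k, .cup s), (k, .cap s)] c c) (h : Mem S (u ++ t)) :
    Mem S (u ++ [(k, .cup s), (k, .cap s)] ++ t) := by
  obtain ⟨hl, hm⟩ := h
  obtain ⟨c', hu', ht⟩ := leads_append_iff.1 hl
  obtain rfl := hu.unique hu'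
  refine ⟨(hu.append hc).append ht, ?_⟩
  have := congrArg (fun x => Skein.comp N K a c b (Skein.comp N K a c c (Skein.of K ⟨u, hu⟩) x)
    (Skein.of K ⟨t, ht⟩)) (Skein.of_circle (K := K) k s ⟨_, hc⟩ ⟨[], rfl⟩ rfl rfl)
  simp only [map_smul, LinearMap.smul_apply, Skein.of_comp] at this
  refine this ▸ S.smul_mem _ ?_
  simpa [Diagram.comp] using hm

lemma cups_rep_succ (n m : ℕ) : cups n (rep (m + 1)) = cups n (rep m) ++ [(n + m, .cup true)] := by
  rw [rep_succ', cups_append]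
  simp [cups]

/-- A diagram with a word of crossings in the middle, as a linear function of the latter. -/
def sandwich (N K : ℕ) {a b c r : List Bool} (U : Diagram N a (c ++ r)) (V : Diagram N (c ++ r) b) :
    Skein N K c c →ₗ[ℂ] Skein N K a b :=
  (Skein.comp N K a (c ++ r) b).flip (Skein.of K V) ∘ₗ
    Skein.comp N K a (c ++ r) (c ++ r) (Skein.of K U) ∘ₗ Skein.whisker N K c c r

lemma sandwich_of {a b c r : List Bool} (U : Diagram N a (c ++ r)) (V : Diagram N (c ++ r) b)
    (f : Diagram N c c) :
    sandwich N K U V (Skein.of K f) = Skein.of K ((U.comp (f.whisker r)).comp V) := by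
  simp only [sandwich, LinearMap.comp_apply, LinearMap.flip_apply, Skein.whisker_of,
    Skein.of_comp]

lemma cap_mem {n : ℕ} {b : List Bool} (hb : ups b = n + downs b) {y : List Layer}
    (hy : CrossWord (ups b + 1) y) : Mem (normalSpan N K n b)
      (cups n (rep (downs b + 1)) ++ y ++ [(ups b, .cap true)] ++ unsort b) := by
  have hcups : Leads N (cups n (rep (downs b))) (rep n) (srt (ups b) (downs b)) := by
    rw [hb]; exact leads_cups_rep' n _
  have hcup := leads_cup_srt (N := N) (ups b) (downs b)
  have hcap := leads_cap_srt (N := N) (ups b) (downs b)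
  have hun := leads_unsort (N := N) b
  rw [cups_rep_succ, ← hb]
  -- a braid of the other strands
  have key1 : ∀ y, CrossWord (ups b) y → Mem (normalSpan N K n b)
      (cups n (rep (downs b)) ++ [(ups b, .cup true)] ++ y ++ [(ups b, .cap true)] ++
        unsort b) := by
    intro y hy
    have h0 : Leads N [(0, .cup true)] [] [true, false] := leads_of_runWord rfl
    have h1 := hy.comm (K := K) h0 (repF (downs b))
    have h2 := Sim.ctx' (t := [(ups b, .cap true)] ++ unsort b) (c := b) hcups
      (by simpa using h1.symm) (b := srt (ups b + 1) (downs b + 1))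
      (hcup.append ((hy.mono (Nat.le_succ _)).leads' _)) (hcap.append hun)
    have h3 := Mem.circle (K := K) (ups b) true (hcups.append (hy.leads' _)) (hcup.append hcap)
      (mem_normalSpan (K := K) hb hy)
    refine Mem.of_sim ?_ h3
    simpa using h2
  have key2 : ∀ q, ups b = q + 1 → ∀ y1 y2, CrossWord (ups b) y1 → CrossWord (ups b) y2 →
      Mem (normalSpan N K n b) (cups n (rep (downs b)) ++ [(ups b, .cup true)] ++
        (y1 ++ [(q, .cross true)] ++ y2) ++ [(ups b, .cap true)] ++ unsort b) := by
    intro q hq y1 y2 hy1 hy2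
    have hX : Leads N [(q, .cross true)] (srt (ups b + 1) (downs b + 1))
      (srt (ups b + 1) (downs b + 1)) := leads_cross_srt _ _ (by omega)
    have l2 : Leads N y2 (srt (ups b + 1) (downs b + 1)) (srt (ups b + 1) (downs b + 1)) :=
      (hy2.mono (Nat.le_succ _)).leads' _
    have l1 : Leads N y1 (srt (ups b + 1) (downs b + 1)) (srt (ups b + 1) (downs b + 1)) :=
      (hy1.mono (Nat.le_succ _)).leads' _
    have h0 : Leads N [(0, .cup true)] [] [true, false] := leads_of_runWord rfl
    have h1 := hy1.comm (K := K) h0 (repF (downs b))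
    have h2 := Sim.ctx' (t := [(q, .cross true)] ++ y2 ++ [(ups b, .cap true)] ++ unsort b)
      (c := b) hcups (by simpa using h1.symm) (b := srt (ups b + 1) (downs b + 1))
      (hcup.append l1) (((hX.append l2).append hcap).append hun)
    have h0' : Leads N [(0, .cap true)] [true, false] [] := leads_of_runWord rfl
    have h3 := hy2.comm (K := K) h0' (repF (downs b))
    have e : rep (ups b) ++ [true, false] ++ repF (downs b) =
        srt (ups b + 1) (downs b + 1) := by
      simp only [srt]; rw [rep_succ']; simp [List.replicate_succ]
    rw [e] at h3
    have h4 := Sim.ctx' (u := cups n (rep (downs b)) ++ y1 ++ [(ups b, .cup true)] ++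
        [(q, .cross true)]) (t := unsort b) (c := b)
      (((hcups.append (hy1.leads' _)).append hcup).append hX)
      (by simpa using h3) (b := srt (ups b) (downs b)) (l2.append hcap) hun
    have hcurl : Leads N [(q + 1, .cup true), (q, .cross true), (q + 1, .cap true)]
        (srt (ups b) (downs b)) (srt (ups b) (downs b)) := by
      rw [← hq]; exact (hcup.append hX).append hcap
    have h5 := Sim.ctx' (t := y2 ++ unsort b) (c := b) (hcups.append (hy1.leads' _))
      (Sim.curlRight (K := K) q true hcurl) hcurl ((hy2.leads' _).append hun)
    rw [← hq] at h5
    simp only [List.append_assoc, List.cons_append, List.nil_append] at h2 h4 h5 ⊢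
    refine Mem.of_sim ((h2.trans h4).trans h5) ?_
    simpa using mem_normalSpan (K := K) hb (hy1.append hy2)
  rcases Nat.eq_zero_or_pos (ups b) with h0 | h0
  · have : y = [] := by
      refine List.eq_nil_iff_forall_not_mem.2 fun x hx => ?_
      obtain ⟨i, e, -, hi⟩ := hy x hx
      omega
    subst this
    exact key1 [] (CrossWord.nil _)
  · obtain ⟨q, hq⟩ : ∃ q, ups b = q + 1 := ⟨ups b - 1, by omega⟩
    have key2' := key2 q hq
    let U : Diagram N (rep n) (rep (ups b + 1) ++ repF (downs b + 1)) :=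
      ⟨cups n (rep (downs b)) ++ [(ups b, .cup true)], hcups.append hcup⟩
    let V : Diagram N (rep (ups b + 1) ++ repF (downs b + 1)) b :=
      ⟨[(ups b, .cap true)] ++ unsort b, hcap.append hun⟩
    have hs : ∀ y (h : Leads N y (rep (ups b + 1)) (rep (ups b + 1))),
        Mem (normalSpan N K n b) (cups n (rep (downs b)) ++ [(ups b, .cup true)] ++ y ++
          [(ups b, .cap true)] ++ unsort b) ↔
        sandwich N K U V (Skein.of K ⟨y, h⟩) ∈ normalSpan N K n b := by
      intro y h
      rw [sandwich_of]
      have hl : ((U.comp (Diagram.whisker ⟨y, h⟩ _)).comp V).1 = cups n (rep (downs b)) ++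
          [(ups b, .cup true)] ++ y ++ [(ups b, .cap true)] ++ unsort b := by
        simp [U, V, Diagram.comp, Diagram.whisker]
      rw [← hl]
      exact ⟨fun h => h.2, fun h => ⟨_, h⟩⟩
    rw [hs y hy.leads]
    revert hs
    generalize sandwich N K U V = L
    clear_value U V
    clear key2
    intro hs
    have k1 : ∀ y h, CrossWord (ups b) y → L (Skein.of K ⟨y, h⟩) ∈ normalSpan N K n b :=
      fun y h hy => (hs y h).1 (key1 y hy)
    have k2 : ∀ y y' h, CrossWord (ups b) y → CrossWord (ups b) y' →
        L (Skein.of K ⟨y ++ [(q, .cross true)] ++ y', h⟩) ∈ normalSpan N K n b :=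
      fun y y' h hy hy' => (hs _ h).1 (key2' y y' hy hy')
    clear key1 key2' hs U V hcups hcup hcap hun
    revert k1 k2 L y
    generalize normalSpan N K n b = T
    rw [hq]
    intro y hy L k1 k2
    exact braid_mem_of_last T L k1 k2 hy

/-- A word of layers without coupons. -/
def CouponFree (w : List Layer) : Prop := ∀ x ∈ w, x.2 ≠ .couponIn ∧ x.2 ≠ .couponOut

lemma normalSpan_layer {n : ℕ} {b b' : List Bool} {x : Layer} (hx : Layer.Leads N x b b')
    (hc : x.2 ≠ .couponIn ∧ x.2 ≠ .couponOut) (hb : ups b = n + downs b) {y : List Layer}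
    (hy : CrossWord (ups b) y) :
    Mem (normalSpan N K n b') (cups n (rep (downs b)) ++ y ++ unsort b ++ [x]) := by
  obtain ⟨k, g⟩ := x
  obtain ⟨l, r, rfl, hb₁, hb₂⟩ := hx
  have hcups : ∀ m, Leads N (cups n (rep m)) (rep n) (srt (n + m) m) := fun m =>
    leads_cups_rep' n m
  cases g with
  | couponIn => exact absurd rfl hc.1
  | couponOut => exact absurd rfl hc.2
  | cross e =>
    simp only [Piece.bot, Piece.top, List.append_assoc, List.cons_append, List.nil_append] at *
    subst hb₁ hb₂
    have hi : ups l + 1 < ups (l ++ true :: true :: r) := by simp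
    have h1 := (unsort_cross (N := N) (K := K) l r e).append_left
      (u := cups n (rep (downs (l ++ true :: true :: r))) ++ y) (a' := rep n)
      ((hb ▸ hcups _ : Leads N _ _ (srt (ups _) _)).append (hy.leads' _))
    have := mem_normalSpan (N := N) (K := K) hb (hy.append (CrossWord.single e hi))
    simp only [List.append_assoc] at h1 this ⊢
    exact Mem.of_sim h1 this
  | cup s =>
    simp only [Piece.bot, Piece.top, List.append_assoc, List.cons_append, List.nil_append] at *
    subst hb₁ hb₂
    obtain ⟨A, hA, h⟩ := unsort_cup (N := N) (K := K) l r s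
    have hu := ups_insert l r s
    have hd := downs_insert l r s
    have hun := leads_unsort (N := N) (l ++ s :: (!s) :: r)
    set b := l ++ r with hbdef
    set b' := l ++ s :: (!s) :: r with hb'def
    have hcb : Leads N (cups n (rep (downs b))) (rep n) (srt (ups b) (downs b)) := hb ▸ hcups _
    have h1 := h.append_left (hcb.append (hy.leads' _))
    have h0 : Leads N [(0, .cup true)] [] [true, false] := leads_of_runWord rfl
    have h2 := hy.comm (K := K) h0 (repF (downs b))
    have hcup := leads_cup_srt (N := N) (ups b) (downs b)
    rw [hu, hd] at hun
    have h3 := Sim.ctx' (t := A ++ unsort b') (c := b') hcb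
      (by simpa using h2) (b := srt (ups b + 1) (downs b + 1))
      ((hy.leads' _).append hcup) (hA.leads.append hun)
    have hb1 : ups b + 1 = n + (downs b + 1) := by omega
    have hy1 : CrossWord (n + (downs b + 1)) y := hy.mono (by omega)
    rw [hb1] at hA
    obtain ⟨y', hy', h4⟩ := absorb (N := N) (K := K) hA hy1
    have h5 := h4.append_right (t := unsort b') (c := b')
      ((((hcups _).append (hy1.leads' _)).append hA.leads).append (hb1 ▸ hun))
    rw [cups_rep_succ, ← hb] at h5
    have hm := mem_normalSpan (N := N) (K := K) (n := n) (b := b') (by omega) (y := y')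
      (by rw [hu, hb1]; exact hy')
    rw [hd, cups_rep_succ, ← hb] at hm
    simp only [List.append_assoc, List.cons_append, List.nil_append] at h1 h3 h5 hm ⊢
    exact Mem.of_sim ((h1.trans h3).trans h5) hm
  | cap s =>
    simp only [Piece.bot, Piece.top, List.append_assoc, List.cons_append, List.nil_append] at *
    subst hb₁ hb₂
    obtain ⟨A, hA, h⟩ := unsort_cap (N := N) (K := K) l r s
    have hu := ups_insert l r s
    have hd := downs_insert l r s
    set b := l ++ r with hbdef
    set b' := l ++ s :: (!s) :: r with hb'def
    rw [hu, hd] at hb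
    rw [hu] at hy
    rw [hd]
    have hcb : Leads N (cups n (rep (downs b + 1))) (rep n) (srt (ups b + 1) (downs b + 1)) :=
      hb ▸ hcups _
    have h1 := h.append_left (hcb.append (hy.leads' _))
    have hlc := (leads_cap_srt (N := N) (ups b) (downs b)).append (leads_unsort (N := N) b)
    rw [hb] at hA hy hcb hlc
    obtain ⟨y', hy', h4⟩ := absorb (N := N) (K := K) hA hy
    have h5 := h4.append_right (t := [(ups b, .cap true)] ++ unsort b) (c := b)
      (((hcb.append (hy.leads' _)).append hA.leads).append hlc)
    have hm := cap_mem (N := N) (K := K) (n := n) (b := b) (by omega) (y := y')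
      (by rw [hb]; exact hy')
    simp only [List.append_assoc, List.cons_append, List.nil_append] at h1 h5 hm ⊢
    exact Mem.of_sim (h1.trans h5) hm

lemma unsort_rep (k : ℕ) : unsort (rep k) = [] := by
  induction k with
  | zero => rfl
  | succ k ih => rw [rep, List.replicate_succ, unsort, ih]; rfl

lemma ups_rep (k : ℕ) : ups (rep k) = k := by simp

lemma downs_rep (k : ℕ) : downs (rep k) = 0 := by simp [List.count_replicate]

lemma couponFree_mem {n : ℕ} {b : List Bool} {w : List Layer} (hc : CouponFree w)
    (hw : Leads N w (rep n) b) : Skein.of K ⟨w, hw⟩ ∈ normalSpan N K n b := by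
  induction w using List.reverseRecOn generalizing b with
  | nil =>
    cases hw
    obtain ⟨h, hm⟩ := mem_normalSpan (N := N) (K := K) (n := n) (b := rep n)
      (by rw [ups_rep, downs_rep, add_zero])
      (CrossWord.nil _)
    simpa [unsort_rep, downs_rep, cups] using hm
  | append_singleton w x ih =>
    obtain ⟨c, h1, h2⟩ := leads_append_iff.1 hw
    have h3 := ih (fun x hx => hc x (by simp [hx])) h1
    have := span_map_mem (T := normalSpan N K n b)
      ((Skein.comp N K (rep n) c b).flip (Skein.of K ⟨[x], h2⟩)) ?_ h3
    · rw [LinearMap.flip_apply, Skein.of_comp] at this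
      exact this
    · rintro _ ⟨y, hb, hy, rfl⟩
      rw [LinearMap.flip_apply, Skein.of_comp]
      exact (normalSpan_layer (leads_singleton_iff.1 h2) (hc x (by simp)) hb hy).2

lemma couponFree_mem_range {n : ℕ} {w : List Layer} (hc : CouponFree w)
    (hw : Leads N w (rep n) (rep n)) :
    Skein.of K ⟨w, hw⟩ ∈ LinearMap.range (toSkeinLin N K n) := by
  refine (Submodule.span_le.2 ?_) (couponFree_mem (K := K) hc hw)
  rintro _ ⟨y, hb, hy, rfl⟩
  have hy' : CrossWord n y := by rwa [ups_rep] at hy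
  obtain ⟨x, hx⟩ := crossWord_mem_range (N := N) (K := K) hy'
  refine ⟨x, hx.trans ?_⟩
  simp [unsort_rep, downs_rep, cups]

end

section

/-! ### Inversions and reduced words -/

section Inversions

variable {N : ℕ}

/-- The number of inversions of a word. -/
def inversions : List (Fin N) → ℕ
  | [] => 0
  | a :: w => w.countP (· < a) + inversions w

lemma inversions_swap (p r : List (Fin N)) {a b : Fin N} (h : a < b) :
    inversions (p ++ b :: a :: r) = inversions (p ++ a :: b :: r) + 1 := by
  induction p with
  | nil =>
    have h' : ¬ b < a := h.not_gt
    simp only [List.nil_append, inversions, List.countP_cons, h, h', decide_true, decide_false,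
      if_true, Bool.false_eq_true, if_false]
    omega
  | cons c p ih =>
    simp only [List.cons_append, inversions, ih]
    rw [((List.Perm.swap a b r).append_left p).countP_eq]
    omega

lemma inversions_eq_zero {w : List (Fin N)} (h : w.Pairwise (· < ·)) : inversions w = 0 := by
  induction h with
  | nil => rfl
  | cons h _ ih =>
    rw [inversions, ih, add_zero, List.countP_eq_zero]
    intro b hb
    simpa using (h b hb).le

lemma exists_descent {w : List (Fin N)} (h : ¬ w.Pairwise (· < ·)) :
    ∃ p a b r, w = p ++ a :: b :: r ∧ ¬ a < b := by
  rw [← List.isChain_iff_pairwise, List.isChain_iff_forall_rel_of_append_cons_cons] at h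
  push Not at h
  obtain ⟨a, b, p, r, e, h⟩ := h
  exact ⟨p, a, b, r, e, not_lt.2 h⟩

lemma eq_finRange {w : List (Fin N)} (h : w.Pairwise (· < ·)) (hl : w.length = N) :
    w = List.finRange N := by
  have hn : w.Nodup := h.imp fun h => h.ne
  refine List.Perm.eq_of_pairwise' (r := (· ≤ ·)) (h.imp fun h => h.le)
    ((List.pairwise_lt_finRange N).imp fun h => h.le) ?_
  refine (List.perm_ext_iff_of_nodup hn (List.nodup_finRange N)).2 fun a => ?_
  have : w.toFinset = Finset.univ :=
    Finset.eq_univ_of_card _ (by rw [List.toFinset_card_of_nodup hn, hl, Fintype.card_fin])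
  simp [← List.mem_toFinset, this]

/-- The antisymmetric function of words with value `1` on the increasing word. -/
def antiSign (x : ℂ) (w : List (Fin N)) : ℂ := if w.Nodup then x ^ inversions w else 0

lemma antiSign_swap (x : ℂ) (p r : List (Fin N)) {a b : Fin N} (h : a < b) :
    antiSign x (p ++ b :: a :: r) = x * antiSign x (p ++ a :: b :: r) := by
  have hp := ((List.Perm.swap a b r).append_left p).nodup_iff
  by_cases hn : (p ++ a :: b :: r).Nodup
  · rw [antiSign, antiSign, if_pos hn, if_pos (hp.2 hn), inversions_swap p r h, pow_succ']
  · rw [antiSign, antiSign, if_neg hn, if_neg fun h' => hn (hp.1 h'), mul_zero]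

lemma antiSign_repeat (x : ℂ) (p r : List (Fin N)) (a : Fin N) :
    antiSign x (p ++ a :: a :: r) = 0 := by
  unfold antiSign
  rw [if_neg]
  simp [List.nodup_append]

lemma antiSign_finRange (x : ℂ) : antiSign x (List.finRange N) = 1 := by
  rw [antiSign, if_pos (List.nodup_finRange N), inversions_eq_zero (List.pairwise_lt_finRange N),
    pow_zero]

/-- Antisymmetric functions are multiples of the standard one. -/
lemma eq_antiSign_mul (x : ℂ) (G : List (Fin N) → ℂ)
    (hs : ∀ p r a b, (p ++ a :: b :: r).length = N → a < b →
      G (p ++ b :: a :: r) = x * G (p ++ a :: b :: r))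
    (hr : ∀ p r a, (p ++ a :: a :: r).length = N → G (p ++ a :: a :: r) = 0)
    {w : List (Fin N)} (hw : w.length = N) : G w = antiSign x w * G (List.finRange N) := by
  induction h : inversions w using Nat.strong_induction_on generalizing w with
  | _ n ih =>
    subst h
    by_cases hp : w.Pairwise (· < ·)
    · rw [eq_finRange hp hw, antiSign_finRange, one_mul]
    · obtain ⟨p, b, a, r, rfl, hab⟩ := exists_descent hp
      rcases eq_or_lt_of_le (not_lt.1 hab) with rfl | hlt
      · rw [hr p r a hw, antiSign_repeat, zero_mul]
      · have hw' : (p ++ a :: b :: r).length = N := by simpa using hw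
        rw [hs p r a b hw' hlt, antiSign_swap x p r hlt,
          ih _ (by rw [inversions_swap p r hlt]; omega) hw' rfl, mul_assoc]

lemma ofFn_swap (f : Fin N → Fin N) (i : {i : ℕ // i + 1 < N}) :
    ∃ p r, List.ofFn f = p ++ f ⟨i.1, Nat.lt_of_succ_lt i.2⟩ :: f ⟨i.1 + 1, i.2⟩ :: r ∧
      List.ofFn (f ∘ adjSwap N i) =
        p ++ f ⟨i.1 + 1, i.2⟩ :: f ⟨i.1, Nat.lt_of_succ_lt i.2⟩ :: r := by
  obtain ⟨i, hi⟩ := i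
  have key : ∀ g : Fin N → Fin N, List.ofFn g = (List.ofFn g).take i ++
      g ⟨i, Nat.lt_of_succ_lt hi⟩ :: g ⟨i + 1, hi⟩ :: (List.ofFn g).drop (i + 2) := by
    intro g
    conv_lhs => rw [← List.take_append_drop i (List.ofFn g)]
    rw [List.drop_eq_getElem_cons (by simp; omega), List.drop_eq_getElem_cons (by simp; omega)]
    simp
  refine ⟨(List.ofFn f).take i, (List.ofFn f).drop (i + 2), key f, ?_⟩
  rw [key (f ∘ adjSwap N ⟨i, hi⟩)]
  have h0 : adjSwap N ⟨i, hi⟩ ⟨i, Nat.lt_of_succ_lt hi⟩ = ⟨i + 1, hi⟩ := Equiv.swap_apply_left _ _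
  have h1 : adjSwap N ⟨i, hi⟩ ⟨i + 1, hi⟩ = ⟨i, Nat.lt_of_succ_lt hi⟩ := Equiv.swap_apply_right _ _
  have h2 : ∀ j : Fin N, j.1 ≠ i → j.1 ≠ i + 1 → adjSwap N ⟨i, hi⟩ j = j := fun j h h' =>
    Equiv.swap_apply_of_ne_of_ne (fun e => h (by rw [e])) (fun e => h' (by rw [e]))
  congr 1
  · refine List.ext_getElem (by simp) fun j hj hj' => ?_
    simp only [List.length_take, List.length_ofFn, lt_min_iff] at hj
    simp only [List.getElem_take, List.getElem_ofFn, Function.comp_apply]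
    rw [h2 _ (by simp; omega) (by simp; omega)]
  · simp only [Function.comp_apply, h0, h1]
    congr 2
    refine List.ext_getElem (by simp) fun j hj hj' => ?_
    simp only [List.getElem_drop, List.getElem_ofFn, Function.comp_apply]
    rw [h2 _ (by simp; omega) (by simp; omega)]

/-- The length of a permutation. -/
def ell (π : Equiv.Perm (Fin N)) : ℕ := inversions (List.ofFn π.symm)

/-- `i` is a left descent of `π`. -/
def Descent (π : Equiv.Perm (Fin N)) (i : {i : ℕ // i + 1 < N}) : Prop :=
  π.symm ⟨i.1 + 1, i.2⟩ < π.symm ⟨i.1, Nat.lt_of_succ_lt i.2⟩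

lemma adjSwap_mul_self (i : {i : ℕ // i + 1 < N}) : adjSwap N i * adjSwap N i = 1 :=
  Equiv.swap_mul_self _ _

lemma adjSwap_mul_cancel (i : {i : ℕ // i + 1 < N}) (π : Equiv.Perm (Fin N)) :
    adjSwap N i * (adjSwap N i * π) = π := by
  rw [← mul_assoc, adjSwap_mul_self, one_mul]

lemma adjSwap_apply_left (i : {i : ℕ // i + 1 < N}) :
    adjSwap N i ⟨i.1, Nat.lt_of_succ_lt i.2⟩ = ⟨i.1 + 1, i.2⟩ := Equiv.swap_apply_left _ _

lemma adjSwap_apply_right (i : {i : ℕ // i + 1 < N}) :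
    adjSwap N i ⟨i.1 + 1, i.2⟩ = ⟨i.1, Nat.lt_of_succ_lt i.2⟩ := Equiv.swap_apply_right _ _

lemma adjSwap_apply_of_ne (i : {i : ℕ // i + 1 < N}) {j : Fin N} (h : j.1 ≠ i.1)
    (h' : j.1 ≠ i.1 + 1) : adjSwap N i j = j :=
  Equiv.swap_apply_of_ne_of_ne (fun e => h (by rw [e])) (fun e => h' (by rw [e]))

lemma symm_adjSwap_mul (i : {i : ℕ // i + 1 < N}) (π : Equiv.Perm (Fin N)) (j : Fin N) :
    (adjSwap N i * π).symm j = π.symm (adjSwap N i j) := by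
  rw [Equiv.symm_apply_eq, Equiv.Perm.mul_apply, Equiv.apply_symm_apply]
  exact (Equiv.swap_apply_self _ _ _).symm

lemma not_descent_iff {π : Equiv.Perm (Fin N)} {i : {i : ℕ // i + 1 < N}} :
    ¬ Descent π i ↔ π.symm ⟨i.1, Nat.lt_of_succ_lt i.2⟩ < π.symm ⟨i.1 + 1, i.2⟩ := by
  unfold Descent
  rw [not_lt, le_iff_lt_or_eq, or_iff_left]
  intro e
  simpa using π.symm.injective e

lemma descent_adjSwap_mul {π : Equiv.Perm (Fin N)} {i : {i : ℕ // i + 1 < N}} :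
    Descent (adjSwap N i * π) i ↔ ¬ Descent π i := by
  rw [not_descent_iff, Descent, symm_adjSwap_mul, symm_adjSwap_mul, adjSwap_apply_left,
    adjSwap_apply_right]

lemma ell_adjSwap_mul {π : Equiv.Perm (Fin N)} {i : {i : ℕ // i + 1 < N}} (h : ¬ Descent π i) :
    ell (adjSwap N i * π) = ell π + 1 := by
  obtain ⟨p, r, e1, e2⟩ := ofFn_swap π.symm i
  have e3 : ⇑(adjSwap N i * π).symm = π.symm ∘ adjSwap N i := funext (symm_adjSwap_mul i π)
  rw [ell, ell, e3, e2, e1, inversions_swap _ _ (not_descent_iff.1 h)]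

lemma Descent.ell {π : Equiv.Perm (Fin N)} {i : {i : ℕ // i + 1 < N}} (h : Descent π i) :
    ell π = ell (adjSwap N i * π) + 1 := by
  rw [← ell_adjSwap_mul, adjSwap_mul_cancel]
  rwa [descent_adjSwap_mul, not_not]

lemma ell_one : ell (1 : Equiv.Perm (Fin N)) = 0 := by
  refine inversions_eq_zero ?_
  change (List.ofFn (id : Fin N → Fin N)).Pairwise (· < ·)
  rw [List.ofFn_id]
  exact List.pairwise_lt_finRange N

lemma eq_one_of_not_descent {π : Equiv.Perm (Fin N)} (h : ∀ i, ¬ Descent π i) : π = 1 := by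
  have hm : StrictMono π.symm := by
    cases N with
    | zero => exact fun a => a.elim0
    | succ n =>
      refine Fin.strictMono_iff_lt_succ.2 fun i => ?_
      exact not_descent_iff.1 (h ⟨i.1, by have := i.2; omega⟩)
  have : hm.orderIsoOfSurjective _ π.symm.surjective = OrderIso.refl _ := Subsingleton.elim _ _
  refine Equiv.symm_bijective.injective (Equiv.ext fun a => ?_)
  exact DFunLike.congr_fun this a

lemma exists_word_ell (π : Equiv.Perm (Fin N)) :
    ∃ u : List {i : ℕ // i + 1 < N}, (u.map (adjSwap N)).prod = π ∧ u.length = ell π := by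
  induction h : ell π generalizing π with
  | zero =>
    refine ⟨[], ?_, rfl⟩
    rw [eq_one_of_not_descent (π := π) fun i hi => ?_]
    · rfl
    · have := hi.ell
      omega
  | succ n ih =>
    have : ∃ i, Descent π i := by
      by_contra! hc
      rw [eq_one_of_not_descent hc, ell_one] at h
      omega
    obtain ⟨i, hi⟩ := this
    obtain ⟨u, hu, hl⟩ := ih (adjSwap N i * π) (by have := hi.ell; omega)
    exact ⟨i :: u, by rw [List.map_cons, List.prod_cons, hu, adjSwap_mul_cancel], by simp [hl]⟩

lemma ell_le (u : List {i : ℕ // i + 1 < N}) : ell (u.map (adjSwap N)).prod ≤ u.length := by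
  induction u with
  | nil => simp [ell_one]
  | cons i u ih =>
    rw [List.map_cons, List.prod_cons, List.length_cons]
    by_cases h : Descent (u.map (adjSwap N)).prod i
    · have := h.ell
      omega
    · rw [ell_adjSwap_mul h]
      omega

lemma IsReduced.length_eq {π : Equiv.Perm (Fin N)} {u : List {i : ℕ // i + 1 < N}}
    (h : IsReduced π u) : u.length = ell π := by
  obtain ⟨v, hv, hl⟩ := exists_word_ell π
  refine le_antisymm (hl ▸ h.2 v hv) ?_
  rw [← h.1]
  exact ell_le u

lemma isReduced_iff {π : Equiv.Perm (Fin N)} {u : List {i : ℕ // i + 1 < N}} :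
    IsReduced π u ↔ (u.map (adjSwap N)).prod = π ∧ u.length = ell π :=
  ⟨fun h => ⟨h.1, h.length_eq⟩, fun h => ⟨h.1, fun v hv => by rw [h.2, ← hv]; exact ell_le v⟩⟩

lemma IsReduced.cons {π : Equiv.Perm (Fin N)} {u : List {i : ℕ // i + 1 < N}}
    {i : {i : ℕ // i + 1 < N}} (hd : ¬ Descent π i) (h : IsReduced π u) :
    IsReduced (adjSwap N i * π) (i :: u) := by
  rw [isReduced_iff] at h ⊢
  rw [ell_adjSwap_mul hd, List.map_cons, List.prod_cons, h.1, List.length_cons, h.2]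
  exact ⟨rfl, rfl⟩

lemma IsReduced.of_descent {π : Equiv.Perm (Fin N)} {u : List {i : ℕ // i + 1 < N}}
    {i : {i : ℕ // i + 1 < N}} (hd : Descent π i) (h : IsReduced (adjSwap N i * π) u) :
    IsReduced π (i :: u) := by
  have := h.cons (i := i) (by rwa [descent_adjSwap_mul, not_not])
  rwa [adjSwap_mul_cancel] at this

lemma IsReduced.tail {π : Equiv.Perm (Fin N)} {u : List {i : ℕ // i + 1 < N}}
    {i : {i : ℕ // i + 1 < N}} (h : IsReduced π (i :: u)) :
    Descent π i ∧ IsReduced (adjSwap N i * π) u := by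
  rw [isReduced_iff] at h ⊢
  obtain ⟨h1, h2⟩ := h
  rw [List.map_cons, List.prod_cons] at h1
  have h3 : (u.map (adjSwap N)).prod = adjSwap N i * π := by rw [← h1, adjSwap_mul_cancel]
  have h4 := ell_le u
  rw [h3] at h4
  rw [List.length_cons] at h2
  have hd : Descent π i := by
    by_contra hd
    rw [ell_adjSwap_mul hd] at h4
    omega
  exact ⟨hd, h3, by have := hd.ell; omega⟩

lemma adjSwap_far {i j : {i : ℕ // i + 1 < N}} (h : i.1 + 2 ≤ j.1) :
    adjSwap N i * adjSwap N j = adjSwap N j * adjSwap N i := by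
  refine Equiv.Perm.Disjoint.commute ?_
  intro x
  by_cases h1 : x.1 = i.1 ∨ x.1 = i.1 + 1
  · right
    exact adjSwap_apply_of_ne j (by omega) (by omega)
  · left
    exact adjSwap_apply_of_ne i (by omega) (by omega)

lemma adjSwap_braid {i j : {i : ℕ // i + 1 < N}} (h : i.1 + 1 = j.1) :
    adjSwap N i * adjSwap N j * adjSwap N i = adjSwap N j * adjSwap N i * adjSwap N j := by
  obtain ⟨i, hi⟩ := i
  obtain ⟨j, hj⟩ := j
  obtain rfl : i + 1 = j := h
  unfold adjSwap
  have h1 := Equiv.swap_mul_swap_mul_swap (x := (⟨i + 1 + 1, hj⟩ : Fin N)) (y := ⟨i + 1, hi⟩)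
    (z := ⟨i, Nat.lt_of_succ_lt hi⟩) (by simp) (by simp; omega)
  have h2 := Equiv.swap_mul_swap_mul_swap (x := (⟨i, Nat.lt_of_succ_lt hi⟩ : Fin N))
    (y := ⟨i + 1, hi⟩) (z := ⟨i + 1 + 1, hj⟩) (by simp) (by simp; omega)
  rw [Equiv.swap_comm (⟨i + 1 + 1, hj⟩ : Fin N) ⟨i + 1, hi⟩,
    Equiv.swap_comm (⟨i + 1, hi⟩ : Fin N) ⟨i, _⟩] at h1
  exact h1.trans ((Equiv.swap_comm _ _).trans h2.symm)

lemma exists_isReduced (π : Equiv.Perm (Fin N)) : ∃ u, IsReduced π u := by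
  obtain ⟨u, hu⟩ := exists_word_ell π
  exact ⟨u, isReduced_iff.2 hu⟩

/-- Reduced words of the same permutation are related by braid moves. -/
lemma IsReduced.rel (R : List {i : ℕ // i + 1 < N} → List {i : ℕ // i + 1 < N} → Prop)
    (refl : ∀ u, R u u) (symm : ∀ u v, R u v → R v u) (trans : ∀ u v w, R u v → R v w → R u w)
    (cons : ∀ i u v, R u v → R (i :: u) (i :: v))
    (far : ∀ i j u, i.1 + 2 ≤ j.1 → R (i :: j :: u) (j :: i :: u))
    (braid : ∀ i j u, i.1 + 1 = j.1 → R (i :: j :: i :: u) (j :: i :: j :: u))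
    {π : Equiv.Perm (Fin N)} {u v : List {i : ℕ // i + 1 < N}} (hu : IsReduced π u)
    (hv : IsReduced π v) : R u v := by
  induction h : u.length using Nat.strong_induction_on generalizing π u v with
  | _ n ih =>
    subst h
    have hlen : u.length = v.length := hu.length_eq.trans hv.length_eq.symm
    rcases u with _ | ⟨i, u⟩
    · obtain rfl := List.length_eq_zero_iff.1 hlen.symm
      exact refl _
    rcases v with _ | ⟨j, v⟩
    · simp at hlen
    obtain ⟨di, hu'⟩ := hu.tail
    obtain ⟨dj, hv'⟩ := hv.tail
    have key : ∀ {i j : {i : ℕ // i + 1 < N}} {u' v' : List {i : ℕ // i + 1 < N}}, i.1 < j.1 →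
        u'.length = u.length → v'.length = u.length → Descent π i → Descent π j →
        IsReduced (adjSwap N i * π) u' → IsReduced (adjSwap N j * π) v' →
        R (i :: u') (j :: v') := by
      intro i j u' v' hij hlu hlv di dj hu' hv'
      rcases Nat.lt_or_ge (i.1 + 1) j.1 with hlt | hge
      · have d1 : Descent (adjSwap N i * π) j := by
          rw [Descent, symm_adjSwap_mul, symm_adjSwap_mul, adjSwap_apply_of_ne, adjSwap_apply_of_ne]
          · exact dj
          all_goals simp; omega
        have d2 : Descent (adjSwap N j * π) i := by
          rw [Descent, symm_adjSwap_mul, symm_adjSwap_mul, adjSwap_apply_of_ne, adjSwap_apply_of_ne]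
          · exact di
          all_goals simp; omega
        obtain ⟨t, ht⟩ := exists_isReduced (adjSwap N j * (adjSwap N i * π))
        have ht' := ht
        rw [← mul_assoc, ← adjSwap_far hlt, mul_assoc] at ht'
        have r1 := ih u'.length (by simp [hlu]) hu' (ht.of_descent d1) rfl
        have r2 := ih v'.length (by simp [hlv]) hv' (ht'.of_descent d2) rfl
        exact trans _ _ _ (cons i _ _ r1) (trans _ _ _ (far i j t hlt) (cons j _ _ (symm _ _ r2)))
      · have hj : i.1 + 1 = j.1 := by omega
        obtain ⟨i, hi⟩ := i
        obtain ⟨j, hj'⟩ := j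
        obtain rfl : i + 1 = j := hj
        have e0 : adjSwap N ⟨i, hi⟩ ⟨i, by omega⟩ = ⟨i + 1, by omega⟩ := adjSwap_apply_left _
        have e1 : adjSwap N ⟨i, hi⟩ ⟨i + 1, by omega⟩ = ⟨i, by omega⟩ := adjSwap_apply_right _
        have e2 : adjSwap N ⟨i, hi⟩ ⟨i + 1 + 1, by omega⟩ = ⟨i + 1 + 1, by omega⟩ :=
          adjSwap_apply_of_ne _ (by simp; omega) (by simp)
        have f0 : adjSwap N ⟨i + 1, hj'⟩ ⟨i, by omega⟩ = ⟨i, by omega⟩ :=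
          adjSwap_apply_of_ne _ (by simp) (by simp; omega)
        have f1 : adjSwap N ⟨i + 1, hj'⟩ ⟨i + 1, by omega⟩ = ⟨i + 1 + 1, by omega⟩ :=
          adjSwap_apply_left _
        have f2 : adjSwap N ⟨i + 1, hj'⟩ ⟨i + 1 + 1, by omega⟩ = ⟨i + 1, by omega⟩ :=
          adjSwap_apply_right _
        unfold Descent at di dj
        simp only at di dj
        have d1 : Descent (adjSwap N ⟨i, hi⟩ * π) ⟨i + 1, hj'⟩ := by
          simp only [Descent, symm_adjSwap_mul, e1, e2]
          exact dj.trans di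
        have d2 : Descent (adjSwap N ⟨i + 1, hj'⟩ * (adjSwap N ⟨i, hi⟩ * π)) ⟨i, hi⟩ := by
          simp only [Descent, symm_adjSwap_mul, e0, e2, f0, f1]
          exact dj
        have d3 : Descent (adjSwap N ⟨i + 1, hj'⟩ * π) ⟨i, hi⟩ := by
          simp only [Descent, symm_adjSwap_mul, f0, f1]
          exact dj.trans di
        have d4 : Descent (adjSwap N ⟨i, hi⟩ * (adjSwap N ⟨i + 1, hj'⟩ * π)) ⟨i + 1, hj'⟩ := by
          simp only [Descent, symm_adjSwap_mul, e1, e2, f0, f2]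
          exact di
        obtain ⟨t, ht⟩ := exists_isReduced
          (adjSwap N ⟨i, hi⟩ * (adjSwap N ⟨i + 1, hj'⟩ * (adjSwap N ⟨i, hi⟩ * π)))
        have ht' := ht
        rw [← mul_assoc, ← mul_assoc, adjSwap_braid rfl, mul_assoc, mul_assoc] at ht'
        have r1 := ih u'.length (by simp [hlu]) hu' ((ht.of_descent d2).of_descent d1) rfl
        have r2 := ih v'.length (by simp [hlv]) hv' ((ht'.of_descent d4).of_descent d3) rfl
        exact trans _ _ _ (cons _ _ _ r1) (trans _ _ _ (braid _ _ t rfl)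
          (cons _ _ _ (symm _ _ r2)))
    have hl' : v.length = u.length := by simpa using hlen.symm
    rcases lt_trichotomy i.1 j.1 with hij | hij | hij
    · exact key hij rfl hl' di dj hu' hv'
    · obtain rfl := Subtype.ext hij
      exact cons _ _ _ (ih u.length (by simp) hu' hv' rfl)
    · exact symm _ _ (key hij hl' rfl dj di hv' hu')

/-! ### The generating function of the length -/

lemma sum_pow_rank (x : ℂ) (S : Finset (Fin N)) :
    ∑ a ∈ S, x ^ (S.filter (· < a)).card = ∑ i ∈ Finset.range S.card, x ^ i := by
  induction S using Finset.induction_on_max with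
  | empty => simp
  | insert a S h ih =>
    have ha : a ∉ S := fun h' => lt_irrefl _ (h a h')
    rw [Finset.sum_insert ha, Finset.card_insert_of_notMem ha, Finset.sum_range_succ, ← ih,
      add_comm]
    congr 1
    · refine Finset.sum_congr rfl fun b hb => ?_
      rw [Finset.filter_insert, if_neg (h b hb).not_gt]
    · rw [Finset.filter_insert, if_neg (lt_irrefl a), Finset.filter_true_of_mem h]

/-- The words without repetitions of `n` letters from `S`. -/
def arrangements : ℕ → Finset (Fin N) → Finset (List (Fin N))
  | 0, _ => {[]}
  | n + 1, S => S.biUnion fun a => (arrangements n (S.erase a)).image (List.cons a)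

lemma mem_arrangements {n : ℕ} {S : Finset (Fin N)} {w : List (Fin N)} :
    w ∈ arrangements n S ↔ w.length = n ∧ w.Nodup ∧ ∀ a ∈ w, a ∈ S := by
  induction n generalizing S w with
  | zero =>
    simp only [arrangements, Finset.mem_singleton, List.length_eq_zero_iff]
    exact ⟨by rintro rfl; simp, fun h => h.1⟩
  | succ n ih =>
    simp only [arrangements, Finset.mem_biUnion, Finset.mem_image, ih]
    constructor
    · rintro ⟨a, ha, w, ⟨h1, h2, h3⟩, rfl⟩
      refine ⟨by simp [h1], List.nodup_cons.2 ⟨fun h => by simpa using h3 a h, h2⟩, ?_⟩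
      intro b hb
      rcases List.mem_cons.1 hb with rfl | hb
      · exact ha
      · exact Finset.mem_of_mem_erase (h3 b hb)
    · rintro ⟨h1, h2, h3⟩
      rcases w with _ | ⟨a, w⟩
      · simp at h1
      · rw [List.nodup_cons] at h2
        refine ⟨a, h3 a (by simp), w, ⟨by simpa using h1, h2.2, fun b hb => ?_⟩, rfl⟩
        exact Finset.mem_erase.2 ⟨fun e => h2.1 (e ▸ hb), h3 b (by simp [hb])⟩

lemma countP_arrangement {n : ℕ} {S : Finset (Fin N)} (hS : S.card = n) {w : List (Fin N)}
    (hw : w ∈ arrangements n S) (a : Fin N) :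
    w.countP (· < a) = (S.filter (· < a)).card := by
  obtain ⟨h1, h2, h3⟩ := mem_arrangements.1 hw
  have : w.toFinset = S := Finset.eq_of_subset_of_card_le (fun b hb => h3 b (by simpa using hb))
    (by rw [List.toFinset_card_of_nodup h2, h1, hS])
  rw [← this, List.countP_eq_length_filter, ← List.toFinset_card_of_nodup (h2.filter _),
    List.toFinset_filter]
  simp

lemma sum_pow_inversions (x : ℂ) (n : ℕ) (S : Finset (Fin N)) (hS : S.card = n) :
    ∑ w ∈ arrangements n S, x ^ inversions w =
      ∏ j ∈ Finset.range n, ∑ i ∈ Finset.range (j + 1), x ^ i := by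
  induction n generalizing S with
  | zero => simp [arrangements, inversions]
  | succ n ih =>
    rw [arrangements, Finset.sum_biUnion, Finset.prod_range_succ, ← hS, ← sum_pow_rank,
      Finset.mul_sum]
    · refine Finset.sum_congr rfl fun a ha => ?_
      have hc : (S.erase a).card = n := by rw [Finset.card_erase_of_mem ha, hS]; rfl
      rw [Finset.sum_image fun _ _ _ _ h => (List.cons.inj h).2, ← ih _ hc, Finset.sum_mul]
      refine Finset.sum_congr rfl fun w hw => ?_
      rw [inversions, countP_arrangement hc hw, Finset.filter_erase,
        Finset.erase_eq_of_notMem (by simp), pow_add, mul_comm]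
    · intro a _ b _ hab
      simp only [Function.onFun, Finset.disjoint_left, Finset.mem_image]
      rintro _ ⟨w, _, rfl⟩ ⟨w', _, e⟩
      exact hab (List.cons.inj e).1.symm

lemma sum_pow_ell (x : ℂ) : ∑ π : Equiv.Perm (Fin N), x ^ ell π =
    ∏ j ∈ Finset.range N, ∑ i ∈ Finset.range (j + 1), x ^ i := by
  rw [← sum_pow_inversions x N (Finset.univ : Finset (Fin N)) (by simp)]
  refine Finset.sum_bij (fun π _ => List.ofFn π.symm) (fun π _ => ?_) (fun π _ π' _ h => ?_)
    (fun w hw => ?_) (fun π _ => rfl)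
  · refine mem_arrangements.2 ⟨by simp, List.nodup_ofFn.2 π.symm.injective, by simp⟩
  · exact Equiv.symm_bijective.injective (DFunLike.coe_injective (List.ofFn_injective h))
  · obtain ⟨h1, h2, -⟩ := mem_arrangements.1 hw
    have hb : Function.Bijective fun i : Fin N => w.get (i.cast h1.symm) :=
      Finite.injective_iff_bijective.1
        ((List.nodup_iff_injective_get.1 h2).comp (Fin.cast_injective _))
    refine ⟨(Equiv.ofBijective _ hb).symm, Finset.mem_univ _, ?_⟩
    exact List.ext_getElem (by simp [h1]) (by simp)

end Inversions

end

section

variable {N K : ℕ}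

/-! ### Elimination of coupons -/

/-- The number of incoming coupons of a word. -/
def numIn (w : List Layer) : ℕ := w.countP fun x => x.2 matches .couponIn

/-- The number of outgoing coupons of a word. -/
def numOut (w : List Layer) : ℕ := w.countP fun x => x.2 matches .couponOut

lemma numIn_append (w v : List Layer) : numIn (w ++ v) = numIn w + numIn v :=
  List.countP_append

lemma numOut_append (w v : List Layer) : numOut (w ++ v) = numOut w + numOut v :=
  List.countP_append

lemma numIn_sh (k : ℕ) (w : List Layer) : numIn (sh k w) = numIn w := by
  simp [numIn, sh, List.countP_map, Function.comp_def]

lemma numOut_sh (k : ℕ) (w : List Layer) : numOut (sh k w) = numOut w := by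
  simp [numOut, sh, List.countP_map, Function.comp_def]

lemma CouponFree.numIn {w : List Layer} (h : CouponFree w) : numIn w = 0 := by
  refine List.countP_eq_zero.2 fun x hx => ?_
  have := (h x hx).1
  cases h' : x.2 <;> simp_all

lemma CouponFree.numOut {w : List Layer} (h : CouponFree w) : numOut w = 0 := by
  refine List.countP_eq_zero.2 fun x hx => ?_
  have := (h x hx).2
  cases h' : x.2 <;> simp_all

lemma couponFree_of_num {w : List Layer} (h : numIn w = 0) (h' : numOut w = 0) :
    CouponFree w := by
  intro x hx
  have h1 := List.countP_eq_zero.1 h x hx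
  have h2 := List.countP_eq_zero.1 h' x hx
  constructor
  · intro e; simp [e] at h1
  · intro e; simp [e] at h2

lemma exists_in {w : List Layer} (h : 0 < numIn w) :
    ∃ u k v, w = u ++ [(k, .couponIn)] ++ v := by
  obtain ⟨⟨k, g⟩, hx, hg⟩ := List.countP_pos_iff.1 h
  obtain ⟨u, v, rfl⟩ := List.append_of_mem hx
  cases g <;> simp at hg
  exact ⟨u, k, v, by simp⟩

lemma exists_out {w : List Layer} (h : 0 < numOut w) :
    ∃ u k v, w = u ++ [(k, .couponOut)] ++ v := by
  obtain ⟨⟨k, g⟩, hx, hg⟩ := List.countP_pos_iff.1 h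
  obtain ⟨u, v, rfl⟩ := List.append_of_mem hx
  cases g <;> simp at hg
  exact ⟨u, k, v, by simp⟩

lemma CouponFree.append {w v : List Layer} (h : CouponFree w) (h' : CouponFree v) :
    CouponFree (w ++ v) := by
  intro x hx
  rcases List.mem_append.1 hx with hx | hx
  exacts [h x hx, h' x hx]

lemma CouponFree.sh {w : List Layer} (h : CouponFree w) (k : ℕ) : CouponFree (sh k w) := by
  intro x hx
  obtain ⟨y, hy, rfl⟩ := List.mem_map.1 hx
  exact h y hy

lemma CouponFree.cups (k : ℕ) (a : List Bool) : CouponFree (cups k a) := by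
  induction a generalizing k with
  | nil => simp [SkeinSU.cups, CouponFree]
  | cons s a ih =>
    intro x hx
    rcases List.mem_cons.1 hx with rfl | hx
    · simp
    · exact ih _ x hx

lemma CouponFree.caps (k : ℕ) (a : List Bool) : CouponFree (caps k a) := by
  induction a generalizing k with
  | nil => simp [SkeinSU.caps, CouponFree]
  | cons s a ih =>
    refine (ih _).append ?_
    simp [CouponFree]

lemma CouponFree.pass (k m : ℕ) (p : Bool) : CouponFree (pass k m p) := by
  intro x hx
  obtain ⟨i, -, rfl⟩ := List.mem_map.1 hx
  simp

lemma CouponFree.single (k : ℕ) (g : Piece) (h : g ≠ .couponIn ∧ g ≠ .couponOut) :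
    CouponFree [(k, g)] := by
  intro x hx
  obtain rfl := List.mem_singleton.1 hx
  exact h

/-- The inverse of `pass`. -/
def unpass (k m : ℕ) (p : Bool) : List Layer := (pass k m (!p)).reverse

lemma CouponFree.unpass (k m : ℕ) (p : Bool) : CouponFree (unpass k m p) := by
  intro x hx
  exact CouponFree.pass k m (!p) x (List.mem_reverse.1 hx)

lemma sh_unpass (j k m : ℕ) (p : Bool) : sh j (unpass k m p) = unpass (j + k) m p := by
  rw [unpass, unpass, ← sh_pass, sh, sh, List.map_reverse]

lemma pass_succ (k m : ℕ) (p : Bool) : pass k (m + 1) p = pass k m p ++ [(k + m, .cross p)] := by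
  simp [pass, List.range_succ]

lemma unpass_succ (k m : ℕ) (p : Bool) :
    unpass k (m + 1) p = [(k + m, .cross !p)] ++ unpass k m p := by
  simp [unpass, pass_succ]

lemma crossWord_pass (m : ℕ) (p : Bool) : CrossWord (m + 1) (pass 0 m p) := by
  intro x hx
  obtain ⟨i, hi, rfl⟩ := List.mem_map.1 hx
  exact ⟨i, p, by simp, by simpa using hi⟩

lemma crossWord_unpass (m : ℕ) (p : Bool) : CrossWord (m + 1) (unpass 0 m p) := by
  intro x hx
  exact crossWord_pass m (!p) x (List.mem_reverse.1 hx)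

lemma sim_cross_cross' {k p : ℕ} (e : Bool) (h : k + 1 < p) :
    Sim N K (rep p) [(k, .cross e), (k, .cross !e)] [] :=
  Sim.of_move (.reidemeister2 k e) ((leads_cross_rep e h).append (leads_cross_rep (!e) h)) rfl

lemma unpass_pass (m : ℕ) (p : Bool) :
    Sim N K (rep (m + 1)) (unpass 0 m p ++ pass 0 m p) [] := by
  induction m with
  | zero => exact Sim.refl rfl
  | succ m ih =>
    have hl : Leads N [(m, .cross !p)] (rep (m + 1 + 1)) (rep (m + 1 + 1)) :=
      leads_cross_rep _ (by omega)
    have hl' : Leads N [(m, .cross p)] (rep (m + 1 + 1)) (rep (m + 1 + 1)) :=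
      leads_cross_rep _ (by omega)
    have h1 := ih.whisker [true]
    rw [← rep_succ'] at h1
    have h2 := Sim.ctx' hl h1 (((crossWord_unpass m p).append (crossWord_pass m p)).mono
      (Nat.le_succ _)).leads hl'
    have h3 := sim_cross_cross' (N := N) (K := K) (k := m) (p := m + 1 + 1) (!p) (by omega)
    rw [Bool.not_not] at h3
    rw [pass_succ, unpass_succ]
    simp only [List.append_assoc, zero_add, List.nil_append] at h2 h3 ⊢
    exact h2.trans h3

lemma pass_unpass (m : ℕ) (p : Bool) :
    Sim N K (rep (m + 1)) (pass 0 m p ++ unpass 0 m p) [] := by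
  induction m with
  | zero => exact Sim.refl rfl
  | succ m ih =>
    have h1 := ih.whisker [true]
    rw [← rep_succ'] at h1
    have h3 := sim_cross_cross' (N := N) (K := K) (k := m) (p := m + 1 + 1) p (by omega)
    have h2 := Sim.ctx' ((crossWord_pass m p).mono (Nat.le_succ _)).leads h3
      ((leads_cross_rep p (by omega)).append (leads_cross_rep (!p) (by omega)))
      ((crossWord_unpass m p).mono (Nat.le_succ _)).leads
    rw [pass_succ, unpass_succ]
    simp only [List.append_assoc, zero_add, List.nil_append] at h1 h2 ⊢
    exact h2.trans h1

lemma leads_in (l r : List Bool) :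
    Leads N [(l.length, .couponIn)] (l ++ rep N ++ r) (l ++ r) :=
  leads_singleton_iff.2 (by simpa [Piece.top, Piece.bot] using Layer.leads_mk N l r .couponIn)

lemma leads_out (l r : List Bool) :
    Leads N [(l.length, .couponOut)] (l ++ r) (l ++ rep N ++ r) :=
  leads_singleton_iff.2 (by simpa [Piece.top, Piece.bot] using Layer.leads_mk N l r .couponOut)

lemma leads_pass (l : List Bool) (p : Bool) (r : List Bool) (m : ℕ) :
    Leads N (pass l.length m p) (l ++ rep (m + 1) ++ r) (l ++ rep (m + 1) ++ r) :=
  Leads.at' (crossWord_pass m p).leads l r rfl rfl (by rw [sh_pass]; simp)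

lemma leads_unpass (l : List Bool) (p : Bool) (r : List Bool) (m : ℕ) :
    Leads N (unpass l.length m p) (l ++ rep (m + 1) ++ r) (l ++ rep (m + 1) ++ r) :=
  Leads.at' (crossWord_unpass m p).leads l r rfl rfl (by rw [sh_unpass]; simp)

lemma in_past_up : Sim N K (rep (N + 1)) [(1, .couponIn)] (pass 0 N true ++ [(0, .couponIn)]) := by
  refine (Sim.of_move (b := [true]) (.passIn 0 true) ?_ ?_).symm
  · refine (crossWord_pass N true).leads.append ?_
    simpa [rep_succ'] using leads_in (N := N) [] [true]
  · simpa [List.replicate_succ] using leads_in (N := N) [true] []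

lemma out_past_up : Sim N K [true] [(1, .couponOut)]
    ([(0, .couponOut)] ++ unpass 0 N true) := by
  have l1 : Leads N [(1, .couponOut)] [true] (rep (N + 1)) := by
    simpa [List.replicate_succ] using leads_out (N := N) [true] []
  have l0 : Leads N [(0, .couponOut)] [true] (rep (N + 1)) := by
    simpa [rep_succ'] using leads_out (N := N) [] [true]
  have lp := (crossWord_pass N true).leads (N := N)
  have h1 := Sim.of_move (K := K) (.passOut 0 true) (l1.append lp) l0
  have h2 := h1.append_right (t := unpass 0 N true) (c := rep (N + 1))
    ((l1.append lp).append (crossWord_unpass N true).leads)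
  have h3 := (pass_unpass (N := N) (K := K) N true).append_left l1
  simp only [List.append_assoc, zero_add, List.append_nil] at h2 h3 ⊢
  exact h3.symm.trans h2

lemma in_past_down : Sim N K (false :: rep N) [(1, .couponIn)]
    ([(N + 1, .cup true)] ++ unpass 1 N true ++ [(0, .cap false)] ++ [(0, .couponIn)]) := by
  have lcup : Leads N [(N + 1, .cup true)] (false :: rep N) ([false] ++ rep (N + 1) ++ [false]) := by
    have := leads_cup (N := N) (false :: rep N) [] true
    simpa [rep_succ'] using this
  have lun : Leads N (unpass 1 N true) ([false] ++ rep (N + 1) ++ [false])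
      ([false] ++ rep (N + 1) ++ [false]) := leads_unpass [false] true [false] N
  have lpa : Leads N (pass 1 N true) ([false] ++ rep (N + 1) ++ [false])
      ([false] ++ rep (N + 1) ++ [false]) := leads_pass [false] true [false] N
  have h1 : Sim N K ([false] ++ rep (N + 1) ++ [false]) ([(0, .cap false)] ++ [(0, .couponIn)])
      ([(2, .couponIn)] ++ [(0, .cap false)]) := by
    have := Sim.interchange (K := K) (w := [(0, .cap false)]) (a := [false, true]) (b := [])
      (leads_of_runWord rfl) (leads_in (N := N) [] [false])
    simpa [List.replicate_succ] using this
  have g1 := h1.append_left (lcup.append lun)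
  have h2 : Sim N K ([false] ++ rep (N + 1) ++ [false]) [(2, .couponIn)]
      (pass 1 N true ++ [(1, .couponIn)]) :=
    in_past_up.at' [false] [false] rfl rfl (by simp [sh_pass])
  have l1 : Leads N [(1, .couponIn)] ([false] ++ rep (N + 1) ++ [false])
      [false, true, false] := by
    have := leads_in (N := N) [false] [true, false]
    simpa [rep_succ'] using this
  have lcap : Leads N [(0, .cap false)] [false, true, false] [false] := leads_of_runWord rfl
  have g2 := Sim.ctx' (lcup.append lun) h2 (b := [false, true, false])
    (h2.symm.leads (lpa.append l1)) lcap
  have h3 : Sim N K ([false] ++ rep (N + 1) ++ [false]) (unpass 1 N true ++ pass 1 N true) [] :=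
    (unpass_pass N true).at' [false] [false] rfl (by simp [sh_unpass, sh_pass]) rfl
  have g3 := Sim.ctx' lcup h3 (lun.append lpa) (l1.append lcap)
  have h4 : Sim N K (false :: rep N) ([(N + 1, .cup true)] ++ [(1, .couponIn)])
      ([(1, .couponIn)] ++ [(1, .cup true)]) := by
    have := Sim.interchange (K := K) (leads_in (N := N) [false] []) (v := [(0, .cup true)])
      (c := []) (d := [true, false]) (leads_of_runWord rfl)
    simpa [List.replicate_succ, add_comm] using this.symm
  have l1' : Leads N [(1, .couponIn)] (false :: rep N) [false] := by
    simpa using leads_in (N := N) [false] []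
  have g4 := h4.append_right (t := [(0, .cap false)]) (c := [false])
    ((lcup.append l1).append lcap)
  have h5 : Sim N K [false] [(1, .cup true), (0, .cap false)] [] :=
    Sim.of_move (.zagzig 0 true) (leads_of_runWord rfl) rfl
  have g5 := h5.append_left l1'
  simp only [List.append_assoc, List.cons_append, List.nil_append] at g1 g2 g3 g4 g5 ⊢
  exact ((((g1.trans g2).trans g3).trans g4).trans g5).symm

lemma out_past_down : Sim N K [false] [(1, .couponOut)]
    ([(0, .couponOut)] ++ ([(0, .cup false)] ++ pass 1 N true ++ [(N + 1, .cap true)])) := by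
  have lcup : Leads N [(0, .cup false)] [false] [false, true, false] := leads_of_runWord rfl
  have lcap : Leads N [(N + 1, .cap true)] ([false] ++ rep (N + 1) ++ [false]) (false :: rep N) := by
    have := leads_cap (N := N) (false :: rep N) [] true
    simpa [rep_succ'] using this
  have lpa : Leads N (pass 1 N true) ([false] ++ rep (N + 1) ++ [false])
      ([false] ++ rep (N + 1) ++ [false]) := leads_pass [false] true [false] N
  have h1 : Sim N K [false] ([(0, .couponOut)] ++ [(0, .cup false)])
      ([(0, .cup false)] ++ [(2, .couponOut)]) := by
    have := Sim.interchange (K := K) (w := [(0, .cup false)]) (a := []) (b := [false, true])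
      (leads_of_runWord rfl) (leads_out (N := N) [] [false])
    simpa using this.symm
  have l2 : Leads N [(2, .couponOut)] [false, true, false] ([false] ++ rep (N + 1) ++ [false]) := by
    simpa [List.replicate_succ] using leads_out (N := N) [false, true] [false]
  have l1 : Leads N [(1, .couponOut)] [false, true, false] ([false] ++ rep (N + 1) ++ [false]) := by
    simpa [rep_succ'] using leads_out (N := N) [false] [true, false]
  have g1 := h1.append_right (t := pass 1 N true ++ [(N + 1, .cap true)]) (c := false :: rep N)
    (h1.symm.append_right (t := []) (c := [false] ++ rep (N + 1) ++ [false])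
      (by simpa using lcup.append l2) |>.leads (by simpa using lcup.append l2) |> fun h =>
        (by simpa using h.append (lpa.append lcap)))
  have h2 : Sim N K [false, true, false] ([(2, .couponOut)] ++ pass 1 N true)
      [(1, .couponOut)] := Sim.of_move (.passOut 1 true) (l2.append lpa) l1
  have g2 := Sim.ctx' lcup h2 (l2.append lpa) lcap
  have h3 : Sim N K [false, true, false] ([(1, .couponOut)] ++ [(N + 1, .cap true)])
      ([(1, .cap true)] ++ [(1, .couponOut)]) := by
    have := Sim.interchange (K := K) (leads_out (N := N) [false] []) (v := [(0, .cap true)])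
      (c := [true, false]) (d := []) (leads_of_runWord rfl)
    simpa [add_comm] using this
  have g3 := h3.append_left lcup
  have h4 : Sim N K [false] [(0, .cup false), (1, .cap true)] [] :=
    Sim.of_move (.zigzag 0 false) (leads_of_runWord rfl) rfl
  have g4 := h4.append_right (t := [(1, .couponOut)]) (c := false :: rep N)
    (Leads.append (b := [false]) (leads_of_runWord rfl) (by simpa using leads_out (N := N) [false] []))
  simp only [List.append_assoc, List.cons_append, List.nil_append] at g1 g2 g3 g4 ⊢
  exact (((g1.trans g2).trans g3).trans g4).symm

lemma in_to_left (l r : List Bool) : ∃ X, CouponFree X ∧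
    Sim N K (l ++ rep N ++ r) [(l.length, .couponIn)] (X ++ [(0, .couponIn)]) ∧
      Leads N X (l ++ rep N ++ r) (rep N ++ l ++ r) := by
  induction l with
  | nil => exact ⟨[], by simp [CouponFree], by simpa using Sim.refl (leads_in [] r), by simp [Leads]⟩
  | cons s l ih =>
    obtain ⟨X, hX, h, hl⟩ := ih
    have h1 := h.shift [s]
    have hl1 := hl.shift [s]
    obtain ⟨Y, hY, g, gl⟩ : ∃ Y, CouponFree Y ∧ Sim N K (s :: rep N) [(1, .couponIn)]
        (Y ++ [(0, .couponIn)]) ∧ Leads N Y (s :: rep N) (rep N ++ [s]) := by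
      cases s with
      | true =>
        refine ⟨_, .pass 0 N true, in_past_up, ?_⟩
        have := (crossWord_pass N true).leads (N := N)
        rwa [← rep_succ']
      | false =>
        refine ⟨_, ((CouponFree.single _ _ (by simp)).append (.unpass 1 N true)).append
          (.single _ _ (by simp)), in_past_down, ?_⟩
        refine Leads.append (b := [false, true] ++ rep N ++ [false]) (Leads.append
          (b := [false] ++ rep (N + 1) ++ [false]) ?_ ?_) ?_
        · have := leads_cup (N := N) (false :: rep N) [] true
          simpa [rep_succ'] using this
        · simpa [List.replicate_succ] using leads_unpass (N := N) [false] true [false] N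
        · simpa using leads_cap (N := N) [] (rep N ++ [false]) false
    refine ⟨sh 1 X ++ Y, (hX.sh _).append hY, ?_, ?_⟩
    · have g1 := (g.whisker (l ++ r)).append_left (u := sh 1 X) (a' := s :: (l ++ rep N ++ r))
        (by simpa using hl1)
      simp only [sh_append, sh_cons, sh_nil, List.length_cons, List.length_nil, zero_add,
        add_zero, add_comm 1 l.length, List.append_assoc, List.cons_append, List.nil_append]
        at h1 g1 ⊢
      exact h1.trans g1
    · refine Leads.append (b := s :: (rep N ++ l ++ r)) (by simpa using hl1) ?_
      simpa using gl.whisker (l ++ r)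

lemma out_to_left (l r : List Bool) : ∃ X, CouponFree X ∧
    Sim N K (l ++ r) [(l.length, .couponOut)] ([(0, .couponOut)] ++ X) := by
  induction l with
  | nil => exact ⟨[], by simp [CouponFree], by simpa using Sim.refl (leads_out [] r)⟩
  | cons s l ih =>
    obtain ⟨X, hX, h⟩ := ih
    have h1 := h.shift [s]
    obtain ⟨Y, hY, g⟩ : ∃ Y, CouponFree Y ∧ Sim N K [s] [(1, .couponOut)]
        ([(0, .couponOut)] ++ Y) := by
      cases s with
      | true => exact ⟨_, .unpass 0 N true, out_past_up⟩
      | false =>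
        exact ⟨_, ((CouponFree.single _ _ (by simp)).append (.pass 1 N true)).append
          (.single _ _ (by simp)), out_past_down⟩
    refine ⟨Y ++ sh 1 X, hY.append (hX.sh _), ?_⟩
    have hl := (h1.leads ((leads_out (N := N) l r).shift [s]))
    have g1 := (g.whisker (l ++ r)).append_right (t := sh 1 X) (c := [s] ++ (l ++ rep N ++ r))
      (by simpa using hl)
    simp only [sh_append, sh_cons, sh_nil, List.length_cons, List.length_nil, zero_add,
      add_zero, add_comm 1 l.length, List.append_assoc, List.cons_append, List.nil_append]
      at h1 g1 ⊢
    exact h1.trans g1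

lemma caps_append (k : ℕ) (a b : List Bool) :
    caps k (a ++ b) = caps (k + a.length) b ++ caps k a := by
  induction a generalizing k with
  | nil => simp [caps]
  | cons s a ih => simp [caps, ih, add_comm, add_left_comm]

lemma leads_caps_repF (k m : ℕ) (r : List Bool) :
    Leads N (caps k (repF m)) (rep k ++ repF m ++ rep m ++ r) (rep k ++ r) := by
  have := leads_caps N (repF m) (rep k) r
  rw [show dual (repF m) = rep m by simp [dual]] at this
  simpa using this

lemma cups_caps (m : ℕ) : Sim N K (rep m) (cups 0 (rep m) ++ caps m (repF m)) [] := by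
  induction m with
  | zero => exact Sim.refl rfl
  | succ m ih =>
    have e1 : cups 0 (rep (m + 1)) = [(0, .cup true)] ++ cups 1 (rep m) := rfl
    have e2 : caps (m + 1) (repF (m + 1)) = [(m + 1 + m, .cap false)] ++ caps (m + 1) (repF m) := by
      rw [repF, List.replicate_succ', caps_append]; simp [caps]
    have lc : Leads N (cups 0 (rep m)) [] (rep m ++ repF m) := by
      simpa using leads_cups_rep' (N := N) 0 m
    have h1 : Sim N K ([true, false] ++ rep (m + 1)) (cups 1 (rep m) ++ [(m + 1 + m, .cap false)])
        ([(1, .cap false)] ++ cups 1 (rep m)) := by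
      refine (Sim.interchange (K := K) lc (v := [(0, .cap false)]) (c := [false, true]) (d := [])
        (leads_of_runWord rfl)).at' [true] (rep m) (by simp [List.replicate_succ]) ?_ ?_
      · simp [sh_cups]; omega
      · simp [sh_cups]
    have l1 : Leads N [(0, .cup true)] (rep (m + 1)) ([true, false] ++ rep (m + 1)) := by
      simpa using leads_cup (N := N) [] (rep (m + 1)) true
    have lcap : Leads N (caps (m + 1) (repF m)) (rep (m + 1) ++ repF m ++ rep m) (rep (m + 1)) := by
      simpa using leads_caps_repF (N := N) (m + 1) m []
    have lcap1 : Leads N [(1, .cap false)] ([true, false] ++ rep (m + 1)) (rep (m + 1)) := by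
      simpa [List.replicate_succ] using leads_cap (N := N) [true] (rep m) false
    have lcups1 : Leads N (cups 1 (rep m)) (rep (m + 1)) (rep (m + 1) ++ repF m ++ rep m) := by
      have := Leads.at' lc [true] (rep m) (a' := rep (m + 1))
        (b' := rep (m + 1) ++ repF m ++ rep m) (by simp [List.replicate_succ])
        (by simp [List.replicate_succ]) rfl
      simpa [sh_cups] using this
    have g1 := Sim.ctx' l1 h1 (h1.symm.leads (lcap1.append lcups1)) lcap
    have h2 : Sim N K (rep (m + 1)) [(0, .cup true), (1, .cap false)] [] :=
      Sim.of_move (.zigzag 0 true) (l1.append lcap1) rfl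
    have g2 := h2.append_right (t := cups 1 (rep m) ++ caps (m + 1) (repF m)) (c := rep (m + 1))
      ((l1.append lcap1).append (lcups1.append lcap))
    have h3 : Sim N K (rep (m + 1)) (cups 1 (rep m) ++ caps (m + 1) (repF m)) [] := by
      refine ih.at' [true] [] (by simp [List.replicate_succ]) ?_ rfl
      simp [sh_cups, sh_caps, add_comm]
    rw [e1, e2]
    simp only [List.append_assoc, List.cons_append, List.nil_append] at g1 g2 h3 ⊢
    exact (g1.trans g2).trans h3

/-- An incoming coupon at the top can be moved below the rest of the diagram. -/
lemma bend_in {c d : List Bool} {w : List Layer} (hw : Leads N w c (rep N ++ d)) :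
    Sim N K c (w ++ [(0, .couponIn)])
      (cups 0 (rep N) ++ [(0, .couponIn)] ++ sh N w ++ caps 0 (repF N)) := by
  have lc : ∀ r, Leads N (cups 0 (rep N)) r (rep N ++ repF N ++ r) := fun r => by
    simpa using leads_cups_rep (N := N) 0 N r
  have lc0 : Leads N (cups 0 (rep N)) [] (rep N ++ repF N) := by simpa using lc []
  have lin : ∀ r, Leads N [(0, .couponIn)] (rep N ++ r) r := fun r => by
    simpa using leads_in (N := N) [] r
  have hsw : Leads N (sh N w) (repF N ++ c) (repF N ++ (rep N ++ d)) := by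
    simpa using hw.shift (repF N)
  have hcap : Leads N (caps 0 (repF N)) (repF N ++ rep N ++ d) d := by
    simpa using leads_caps_repF (N := N) 0 N d
  have hv : Leads N (sh N w ++ caps 0 (repF N)) (repF N ++ c) d :=
    hsw.append (by simpa using hcap)
  have h1 := (Sim.interchange (K := K) (lin []) (by simpa using hv)).append_left
    (u := cups 0 (rep N)) (a' := c) (by simpa using lc c)
  have h2 := Sim.interchange (K := K) lc0 hw
  have hca : Leads N (caps N (repF N)) (rep N ++ repF N ++ (rep N ++ d)) (rep N ++ d) := by
    simpa using leads_caps_repF (N := N) N N d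
  have g2 := h2.append_right (t := caps N (repF N) ++ [(0, .couponIn)]) (c := d)
    (h2.symm.leads (by simpa using hw.append (lc _)) |>.append (hca.append (lin d)))
  have h3 := ((cups_caps (N := N) (K := K) N).whisker d)
  have g3 := Sim.ctx' hw h3 ((lc _).append hca) (lin d)
  simp only [List.append_assoc, List.nil_append, List.length_nil, sh_zero, List.append_nil,
    sh_append, sh_sh, sh_caps, List.length_append, List.length_replicate, add_zero, zero_add] at h1 g2 g3 ⊢
  exact ((h1.trans g2).trans g3).symm

/-- The span of the diagrams without coupons. -/
def freeSpan (N K : ℕ) (a b : List Bool) : Submodule ℂ (Skein N K a b) :=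
  Submodule.span ℂ {x | ∃ (w : List Layer) (_ : CouponFree w) (h : Leads N w a b),
    x = Skein.of K ⟨w, h⟩}

lemma couponFree_positiveBraid (k : ℕ) (u : List {i : ℕ // i + 1 < N}) :
    CouponFree (positiveBraid k u) := by
  intro x hx
  obtain ⟨i, -, rfl⟩ := List.mem_map.1 hx
  simp

lemma leads_positiveBraid (u : List {i : ℕ // i + 1 < N}) (r : List Bool) :
    Leads N (positiveBraid 0 u) (rep N ++ r) (rep N ++ r) := by
  refine CrossWord.leads' (p := N) ?_ r
  intro x hx
  obtain ⟨i, -, rfl⟩ := List.mem_map.1 hx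
  exact ⟨i.1, true, by simp, i.2⟩

lemma Mem.in_out {a b c : List Bool} {S : Submodule ℂ (Skein N K a b)} {u t : List Layer}
    (hu : Leads N u a (rep N ++ c)) (ht : Leads N t (rep N ++ c) b)
    (h : ∀ v, CouponFree v → Leads N v (rep N ++ c) (rep N ++ c) → Mem S (u ++ v ++ t)) :
    Mem S (u ++ [(0, .couponIn), (0, .couponOut)] ++ t) := by
  choose r hr using fun π : Equiv.Perm (Fin N) => exists_isReduced π
  have hl : Leads N [(0, .couponIn), (0, .couponOut)] (rep N ++ c) (rep N ++ c) :=
    Leads.append (w := [(0, .couponIn)]) (v := [(0, .couponOut)]) (b := c)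
      (by simpa using leads_in (N := N) [] c) (by simpa using leads_out (N := N) [] c)
  refine ⟨(hu.append hl).append ht, ?_⟩
  have h1 := Skein.mk_localRel (K := K) (LocalRel.couponInOut (K := K) 0 r hr ⟨_, hl⟩
    (fun π => ⟨_, leads_positiveBraid (r π) c⟩) rfl fun _ => rfl)
  rw [map_sub, map_smul, map_sum, sub_eq_zero] at h1
  simp only [map_smul] at h1
  have h2 := congrArg (fun x => Skein.comp N K a _ b (Skein.comp N K a _ _ (Skein.of K ⟨u, hu⟩) x)
    (Skein.of K ⟨t, ht⟩)) h1
  have e : ∀ f : Diagram N (rep N ++ c) (rep N ++ c),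
      (relations N K (rep N ++ c) (rep N ++ c)).mkQ (diag f) = Skein.of K f := fun _ => rfl
  simp only [e, map_smul, map_sum, LinearMap.smul_apply, LinearMap.sum_apply, Skein.of_comp] at h2
  refine h2 ▸ S.smul_mem _ (Submodule.sum_mem _ fun π _ => S.smul_mem _ ?_)
  exact (h _ (couponFree_positiveBraid 0 (r π)) (leads_positiveBraid (r π) c)).2

lemma layer_in {k : ℕ} {a b : List Bool} (h : Leads N [(k, .couponIn)] a b) :
    ∃ l r, l.length = k ∧ a = l ++ rep N ++ r ∧ b = l ++ r := by
  obtain ⟨l, r, h1, h2, h3⟩ := leads_singleton_iff.1 h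
  exact ⟨l, r, h1, h2, by simpa [Piece.top] using h3⟩

lemma layer_out {k : ℕ} {a b : List Bool} (h : Leads N [(k, .couponOut)] a b) :
    ∃ l r, l.length = k ∧ a = l ++ r ∧ b = l ++ rep N ++ r := by
  obtain ⟨l, r, h1, h2, h3⟩ := leads_singleton_iff.1 h
  exact ⟨l, r, h1, by simpa [Piece.bot] using h2, h3⟩

lemma mem_freeSpan_in_out {m : ℕ}
    (ih : ∀ (a b : List Bool) (w : List Layer), Leads N w a b → numIn w = m → numOut w = m →
      Mem (freeSpan N K a b) w)
    {a b : List Bool} {w₁ w₂ w₃ : List Layer} {j k : ℕ}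
    (hw : Leads N (w₁ ++ [(k, .couponIn)] ++ w₂ ++ [(j, .couponOut)] ++ w₃) a b)
    (hi : numIn w₁ + numIn w₂ + numIn w₃ = m) (ho : numOut w₁ + numOut w₂ + numOut w₃ = m) :
    Mem (freeSpan N K a b) (w₁ ++ [(k, .couponIn)] ++ w₂ ++ [(j, .couponOut)] ++ w₃) := by
  obtain ⟨c4, h, l3⟩ := leads_append_iff.1 hw
  obtain ⟨c3, h, lo⟩ := leads_append_iff.1 h
  obtain ⟨c2, h, l2⟩ := leads_append_iff.1 h
  obtain ⟨c1, l1, li⟩ := leads_append_iff.1 h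
  obtain ⟨l, r, rfl, rfl, rfl⟩ := layer_in li
  obtain ⟨l', r', rfl, rfl, rfl⟩ := layer_out lo
  obtain ⟨X, hX, sX, lX⟩ := in_to_left (N := N) (K := K) l r
  obtain ⟨Y, hY, sY⟩ := out_to_left (N := N) (K := K) l' r'
  have lY := sY.leads lo
  have g1 := Sim.ctx' l1 sX li (l2.append (lo.append l3))
  have g2 := Sim.ctx' ((l1.append (sX.leads li)).append l2) sY lo l3
  have lin0 : ∀ r, Leads N [(0, .couponIn)] (rep N ++ r) r := fun r => by
    simpa using leads_in (N := N) [] r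
  have lout0 : ∀ r, Leads N [(0, .couponOut)] r (rep N ++ r) := fun r => by
    simpa using leads_out (N := N) [] r
  have g3 := Sim.interchange (K := K) (lin0 []) (v := w₂) (c := l ++ r) (by simpa using l2)
  obtain ⟨c5, lY1, lY2⟩ := leads_append_iff.1 lY
  obtain rfl := (lout0 _).unique lY1
  have g4 := Sim.ctx' (t := [(0, .couponOut)] ++ Y ++ w₃) (c := b) (b := l' ++ r') (l1.append lX)
    (by simpa using g3) (by simpa using (lin0 (l ++ r)).append l2) (lY.append l3)
  have lsh : Leads N (sh N w₂) (rep N ++ (l ++ r)) (rep N ++ (l' ++ r')) := by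
    simpa using l2.shift (rep N)
  have g5 := Mem.in_out (S := freeSpan N K a b) (K := K)
    (u := w₁ ++ X ++ sh N w₂) (t := Y ++ w₃) (c := l' ++ r')
    ((l1.append (by simpa using lX)).append lsh) (lY2.append l3) (by
      intro v hv lv
      refine ih _ _ _ ((((l1.append (by simpa using lX)).append lsh).append lv).append
        (lY2.append l3)) ?_ ?_
      · simp only [numIn_append, numIn_sh, hX.numIn, hv.numIn, hY.numIn]; omega
      · simp only [numOut_append, numOut_sh, hX.numOut, hv.numOut, hY.numOut]; omega)
  simp only [List.append_assoc, List.cons_append, List.nil_append] at g1 g2 g4 g5 ⊢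
  exact Mem.of_sim ((g1.trans g2).trans g4) g5

lemma mem_freeSpan (m : ℕ) {a b : List Bool} {w : List Layer} (hw : Leads N w a b)
    (hi : numIn w = m) (ho : numOut w = m) : Mem (freeSpan N K a b) w := by
  induction m generalizing a b w with
  | zero => exact ⟨hw, Submodule.subset_span ⟨w, couponFree_of_num hi ho, hw, rfl⟩⟩
  | succ m ih =>
    have one : ∀ k, numIn [(k, .couponIn)] = 1 ∧ numOut [(k, .couponIn)] = 0 ∧
        numIn [(k, .couponOut)] = 0 ∧ numOut [(k, .couponOut)] = 1 := by
      intro k; simp [numIn, numOut]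
    have ih' : ∀ (a b : List Bool) (w : List Layer), Leads N w a b → numIn w = m →
      numOut w = m → Mem (freeSpan N K a b) w := fun a b w h => ih h
    obtain ⟨w₁, k, w₂, rfl⟩ := exists_in (w := w) (by omega)
    rcases Nat.eq_zero_or_pos (numOut w₂) with h0 | h0
    · have h1 : 0 < numOut w₁ := by
        simp only [numOut_append, (one k).2.1] at ho; omega
      obtain ⟨u₁, j, u₂, rfl⟩ := exists_out h1
      obtain ⟨c2, h, l2⟩ := leads_append_iff.1 hw
      obtain ⟨c1, l1, li⟩ := leads_append_iff.1 h
      obtain ⟨l, r, rfl, rfl, rfl⟩ := layer_in li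
      obtain ⟨X, hX, sX, lX⟩ := in_to_left (N := N) (K := K) l r
      have g1 := Sim.ctx' l1 sX li l2
      have lX' : Leads N X (l ++ rep N ++ r) (rep N ++ (l ++ r)) := by simpa using lX
      have g2 := (bend_in (K := K) (l1.append lX')).append_right (t := w₂) (c := b)
        (by simpa using (l1.append (sX.leads li)).append l2)
      have lf := (g1.trans (by simpa using g2)).leads hw
      simp only [sh_append, sh_cons, sh_nil] at g1 g2 lf
      have g3 := mem_freeSpan_in_out (K := K) ih' (a := a) (b := b) (w₁ := cups 0 (rep N))
        (k := 0) (w₂ := sh N u₁) (j := N + j) (w₃ := sh N u₂ ++ sh N X ++ caps 0 (repF N) ++ w₂)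
        (by simpa using lf)
        (by
          simp only [numIn_append, numIn_sh, hX.numIn, (CouponFree.cups _ _).numIn,
            (CouponFree.caps _ _).numIn, (one _).1, (one _).2.2.1] at hi ⊢; omega)
        (by
          simp only [numOut_append, numOut_sh, hX.numOut, (CouponFree.cups _ _).numOut,
            (CouponFree.caps _ _).numOut, (one _).2.1, (one _).2.2.2] at ho ⊢; omega)
      simp only [List.append_assoc, List.cons_append, List.nil_append] at g1 g2 g3 ⊢
      exact Mem.of_sim (g1.trans g2) g3
    · obtain ⟨u₁, j, u₂, rfl⟩ := exists_out h0
      have g := mem_freeSpan_in_out (K := K) ih' (a := a) (b := b) (w₁ := w₁)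
        (k := k) (w₂ := u₁) (j := j) (w₃ := u₂) (by simpa using hw)
        (by simp only [numIn_append, (one _).1, (one _).2.2.1] at hi ⊢; omega)
        (by simp only [numOut_append, (one _).2.1, (one _).2.2.2] at ho ⊢; omega)
      simpa using g

lemma Leads.charge {a b : List Bool} {w : List Layer} (hw : Leads N w a b) :
    ups b + downs a + N * numIn w = ups a + downs b + N * numOut w := by
  induction w generalizing a with
  | nil => cases hw; simp [numIn, numOut]
  | cons x w ih =>
    obtain ⟨c, ⟨l, r, h1, h2, h3⟩, hw⟩ := hw
    have := ih hw
    obtain ⟨k, g⟩ := x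
    have ei : numIn ((k, g) :: w) = numIn [(k, g)] + numIn w := numIn_append [(k, g)] w
    have eo : numOut ((k, g) :: w) = numOut [(k, g)] + numOut w := numOut_append [(k, g)] w
    rw [ei, eo]
    subst h2 h3
    cases g with
    | cross e => simp [Piece.bot, Piece.top, numIn, numOut] at this ⊢; omega
    | cup s => cases s <;> simp [Piece.bot, Piece.top, numIn, numOut] at this ⊢ <;> omega
    | cap s => cases s <;> simp [Piece.bot, Piece.top, numIn, numOut] at this ⊢ <;> omega
    | couponIn =>
      simp [Piece.bot, Piece.top, numIn, numOut, List.count_replicate, mul_add] at this ⊢; omega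
    | couponOut =>
      simp [Piece.bot, Piece.top, numIn, numOut, List.count_replicate, mul_add] at this ⊢; omega

lemma toSkeinLin_surjective (hN : N ≠ 0) (n : ℕ) :
    Function.Surjective (toSkeinLin N K n) := by
  rw [← LinearMap.range_eq_top, eq_top_iff]
  rintro x -
  obtain ⟨x, rfl⟩ := Submodule.mkQ_surjective _ x
  induction x using Finsupp.induction_linear with
  | zero => rw [map_zero]; exact Submodule.zero_mem _
  | add x y hx hy => rw [map_add]; exact Submodule.add_mem _ hx hy
  | single f c =>
    rw [← mul_one c, ← smul_eq_mul, ← Finsupp.smul_single, map_smul]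
    refine Submodule.smul_mem _ _ ?_
    have hc := f.2.charge
    have hio : numIn f.1 = numOut f.1 :=
      Nat.eq_of_mul_eq_mul_left (Nat.pos_of_ne_zero hN) (by omega)
    obtain ⟨h, hm⟩ := mem_freeSpan (K := K) _ f.2 rfl hio.symm
    refine (Submodule.span_le.2 ?_) hm
    rintro _ ⟨w, hw, hl, rfl⟩
    exact couponFree_mem_range hw hl

end

section

/-! ### The path model of the Hecke algebras

Paths of weights are lists of letters in `Fin N`, the last step at the head of the list. The weight
after the path `w` is recorded by the numbers `q ^ (c + count c w)`, `c : Fin N`. -/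

variable {N : ℕ} (q : ℂ)

/-- The coordinates of the weight after the path `w`. -/
def wt (w : List (Fin N)) (c : Fin N) : ℂ := q ^ (c.val + w.count c)

/-- All weights along the path are in the open alcove. -/
def Ok : List (Fin N) → Prop
  | [] => Function.Injective (wt (N := N) q [])
  | a :: u => Ok u ∧ Function.Injective (wt q (a :: u))

/-- The coefficients of the operators. -/
def fw (u : List (Fin N)) (a b : Fin N) : ℂ :=
  (q * wt q u a - wt q u b) / ((q + 1) * (wt q u a - wt q u b))

/-- The idempotents, as operators on functions of paths. -/
def loc (i : ℕ) : (List (Fin N) → ℂ) → List (Fin N) → ℂ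
  | F, b :: a :: u =>
    if u.length = i then
      if a = b then 0 else fw q u a b * F (b :: a :: u) + fw q u b a * F (a :: b :: u)
    else loc i (fun v => F (b :: v)) (a :: u)
  | _, _ => 0

variable {q}

lemma wt_cons_self (u : List (Fin N)) (a : Fin N) : wt q (a :: u) a = q * wt q u a := by
  simp [wt]; ring

lemma wt_cons_of_ne (u : List (Fin N)) {a c : Fin N} (h : a ≠ c) :
    wt q (a :: u) c = wt q u c := by
  simp [wt, h]

lemma wt_perm {u v : List (Fin N)} (h : u.Perm v) : wt q u = wt q v := by
  ext c; simp [wt, h.count_eq]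

lemma fw_perm {u v : List (Fin N)} (h : u.Perm v) (a b : Fin N) : fw q u a b = fw q v a b := by
  simp only [fw, wt_perm h]

lemma fw_cons {u : List (Fin N)} {a b c : Fin N} (hb : a ≠ b) (hc : a ≠ c) :
    fw q (a :: u) b c = fw q u b c := by
  simp only [fw, wt_cons_of_ne _ hb, wt_cons_of_ne _ hc]

lemma Ok.inj {u : List (Fin N)} (h : Ok q u) : Function.Injective (wt q u) := by
  cases u with
  | nil => exact h
  | cons a u => exact h.2

lemma Ok.sub_ne {u : List (Fin N)} (h : Ok q u) {a b : Fin N} (hab : a ≠ b) :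
    wt q u a - wt q u b ≠ 0 := sub_ne_zero.2 fun e => hab (h.inj e)

lemma Ok.step_ne {u : List (Fin N)} {a b : Fin N} (h : Ok q (a :: u)) (hab : a ≠ b) :
    q * wt q u a - wt q u b ≠ 0 := by
  have := h.sub_ne hab
  rwa [wt_cons_self, wt_cons_of_ne _ hab] at this

lemma ok_cons {u : List (Fin N)} (hu : Ok q u) {a : Fin N}
    (h : ∀ c, a ≠ c → q * wt q u a - wt q u c ≠ 0) : Ok q (a :: u) := by
  refine ⟨hu, fun c d hcd => ?_⟩
  by_contra hne
  rcases eq_or_ne a c with rfl | hc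
  · rw [wt_cons_self, wt_cons_of_ne _ hne] at hcd
    exact h d hne (sub_eq_zero.2 hcd)
  · rcases eq_or_ne a d with rfl | hd
    · rw [wt_cons_self, wt_cons_of_ne _ hc] at hcd
      exact h c hc (sub_eq_zero.2 hcd.symm)
    · rw [wt_cons_of_ne _ hc, wt_cons_of_ne _ hd] at hcd
      exact hne (hu.inj hcd)

lemma Ok.cons_perm {u v : List (Fin N)} (h : u.Perm v) {a : Fin N} (hv : Ok q v)
    (hu : Ok q (a :: u)) : Ok q (a :: v) :=
  ⟨hv, by rw [← wt_perm (h.cons a)]; exact hu.2⟩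

/-- A path can be changed to one with two steps exchanged, unless the coefficient vanishes. -/
lemma Ok.swap {u : List (Fin N)} {a b : Fin N} (h : Ok q (b :: a :: u)) (hab : a ≠ b)
    (hf : fw q u b a ≠ 0) : Ok q (a :: b :: u) := by
  have hu : Ok q u := h.1.1
  have h1 : Ok q (b :: u) := by
    refine ok_cons hu fun c hc => ?_
    rcases eq_or_ne a c with rfl | hac
    · intro e
      exact hf (by simp [fw, e])
    · have := h.step_ne hc
      rwa [wt_cons_of_ne _ hab, wt_cons_of_ne _ hac] at this
  exact ⟨h1, by rw [wt_perm (List.Perm.swap b a u)]; exact h.2⟩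

lemma loc_top (F : List (Fin N) → ℂ) (a b : Fin N) (u : List (Fin N)) :
    loc q u.length F (b :: a :: u) =
      if a = b then 0 else fw q u a b * F (b :: a :: u) + fw q u b a * F (a :: b :: u) := by
  simp [loc]

lemma loc_cons {i : ℕ} {w : List (Fin N)} (h : i + 1 < w.length) (F : List (Fin N) → ℂ)
    (b : Fin N) : loc q i F (b :: w) = loc q i (fun v => F (b :: v)) w := by
  cases w with
  | nil => simp at h
  | cons a u =>
    have : u.length ≠ i := by simp at h; omega
    simp [loc, this]

/-- Splitting a path at the letters on which an operator acts. -/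
lemma exists_top {i : ℕ} {w : List (Fin N)} (h : i + 1 < w.length) :
    (∃ a b u, w = b :: a :: u ∧ u.length = i) ∨ (∃ b u, w = b :: u ∧ i + 1 < u.length) := by
  rcases w with _ | ⟨b, _ | ⟨a, u⟩⟩
  · simp at h
  · simp at h
  · rcases eq_or_ne u.length i with e | e
    · exact Or.inl ⟨a, b, u, rfl, e⟩
    · exact Or.inr ⟨b, a :: u, rfl, by simp at h ⊢; omega⟩

lemma loc_add (i : ℕ) (F G : List (Fin N) → ℂ) (w : List (Fin N)) :
    loc q i (fun v => F v + G v) w = loc q i F w + loc q i G w := by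
  induction w generalizing F G with
  | nil => simp [loc]
  | cons b w ih =>
    cases w with
    | nil => simp [loc]
    | cons a u =>
      simp only [loc]
      split_ifs
      · simp
      · ring
      · exact ih _ _

/-- Functions of the final weight commute with the operators. -/
lemma loc_mul (i : ℕ) (k F : List (Fin N) → ℂ) (w : List (Fin N))
    (hk : ∀ v, v.Perm w → k v = k w) :
    loc q i (fun v => k v * F v) w = k w * loc q i F w := by
  induction w generalizing F k with
  | nil => simp [loc]
  | cons b w ih =>
    cases w with
    | nil => simp [loc]
    | cons a u =>
      simp only [loc]
      split_ifs
      · simp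
      · rw [hk _ (List.Perm.swap b a u)]; ring
      · rw [ih (fun v => k (b :: v)) (fun v => F (b :: v)) fun v hv => hk _ (hv.cons b)]

lemma loc_congr (i : ℕ) {F G : List (Fin N) → ℂ} {w : List (Fin N)} (hw : Ok q w)
    (h : ∀ v, v.Perm w → Ok q v → F v = G v) : loc q i F w = loc q i G w := by
  induction w generalizing F G with
  | nil => simp [loc]
  | cons b w ih =>
    cases w with
    | nil => simp [loc]
    | cons a u =>
      simp only [loc]
      split_ifs with h1 h2
      · rfl
      · rw [h _ (List.Perm.refl _) hw]
        by_cases h0 : fw q u b a = 0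
        · simp [h0]
        · rw [h _ (List.Perm.swap b a u) (hw.swap h2 h0)]
      · exact ih hw.1 fun v hv hv' => h _ (hv.cons b) (Ok.cons_perm hv.symm hv' hw)

lemma fw_add (hq : q + 1 ≠ 0) {u : List (Fin N)} (hu : Ok q u) {a b : Fin N} (hab : a ≠ b) :
    fw q u a b + fw q u b a = 1 := by
  have h1 := hu.sub_ne hab
  have h2 := hu.sub_ne hab.symm
  unfold fw
  field_simp
  have : wt q u b - wt q u a = -(wt q u a - wt q u b) := by ring
  rw [this]
  field_simp
  ring

lemma loc_idem (hq : q + 1 ≠ 0) (i : ℕ) (F : List (Fin N) → ℂ) {w : List (Fin N)}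
    (hw : Ok q w) : loc q i (loc q i F) w = loc q i F w := by
  induction w generalizing F with
  | nil => simp [loc]
  | cons b w ih =>
    cases w with
    | nil => simp [loc]
    | cons a u =>
      by_cases h : u.length = i
      · subst h
        rw [loc_top]
        simp only [loc_top]
        split_ifs with h1 h2
        · rfl
        · exact absurd h2.symm h1
        · have := fw_add hq hw.1.1 h1
          linear_combination (fw q u a b * F (b :: a :: u) + fw q u b a * F (a :: b :: u)) * this
      · have e : ∀ G, loc q i G (b :: a :: u) = loc q i (fun v => G (b :: v)) (a :: u) := by
          intro G; simp [loc, h]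
        rw [e, e F]
        refine (loc_congr i hw.1 fun v hv _ => ?_).trans (ih _ hw.1)
        have hl := hv.length_eq
        rcases v with _ | ⟨d, v⟩
        · simp at hl
        · change loc q i F (b :: d :: v) = _
          rw [loc, if_neg]
          simp at hl; omega

lemma loc_far {i j : ℕ} (hij : i + 2 ≤ j) (F : List (Fin N) → ℂ) {w : List (Fin N)}
    (hj : j + 1 < w.length) (hw : Ok q w) :
    loc q i (loc q j F) w = loc q j (loc q i F) w := by
  induction w generalizing F with
  | nil => simp at hj
  | cons d w ih =>
    rcases exists_top hj with ⟨a, b, u, e, hu⟩ | ⟨b, u, e, hu⟩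
    · obtain ⟨rfl, rfl⟩ := List.cons.inj e
      subst hu
      have hi : i + 1 < u.length := by omega
      have hi' : ∀ c : Fin N, i + 1 < (c :: u).length := fun c => by simp; omega
      rw [loc_top, loc_cons (hi' a), loc_cons hi, loc_cons (hi' d), loc_cons hi, loc_cons (hi' a),
        loc_cons hi]
      have hl : ∀ v : List (Fin N), v.Perm u → loc q u.length F (d :: a :: v) =
          if a = d then 0 else fw q u a d * F (d :: a :: v) + fw q u d a * F (a :: d :: v) := by
        intro v hv
        rw [← hv.length_eq, loc_top, fw_perm hv, fw_perm hv]
      rw [loc_congr i hw.1.1 fun v hv _ => hl v hv]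
      split_ifs with h
      · have := loc_mul (q := q) i (fun _ => 0) (fun _ => 0) u fun _ _ => rfl
        simpa using this
      · rw [loc_add, loc_mul _ (fun _ => fw q u a d) _ _ fun _ _ => rfl,
          loc_mul _ (fun _ => fw q u d a) _ _ fun _ _ => rfl]
    · obtain ⟨rfl, rfl⟩ := List.cons.inj e
      rw [loc_cons (by omega), loc_cons hu]
      refine (loc_congr i hw.1 fun v hv _ => ?_).trans ((ih (fun v => F (d :: v)) hu hw.1).trans
        (loc_congr j hw.1 fun v hv _ => ?_))
      · exact loc_cons (by rw [hv.length_eq]; omega) _ _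
      · exact (loc_cons (by rw [hv.length_eq]; omega) _ _).symm

/-- `q / (1 + q)²`. -/
def tau (q : ℂ) : ℂ := q / (q + 1) ^ 2

lemma fw_mul_repeat (hq : q + 1 ≠ 0) {u : List (Fin N)} {a b : Fin N} (hab : a ≠ b)
    (h1 : wt q u a - wt q u b ≠ 0) (h2 : q * wt q u a - wt q u b ≠ 0) :
    fw q (a :: u) b a * fw q u a b = tau q := by
  unfold fw tau
  rw [wt_cons_self, wt_cons_of_ne _ hab]
  have e1 : q * wt q u b - q * wt q u a = -(q * (wt q u a - wt q u b)) := by ring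
  have e2 : wt q u b - q * wt q u a = -(q * wt q u a - wt q u b) := by ring
  rw [e1, e2]
  field_simp

lemma fw_triple (hq : q + 1 ≠ 0) {u : List (Fin N)} (hu : Ok q u) {a b c : Fin N} (hab : a ≠ b)
    (hac : a ≠ c) (hbc : b ≠ c) :
    fw q u a b * fw q u b c + fw q u b a * fw q u a c - fw q u b c * fw q u a c = tau q := by
  have h1 := hu.sub_ne hab
  have h2 := hu.sub_ne hac
  have h3 := hu.sub_ne hbc
  have h4 : fw q u b a = 1 - fw q u a b := by rw [← fw_add hq hu hab]; ring
  rw [h4]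
  unfold fw tau
  field_simp
  ring

lemma loc_braid (hq : q + 1 ≠ 0) (i : ℕ) (F : List (Fin N) → ℂ) {w : List (Fin N)}
    (hi : i + 2 < w.length) (hw : Ok q w) :
    loc q i (loc q (i + 1) (loc q i F)) w - tau q * loc q i F w =
      loc q (i + 1) (loc q i (loc q (i + 1) F)) w - tau q * loc q (i + 1) F w := by
  induction w generalizing F with
  | nil => simp at hi
  | cons c w ih =>
    rcases exists_top (i := i + 1) hi with ⟨b, c', u, e, hu⟩ | ⟨c', u, e, hu⟩
    · obtain ⟨rfl, rfl⟩ := List.cons.inj e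
      rcases u with _ | ⟨a, u⟩
      · simp at hu
      obtain rfl : u.length = i := by simpa using hu
      have t1 : ∀ (G : List (Fin N) → ℂ) (a b c : Fin N), loc q u.length G (c :: b :: a :: u) =
          if a = b then 0 else
            fw q u a b * G (c :: b :: a :: u) + fw q u b a * G (c :: a :: b :: u) := by
        intro G a b c
        rw [loc_cons (by simp), loc_top]
      have t2 : ∀ (G : List (Fin N) → ℂ) (a b c : Fin N),
          loc q (u.length + 1) G (c :: b :: a :: u) = if b = c then 0 else
            fw q (a :: u) b c * G (c :: b :: a :: u) + fw q (a :: u) c b * G (b :: c :: a :: u) := by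
        intro G a b c
        exact loc_top G b c (a :: u)
      have hu0 : Ok q u := hw.1.1.1
      by_cases hab : a = b
      · subst hab
        by_cases hac : a = c
        · subst hac
          simp [t1, t2]
        · -- the path `a a c`
          have hca : ¬ c = a := fun e => hac e.symm
          have key := fw_mul_repeat hq hac (hu0.sub_ne hac) (hw.1.1.step_ne hac)
          simp only [t1, t2, hac, hca, if_true, if_false]
          linear_combination (-(fw q (a :: u) a c * F (c :: a :: a :: u)
            + fw q (a :: u) c a * F (a :: c :: a :: u))) * key
      · have hba : ¬ b = a := fun e => hab e.symm
        by_cases hac : a = c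
        · subst hac
          have key := fw_mul_repeat hq hab (hu0.sub_ne hab) (hw.1.1.step_ne hab)
          simp only [t1, t2, hab, hba, if_true, if_false]
          linear_combination (fw q u a b * F (a :: b :: a :: u) + fw q u b a * F (a :: a :: b :: u)
            - (fw q (a :: u) b a * F (a :: b :: a :: u)
              + fw q (a :: u) a b * F (b :: a :: a :: u))) * key
        · have hca : ¬ c = a := fun e => hac e.symm
          by_cases hbc : b = c
          · subst hbc
            have hs : q * wt q u b - wt q u a ≠ 0 := by
              have h := hw.step_ne hba
              rw [wt_cons_self, wt_cons_of_ne _ hab, wt_cons_of_ne _ hba, wt_cons_self] at h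
              intro e
              apply h
              linear_combination q * e
            have key := fw_mul_repeat hq hba (hu0.sub_ne hba) hs
            simp only [t1, t2, hab, hba, if_true, if_false]
            linear_combination (fw q u a b * F (b :: b :: a :: u)
              + fw q u b a * F (b :: a :: b :: u)) * key
          · have hcb : ¬ c = b := fun e => hbc e.symm
            have k1 := fw_triple hq hu0 hab hac hbc
            have k2 := fw_triple hq hu0 (a := b) (b := c) (c := a) hbc hba hca
            have k3 := fw_add hq hu0 hab
            have k4 := fw_add hq hu0 hac
            have k5 := fw_add hq hu0 hbc
            simp only [t1, t2, hab, hba, hac, hbc, hcb, if_false,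
              fw_cons hab hac, fw_cons hac hab, fw_cons hba hbc, fw_cons hbc hba, fw_cons hca hcb,
              fw_cons hcb hca]
            have e1 : fw q u b a = 1 - fw q u a b := by linear_combination k3
            have e2 : fw q u c a = 1 - fw q u a c := by linear_combination k4
            have e3 : fw q u c b = 1 - fw q u b c := by linear_combination k5
            rw [e1] at k1
            rw [e1, e2, e3]
            generalize fw q u a b = x at *
            generalize fw q u a c = y at *
            generalize fw q u b c = z at *
            linear_combination ((x - z) * F (c :: b :: a :: u) + (1 - x) * F (c :: a :: b :: u)
              - (1 - z) * F (b :: c :: a :: u)) * k1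
    · obtain ⟨rfl, rfl⟩ := List.cons.inj e
      have hi0 : i + 1 < w.length := by omega
      have c0 : ∀ (G : List (Fin N) → ℂ) (v : List (Fin N)), v.Perm w →
          loc q i G (c :: v) = loc q i (fun v => G (c :: v)) v := fun G v hv =>
        loc_cons (by rw [hv.length_eq]; omega) _ _
      have c1 : ∀ (G : List (Fin N) → ℂ) (v : List (Fin N)), v.Perm w →
          loc q (i + 1) G (c :: v) = loc q (i + 1) (fun v => G (c :: v)) v := fun G v hv =>
        loc_cons (by rw [hv.length_eq]; omega) _ _
      have r := List.Perm.refl w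
      have := ih (fun v => F (c :: v)) hu hw.1
      rw [c0 _ _ r, c0 _ _ r, c1 _ _ r, c1 _ _ r]
      rw [loc_congr i hw.1 fun v hv hv' => (c1 _ v hv).trans
          (loc_congr (i + 1) hv' fun v' hv2 _ => c0 F v' (hv2.trans hv)),
        loc_congr (i + 1) hw.1 fun v hv hv' => (c0 _ v hv).trans
          (loc_congr i hv' fun v' hv2 _ => c1 F v' (hv2.trans hv))]
      exact this

end

section

/-! ### Quantum integers and weights of paths -/

/-- A consequence of Lagrange interpolation. -/
lemma sum_prod_div {ι : Type*} [DecidableEq ι] (S : Finset ι) (y : ι → ℂ) (q : ℂ)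
    (hy : Set.InjOn y S) (h0 : ∀ a ∈ S, y a ≠ 0) :
    (q - 1) * ∑ a ∈ S, ∏ c ∈ S.erase a, (q * y a - y c) / (y a - y c) = q ^ S.card - 1 := by
  classical
  open Polynomial in
  let P : ℂ[X] := ∏ c ∈ S, (C q * X - C (y c))
  let v : Option ι → ℂ := fun o => o.elim 0 y
  have hdeg : ∀ c ∈ S, (Polynomial.C q * Polynomial.X - Polynomial.C (y c)).natDegree ≤ 1 := by
    intro c _
    compute_degree
  have hP : P.degree < (Finset.insertNone S).card := by
    rw [Finset.card_insertNone]
    refine lt_of_le_of_lt (Polynomial.degree_le_natDegree.trans (Nat.cast_le.2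
      (Polynomial.natDegree_prod_le S _))) ?_
    have := Finset.sum_le_card_nsmul S _ 1 hdeg
    rw [smul_eq_mul, mul_one] at this
    exact_mod_cast Nat.lt_succ_of_le this
  have hv : Set.InjOn v (Finset.insertNone S) := by
    rintro (_ | a) ha (_ | b) hb hab
    · rfl
    · exact absurd hab.symm (h0 b (by simpa using hb))
    · exact absurd hab (h0 a (by simpa using ha))
    · rw [hy (by simpa using ha) (by simpa using hb) hab]
  have key := Lagrange.coeff_eq_sum hv hP
  have hc : P.coeff S.card = q ^ S.card := by
    have := Polynomial.coeff_prod_of_natDegree_le (s := S) _ 1 hdeg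
    rw [mul_one] at this
    refine this.trans ?_
    simp
  have hev : ∀ x, P.eval x = ∏ c ∈ S, (q * x - y c) := by
    intro x; simp [P, Polynomial.eval_prod]
  have e0 : (Finset.insertNone S).erase none = S.map Function.Embedding.some := by
    ext o; cases o <;> simp
  have e1 : ∀ a, (Finset.insertNone S).erase (some a) = Finset.insertNone (S.erase a) := by
    intro a; ext o; cases o <;> simp
  rw [Finset.card_insertNone, Nat.add_sub_cancel, hc, Finset.sum_insertNone, e0,
    Finset.prod_map, hev] at key
  have hnone : (∏ c ∈ S, (q * v none - y c)) / ∏ c ∈ S, (v none - v (Function.Embedding.some c))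
      = 1 := by
    rw [← Finset.prod_div_distrib]
    refine Finset.prod_eq_one fun c hc => ?_
    have := h0 c hc
    simp [v, this]
  rw [hnone] at key
  rw [key, add_sub_cancel_left, Finset.mul_sum]
  refine Finset.sum_congr rfl fun a ha => ?_
  rw [e1, Finset.prod_insertNone, hev, ← Finset.mul_prod_erase S _ ha]
  have h1 : v (some a) = y a := rfl
  have h2 : ∀ x, v (some x) = y x := fun _ => rfl
  have h3 : v none = 0 := rfl
  simp only [h2, h3, sub_zero]
  rw [Finset.prod_div_distrib]
  have := h0 a ha
  have h4 : ∏ c ∈ S.erase a, (y a - y c) ≠ 0 := by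
    refine Finset.prod_ne_zero_iff.2 fun c hc => sub_ne_zero.2 fun e => ?_
    rw [Finset.mem_erase] at hc
    exact hc.1 (hy ha hc.2 e).symm
  field_simp

section

variable (N K : ℕ)

/-- The angle `π / (N + K)`. -/
def theta : ℝ := Real.pi / ((N : ℝ) + K)

lemma qpow_eq_exp (x : ℚ) : qpow N K x = Complex.exp (((2 * x * theta N K : ℝ) : ℂ) * Complex.I) := by
  unfold qpow theta
  congr 1
  push_cast
  ring

lemma qpow_neg (x : ℚ) : qpow N K (-x) = (qpow N K x)⁻¹ := by
  refine eq_inv_of_mul_eq_one_left ?_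
  rw [← qpow_add, neg_add_cancel, qpow_zero]

lemma qpow_ne_zero (x : ℚ) : qpow N K x ≠ 0 := Complex.exp_ne_zero _

lemma qpow_natCast_mul (n : ℕ) (x : ℚ) : qpow N K (n * x) = qpow N K x ^ n := by
  induction n with
  | zero => simp [qpow_zero]
  | succ n ih => rw [Nat.cast_succ, add_mul, one_mul, qpow_add, ih, pow_succ]

lemma qpow_half_sq : qpow N K (1 / 2) * qpow N K (1 / 2) = qpow N K 1 := by
  rw [← qpow_add]; norm_num

lemma qpow_half_zpow_sub (d : ℤ) : qpow N K (1 / 2) ^ d - qpow N K (1 / 2) ^ (-d) =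
    2 * Complex.I * ((Real.sin (d * theta N K) : ℝ) : ℂ) := by
  have h : ∀ d : ℤ, qpow N K (1 / 2) ^ d = Complex.exp (((d * theta N K : ℝ) : ℂ) * Complex.I) := by
    intro d
    rw [qpow_eq_exp, ← Complex.exp_int_mul]
    congr 1
    push_cast
    ring
  rw [h, h, Complex.exp_mul_I, Complex.exp_mul_I]
  push_cast
  rw [neg_mul, Complex.cos_neg, Complex.sin_neg]
  ring

lemma qpow_half_add_inv : qpow N K (1 / 2) + (qpow N K (1 / 2))⁻¹ =
    ((2 * Real.cos (theta N K) : ℝ) : ℂ) := by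
  rw [← qpow_neg, qpow_eq_exp, qpow_eq_exp, Complex.exp_mul_I, Complex.exp_mul_I]
  push_cast
  have e1 : (2 : ℂ) * (1 / 2) * (theta N K : ℂ) = theta N K := by ring
  have e2 : (2 : ℂ) * -(1 / 2) * (theta N K : ℂ) = -theta N K := by ring
  rw [e1, e2, Complex.cos_neg, Complex.sin_neg]
  ring

lemma qint_eq_sin (j : ℕ) : qint N K j =
    ((Real.sin (j * theta N K) / Real.sin (theta N K) : ℝ) : ℂ) := by
  have h : ∀ j : ℕ, qpow N K ((j : ℚ) / 2) - qpow N K (-(j : ℚ) / 2) =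
      2 * Complex.I * ((Real.sin (j * theta N K) : ℝ) : ℂ) := by
    intro j
    have e1 : ((j : ℚ) / 2) = j * (1 / 2) := by ring
    have e2 : (-(j : ℚ) / 2) = -(j * (1 / 2)) := by ring
    have := qpow_half_zpow_sub N K j
    rw [e2, e1, qpow_neg, qpow_natCast_mul]
    rw [zpow_neg, zpow_natCast] at this
    simpa using this
  have h1 := h 1
  unfold qint
  rw [h j]
  simp only [Nat.cast_one, one_mul] at h1
  rw [h1]
  have : (2 : ℂ) * Complex.I ≠ 0 := by simp
  push_cast
  rw [mul_div_mul_left _ _ this]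

variable {N K} (hN : 2 ≤ N) (hK : 1 ≤ K)
include hN hK

lemma theta_pos : 0 < theta N K := by
  unfold theta
  have : (0 : ℝ) < N := by exact_mod_cast (by omega : 0 < N)
  positivity

lemma natCast_mul_theta : ((N + K : ℕ) : ℝ) * theta N K = Real.pi := by
  unfold theta
  have : (0 : ℝ) < N := by exact_mod_cast (by omega : 0 < N)
  push_cast
  field_simp

lemma sin_theta_pos {j : ℕ} (h0 : 0 < j) (h : j < N + K) : 0 < Real.sin (j * theta N K) := by
  have ht := theta_pos hN hK
  refine Real.sin_pos_of_pos_of_lt_pi (mul_pos (by exact_mod_cast h0) ht) ?_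
  rw [← natCast_mul_theta hN hK]
  exact mul_lt_mul_of_pos_right (by exact_mod_cast h) ht

lemma cos_theta_pos : 0 < Real.cos (theta N K) := by
  have ht := theta_pos hN hK
  refine Real.cos_pos_of_mem_Ioo ⟨by linarith [Real.pi_pos], ?_⟩
  have h := natCast_mul_theta hN hK
  have h3 : (3 : ℝ) ≤ ((N + K : ℕ) : ℝ) := by exact_mod_cast (by omega : 3 ≤ N + K)
  nlinarith

/-- Consecutive multiples of `θ` lie in the same half period. -/
lemma sin_mul_sin_nonneg (d : ℤ) :
    0 ≤ Real.sin ((d + 1 : ℤ) * theta N K) * Real.sin (d * theta N K) := by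
  have ht := theta_pos hN hK
  have hr := natCast_mul_theta hN hK
  obtain ⟨r, hrdef⟩ : ∃ r : ℤ, r = ((N + K : ℕ) : ℤ) := ⟨_, rfl⟩
  have hr0 : 0 < r := by omega
  have hd : (d : ℝ) * theta N K = ((d % r : ℤ) : ℝ) * theta N K + (d / r : ℤ) * Real.pi := by
    rw [← hr, ← mul_assoc, ← add_mul]
    congr 1
    have : d = d % r + d / r * r := by rw [mul_comm]; exact (Int.emod_add_mul_ediv d r).symm
    have h2 : ((N + K : ℕ) : ℝ) = ((r : ℤ) : ℝ) := by rw [hrdef]; simp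
    rw [h2]
    exact_mod_cast this
  have hd1 : ((d + 1 : ℤ) : ℝ) * theta N K =
      ((d % r : ℤ) + 1 : ℝ) * theta N K + (d / r : ℤ) * Real.pi := by
    push_cast at hd ⊢
    rw [add_mul, hd]; ring
  rw [hd, hd1, Real.sin_add_int_mul_pi, Real.sin_add_int_mul_pi]
  have hsq : ((-1 : ℝ) ^ (d / r)) * ((-1 : ℝ) ^ (d / r)) = 1 := by
    rw [← mul_zpow]; norm_num
  have h1 : 0 ≤ Real.sin (((d % r : ℤ) : ℝ) * theta N K) := by
    have : (0 : ℝ) ≤ ((d % r : ℤ) : ℝ) := by exact_mod_cast Int.emod_nonneg d hr0.ne'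
    refine Real.sin_nonneg_of_nonneg_of_le_pi (by positivity) ?_
    rw [← hr]
    refine mul_le_mul_of_nonneg_right ?_ ht.le
    have := (Int.emod_lt_of_pos d hr0).le
    have h2 : ((N + K : ℕ) : ℝ) = ((r : ℤ) : ℝ) := by rw [hrdef]; simp
    rw [h2]
    exact_mod_cast this
  have h2 : 0 ≤ Real.sin (((d % r : ℤ) + 1 : ℝ) * theta N K) := by
    have : (0 : ℝ) ≤ ((d % r : ℤ) : ℝ) := by exact_mod_cast Int.emod_nonneg d hr0.ne'
    refine Real.sin_nonneg_of_nonneg_of_le_pi (by positivity) ?_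
    rw [← hr]
    refine mul_le_mul_of_nonneg_right ?_ ht.le
    have := Int.add_one_le_of_lt (Int.emod_lt_of_pos d hr0)
    have h2 : ((N + K : ℕ) : ℝ) = ((r : ℤ) : ℝ) := by rw [hrdef]; simp
    rw [h2]
    exact_mod_cast this
  have : 0 ≤ (((-1 : ℝ) ^ (d / r)) * ((-1 : ℝ) ^ (d / r))) *
      (Real.sin (((d % r : ℤ) + 1 : ℝ) * theta N K) *
        Real.sin (((d % r : ℤ) : ℝ) * theta N K)) := by
    rw [hsq, one_mul]; exact mul_nonneg h2 h1
  calc (0 : ℝ) ≤ _ := this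
    _ = _ := by ring

lemma qint_N_pos : ∃ x : ℝ, 0 < x ∧ qint N K N = x := by
  refine ⟨_, div_pos (sin_theta_pos hN hK (by omega) (by omega)) ?_, qint_eq_sin N K N⟩
  simpa using sin_theta_pos hN hK one_pos (by omega)

lemma qpow_one_add_one_ne : qpow N K 1 + 1 ≠ 0 := by
  have h := qpow_half_add_inv N K
  have hs := qpow_ne_zero N K (1 / 2)
  intro e
  rw [← qpow_half_sq] at e
  have h0 : qpow N K (1 / 2) + (qpow N K (1 / 2))⁻¹ = 0 := by
    field_simp
    linear_combination e
  rw [h0] at h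
  have := cos_theta_pos hN hK
  exact absurd h.symm (by exact_mod_cast (by positivity : (2 * Real.cos (theta N K) : ℝ) ≠ 0))

lemma qpow_one_pow_ne {m l : ℕ} (h : l < m) (h' : m < l + (N + K)) :
    qpow N K 1 ^ m ≠ qpow N K 1 ^ l := by
  intro e
  have hs := qpow_ne_zero N K (1 / 2)
  have h1 := qpow_half_zpow_sub N K ((m - l : ℕ) : ℤ)
  have h2 := sin_theta_pos hN hK (j := m - l) (by omega) (by omega)
  have h0 : qpow N K (1 / 2) ^ ((m - l : ℕ) : ℤ) - qpow N K (1 / 2) ^ (-((m - l : ℕ) : ℤ)) = 0 := by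
    rw [zpow_neg, zpow_natCast, sub_eq_zero]
    refine eq_inv_of_mul_eq_one_left ?_
    rw [← mul_pow, qpow_half_sq]
    obtain ⟨k, rfl⟩ := Nat.exists_eq_add_of_lt h
    rw [show l + k + 1 = l + (k + 1) by ring, pow_add] at e
    have := mul_left_cancel₀ (pow_ne_zero l (qpow_ne_zero N K 1)) (e.trans (mul_one _).symm)
    rwa [show l + k + 1 - l = k + 1 by omega]
  rw [h0] at h1
  have : (2 : ℂ) * Complex.I ≠ 0 := by simp
  have h3 := (mul_eq_zero.1 h1.symm).resolve_left this
  rw [Complex.ofReal_eq_zero] at h3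
  push_cast at h3 h2
  exact h2.ne' (by simpa using h3)

lemma qpow_one_ne_one : qpow N K 1 ≠ 1 := by
  have := qpow_one_pow_ne hN hK (m := 1) (l := 0) (by omega) (by omega)
  simpa using this

lemma qint_N_eq : qint N K N * (qpow N K (1 / 2) ^ (N - 1) * (qpow N K 1 - 1)) =
    qpow N K 1 ^ N - 1 := by
  have hs := qpow_ne_zero N K (1 / 2)
  have h1 := qpow_one_ne_one hN hK
  rw [← qpow_half_sq] at h1 ⊢
  unfold qint
  have e1 : ((N : ℚ) / 2) = N * (1 / 2) := by ring
  have e2 : (-(N : ℚ) / 2) = -(N * (1 / 2)) := by ring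
  have e3 : (-1 / 2 : ℚ) = -(1 / 2) := by norm_num
  rw [e2, e1, e3, qpow_neg, qpow_neg, qpow_natCast_mul]
  generalize qpow N K (1 / 2) = s at *
  obtain ⟨m, rfl⟩ : ∃ m, N = m + 1 := ⟨N - 1, by omega⟩
  have h2 : s - s⁻¹ ≠ 0 := by
    intro e
    apply h1
    field_simp at e
    linear_combination e
  rw [Nat.add_sub_cancel, div_mul_eq_mul_div, div_eq_iff h2]
  field_simp
  ring

open ComplexOrder in
lemma fw_nonneg (u : List (Fin N)) (a b : Fin N) : 0 ≤ fw (qpow N K 1) u a b := by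
  have hs := qpow_ne_zero N K (1 / 2)
  unfold fw wt
  generalize a.val + u.count a = m
  generalize b.val + u.count b = l
  have h0 := qpow_half_zpow_sub N K ((m : ℤ) - l)
  have h1 := qpow_half_zpow_sub N K ((m : ℤ) - l + 1)
  have h2 := qpow_half_add_inv N K
  have hnn := sin_mul_sin_nonneg hN hK ((m : ℤ) - l)
  have hc := cos_theta_pos hN hK
  set A := Real.sin (((m : ℤ) - l : ℤ) * theta N K)
  set B := Real.sin (((m : ℤ) - l + 1 : ℤ) * theta N K)
  rw [← qpow_half_sq]
  generalize qpow N K (1 / 2) = s at *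
  have e1 : (s * s) ^ m - (s * s) ^ l = s ^ (m + l) * (2 * Complex.I * A) := by
    rw [← h0, mul_sub, ← zpow_natCast s (m + l), ← zpow_add₀ hs, ← zpow_add₀ hs,
      show ((m + l : ℕ) : ℤ) + (m - l) = ((m + m : ℕ) : ℤ) by push_cast; ring,
      show ((m + l : ℕ) : ℤ) + -(m - l) = ((l + l : ℕ) : ℤ) by push_cast; ring,
      zpow_natCast, zpow_natCast, pow_add, pow_add, mul_pow, mul_pow]
  have e2 : s * s * (s * s) ^ m - (s * s) ^ l = s ^ (m + l + 1) * (2 * Complex.I * B) := by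
    rw [← h1, mul_sub, ← zpow_natCast s (m + l + 1), ← zpow_add₀ hs, ← zpow_add₀ hs,
      show ((m + l + 1 : ℕ) : ℤ) + (m - l + 1) = ((m + m + 2 : ℕ) : ℤ) by push_cast; ring,
      show ((m + l + 1 : ℕ) : ℤ) + -(m - l + 1) = ((l + l : ℕ) : ℤ) by push_cast; ring,
      zpow_natCast, zpow_natCast, pow_add, pow_add, pow_add, mul_pow, mul_pow]
    ring
  have e3 : s * s + 1 = s * ((2 * Real.cos (theta N K) : ℝ) : ℂ) := by
    rw [← h2]; field_simp
  rw [e1, e2, e3]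
  have e4 : s ^ (m + l + 1) * (2 * Complex.I * B) / (s * ((2 * Real.cos (theta N K) : ℝ) : ℂ) *
      (s ^ (m + l) * (2 * Complex.I * A))) = ((B / (2 * Real.cos (theta N K) * A) : ℝ) : ℂ) := by
    have hI : (2 : ℂ) * Complex.I ≠ 0 := by simp
    have : s ^ (m + l + 1) * (2 * Complex.I) ≠ 0 := mul_ne_zero (pow_ne_zero _ hs) hI
    push_cast
    rw [← mul_div_mul_left (B : ℂ) _ this]
    congr 1
    · ring
    · ring
  rw [e4]
  refine Complex.zero_le_real.2 ?_
  rcases eq_or_ne A 0 with h | h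
  · simp [h]
  · have : B / (2 * Real.cos (theta N K) * A) = (B * A) / (2 * Real.cos (theta N K) * (A * A)) := by
      field_simp
    rw [this]
    have : 0 < A * A := mul_self_pos.2 h
    positivity

lemma ok_nil : Ok (N := N) (qpow N K 1) [] := by
  intro a b h
  simp only [wt, List.count_nil, add_zero] at h
  by_contra hne
  rcases lt_or_gt_of_ne (Fin.val_injective.ne hne) with hl | hl
  · exact qpow_one_pow_ne hN hK hl (by omega) h.symm
  · exact qpow_one_pow_ne hN hK hl (by omega) h

end

end

section

/-! ### Homomorphisms from idempotents -/

section

variable {N K : ℕ}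

lemma Hecke.sigma_eq_e (hq : qpow N K 1 + 1 ≠ 0) {n : ℕ∞} (i : BraidGen n) :
    Hecke.sigma N K i = (qpow N K ((N + 1) / (2 * N)))⁻¹ •
      (qpow N K 1 • 1 - (1 + qpow N K 1) • Hecke.e N K i) := by
  have hq' : 1 + qpow N K 1 ≠ 0 := by rwa [add_comm]
  unfold Hecke.e
  rw [smul_smul, mul_inv_cancel₀ hq', one_smul, sub_sub_cancel, smul_smul,
    inv_mul_cancel₀ (qpow_ne_zero N K _), one_smul]

/-- Induction in Hecke algebras with left multiplication by the idempotents. -/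
@[elab_as_elim]
lemma Hecke.induction_e (hq : qpow N K 1 + 1 ≠ 0) {n : ℕ∞} {P : Hecke N K n → Prop}
    (x : Hecke N K n) (one : P 1) (add : ∀ x y, P x → P y → P (x + y))
    (smul : ∀ (c : ℂ) x, P x → P (c • x)) (mul : ∀ i x, P x → P (Hecke.e N K i * x)) : P x := by
  induction x using Hecke.induction with
  | one => exact one
  | add x y hx hy => exact add x y hx hy
  | smul c x hx => exact smul c x hx
  | mul i x hx =>
    have hsub : ∀ x y : Hecke N K n, x - y = x + (-1 : ℂ) • y := fun x y => by module
    rw [Hecke.sigma_eq_e hq, smul_mul_assoc, sub_mul, smul_mul_assoc, one_mul, smul_mul_assoc,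
      hsub, smul_smul]
    exact smul _ _ (add _ _ (smul _ _ hx) (smul _ _ (mul i x hx)))

/-- A homomorphism from a Hecke algebra with prescribed images of the idempotents. -/
lemma Hecke.exists_hom_of_idem (hN : N ≠ 0) (hq : qpow N K 1 + 1 ≠ 0) {n : ℕ∞} {A : Type}
    [Ring A] [Algebra ℂ A] (e : BraidGen n → A) (hidem : ∀ i, e i * e i = e i)
    (hfar : ∀ i j : BraidGen n, i.1 + 2 ≤ j.1 → e i * e j = e j * e i)
    (hbraid : ∀ i j : BraidGen n, i.1 + 1 = j.1 →
      e i * e j * e i - tau (qpow N K 1) • e i = e j * e i * e j - tau (qpow N K 1) • e j) :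
    ∃ ρ : Hecke N K n →ₐ[ℂ] A, ∀ i, ρ (Hecke.e N K i) = e i := by
  have hq0 := qpow_ne_zero N K 1
  set q := qpow N K 1 with hqdef
  set γ := qpow N K ((N + 1) / (2 * N)) with hγ
  have hγ0 : γ ≠ 0 := qpow_ne_zero N K _
  have hmul : ∀ (i) (a b c d : ℂ), (a • (1 : A) - b • e i) * (c • (1 : A) - d • e i) =
      (a * c) • 1 - (a * d + b * c - b * d) • e i := by
    intro i a b c d
    simp only [sub_mul, mul_sub, smul_mul_assoc, mul_smul_comm, one_mul, mul_one, hidem]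
    module
  let u : BraidGen n → Aˣ := fun i =>
    { val := (γ⁻¹ * q) • 1 - (γ⁻¹ * (1 + q)) • e i
      inv := (γ * q⁻¹) • 1 - (γ * (1 + q⁻¹)) • e i
      val_inv := by
        rw [hmul]
        have e1 : γ⁻¹ * q * (γ * q⁻¹) = 1 := by field_simp
        have e2 : γ⁻¹ * q * (γ * (1 + q⁻¹)) + γ⁻¹ * (1 + q) * (γ * q⁻¹) -
          γ⁻¹ * (1 + q) * (γ * (1 + q⁻¹)) = 0 := by field_simp; ring
        rw [e1, e2, one_smul, zero_smul, sub_zero]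
      inv_val := by
        rw [hmul]
        have e1 : γ * q⁻¹ * (γ⁻¹ * q) = 1 := by field_simp
        have e2 : γ * q⁻¹ * (γ⁻¹ * (1 + q)) + γ * (1 + q⁻¹) * (γ⁻¹ * q) -
          γ * (1 + q⁻¹) * (γ⁻¹ * (1 + q)) = 0 := by field_simp; ring
        rw [e1, e2, one_smul, zero_smul, sub_zero] }
  have hu : ∀ i, (u i : A) = γ⁻¹ • (q • 1 - (1 + q) • e i) := by
    intro i
    rw [smul_sub, smul_smul, smul_smul]
  refine ⟨Hecke.liftAlg N K u ?_ ?_ ?_, ?_⟩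
  · intro i j h
    refine Units.ext ?_
    have := hfar i j h
    simp only [Units.val_mul, hu, smul_mul_assoc, mul_smul_comm, sub_mul, mul_sub, one_mul, mul_one,
      this]
    module
  · intro i j h
    refine Units.ext ?_
    have hb := hbraid i j h
    have hi := hidem i
    have hj := hidem j
    simp only [Units.val_mul, hu, smul_mul_assoc, mul_smul_comm]
    congr 3
    have hb' : e i * e j * e i = e j * e i * e j + tau q • e i - tau q • e j := by
      rw [sub_eq_iff_eq_add] at hb
      rw [hb]
      abel
    have lhs : ∀ x y : A, x * x = x → (q • 1 - (1 + q) • x) * (q • 1 - (1 + q) • y) *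
        (q • 1 - (1 + q) • x) = (q ^ 3) • 1 - (q * (1 + q) * (q - 1)) • x
          - (q ^ 2 * (1 + q)) • y + (q * (1 + q) ^ 2) • (x * y + y * x)
          - (1 + q) ^ 3 • (x * y * x) := by
      intro x y hx
      simp only [sub_mul, mul_sub, smul_mul_assoc, mul_smul_comm, one_mul, mul_one, hx, smul_sub,
        smul_smul, smul_add]
      module
    rw [lhs _ _ hi, lhs _ _ hj, hb']
    have ht : (1 + q) ^ 3 * tau q = q * (1 + q) := by
      unfold tau
      rw [add_comm 1 q]
      field_simp
    have hm : ∀ x y z : A, (1 + q) ^ 3 • (x + tau q • y - tau q • z) =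
        (1 + q) ^ 3 • x + (q * (1 + q)) • y - (q * (1 + q)) • z := by
      intro x y z
      rw [← ht]
      module
    rw [hm]
    module
  · intro i
    change qpow N K (1 / (2 * N)) • ((γ⁻¹ * q) • (1 : A) - (γ⁻¹ * (1 + q)) • e i) -
      qpow N K (-(1 / (2 * N))) • ((γ * q⁻¹) • (1 : A) - (γ * (1 + q⁻¹)) • e i) = _
    have hN' : (N : ℚ) ≠ 0 := by exact_mod_cast hN
    have hs0 := qpow_ne_zero N K (1 / 2)
    have hsq := qpow_half_sq N K
    have g1 : γ = qpow N K (1 / 2) * qpow N K (1 / (2 * N)) := by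
      rw [hγ, ← qpow_add]; congr 1; field_simp
    have e3 : (-1 / 2 : ℚ) = -(1 / 2) := by norm_num
    have ht0 := qpow_ne_zero N K (1 / (2 * N))
    rw [e3, qpow_neg, qpow_neg, g1, ← hsq.trans hqdef.symm]
    clear_value q γ u
    clear g1 hsq hγ hqdef
    generalize qpow N K (1 / 2) = s at *
    generalize qpow N K (1 / (2 * N)) = t at *
    rw [smul_sub, smul_sub, smul_smul, smul_smul, smul_smul, smul_smul]
    have a1 : t * ((s * t)⁻¹ * (s * s)) = s := by field_simp
    have a2 : t * ((s * t)⁻¹ * (1 + s * s)) = s⁻¹ + s := by field_simp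
    have a3 : t⁻¹ * (s * t * (s * s)⁻¹) = s⁻¹ := by field_simp
    have a4 : t⁻¹ * (s * t * (1 + (s * s)⁻¹)) = s⁻¹ + s := by field_simp; ring
    rw [a1, a2, a3, a4, sub_smul]
    abel
  · intro i
    unfold Hecke.e
    rw [map_smul, map_sub, map_smul, map_smul, map_one, Hecke.liftAlg_sigma, hu, smul_smul,
      mul_inv_cancel₀ hγ0, one_smul, sub_sub_cancel, smul_smul, inv_mul_cancel₀, one_smul]
    rwa [add_comm]

end

end

section

/-! ### Weights of paths -/

section

variable {N : ℕ} (q s B : ℂ)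

/-- The weight of a step of a path. -/
def stepW (u : List (Fin N)) (a : Fin N) : ℂ :=
  (∏ c ∈ Finset.univ.erase a, (q * wt q u a - wt q u c) / (s * (wt q u a - wt q u c))) / B

/-- The weight of a path, whose sum defines the trace. -/
def pathW : List (Fin N) → ℂ
  | [] => 1
  | a :: u => pathW u * stepW q s B u a

/-- The norms of the paths, up to scalars, for which the idempotents are self-adjoint. -/
def pathN : List (Fin N) → ℝ
  | [] => 1
  | a :: u => pathN u * ∏ c ∈ Finset.univ.erase a, ‖q * wt q u a - wt q u c‖

variable {q s B}

lemma stepW_perm {u v : List (Fin N)} (h : u.Perm v) (a : Fin N) :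
    stepW q s B u a = stepW q s B v a := by
  simp only [stepW, wt_perm h]

lemma stepW_eq_zero {u : List (Fin N)} (hu : Ok q u) {a : Fin N} (h : ¬ Ok q (a :: u)) :
    stepW q s B u a = 0 := by
  have : ∃ c, a ≠ c ∧ q * wt q u a - wt q u c = 0 := by
    by_contra! hc
    exact h (ok_cons hu hc)
  obtain ⟨c, hc, e⟩ := this
  unfold stepW
  rw [Finset.prod_eq_zero (i := c) (by simp [hc.symm]) (by rw [e, zero_div]), zero_div]

lemma wt_ne_zero (hq : q ≠ 0) (u : List (Fin N)) (a : Fin N) : wt q u a ≠ 0 :=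
  pow_ne_zero _ hq

lemma prod_div_mul {ι : Type*} (S : Finset ι) (f g : ι → ℂ) :
    ∏ c ∈ S, f c / (s * g c) = (s ^ S.card)⁻¹ * ∏ c ∈ S, f c / g c := by
  rw [← Finset.prod_const, ← Finset.prod_inv_distrib, ← Finset.prod_mul_distrib]
  refine Finset.prod_congr rfl fun c _ => ?_
  rw [div_mul_eq_div_div, div_eq_mul_inv (f c), div_eq_mul_inv]
  ring

lemma stepW_sum (hq : q ≠ 0) (hq1 : q ≠ 1) (hs : s ≠ 0) (hB0 : B ≠ 0)
    (hB : B * (s ^ (N - 1) * (q - 1)) = q ^ N - 1) {u : List (Fin N)} (hu : Ok q u) :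
    ∑ a, stepW q s B u a = 1 := by
  have key := sum_prod_div Finset.univ (wt q u) q hu.inj.injOn fun a _ => wt_ne_zero hq u a
  rw [Finset.card_univ, Fintype.card_fin] at key
  have hq1' : q - 1 ≠ 0 := sub_ne_zero.2 hq1
  unfold stepW
  rw [← Finset.sum_div, div_eq_one_iff_eq hB0]
  have : ∀ a ∈ Finset.univ, (∏ c ∈ Finset.univ.erase a,
      (q * wt q u a - wt q u c) / (s * (wt q u a - wt q u c))) = (s ^ (N - 1))⁻¹ *
      ∏ c ∈ Finset.univ.erase a, (q * wt q u a - wt q u c) / (wt q u a - wt q u c) := by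
    intro a _
    rw [prod_div_mul, Finset.card_erase_of_mem (Finset.mem_univ a), Finset.card_univ,
      Fintype.card_fin]
  rw [Finset.sum_congr rfl this, ← Finset.mul_sum]
  have hs' : s ^ (N - 1) ≠ 0 := pow_ne_zero _ hs
  field_simp
  refine mul_left_cancel₀ hq1' ?_
  rw [key, ← hB]
  ring

/-- The weight of a step, when one of the factors is separated. -/
lemma stepW_cons {u : List (Fin N)} {a b : Fin N} (hab : a ≠ b) :
    stepW q s B (a :: u) b = (q * wt q u b - q * wt q u a) / (s * (wt q u b - q * wt q u a)) *
      (∏ c ∈ (Finset.univ.erase a).erase b,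
        (q * wt q u b - wt q u c) / (s * (wt q u b - wt q u c))) / B := by
  unfold stepW
  rw [← Finset.mul_prod_erase (Finset.univ.erase b) _ (a := a) (by simp [hab]), wt_cons_self,
    wt_cons_of_ne _ hab, Finset.erase_right_comm]
  congr 2
  refine Finset.prod_congr rfl fun c hc => ?_
  have : a ≠ c := by
    rintro rfl
    simp at hc
  rw [wt_cons_of_ne _ this]

lemma stepW_eq {u : List (Fin N)} {a b : Fin N} (hab : a ≠ b) :
    stepW q s B u a = (q * wt q u a - wt q u b) / (s * (wt q u a - wt q u b)) *
      (∏ c ∈ (Finset.univ.erase a).erase b,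
        (q * wt q u a - wt q u c) / (s * (wt q u a - wt q u c))) / B := by
  unfold stepW
  rw [← Finset.mul_prod_erase (Finset.univ.erase a) _ (a := b) (by simp [hab.symm])]

lemma stepW_swap (hs : s * s = q) (hs0 : s ≠ 0) {u : List (Fin N)} {a b : Fin N} (hab : a ≠ b)
    (h : Ok q (b :: a :: u)) (h' : Ok q (a :: b :: u)) :
    stepW q s B u a * stepW q s B (a :: u) b = stepW q s B u b * stepW q s B (b :: u) a := by
  have h1 := h.1.1.sub_ne hab
  have h2 := h.1.1.sub_ne hab.symm
  have h3 := h.1.step_ne hab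
  have h4 := h'.1.step_ne hab.symm
  rw [stepW_cons hab, stepW_cons hab.symm, stepW_eq hab, stepW_eq hab.symm,
    Finset.erase_right_comm (a := b) (b := a)]
  generalize ∏ c ∈ (Finset.univ.erase a).erase b,
        (q * wt q u a - wt q u c) / (s * (wt q u a - wt q u c)) = X
  generalize ∏ c ∈ (Finset.univ.erase a).erase b,
        (q * wt q u b - wt q u c) / (s * (wt q u b - wt q u c)) = Y
  have k1 : (q * wt q u a - wt q u b) / (s * (wt q u a - wt q u b)) *
      ((q * wt q u b - q * wt q u a) / (s * (wt q u b - q * wt q u a))) = 1 := by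
    have e1 : q * wt q u b - q * wt q u a = -(s * s * (wt q u a - wt q u b)) := by rw [hs]; ring
    have e2 : wt q u b - q * wt q u a = -(q * wt q u a - wt q u b) := by ring
    rw [e1, e2]
    field_simp
  have k2 : (q * wt q u b - wt q u a) / (s * (wt q u b - wt q u a)) *
      ((q * wt q u a - q * wt q u b) / (s * (wt q u a - q * wt q u b))) = 1 := by
    have e1 : q * wt q u a - q * wt q u b = -(s * s * (wt q u b - wt q u a)) := by rw [hs]; ring
    have e2 : wt q u a - q * wt q u b = -(q * wt q u b - wt q u a) := by ring
    rw [e1, e2]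
    field_simp
  calc _ = ((q * wt q u a - wt q u b) / (s * (wt q u a - wt q u b)) *
      ((q * wt q u b - q * wt q u a) / (s * (wt q u b - q * wt q u a)))) * (X * Y / B / B) := by ring
    _ = ((q * wt q u b - wt q u a) / (s * (wt q u b - wt q u a)) *
      ((q * wt q u a - q * wt q u b) / (s * (wt q u a - q * wt q u b)))) * (X * Y / B / B) := by
      rw [k1, k2]
    _ = _ := by ring

lemma pathW_swap (hs : s * s = q) (hs0 : s ≠ 0) (p : List (Fin N)) {u : List (Fin N)}
    {a b : Fin N} (hab : a ≠ b) (h : Ok q (p ++ b :: a :: u)) (h' : Ok q (p ++ a :: b :: u)) :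
    pathW q s B (p ++ b :: a :: u) = pathW q s B (p ++ a :: b :: u) := by
  induction p with
  | nil =>
    simp only [List.nil_append, pathW] at h h' ⊢
    rw [mul_assoc, mul_assoc, stepW_swap hs hs0 hab h h']
  | cons d p ih =>
    simp only [List.cons_append, pathW] at h h' ⊢
    rw [ih h.1 h'.1, stepW_perm ((List.Perm.swap a b u).append_left p)]

/-- The sum that determines the Markov parameter. -/
lemma stepW_markov (hq : q ≠ 0) (hq1 : q ≠ 1) (hq2 : q + 1 ≠ 0) (hs : s ≠ 0) (hB0 : B ≠ 0)
    (hN : 2 ≤ N) (hB : B * (s ^ (N - 1) * (q - 1)) = q ^ N - 1) {u : List (Fin N)} {a : Fin N}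
    (hu : Ok q (a :: u)) :
    ∑ b, stepW q s B (a :: u) b * (if a = b then 0 else fw q u a b) =
      (q - q ^ N) / ((1 + q) * (1 - q ^ N)) := by
  have key := sum_prod_div (Finset.univ.erase a) (wt q u) q hu.1.inj.injOn
    fun a _ => wt_ne_zero hq u a
  rw [Finset.card_erase_of_mem (Finset.mem_univ a), Finset.card_univ, Fintype.card_fin] at key
  have hq1' : q - 1 ≠ 0 := sub_ne_zero.2 hq1
  rw [← Finset.sum_erase (a := a) _ (by simp)]
  have : ∀ b ∈ Finset.univ.erase a, stepW q s B (a :: u) b * (if a = b then 0 else fw q u a b) =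
      q / ((q + 1) * s ^ (N - 1) * B) * ∏ c ∈ (Finset.univ.erase a).erase b,
        (q * wt q u b - wt q u c) / (wt q u b - wt q u c) := by
    intro b hb
    have hab : a ≠ b := by rintro rfl; simp at hb
    have h1 := hu.1.sub_ne hab
    have h3 := hu.step_ne hab
    rw [if_neg hab, stepW_cons hab, prod_div_mul, Finset.card_erase_of_mem hb,
      Finset.card_erase_of_mem (Finset.mem_univ a), Finset.card_univ, Fintype.card_fin]
    generalize ∏ c ∈ (Finset.univ.erase a).erase b,
        (q * wt q u b - wt q u c) / (wt q u b - wt q u c) = X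
    unfold fw
    have e1 : q * wt q u b - q * wt q u a = -(q * (wt q u a - wt q u b)) := by ring
    have e2 : wt q u b - q * wt q u a = -(q * wt q u a - wt q u b) := by ring
    obtain ⟨m, hm⟩ : ∃ m, N = m + 2 := ⟨N - 2, by omega⟩
    have e3 : N - 1 = m + 1 := by omega
    have e4 : N - 1 - 1 = m := by omega
    rw [e1, e2, e4, e3, pow_succ]
    field_simp
  rw [Finset.sum_congr rfl this, ← Finset.mul_sum]
  have hs' : s ^ (N - 1) ≠ 0 := pow_ne_zero _ hs
  have hN1 : q ^ N = q * q ^ (N - 1) := by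
    rw [← pow_succ']; congr 1; omega
  have hBn : q ^ N - 1 ≠ 0 := by
    rw [← hB]; exact mul_ne_zero hB0 (mul_ne_zero hs' hq1')
  have h5 : 1 - q ^ N ≠ 0 := fun e => hBn (by linear_combination -e)
  have h6 : 1 + q ≠ 0 := by rwa [add_comm]
  rw [eq_div_iff (mul_ne_zero h6 h5)]
  have e5 : (1 - q ^ N) = -(B * (s ^ (N - 1) * (q - 1))) := by rw [hB]; ring
  rw [e5]
  calc _ = -(q * ((q - 1) * ∑ b ∈ Finset.univ.erase a, ∏ c ∈ (Finset.univ.erase a).erase b,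
        (q * wt q u b - wt q u c) / (wt q u b - wt q u c))) := by
        field_simp
        ring
    _ = _ := by rw [key, hN1]; ring

lemma pathN_pos {w : List (Fin N)} (h : Ok q w) : 0 < pathN q w := by
  induction w with
  | nil => exact one_pos
  | cons a u ih =>
    refine mul_pos (ih h.1) (Finset.prod_pos fun c hc => norm_pos_iff.2 (h.step_ne ?_))
    rintro rfl
    simp at hc

open ComplexOrder in
lemma pathN_swap (p : List (Fin N)) {u : List (Fin N)} {a b : Fin N} (hab : a ≠ b)
    (h1 : 0 ≤ fw q u a b) (h2 : 0 ≤ fw q u b a) :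
    pathN q (p ++ b :: a :: u) * fw q u b a = pathN q (p ++ a :: b :: u) * fw q u a b := by
  induction p with
  | nil =>
    have e1 := Complex.norm_of_nonneg' h1
    have e2 := Complex.norm_of_nonneg' h2
    rw [← e1, ← e2]
    norm_cast
    unfold fw
    simp only [List.nil_append, pathN, norm_div, norm_mul]
    have key : ∀ a b : Fin N, a ≠ b → ∏ c ∈ Finset.univ.erase b,
        ‖q * wt q (a :: u) b - wt q (a :: u) c‖ = ‖q * wt q u b - q * wt q u a‖ *
          ∏ c ∈ (Finset.univ.erase a).erase b, ‖q * wt q u b - wt q u c‖ := by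
      intro a b hab
      rw [← Finset.mul_prod_erase (Finset.univ.erase b) _ (a := a) (by simp [hab]), wt_cons_self,
        wt_cons_of_ne _ hab, Finset.erase_right_comm]
      congr 1
      refine Finset.prod_congr rfl fun c hc => ?_
      have : a ≠ c := by
        rintro rfl
        simp at hc
      rw [wt_cons_of_ne _ this]
    have key2 : ∀ a b : Fin N, a ≠ b → ∏ c ∈ Finset.univ.erase a,
        ‖q * wt q u a - wt q u c‖ = ‖q * wt q u a - wt q u b‖ *
          ∏ c ∈ (Finset.univ.erase a).erase b, ‖q * wt q u a - wt q u c‖ := by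
      intro a b hab
      rw [← Finset.mul_prod_erase (Finset.univ.erase a) _ (a := b) (by simp [hab.symm])]
    rw [key a b hab, key b a hab.symm, key2 a b hab, key2 b a hab.symm,
      Finset.erase_right_comm (a := b) (b := a), norm_sub_rev (q * wt q u b) (q * wt q u a),
      norm_sub_rev (wt q u b) (wt q u a)]
    ring
  | cons d p ih =>
    simp only [List.cons_append, pathN]
    have e : wt q (p ++ b :: a :: u) = wt q (p ++ a :: b :: u) :=
      wt_perm ((List.Perm.swap a b u).append_left p)
    rw [e]
    push_cast
    linear_combination (∏ c ∈ Finset.univ.erase d,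
      (‖q * wt q (p ++ a :: b :: u) d - wt q (p ++ a :: b :: u) c‖ : ℂ)) * ih

end

open ComplexOrder in
lemma pathW_nonneg {N K : ℕ} (hN : 2 ≤ N) (hK : 1 ≤ K) (w : List (Fin N)) :
    0 ≤ pathW (qpow N K 1) (qpow N K (1 / 2)) (qint N K N) w := by
  induction w with
  | nil => simp [pathW]
  | cons a u ih =>
    refine mul_nonneg ih ?_
    unfold stepW
    obtain ⟨x, hx, e⟩ := qint_N_pos hN hK
    rw [e, div_eq_mul_inv, ← Complex.ofReal_inv]
    refine mul_nonneg (Finset.prod_nonneg fun c _ => ?_)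
      (Complex.zero_le_real.2 (inv_pos.2 hx).le)
    have h1 : (qpow N K 1 * wt (qpow N K 1) u a - wt (qpow N K 1) u c) /
        (qpow N K (1 / 2) * (wt (qpow N K 1) u a - wt (qpow N K 1) u c)) =
        (qpow N K (1 / 2) + (qpow N K (1 / 2))⁻¹) * fw (qpow N K 1) u a c := by
      have hs := qpow_ne_zero N K (1 / 2)
      have hq := qpow_one_add_one_ne hN hK
      have e : qpow N K (1 / 2) + (qpow N K (1 / 2))⁻¹ = (qpow N K 1 + 1) / qpow N K (1 / 2) := by
        rw [← qpow_half_sq]; field_simp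
      rw [e]
      unfold fw
      rw [div_mul_div_comm, mul_left_comm (qpow N K (1 / 2)) (qpow N K 1 + 1),
        mul_div_mul_left _ _ hq]
    rw [h1, qpow_half_add_inv]
    exact mul_nonneg (Complex.zero_le_real.2 (by have := cos_theta_pos hN hK; positivity))
      (fw_nonneg hN hK u a c)

end

section

/-! ### The path representations and the Markov trace -/

section PathRepresentation

variable {N : ℕ} {q : ℂ}

lemma loc_split (p u : List (Fin N)) (F : List (Fin N) → ℂ) (a b : Fin N) :
    loc q u.length F (p ++ b :: a :: u) = if a = b then 0 else
      fw q u a b * F (p ++ b :: a :: u) + fw q u b a * F (p ++ a :: b :: u) := by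
  induction p generalizing F with
  | nil => exact loc_top F a b u
  | cons d p ih =>
    rw [List.cons_append, loc_cons (by simp; omega), ih]
    rfl

lemma exists_split {i : ℕ} {w : List (Fin N)} (h : i + 1 < w.length) :
    ∃ p a b u, w = p ++ b :: a :: u ∧ u.length = i := by
  induction w with
  | nil => simp at h
  | cons d w ih =>
    rcases exists_top h with ⟨a, b, u, e, hu⟩ | ⟨b, u, e, hu⟩
    · exact ⟨[], a, b, u, e, hu⟩
    · obtain ⟨rfl, rfl⟩ := List.cons.inj e
      obtain ⟨p, a, b, u, rfl, h'⟩ := ih hu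
      exact ⟨d :: p, a, b, u, rfl, h'⟩

variable (q) in
/-- The paths of length `n` inside the alcove. -/
abbrev Path (N : ℕ) (n : ℕ) : Type := {w : List (Fin N) // w.length = n ∧ Ok q w}

instance (n : ℕ) : Finite (Path q N n) :=
  ((List.finite_length_eq (Fin N) n).subset (fun _ h => h.1) :
    {w : List (Fin N) | w.length = n ∧ Ok q w}.Finite)

instance (n : ℕ) : Fintype (Path q N n) := Fintype.ofFinite _

open Classical in
/-- Extension by zero to all lists. -/
def extendZero {n : ℕ} (F : Path q N n → ℂ) (v : List (Fin N)) : ℂ :=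
  if h : v.length = n ∧ Ok q v then F ⟨v, h⟩ else 0

lemma extendZero_coe {n : ℕ} (F : Path q N n → ℂ) (w : Path q N n) :
    extendZero F w.1 = F w := dif_pos w.2

lemma extendZero_mk {n : ℕ} (F : Path q N n → ℂ) {v : List (Fin N)} (h : v.length = n ∧ Ok q v) :
    extendZero F v = F ⟨v, h⟩ := dif_pos h

lemma extendZero_neg {n : ℕ} (F : Path q N n → ℂ) {v : List (Fin N)}
    (h : ¬ (v.length = n ∧ Ok q v)) : extendZero F v = 0 := dif_neg h

lemma extendZero_single [DecidableEq (Path q N n)] (w : Path q N n) (v : List (Fin N)) :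
    extendZero (Pi.single w (1 : ℂ)) v = if v = w.1 then 1 else 0 := by
  by_cases h : v.length = n ∧ Ok q v
  · rw [extendZero_mk _ h, Pi.single_apply]
    simp only [Subtype.ext_iff]
  · rw [extendZero_neg _ h, if_neg]
    rintro rfl
    exact h w.2

/-- The operators of the idempotents on functions of paths. -/
def pathOp (q : ℂ) (N n i : ℕ) : Module.End ℂ (Path q N n → ℂ) where
  toFun F w := loc q i (extendZero F) w.1
  map_add' F G := by
    ext w
    refine (loc_congr i w.2.2 fun v hv h => ?_).trans (loc_add i _ _ _)
    have h' : v.length = n ∧ Ok q v := ⟨hv.length_eq.trans w.2.1, h⟩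
    simp only [extendZero_mk _ h', Pi.add_apply]
  map_smul' c F := by
    ext w
    refine (loc_congr i w.2.2 fun v hv h => ?_).trans (loc_mul i (fun _ => c) _ _ fun _ _ => rfl)
    have h' : v.length = n ∧ Ok q v := ⟨hv.length_eq.trans w.2.1, h⟩
    simp only [extendZero_mk _ h', Pi.smul_apply, smul_eq_mul]

lemma loc_extendZero {n : ℕ} {F : Path q N n → ℂ} {G : List (Fin N) → ℂ} (i : ℕ)
    (h : ∀ w, F w = G w.1) (w : Path q N n) : loc q i (extendZero F) w.1 = loc q i G w.1 := by
  refine loc_congr i w.2.2 fun v hv hv' => ?_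
  rw [extendZero_mk _ ⟨hv.length_eq.trans w.2.1, hv'⟩, h]

lemma pathOp_apply {n : ℕ} (i : ℕ) (F : Path q N n → ℂ) (w : Path q N n) :
    pathOp q N n i F w = loc q i (extendZero F) w.1 := rfl

lemma BraidGen.lt {n : ℕ} (i : BraidGen n) : i.1 + 1 < n := by exact_mod_cast i.2

end PathRepresentation

lemma exists_pathRep (N K : ℕ) (hN : 2 ≤ N) (hK : 1 ≤ K) (n : ℕ) :
    ∃ ρ : Hecke N K n →ₐ[ℂ] Module.End ℂ (Path (qpow N K 1) N n → ℂ),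
      ∀ i, ρ (Hecke.e N K i) = pathOp (qpow N K 1) N n i.1 := by
  have hq := qpow_one_add_one_ne hN hK
  refine Hecke.exists_hom_of_idem (by omega) hq _ (fun i => ?_) (fun i j h => ?_) (fun i j h => ?_)
  · refine LinearMap.ext fun F => funext fun w => ?_
    change loc _ _ _ _ = loc _ _ _ _
    rw [loc_extendZero i.1 (pathOp_apply _ F), loc_idem hq _ _ w.2.2]
  · refine LinearMap.ext fun F => funext fun w => ?_
    change loc _ _ _ _ = loc _ _ _ _
    rw [loc_extendZero i.1 (pathOp_apply _ F), loc_extendZero j.1 (pathOp_apply _ F),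
      loc_far h _ (by rw [w.2.1]; exact j.lt) w.2.2]
  · refine LinearMap.ext fun F => funext fun w => ?_
    change loc _ _ _ _ - tau _ * loc _ _ _ _ = loc _ _ _ _ - tau _ * loc _ _ _ _
    have key : ∀ i j : ℕ, loc (qpow N K 1) i (extendZero (pathOp (qpow N K 1) N n j
        (pathOp (qpow N K 1) N n i F))) w.1 =
        loc (qpow N K 1) i (loc (qpow N K 1) j (loc (qpow N K 1) i (extendZero F))) w.1 :=
      fun i j => loc_extendZero i (fun w => loc_extendZero j (pathOp_apply _ F) w) w
    rw [key, key, ← h]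
    exact loc_braid hq _ _ (by rw [w.2.1]; have := j.lt; omega) w.2.2

/-- The representation of `H_n` on functions of paths. -/
def pathRep (N K : ℕ) (hN : 2 ≤ N) (hK : 1 ≤ K) (n : ℕ) :
    Hecke N K n →ₐ[ℂ] Module.End ℂ (Path (qpow N K 1) N n → ℂ) :=
  (exists_pathRep N K hN hK n).choose

section PathTrace

open Classical

variable {N K : ℕ} (hN : 2 ≤ N) (hK : 1 ≤ K)

lemma pathRep_e {n : ℕ} (i : BraidGen n) :
    pathRep N K hN hK n (Hecke.e N K i) = pathOp (qpow N K 1) N n i.1 :=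
  (exists_pathRep N K hN hK n).choose_spec i

/-- The matrices of the path representation. -/
def pathMat (n : ℕ) : Hecke N K n →ₐ[ℂ]
    Matrix (Path (qpow N K 1) N n) (Path (qpow N K 1) N n) ℂ :=
  (LinearMap.toMatrixAlgEquiv' (R := ℂ)).toAlgHom.comp (pathRep N K hN hK n)

lemma pathMat_apply {n : ℕ} (x : Hecke N K n) (w w' : Path (qpow N K 1) N n) :
    pathMat hN hK n x w w' = pathRep N K hN hK n x (Pi.single w' 1) w := by
  change LinearMap.toMatrixAlgEquiv' _ w w' = _
  rw [LinearMap.toMatrixAlgEquiv'_apply]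
  congr 2

/-- The entries of the matrices of the idempotents. -/
lemma pathMat_e {n : ℕ} (i : BraidGen n) (w w' : Path (qpow N K 1) N n)
    {p u : List (Fin N)} {a b : Fin N} (hw : w.1 = p ++ b :: a :: u) (hu : u.length = i.1) :
    pathMat hN hK n (Hecke.e N K i) w w' = if a = b then 0 else
      fw (qpow N K 1) u a b * (if w = w' then 1 else 0) +
      fw (qpow N K 1) u b a * (if p ++ a :: b :: u = w'.1 then 1 else 0) := by
  rw [pathMat_apply, pathRep_e, pathOp_apply, hw, ← hu, loc_split, extendZero_single,
    extendZero_single, ← hw]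
  simp only [Subtype.ext_iff]

/-- Off-diagonal entries occur only for pairs of paths that differ by a transposition. -/
lemma pathMat_e_cases {n : ℕ} (i : BraidGen n) (w w' : Path (qpow N K 1) N n) (hne : w ≠ w') :
    (∃ p u a b, a ≠ b ∧ u.length = i.1 ∧ w.1 = p ++ b :: a :: u ∧ w'.1 = p ++ a :: b :: u) ∨
    (pathMat hN hK n (Hecke.e N K i) w w' = 0 ∧ pathMat hN hK n (Hecke.e N K i) w' w = 0) := by
  obtain ⟨p, a, b, u, hw, hu⟩ := exists_split (i := i.1) (w := w.1) (by rw [w.2.1]; exact i.lt)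
  obtain ⟨p', a', b', u', hw', hu'⟩ :=
    exists_split (i := i.1) (w := w'.1) (by rw [w'.2.1]; exact i.lt)
  by_cases h : p ++ a :: b :: u = w'.1 ∧ a ≠ b
  · exact Or.inl ⟨p, u, a, b, h.2, hu, hw, h.1.symm⟩
  by_cases h' : p' ++ a' :: b' :: u' = w.1 ∧ a' ≠ b'
  · exact Or.inl ⟨p', u', b', a', h'.2.symm, hu', h'.1.symm, hw'⟩
  · right
    rw [pathMat_e hN hK i w w' hw hu, pathMat_e hN hK i w' w hw' hu', if_neg hne,
      if_neg hne.symm]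
    constructor
    · split_ifs with h1 h2
      · rfl
      · exact absurd ⟨h2, h1⟩ h
      · simp
    · split_ifs with h1 h2
      · rfl
      · exact absurd ⟨h2, h1⟩ h'
      · simp

/-- The matrix of the weights of the paths. -/
def pathDiag (N K n : ℕ) : Matrix (Path (qpow N K 1) N n) (Path (qpow N K 1) N n) ℂ :=
  Matrix.diagonal fun w => pathW (qpow N K 1) (qpow N K (1 / 2)) (qint N K N) w.1

/-- The matrix of the norms of the paths. -/
def normDiag (N K n : ℕ) : Matrix (Path (qpow N K 1) N n) (Path (qpow N K 1) N n) ℂ :=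
  Matrix.diagonal fun w => (pathN (qpow N K 1) w.1 : ℂ)

lemma pathDiag_comm {n : ℕ} (x : Hecke N K n) :
    pathDiag N K n * pathMat hN hK n x = pathMat hN hK n x * pathDiag N K n := by
  induction x using Hecke.induction_e (qpow_one_add_one_ne hN hK) with
  | one => rw [map_one, mul_one, one_mul]
  | add x y hx hy => rw [map_add, mul_add, add_mul, hx, hy]
  | smul c x hx => rw [map_smul, mul_smul_comm, smul_mul_assoc, hx]
  | mul i x hx =>
    rw [map_mul, mul_assoc, ← hx, ← mul_assoc, ← mul_assoc]
    congr 1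
    ext w w'
    unfold pathDiag
    rw [Matrix.diagonal_mul, Matrix.mul_diagonal, mul_comm]
    rcases eq_or_ne w w' with rfl | hne
    · rfl
    rcases pathMat_e_cases hN hK i w w' hne with ⟨p, u, a, b, hab, -, hw, hw'⟩ | ⟨h, -⟩
    · rw [hw, hw', pathW_swap (qpow_half_sq N K) (qpow_ne_zero N K _) p hab (hw ▸ w.2.2)
        (hw' ▸ w'.2.2)]
    · rw [h, zero_mul, zero_mul]

open ComplexOrder in
lemma normDiag_adj {n : ℕ} (x : Hecke N K n) :
    normDiag N K n * pathMat hN hK n (Hecke.adj x) =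
      (pathMat hN hK n x).conjTranspose * normDiag N K n := by
  induction x using Hecke.induction_e (qpow_one_add_one_ne hN hK) with
  | one => simp
  | add x y hx hy => rw [Hecke.adj_add, map_add, map_add, mul_add, Matrix.conjTranspose_add,
      add_mul, hx, hy]
  | smul c x hx => rw [Hecke.adj_smul, map_smul, map_smul, mul_smul_comm, hx,
      Matrix.conjTranspose_smul, smul_mul_assoc]; rfl
  | mul i x hx =>
    rw [Hecke.adj_mul, map_mul, map_mul, ← mul_assoc, hx, Matrix.conjTranspose_mul, mul_assoc,
      mul_assoc, Hecke.adj_e N K (by omega)]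
    congr 1
    have hre : ∀ u (a b : Fin N), star (fw (qpow N K 1) u a b) = fw (qpow N K 1) u a b :=
      fun u a b => (IsSelfAdjoint.of_nonneg (fw_nonneg hN hK u a b))
    ext w w'
    unfold normDiag
    rw [Matrix.diagonal_mul, Matrix.mul_diagonal, Matrix.conjTranspose_apply]
    rcases eq_or_ne w w' with rfl | hne
    · obtain ⟨p, a, b, u, hw, hu⟩ := exists_split (i := i.1) (w := w.1) (by rw [w.2.1]; exact i.lt)
      rw [pathMat_e hN hK i w w hw hu, mul_comm]
      congr 1
      split_ifs <;> simp [hre]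
    rcases pathMat_e_cases hN hK i w w' hne with ⟨p, u, a, b, hab, hu, hw, hw'⟩ | ⟨h, h'⟩
    · rw [pathMat_e hN hK i w w' hw hu, pathMat_e hN hK i w' w hw' hu, if_neg hab, if_neg hab.symm,
        if_neg hne, if_neg hne.symm, if_pos hw'.symm, if_pos hw.symm]
      have := pathN_swap p hab (fw_nonneg hN hK u a b) (fw_nonneg hN hK u b a)
      rw [hw, hw']
      simp only [mul_zero, zero_add, mul_one, hre]
      rw [this, mul_comm]
    · rw [h, h', star_zero, zero_mul, mul_zero]

/-- The trace on `H_n`. -/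
def pathTrace (n : ℕ) : Hecke N K n →ₗ[ℂ] ℂ :=
  Matrix.traceLinearMap _ ℂ ℂ ∘ₗ LinearMap.mulLeft ℂ (pathDiag N K n) ∘ₗ
    (pathMat hN hK n).toLinearMap

lemma pathTrace_apply {n : ℕ} (x : Hecke N K n) :
    pathTrace hN hK n x = (pathDiag N K n * pathMat hN hK n x).trace := rfl

lemma pathTrace_eq_sum {n : ℕ} (x : Hecke N K n) :
    pathTrace hN hK n x = ∑ w, pathW (qpow N K 1) (qpow N K (1 / 2)) (qint N K N) w.1 *
      pathMat hN hK n x w w := by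
  rw [pathTrace_apply, Matrix.trace]
  simp only [Matrix.diag_apply, pathDiag, Matrix.diagonal_mul]

lemma pathTrace_mul_comm {n : ℕ} (x y : Hecke N K n) :
    pathTrace hN hK n (x * y) = pathTrace hN hK n (y * x) := by
  rw [pathTrace_apply, pathTrace_apply, map_mul, map_mul, ← mul_assoc, Matrix.trace_mul_comm,
    ← mul_assoc, ← mul_assoc, pathDiag_comm]

open ComplexOrder in
lemma pathTrace_nonneg {n : ℕ} (x : Hecke N K n) : 0 ≤ pathTrace hN hK n (Hecke.adj x * x) := by
  rw [pathTrace_eq_sum]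
  refine Finset.sum_nonneg fun w _ => mul_nonneg (pathW_nonneg hN hK w.1) ?_
  have h1 := pathN_pos w.2.2
  have h : (pathN (qpow N K 1) w.1 : ℂ) * pathMat hN hK n (Hecke.adj x * x) w w =
      ∑ w', star (pathMat hN hK n x w' w) * pathN (qpow N K 1) w'.1 *
        pathMat hN hK n x w' w := by
    have h0 : normDiag N K n * pathMat hN hK n (Hecke.adj x * x) =
        (pathMat hN hK n x).conjTranspose * (normDiag N K n * pathMat hN hK n x) := by
      rw [map_mul, ← mul_assoc, normDiag_adj, mul_assoc]
    have h2 := congrFun₂ h0 w w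
    unfold normDiag at h2
    rw [Matrix.diagonal_mul, Matrix.mul_apply] at h2
    rw [h2]
    refine Finset.sum_congr rfl fun w' _ => ?_
    rw [Matrix.diagonal_mul, Matrix.conjTranspose_apply, mul_assoc]
  have h2 : pathMat hN hK n (Hecke.adj x * x) w w = ((pathN (qpow N K 1) w.1)⁻¹ : ℝ) *
      ∑ w', star (pathMat hN hK n x w' w) * pathN (qpow N K 1) w'.1 *
        pathMat hN hK n x w' w := by
    rw [← h, ← mul_assoc, ← Complex.ofReal_mul, inv_mul_cancel₀ h1.ne', Complex.ofReal_one, one_mul]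
  rw [h2]
  refine mul_nonneg (Complex.zero_le_real.2 (inv_pos.2 h1).le) (Finset.sum_nonneg fun w' _ => ?_)
  rw [mul_right_comm]
  exact mul_nonneg (star_mul_self_nonneg _) (Complex.zero_le_real.2 (pathN_pos w'.2.2).le)

/-! ### Restriction of the path representations -/

lemma Hecke.mapLE_e {n m : ℕ} (h : n ≤ m) (i : BraidGen n) :
    Hecke.mapLE N K h (Hecke.e N K i) = Hecke.e N K (i.castLE h) := by
  unfold Hecke.e
  rw [map_smul, map_sub, map_smul, map_smul, map_one, Hecke.mapLE_sigma]

/-- Restriction to the paths with a given last step. -/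
def restrictStep {q : ℂ} {n : ℕ} (b : Fin N) (F : Path q N (n + 1) → ℂ) : Path q N n → ℂ :=
  fun w => extendZero F (b :: w.1)

lemma pathRep_mapLE {n : ℕ} (x : Hecke N K n) (F : Path (qpow N K 1) N (n + 1) → ℂ) (b : Fin N)
    (w : Path (qpow N K 1) N n) (h : Ok (qpow N K 1) (b :: w.1)) :
    pathRep N K hN hK (n + 1) (Hecke.mapLE N K (Nat.le_succ n) x) F
        ⟨b :: w.1, by simp [w.2.1], h⟩ =
      pathRep N K hN hK n x (restrictStep b F) w := by
  induction x using Hecke.induction_e (qpow_one_add_one_ne hN hK) generalizing F w with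
  | one =>
    rw [map_one, map_one, map_one, Module.End.one_apply, Module.End.one_apply, restrictStep,
      extendZero_mk]
  | add x y hx hy =>
    rw [map_add, map_add, map_add, LinearMap.add_apply, LinearMap.add_apply, Pi.add_apply,
      Pi.add_apply, hx _ _ h, hy _ _ h]
  | smul c x hx =>
    rw [map_smul, map_smul, map_smul, LinearMap.smul_apply, LinearMap.smul_apply, Pi.smul_apply,
      Pi.smul_apply, hx _ _ h]
  | mul i x hx =>
    rw [map_mul, map_mul, map_mul, Hecke.mapLE_e, pathRep_e, pathRep_e, Module.End.mul_apply,
      Module.End.mul_apply, pathOp_apply, pathOp_apply]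
    change loc _ i.1 _ (b :: w.1) = _
    rw [loc_cons (by rw [w.2.1]; exact i.lt)]
    refine loc_congr _ w.2.2 fun v hv hv' => ?_
    have h1 : v.length = n := hv.length_eq.trans w.2.1
    have h2 := Ok.cons_perm hv.symm hv' h
    rw [extendZero_mk _ ⟨h1, hv'⟩, extendZero_mk _ ⟨by simp [h1], h2⟩]
    exact hx F ⟨v, h1, hv'⟩ h2

lemma sum_path_succ {q : ℂ} {n : ℕ} (g : Path q N (n + 1) → ℂ) :
    ∑ w, g w = ∑ w : Path q N n, ∑ b, extendZero g (b :: w.1) := by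
  rw [← Finset.sum_product']
  symm
  let e : Path q N (n + 1) → Path q N n × Fin N := fun w =>
    (⟨w.1.tail, by simp [w.2.1], by
      rcases w with ⟨_ | ⟨b, u⟩, h⟩
      · simp at h
      · exact h.2.1⟩, w.1.head (by rintro e; have := w.2.1; simp [e] at this))
  have he : ∀ w, (e w).2 :: (e w).1.1 = w.1 := by
    intro w
    simp [e]
  refine (Finset.sum_of_injOn e (fun w _ w' _ h => ?_) (fun _ _ => by simp)
    (fun x _ hx => ?_) (fun w _ => ?_)).symm
  · rw [Subtype.ext_iff, ← he w, ← he w', h]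
  · refine extendZero_neg _ fun h => hx ⟨⟨_, h⟩, by simp, ?_⟩
    simp [e]
  · rw [he, extendZero_coe]

lemma extendZero_pathTrace {n : ℕ} (y : Hecke N K (n + 1 : ℕ)) (w : Path (qpow N K 1) N n)
    (b : Fin N) (c : ℂ)
    (h : ∀ h : (b :: w.1).length = n + 1 ∧ Ok (qpow N K 1) (b :: w.1),
      pathMat hN hK (n + 1) y ⟨b :: w.1, h⟩ ⟨b :: w.1, h⟩ = c) :
    extendZero (fun w => pathW (qpow N K 1) (qpow N K (1 / 2)) (qint N K N) w.1 *
      pathMat hN hK (n + 1) y w w) (b :: w.1) =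
      pathW (qpow N K 1) (qpow N K (1 / 2)) (qint N K N) w.1 *
      (stepW (qpow N K 1) (qpow N K (1 / 2)) (qint N K N) w.1 b * c) := by
  by_cases hb : (b :: w.1).length = n + 1 ∧ Ok (qpow N K 1) (b :: w.1)
  · rw [extendZero_mk _ hb, h hb, pathW, mul_assoc]
  · rw [extendZero_neg _ hb, stepW_eq_zero w.2.2, zero_mul, mul_zero]
    exact fun h => hb ⟨by simp [w.2.1], h⟩

lemma qint_N_ne_zero {N K : ℕ} (hN : 2 ≤ N) (hK : 1 ≤ K) : qint N K N ≠ 0 := by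
  obtain ⟨x, hx, e⟩ := qint_N_pos hN hK
  rw [e]
  exact_mod_cast hx.ne'

lemma pathTrace_mapLE {n : ℕ} (x : Hecke N K n) :
    pathTrace hN hK (n + 1) (Hecke.mapLE N K (Nat.le_succ n) x) = pathTrace hN hK n x := by
  rw [pathTrace_eq_sum, pathTrace_eq_sum, sum_path_succ]
  refine Finset.sum_congr rfl fun w _ => ?_
  rw [Finset.sum_congr rfl fun b _ => extendZero_pathTrace hN hK _ w b (pathMat hN hK n x w w)
    fun h => ?_]
  · rw [← Finset.mul_sum, ← Finset.sum_mul, stepW_sum (qpow_ne_zero N K _) (qpow_one_ne_one hN hK)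
      (qpow_ne_zero N K _) (qint_N_ne_zero hN hK) (qint_N_eq hN hK) w.2.2, one_mul]
  · rw [pathMat_apply, pathMat_apply, pathRep_mapLE hN hK x _ b w h.2]
    have : restrictStep b (Pi.single ⟨b :: w.1, h⟩ 1) = Pi.single w (1 : ℂ) := by
      ext v
      rw [restrictStep, extendZero_single, Pi.single_apply]
      simp [Subtype.ext_iff]
    rw [this]

lemma eta_eq : eta N K = (qpow N K 1 - qpow N K 1 ^ N) /
    ((1 + qpow N K 1) * (1 - qpow N K 1 ^ N)) := by
  unfold eta
  rw [← qpow_natCast_mul, mul_one]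

lemma pathTrace_markov {n : ℕ} (x : Hecke N K (n + 1 : ℕ)) :
    pathTrace hN hK (n + 2) (Hecke.mapLE N K (Nat.le_succ _) x *
      Hecke.e N K (BraidGen.last n)) = eta N K * pathTrace hN hK (n + 1) x := by
  rw [pathTrace_eq_sum, pathTrace_eq_sum, sum_path_succ, Finset.mul_sum]
  refine Finset.sum_congr rfl fun w _ => ?_
  obtain ⟨a, u, hw⟩ : ∃ a u, w.1 = a :: u := by
    rcases w with ⟨_ | ⟨a, u⟩, h⟩
    · simp at h
    · exact ⟨a, u, rfl⟩
  rw [Finset.sum_congr rfl fun b _ => extendZero_pathTrace hN hK _ w b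
    ((if a = b then 0 else fw (qpow N K 1) u a b) * pathMat hN hK (n + 1) x w w) fun h => ?_]
  · simp only [← mul_assoc]
    rw [← Finset.sum_mul]
    simp only [mul_assoc]
    rw [← Finset.mul_sum, hw]
    rw [stepW_markov (qpow_ne_zero N K _) (qpow_one_ne_one hN hK) (qpow_one_add_one_ne hN hK)
      (qpow_ne_zero N K _) (qint_N_ne_zero hN hK) hN (qint_N_eq hN hK) (hw ▸ w.2.2), eta_eq]
    ring
  · rw [pathMat_apply, pathMat_apply, map_mul, Module.End.mul_apply,
      pathRep_mapLE hN hK x _ b w h.2]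
    have : restrictStep b (pathRep N K hN hK (n + 1 + 1) (Hecke.e N K (BraidGen.last n))
        (Pi.single ⟨b :: w.1, h⟩ 1)) =
        (if a = b then 0 else fw (qpow N K 1) u a b) • Pi.single w (1 : ℂ) := by
      ext v
      obtain ⟨a', u', hv⟩ : ∃ a' u', v.1 = a' :: u' := by
        rcases v with ⟨_ | ⟨a, u⟩, h⟩
        · simp at h
        · exact ⟨a, u, rfl⟩
      have hu' : u'.length = n := by have := v.2.1; rw [hv] at this; simpa using this
      rw [restrictStep, Pi.smul_apply, Pi.single_apply, smul_eq_mul]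
      by_cases hb : (b :: v.1).length = n + 1 + 1 ∧ Ok (qpow N K 1) (b :: v.1)
      · rw [extendZero_mk _ hb, pathRep_e, pathOp_apply]
        simp only [BraidGen.last]
        have key := loc_top (q := qpow N K 1)
          (extendZero (Pi.single (⟨b :: w.1, h⟩ : Path (qpow N K 1) N (n + 1 + 1)) 1)) a' b u'
        rw [hu'] at key
        rw [hv, key, extendZero_single, extendZero_single]
        simp only [Subtype.ext_iff, hw, hv, List.cons.injEq, true_and]
        by_cases e1 : a' = a
        · by_cases e2 : u' = u
          · subst e1 e2
            by_cases e3 : a' = b <;> simp [e3]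
          · simp [e1, e2]
        · by_cases e3 : a' = b
          · subst e3
            simp [e1]
          · simp [e1, e3]
      · rw [extendZero_neg _ hb, if_neg (c := v = w), mul_zero]
        rintro rfl
        exact hb h
    rw [this, map_smul, Pi.smul_apply, smul_eq_mul]

end PathTrace

/-- There is a positive Markov trace. -/
lemma exists_markovTrace {N K : ℕ} (hN : 2 ≤ N) (hK : 1 ≤ K) :
    ∃ Tr : Hecke N K ⊤ →ₗ[ℂ] ℂ, IsMarkovTrace N K (eta N K) Tr ∧
      ∀ x, 0 ≤ (Tr (Hecke.adj x * x)).re ∧ (Tr (Hecke.adj x * x)).im = 0 := by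
  obtain ⟨Tr, hTr⟩ := Hecke.exists_extension N K (pathTrace hN hK)
    fun n x => pathTrace_mapLE hN hK x
  refine ⟨Tr, ⟨fun x y => ?_, ?_, fun n x => ?_⟩, fun x => ?_⟩
  · obtain ⟨n, x, rfl⟩ := Hecke.exists_incl N K x
    obtain ⟨m, y, rfl⟩ := Hecke.exists_incl N K y
    rw [← Hecke.incl_mapLE N K (le_max_left n m), ← Hecke.incl_mapLE N K (le_max_right n m),
      ← map_mul, ← map_mul, hTr, hTr, pathTrace_mul_comm]
  · rw [← map_one (Hecke.incl N K 0), hTr, pathTrace_eq_sum, map_one]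
    have : ∀ w : Path (qpow N K 1) N 0, w = ⟨[], rfl, ok_nil hN hK⟩ := by
      intro w
      exact Subtype.ext (List.length_eq_zero_iff.1 w.2.1)
    rw [Finset.sum_eq_single_of_mem ⟨[], rfl, ok_nil hN hK⟩ (Finset.mem_univ _)
      fun w _ h => absurd (this w) h]
    simp [pathW]
  · have e : Hecke.e N K (BraidGen.top n) = Hecke.incl N K (n + 2) (Hecke.e N K (BraidGen.last n)) := by
      unfold Hecke.e
      rw [map_smul, map_sub, map_smul, map_smul, map_one, Hecke.incl_sigma]
      rfl
    rw [← Hecke.incl_mapLE N K (Nat.le_succ (n + 1)), e, ← map_mul, hTr, pathTrace_markov,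
      Hecke.incl_mapLE, hTr]
  · obtain ⟨n, x, rfl⟩ := Hecke.exists_incl N K x
    rw [← Hecke.incl_adj, ← map_mul, hTr]
    have := Complex.nonneg_iff.1 (pathTrace_nonneg hN hK x)
    exact ⟨this.1, this.2.symm⟩

end

section

/-! ### State sums of diagrams

Diagrams act on functions of words in `Fin N`, by pull-back along their matrices. -/

section StateSum

variable {N : ℕ}

/-- The operator `op` with `k` strands to its left. -/
def opAtFun (op : Module.End ℂ (List (Fin N) → ℂ)) :
    ℕ → (List (Fin N) → ℂ) → List (Fin N) → ℂ
  | 0, F, w => op F w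
  | k + 1, F, c :: w => opAtFun op k (fun v => F (c :: v)) w
  | _ + 1, _, [] => 0

/-- The operator `op` with `k` strands to its left, as a linear map. -/
def opAt (k : ℕ) (op : Module.End ℂ (List (Fin N) → ℂ)) : Module.End ℂ (List (Fin N) → ℂ) where
  toFun := opAtFun op k
  map_add' F G := by
    ext w
    induction k generalizing F G w with
    | zero => exact congrFun (map_add op F G) w
    | succ k ih =>
      cases w with
      | nil => simp [opAtFun]
      | cons c w => exact ih _ _ w
  map_smul' x F := by
    ext w
    induction k generalizing F w with
    | zero => exact congrFun (map_smul op x F) w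
    | succ k ih =>
      cases w with
      | nil => simp [opAtFun]
      | cons c w => exact ih _ w

lemma opAt_zero (op : Module.End ℂ (List (Fin N) → ℂ)) (F : List (Fin N) → ℂ) :
    opAt 0 op F = op F := rfl

lemma opAt_cons (op : Module.End ℂ (List (Fin N) → ℂ)) (k : ℕ) (F : List (Fin N) → ℂ) (c : Fin N)
    (w : List (Fin N)) : opAt (k + 1) op F (c :: w) = opAt k op (fun v => F (c :: v)) w := rfl

lemma opAt_append (op : Module.End ℂ (List (Fin N) → ℂ)) (k : ℕ) (F : List (Fin N) → ℂ)
    (l w : List (Fin N)) :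
    opAt (l.length + k) op F (l ++ w) = opAt k op (fun v => F (l ++ v)) w := by
  induction l generalizing F with
  | nil => simp
  | cons c l ih =>
    rw [List.length_cons, add_right_comm, List.cons_append, opAt_cons, ih]
    rfl

/-- The operator `op` acts at `b` by a finite sum over words of length `m`. -/
def IsLocal (op : Module.End ℂ (List (Fin N) → ℂ)) (b : List (Fin N)) (m : ℕ) : Prop :=
  ∃ (ι : Type) (S : Finset ι) (t : ι → List (Fin N)) (c : ι → ℂ), (∀ i, (t i).length = m) ∧
    ∀ F r, op F (b ++ r) = ∑ i ∈ S, c i * F (t i ++ r)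

lemma IsLocal.one (b : List (Fin N)) : IsLocal 1 b b.length :=
  ⟨Unit, {()}, fun _ => b, fun _ => 1, fun _ => rfl, fun F r => by simp⟩

lemma IsLocal.mul {op op' : Module.End ℂ (List (Fin N) → ℂ)} {b : List (Fin N)} {m m' : ℕ}
    (h : IsLocal op b m) (h' : ∀ b', b'.length = m → IsLocal op' b' m') :
    IsLocal (op * op') b m' := by
  obtain ⟨ι, S, t, c, hl, h⟩ := h
  choose ι' S' t' c' hl' h' using fun i => h' (t i) (hl i)
  refine ⟨Σ i, ι' i, S.sigma S', fun x => t' x.1 x.2, fun x => c x.1 * c' x.1 x.2,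
    fun x => hl' _ _, fun F r => ?_⟩
  rw [Module.End.mul_apply, h, Finset.sum_sigma]
  refine Finset.sum_congr rfl fun i _ => ?_
  rw [h', Finset.mul_sum]
  exact Finset.sum_congr rfl fun j _ => (mul_assoc _ _ _).symm

lemma IsLocal.sum {κ : Type} (T : Finset κ) (op : κ → Module.End ℂ (List (Fin N) → ℂ)) (x : κ → ℂ)
    {b : List (Fin N)} {m : ℕ} (h : ∀ j, IsLocal (op j) b m) :
    IsLocal (∑ j ∈ T, x j • op j) b m := by
  choose ι S t c hl h using h
  refine ⟨Σ j, ι j, T.sigma S, fun y => t y.1 y.2, fun y => x y.1 * c y.1 y.2, fun y => hl _ _,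
    fun F r => ?_⟩
  rw [Finset.sum_sigma, LinearMap.sum_apply, Finset.sum_apply]
  refine Finset.sum_congr rfl fun j _ => ?_
  rw [LinearMap.smul_apply, Pi.smul_apply, h, smul_eq_mul, Finset.mul_sum]
  exact Finset.sum_congr rfl fun i _ => (mul_assoc _ _ _).symm

lemma IsLocal.opAt {op : Module.End ℂ (List (Fin N) → ℂ)} {l b r : List (Fin N)} {m : ℕ}
    (h : IsLocal op b m) : IsLocal (opAt l.length op) (l ++ b ++ r) (l.length + m + r.length) := by
  obtain ⟨ι, S, t, c, hl, h⟩ := h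
  refine ⟨ι, S, fun i => l ++ t i ++ r, c, fun i => by simp [hl, add_assoc], fun F r' => ?_⟩
  have := opAt_append op 0 F l (b ++ (r ++ r'))
  rw [add_zero] at this
  simp only [List.append_assoc]
  rw [this, opAt_zero, h]

lemma IsLocal.congr {op : Module.End ℂ (List (Fin N) → ℂ)} {b : List (Fin N)} {m : ℕ}
    (h : IsLocal op b m) {F G : List (Fin N) → ℂ} (r : List (Fin N))
    (hFG : ∀ v, v.length = m + r.length → F v = G v) : op F (b ++ r) = op G (b ++ r) := by
  obtain ⟨ι, S, t, c, hl, h⟩ := h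
  rw [h, h]
  exact Finset.sum_congr rfl fun i _ => by rw [hFG _ (by simp [hl])]

/-- Operators at distant places commute. -/
lemma IsLocal.comm {op op' : Module.End ℂ (List (Fin N) → ℂ)} {b : List (Fin N)} {m : ℕ}
    (h : IsLocal op b m) (k : ℕ) (F : List (Fin N) → ℂ) (r : List (Fin N)) :
    op (SkeinSU.opAt (m + k) op' F) (b ++ r) =
      SkeinSU.opAt (b.length + k) op' (op F) (b ++ r) := by
  obtain ⟨ι, S, t, c, hl, h⟩ := h
  rw [h, opAt_append]
  have e : (fun v => op F (b ++ v)) = ∑ i ∈ S, c i • fun v => F (t i ++ v) := by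
    ext v
    rw [h, Finset.sum_apply]
    rfl
  rw [e, map_sum, Finset.sum_apply]
  refine Finset.sum_congr rfl fun i _ => ?_
  rw [map_smul, Pi.smul_apply, smul_eq_mul, ← hl i, opAt_append]

/-! ### The operators of crossings, cups and caps -/

/-- The normalization of the crossings. -/
def crossScale (g : ℂ) : Bool → ℂ
  | true => g⁻¹
  | false => g

/-- The matrix entry of a crossing for strands with equal labels. -/
def crossSame (s : ℂ) : Bool → ℂ
  | true => s
  | false => s⁻¹

/-- The matrix entry of a crossing for different labels that are not exchanged. -/
def crossStay (s : ℂ) (p : Bool) (a b : Fin N) : ℂ :=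
  if p then (if b < a then s - s⁻¹ else 0) else (if a < b then s⁻¹ - s else 0)

/-- The operator of a crossing. -/
def crossOp (N : ℕ) (g s : ℂ) (p : Bool) : Module.End ℂ (List (Fin N) → ℂ) where
  toFun F
    | a :: b :: r => crossScale g p * (if a = b then crossSame s p * F (a :: a :: r) else
        F (b :: a :: r) + crossStay s p a b * F (a :: b :: r))
    | _ => 0
  map_add' F G := by
    ext w
    rcases w with _ | ⟨a, _ | ⟨b, r⟩⟩
    · simp
    · simp
    · simp only [Pi.add_apply]
      split_ifs <;> ring
  map_smul' x F := by
    ext w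
    rcases w with _ | ⟨a, _ | ⟨b, r⟩⟩
    · simp
    · simp
    · simp only [Pi.smul_apply, RingHom.id_apply, smul_eq_mul]
      split_ifs <;> ring

lemma crossOp_apply (g s : ℂ) (p : Bool) (F : List (Fin N) → ℂ) (a b : Fin N)
    (r : List (Fin N)) : crossOp N g s p F (a :: b :: r) =
      crossScale g p * (if a = b then crossSame s p * F (a :: a :: r) else
        F (b :: a :: r) + crossStay s p a b * F (a :: b :: r)) := rfl

/-- The quantum dimension weights. -/
def kap (s : ℂ) (a : Fin N) : ℂ := s ^ ((N : ℤ) - 1 - 2 * a.val)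

/-- The matrix entries of cups. -/
def cupCoef (s : ℂ) (e : Bool) (a : Fin N) : ℂ := if e then 1 else (kap s a)⁻¹

/-- The matrix entries of caps. -/
def capCoef (s : ℂ) (e : Bool) (a : Fin N) : ℂ := if e then kap s a else 1

/-- The operator of a local minimum. -/
def cupOp (N : ℕ) (s : ℂ) (e : Bool) : Module.End ℂ (List (Fin N) → ℂ) where
  toFun F r := ∑ a, cupCoef s e a * F (a :: a :: r)
  map_add' F G := by
    ext r
    simp only [Pi.add_apply, mul_add, Finset.sum_add_distrib]
  map_smul' x F := by
    ext r
    simp only [Pi.smul_apply, RingHom.id_apply, smul_eq_mul, Finset.mul_sum]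
    exact Finset.sum_congr rfl fun a _ => mul_left_comm _ _ _

lemma cupOp_apply (s : ℂ) (e : Bool) (F : List (Fin N) → ℂ) (r : List (Fin N)) :
    cupOp N s e F r = ∑ a, cupCoef s e a * F (a :: a :: r) := rfl

/-- The operator of a local maximum. -/
def capOp (N : ℕ) (s : ℂ) (e : Bool) : Module.End ℂ (List (Fin N) → ℂ) where
  toFun F
    | a :: b :: r => if a = b then capCoef s e a * F r else 0
    | _ => 0
  map_add' F G := by
    ext w
    rcases w with _ | ⟨a, _ | ⟨b, r⟩⟩
    · simp
    · simp
    · simp only [Pi.add_apply]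
      split_ifs <;> ring
  map_smul' x F := by
    ext w
    rcases w with _ | ⟨a, _ | ⟨b, r⟩⟩
    · simp
    · simp
    · simp only [Pi.smul_apply, RingHom.id_apply, smul_eq_mul]
      split_ifs <;> ring

lemma capOp_apply (s : ℂ) (e : Bool) (F : List (Fin N) → ℂ) (a b : Fin N) (r : List (Fin N)) :
    capOp N s e F (a :: b :: r) = if a = b then capCoef s e a * F r else 0 := rfl

lemma isLocal_crossOp (g s : ℂ) (p : Bool) (a b : Fin N) : IsLocal (crossOp N g s p) [a, b] 2 := by
  by_cases h : a = b
  · refine ⟨Unit, {()}, fun _ => [a, a], fun _ => crossScale g p * crossSame s p, fun _ => rfl,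
      fun F r => ?_⟩
    simp [crossOp_apply, h, mul_assoc]
  · refine ⟨Bool, Finset.univ, fun e => if e then [b, a] else [a, b],
      fun e => crossScale g p * if e then 1 else crossStay s p a b,
      fun e => by cases e <;> rfl, fun F r => ?_⟩
    simp [crossOp_apply, h]
    ring

lemma isLocal_cupOp (s : ℂ) (e : Bool) : IsLocal (cupOp N s e) [] 2 :=
  ⟨Fin N, Finset.univ, fun a => [a, a], cupCoef s e, fun _ => rfl, fun _ _ => rfl⟩

lemma isLocal_capOp (s : ℂ) (e : Bool) (a b : Fin N) : IsLocal (capOp N s e) [a, b] 0 := by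
  refine ⟨Unit, {()}, fun _ => [], fun _ => if a = b then capCoef s e a else 0, fun _ => rfl,
    fun F r => ?_⟩
  simp [capOp_apply]

/-- The operator of a word of positive crossings. -/
def braidOp (N : ℕ) (g s : ℂ) (u : List ℕ) : Module.End ℂ (List (Fin N) → ℂ) :=
  (u.map fun i => opAt i (crossOp N g s true)).prod

lemma braidOp_cons (g s : ℂ) (i : ℕ) (u : List ℕ) :
    braidOp N g s (i :: u) = opAt i (crossOp N g s true) * braidOp N g s u := by
  simp [braidOp]

lemma isLocal_opAt_crossOp (g s : ℂ) (p : Bool) {i : ℕ} {b : List (Fin N)} (h : i + 1 < b.length) :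
    IsLocal (opAt i (crossOp N g s p)) b b.length := by
  obtain ⟨l, x, y, r, rfl, hl⟩ : ∃ l x y r, b = l ++ [x, y] ++ r ∧ l.length = i :=
    ⟨b.take i, b[i], b[i + 1], b.drop (i + 2), by
      rw [List.append_assoc]
      conv_lhs => rw [← List.take_append_drop i b]
      rw [List.drop_eq_getElem_cons (by omega), List.drop_eq_getElem_cons (by omega)]
      rfl, by simp; omega⟩
  subst hl
  have := (isLocal_crossOp g s p x y).opAt (l := l) (r := r)
  rwa [show l.length + 2 + r.length = (l ++ [x, y] ++ r).length by simp; omega] at this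

lemma isLocal_braidOp (g s : ℂ) {u : List ℕ} {b : List (Fin N)} (h : ∀ i ∈ u, i + 1 < b.length) :
    IsLocal (braidOp N g s u) b b.length := by
  induction u generalizing b with
  | nil => exact IsLocal.one b
  | cons i u ih =>
    rw [braidOp_cons]
    refine (isLocal_opAt_crossOp g s true (h i (by simp))).mul fun b' hb' => ?_
    rw [← hb'] at h ⊢
    exact ih fun j hj => h j (by simp [hj])

/-- A reduced word of a permutation. -/
def redWord (π : Equiv.Perm (Fin N)) : List {i : ℕ // i + 1 < N} := (exists_isReduced π).choose

lemma isReduced_redWord (π : Equiv.Perm (Fin N)) : IsReduced π (redWord π) :=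
  (exists_isReduced π).choose_spec

/-- The antisymmetrizer, up to a scalar. -/
def antiOp (N : ℕ) (g s : ℂ) : Module.End ℂ (List (Fin N) → ℂ) :=
  ∑ π : Equiv.Perm (Fin N), (-(g * s⁻¹)) ^ ell π • braidOp N g s ((redWord π).map Subtype.val)

lemma isLocal_antiOp (g s : ℂ) {b : List (Fin N)} (h : b.length = N) :
    IsLocal (antiOp N g s) b N := by
  refine IsLocal.sum _ _ _ fun π => ?_
  have := isLocal_braidOp g s (u := (redWord π).map Subtype.val) (b := b) (by
    intro i hi
    obtain ⟨j, -, rfl⟩ := List.mem_map.1 hi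
    rw [h]
    exact j.2)
  rwa [h] at this

/-- The operator of the coupon with incoming bands. -/
def inOp (N : ℕ) (s : ℂ) : Module.End ℂ (List (Fin N) → ℂ) where
  toFun F w := antiSign (-s⁻¹) (w.take N) * F (w.drop N)
  map_add' F G := by ext w; simp [mul_add]
  map_smul' x F := by ext w; simp [mul_left_comm]

/-- The operator of the coupon with outgoing bands. -/
def outOp (N : ℕ) (g s κ : ℂ) : Module.End ℂ (List (Fin N) → ℂ) where
  toFun F r := κ * antiOp N g s F (List.finRange N ++ r)
  map_add' F G := by ext w; simp [mul_add]
  map_smul' x F := by ext w; simp [mul_left_comm]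

lemma inOp_apply (s : ℂ) (F : List (Fin N) → ℂ) {w : List (Fin N)} (hw : w.length = N)
    (r : List (Fin N)) : inOp N s F (w ++ r) = antiSign (-s⁻¹) w * F r := by
  change antiSign _ ((w ++ r).take N) * F ((w ++ r).drop N) = _
  rw [List.take_left' hw, List.drop_left' hw]

lemma outOp_apply (g s κ : ℂ) (F : List (Fin N) → ℂ) (r : List (Fin N)) :
    outOp N g s κ F r = κ * antiOp N g s F (List.finRange N ++ r) := rfl

/-- The operator of a piece of a diagram. -/
def pieceOp (N : ℕ) (g s κ : ℂ) : Piece → Module.End ℂ (List (Fin N) → ℂ)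
  | .cross p => crossOp N g s p
  | .cup e => cupOp N s e
  | .cap e => capOp N s e
  | .couponIn => inOp N s
  | .couponOut => outOp N g s κ

lemma isLocal_pieceOp (g s κ : ℂ) (x : Piece) {b : List (Fin N)} (h : b.length = (x.bot N).length) :
    IsLocal (pieceOp N g s κ x) b (x.top N).length := by
  cases x with
  | cross p =>
    obtain ⟨x, y, rfl⟩ := List.length_eq_two.1 h
    exact isLocal_crossOp g s p x y
  | cup e =>
    obtain rfl := List.length_eq_zero_iff.1 h
    exact isLocal_cupOp s e
  | cap e =>
    obtain ⟨x, y, rfl⟩ := List.length_eq_two.1 h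
    exact isLocal_capOp s e x y
  | couponIn =>
    have h' : b.length = N := by simpa [Piece.bot] using h
    exact ⟨Unit, {()}, fun _ => [], fun _ => antiSign (-s⁻¹) b, fun _ => rfl,
      fun F r => by simp [pieceOp, inOp_apply s F h']⟩
  | couponOut =>
    obtain rfl := List.length_eq_zero_iff.1 h
    obtain ⟨ι, S, t, c, hl, h⟩ := isLocal_antiOp (N := N) g s (b := List.finRange N) (by simp)
    refine ⟨ι, S, t, fun i => κ * c i, fun i => by simp [hl, Piece.top], fun F r => ?_⟩
    simp only [pieceOp, outOp_apply, List.nil_append, h, Finset.mul_sum, mul_assoc]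

/-- The operator of a word of layers. -/
def wordOp (N : ℕ) (g s κ : ℂ) (w : List Layer) : Module.End ℂ (List (Fin N) → ℂ) :=
  (w.map fun x => opAt x.1 (pieceOp N g s κ x.2)).prod

variable (g s κ : ℂ)

lemma wordOp_nil (F : List (Fin N) → ℂ) : wordOp N g s κ [] F = F := rfl

lemma wordOp_cons (x : Layer) (w : List Layer) (F : List (Fin N) → ℂ) :
    wordOp N g s κ (x :: w) F = opAt x.1 (pieceOp N g s κ x.2) (wordOp N g s κ w F) := by
  simp [wordOp]

lemma wordOp_append (w w' : List Layer) (F : List (Fin N) → ℂ) :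
    wordOp N g s κ (w ++ w') F = wordOp N g s κ w (wordOp N g s κ w' F) := by
  simp [wordOp]

lemma wordOp_sh (w : List Layer) (F : List (Fin N) → ℂ) (l v : List (Fin N)) :
    wordOp N g s κ (sh l.length w) F (l ++ v) = wordOp N g s κ w (fun t => F (l ++ t)) v := by
  induction w generalizing v with
  | nil => rfl
  | cons x w ih =>
    change wordOp N g s κ ((l.length + x.1, x.2) :: sh l.length w) F (l ++ v) = _
    rw [wordOp_cons, wordOp_cons, opAt_append]
    exact congrArg (fun G => opAt x.1 (pieceOp N g s κ x.2) G v) (funext ih)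

lemma Layer.Leads.length {x : Layer} {a b : List Bool} (h : Layer.Leads N x a b) :
    x.1 + (x.2.bot N).length ≤ a.length ∧
      a.length + (x.2.top N).length = b.length + (x.2.bot N).length := by
  obtain ⟨l, r, h1, rfl, rfl⟩ := h
  simp only [List.length_append, h1]
  omega

lemma layer_congr {x : Layer} {a b : List Bool} (h : Layer.Leads N x a b)
    {F G : List (Fin N) → ℂ} {v : List (Fin N)} (hv : v.length = a.length)
    (hFG : ∀ t, t.length = b.length → F t = G t) :
    opAt x.1 (pieceOp N g s κ x.2) F v = opAt x.1 (pieceOp N g s κ x.2) G v := by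
  obtain ⟨h1, h2⟩ := h.length
  obtain ⟨k, y⟩ := x
  simp only at h1 h2 ⊢
  obtain ⟨l, t, r, rfl, hl, ht⟩ : ∃ l t r : List (Fin N), v = l ++ t ++ r ∧ l.length = k ∧
      t.length = (y.bot N).length :=
    ⟨v.take k, (v.drop k).take (y.bot N).length, (v.drop k).drop (y.bot N).length, by simp,
      by simp; omega, by simp; omega⟩
  subst hl
  have hloc := (isLocal_pieceOp g s κ y ht).opAt (l := l) (r := r)
  have := hloc.congr (F := F) (G := G) [] (fun v hv' => hFG v (by
    simp only [List.length_append, List.length_nil] at hv hv'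
    omega))
  simpa using this

lemma word_congr {w : List Layer} {a b : List Bool} (h : Leads N w a b)
    {F G : List (Fin N) → ℂ} {v : List (Fin N)} (hv : v.length = a.length)
    (hFG : ∀ t, t.length = b.length → F t = G t) :
    wordOp N g s κ w F v = wordOp N g s κ w G v := by
  induction w generalizing a v with
  | nil =>
    cases h
    exact hFG v hv
  | cons x w ih =>
    obtain ⟨c, h1, h2⟩ := h
    rw [wordOp_cons, wordOp_cons]
    exact layer_congr g s κ h1 hv fun t ht => ih h2 ht

end StateSum

end

section

/-! ### Invariance of the state sums under the moves without coupons -/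

section StateSumMoves

variable {N : ℕ} {g s : ℂ} (κ : ℂ)

lemma crossScale_mul (hg : g ≠ 0) (p : Bool) : crossScale g p * crossScale g (!p) = 1 := by
  cases p <;> simp [crossScale, hg]

lemma wordOp_reidemeister2 (hg : g ≠ 0) (hs : s ≠ 0) (p : Bool) (F : List (Fin N) → ℂ)
    (a b : Fin N) (r : List (Fin N)) :
    wordOp N g s κ [(0, .cross p), (0, .cross !p)] F (a :: b :: r) = F (a :: b :: r) := by
  simp only [wordOp_cons, wordOp_nil, opAt_zero, pieceOp, crossOp_apply]
  have h := crossScale_mul hg p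
  rcases lt_trichotomy a b with hab | rfl | hab
  · have h1 := hab.ne
    have h2 := hab.ne'
    have h3 := hab.not_gt
    cases p <;> simp [h1, h2, h3, hab, crossStay, crossScale] <;> field_simp; ring
  · cases p <;> simp [crossSame, crossScale] <;> field_simp
  · have h1 := hab.ne
    have h2 := hab.ne'
    have h3 := hab.not_gt
    cases p <;> simp [h1, h2, h3, hab, crossStay, crossScale] <;> field_simp; ring

/-- The third Reidemeister move, where two of the crossings may be negative. -/
lemma crossOp_braid (hg : g ≠ 0) (hs : s ≠ 0) (p : Bool) (F : List (Fin N) → ℂ) (a b c : Fin N)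
    (r : List (Fin N)) :
    opAt 1 (crossOp N g s true) (opAt 0 (crossOp N g s p) (opAt 1 (crossOp N g s p) F))
        (a :: b :: c :: r) =
      opAt 0 (crossOp N g s p) (opAt 1 (crossOp N g s p) (opAt 0 (crossOp N g s true) F))
        (a :: b :: c :: r) := by
  simp only [opAt_cons, opAt_zero, crossOp_apply]
  have tri : ∀ x y : Fin N, (x < y ∧ ¬ y < x ∧ x ≠ y ∧ y ≠ x) ∨ x = y ∨
      (y < x ∧ ¬ x < y ∧ x ≠ y ∧ y ≠ x) := by
    intro x y
    rcases lt_trichotomy x y with h | h | h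
    · exact Or.inl ⟨h, h.not_gt, h.ne, h.ne'⟩
    · exact Or.inr (Or.inl h)
    · exact Or.inr (Or.inr ⟨h, h.not_gt, h.ne', h.ne⟩)
  rcases tri a b with ⟨h1, h2, h3, h4⟩ | h1 | ⟨h1, h2, h3, h4⟩ <;>
  rcases tri b c with ⟨k1, k2, k3, k4⟩ | k1 | ⟨k1, k2, k3, k4⟩ <;>
  rcases tri a c with ⟨l1, l2, l3, l4⟩ | l1 | ⟨l1, l2, l3, l4⟩ <;>
  first
  | (exfalso; order)
  | (cases p <;> simp [*, crossStay, crossSame, crossScale] <;> field_simp <;> ring)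

lemma kap_ne_zero (hs : s ≠ 0) (a : Fin N) : kap s a ≠ 0 := zpow_ne_zero _ hs

lemma cupCoef_mul_capCoef (hs : s ≠ 0) (e : Bool) (a : Fin N) :
    cupCoef s e a * capCoef s (!e) a = 1 := by
  have := kap_ne_zero hs a
  cases e <;> simp [cupCoef, capCoef, this]

lemma wordOp_zigzag (hs : s ≠ 0) (e : Bool) (F : List (Fin N) → ℂ) (a : Fin N)
    (r : List (Fin N)) : wordOp N g s κ [(0, .cup e), (1, .cap !e)] F (a :: r) = F (a :: r) := by
  simp only [wordOp_cons, wordOp_nil, opAt_zero, pieceOp, cupOp_apply, opAt_cons, capOp_apply]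
  rw [Finset.sum_eq_single a (fun b _ hb => by rw [if_neg hb, mul_zero]) (by simp), if_pos rfl,
    ← mul_assoc, cupCoef_mul_capCoef hs, one_mul]

lemma wordOp_zagzig (hs : s ≠ 0) (e : Bool) (F : List (Fin N) → ℂ) (a : Fin N)
    (r : List (Fin N)) : wordOp N g s κ [(1, .cup e), (0, .cap !e)] F (a :: r) = F (a :: r) := by
  simp only [wordOp_cons, wordOp_nil, opAt_zero, pieceOp, cupOp_apply, opAt_cons, capOp_apply]
  rw [Finset.sum_eq_single a (fun b _ hb => by rw [if_neg hb.symm, mul_zero]) (by simp),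
    if_pos rfl, ← mul_assoc, cupCoef_mul_capCoef hs, one_mul]

lemma wordOp_circle (hs : s ≠ 0) (e : Bool) (F : List (Fin N) → ℂ) (r : List (Fin N)) :
    (s - s⁻¹) * wordOp N g s κ [(0, .cup e), (0, .cap e)] F r =
      (s ^ (N : ℤ) - s ^ (-N : ℤ)) * F r := by
  simp only [wordOp_cons, wordOp_nil, opAt_zero, pieceOp, cupOp_apply, capOp_apply, if_true]
  simp only [← mul_assoc]
  rw [← Finset.sum_mul, ← mul_assoc]
  congr 1
  cases e
  · have : ∀ a : Fin N, cupCoef s false a * capCoef s false a =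
        s ^ (2 * (a.val : ℤ) + 1 - N) := by
      intro a
      simp only [cupCoef, capCoef, Bool.false_eq_true, if_false, mul_one, kap, ← zpow_neg]
      congr 1
      ring
    simp only [this]
    rw [Fin.sum_univ_eq_sum_range (fun i : ℕ => s ^ (2 * (i : ℤ) + 1 - N)), Finset.mul_sum]
    have := Finset.sum_range_sub (fun i : ℕ => s ^ (2 * (i : ℤ) - N)) N
    rw [show 2 * (N : ℤ) - N = N by ring, show 2 * ((0 : ℕ) : ℤ) - N = -N by simp] at this
    rw [← this]
    refine Finset.sum_congr rfl fun i _ => ?_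
    rw [show 2 * ((i + 1 : ℕ) : ℤ) - N = 2 * (i : ℤ) + 1 - N + 1 by push_cast; ring,
      show 2 * (i : ℤ) - N = 2 * (i : ℤ) + 1 - N - 1 by ring, zpow_add_one₀ hs, zpow_sub_one₀ hs]
    ring
  · have : ∀ a : Fin N, cupCoef s true a * capCoef s true a = s ^ ((N : ℤ) - 1 - 2 * a.val) := by
      intro a
      simp only [cupCoef, capCoef, if_true, one_mul, kap]
    simp only [this]
    rw [Fin.sum_univ_eq_sum_range (fun i : ℕ => s ^ ((N : ℤ) - 1 - 2 * i)), Finset.mul_sum]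
    have := Finset.sum_range_sub' (fun i : ℕ => s ^ ((N : ℤ) - 2 * i)) N
    rw [show (N : ℤ) - 2 * N = -N by ring, show (N : ℤ) - 2 * ((0 : ℕ) : ℤ) = N by simp] at this
    rw [← this]
    refine Finset.sum_congr rfl fun i _ => ?_
    rw [show (N : ℤ) - 2 * ((i + 1 : ℕ) : ℤ) = (N : ℤ) - 1 - 2 * i - 1 by push_cast; ring,
      show (N : ℤ) - 2 * (i : ℤ) = (N : ℤ) - 1 - 2 * i + 1 by ring, zpow_add_one₀ hs,
      zpow_sub_one₀ hs]
    ring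

lemma wordOp_skein (hg : g ≠ 0) (hs : s ≠ 0) (F : List (Fin N) → ℂ) (a b : Fin N)
    (r : List (Fin N)) :
    g * wordOp N g s κ [(0, .cross true)] F (a :: b :: r) -
      g⁻¹ * wordOp N g s κ [(0, .cross false)] F (a :: b :: r) = (s - s⁻¹) * F (a :: b :: r) := by
  simp only [wordOp_cons, wordOp_nil, opAt_zero, pieceOp, crossOp_apply]
  rcases lt_trichotomy a b with hab | rfl | hab
  · simp [hab.ne, hab.not_gt, hab, crossStay, crossScale]
    field_simp
    ring
  · simp [crossSame, crossScale]
    field_simp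
  · simp [hab.ne', hab.not_gt, hab, crossStay, crossScale]
    field_simp
    ring

/-! ### Telescoping sums -/

lemma sum_gt_sub (ψ : ℕ → ℂ) (a : Fin N) :
    ∑ c : Fin N, (if a < c then ψ c - ψ (c + 1) else 0) = ψ (a + 1) - ψ N := by
  have h : ∀ n, a.1 < n → ∑ i ∈ Finset.range n, (if a.1 < i then ψ i - ψ (i + 1) else 0) =
      ψ (a + 1) - ψ n := by
    intro n hn
    induction n with
    | zero => omega
    | succ n ih =>
      rw [Finset.sum_range_succ]
      rcases eq_or_lt_of_le (Nat.lt_succ_iff.1 hn) with e | hlt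
      · rw [if_neg (by omega), Finset.sum_eq_zero, ← e]
        · ring
        · intro i hi
          rw [if_neg]
          have := Finset.mem_range.1 hi
          omega
      · rw [ih hlt, if_pos hlt]
        ring
  rw [← h N a.2, ← Fin.sum_univ_eq_sum_range (fun i => if a.1 < i then ψ i - ψ (i + 1) else 0)]
  rfl

lemma sum_lt_sub (ψ : ℕ → ℂ) (a : Fin N) :
    ∑ c : Fin N, (if c < a then ψ c - ψ (c + 1) else 0) = ψ 0 - ψ a := by
  have h : ∀ n, ∑ i ∈ Finset.range n, (if i < a.1 then ψ i - ψ (i + 1) else 0) =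
      ψ 0 - ψ (min a.1 n) := by
    intro n
    induction n with
    | zero => simp
    | succ n ih =>
      rw [Finset.sum_range_succ, ih]
      split_ifs with h
      · rw [min_eq_right (by omega), min_eq_right (by omega)]
        ring
      · rw [min_eq_left (by omega), min_eq_left (by omega), add_zero]
  have := h N
  rw [min_eq_left a.2.le] at this
  rw [← this, ← Fin.sum_univ_eq_sum_range (fun i => if i < a.1 then ψ i - ψ (i + 1) else 0)]
  rfl

lemma wordOp_curlRight (hs : s ≠ 0) (p : Bool) (F : List (Fin N) → ℂ) (a : Fin N)
    (r : List (Fin N)) :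
    wordOp N g s κ [(1, .cup true), (0, .cross p), (1, .cap true)] F (a :: r) =
      crossScale g p * s ^ (if p then (N : ℤ) else -N) * F (a :: r) := by
  simp only [wordOp_cons, wordOp_nil, opAt_zero, pieceOp, cupOp_apply, opAt_cons, capOp_apply,
    crossOp_apply, cupCoef, capCoef, if_true, one_mul]
  rw [← Finset.mul_sum, mul_assoc]
  congr 1
  have h : ∀ b : Fin N, (if a = b then crossSame s p * (if a = b then kap s a * F (a :: r) else 0)
      else (if a = b then kap s a * F (b :: r) else 0) + crossStay s p a b *
        (if b = b then kap s b * F (a :: r) else 0)) =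
      ((if b = a then crossSame s p * kap s a else 0) +
        (if b = a then 0 else crossStay s p a b * kap s b)) * F (a :: r) := by
    intro b
    by_cases e : a = b
    · subst e; simp [mul_assoc]
    · simp [e, Ne.symm e, mul_assoc]
  simp only [if_true] at h ⊢
  rw [Finset.sum_congr rfl fun b _ => h b, ← Finset.sum_mul, Finset.sum_add_distrib,
    Finset.sum_ite_eq' Finset.univ a, if_pos (Finset.mem_univ a)]
  congr 1
  cases p
  · have := sum_gt_sub (fun i : ℕ => s ^ ((N : ℤ) - 2 * i)) a
    have e : ∀ b : Fin N, (if b = a then 0 else crossStay s false a b * kap s b) =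
        -(if a < b then s ^ ((N : ℤ) - 2 * (b : ℕ)) - s ^ ((N : ℤ) - 2 * ((b + 1 : ℕ) : ℤ)) else 0) := by
      intro b
      rcases eq_or_ne b a with rfl | hne
      · simp
      rw [if_neg hne, crossStay]
      simp only [Bool.false_eq_true, if_false]
      split_ifs
      · rw [kap, show (N : ℤ) - 2 * ((b + 1 : ℕ) : ℤ) = (N : ℤ) - 1 - 2 * (b : ℕ) - 1 by
          push_cast; ring, show (N : ℤ) - 2 * (b : ℕ) = (N : ℤ) - 1 - 2 * (b : ℕ) + 1 by ring,
          zpow_add_one₀ hs, zpow_sub_one₀ hs]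
        ring
      · ring
    rw [Finset.sum_congr rfl fun b _ => e b, Finset.sum_neg_distrib, this]
    simp only [crossSame, kap, Bool.false_eq_true, if_false]
    rw [show (N : ℤ) - 2 * N = -N by ring, show (N : ℤ) - 2 * ((a + 1 : ℕ) : ℤ) =
      (N : ℤ) - 1 - 2 * (a : ℕ) - 1 by push_cast; ring, zpow_sub_one₀ hs]
    ring
  · have := sum_lt_sub (fun i : ℕ => s ^ ((N : ℤ) - 2 * i)) a
    have e : ∀ b : Fin N, (if b = a then 0 else crossStay s true a b * kap s b) =
        (if b < a then s ^ ((N : ℤ) - 2 * (b : ℕ)) - s ^ ((N : ℤ) - 2 * ((b + 1 : ℕ) : ℤ)) else 0) := by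
      intro b
      rcases eq_or_ne b a with rfl | hne
      · simp
      rw [if_neg hne, crossStay]
      simp only [if_true]
      split_ifs
      · rw [kap, show (N : ℤ) - 2 * ((b + 1 : ℕ) : ℤ) = (N : ℤ) - 1 - 2 * (b : ℕ) - 1 by
          push_cast; ring, show (N : ℤ) - 2 * (b : ℕ) = (N : ℤ) - 1 - 2 * (b : ℕ) + 1 by ring,
          zpow_add_one₀ hs, zpow_sub_one₀ hs]
        ring
      · ring
    rw [Finset.sum_congr rfl fun b _ => e b, this]
    simp only [crossSame, kap, if_true]
    rw [show (N : ℤ) - 2 * ((0 : ℕ) : ℤ) = N by simp, show (N : ℤ) - 2 * ((a : ℕ) : ℤ) =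
      (N : ℤ) - 1 - 2 * (a : ℕ) + 1 by ring, zpow_add_one₀ hs]
    ring

lemma wordOp_curlLeft (hs : s ≠ 0) (p : Bool) (F : List (Fin N) → ℂ) (a : Fin N)
    (r : List (Fin N)) :
    wordOp N g s κ [(0, .cup false), (1, .cross p), (0, .cap false)] F (a :: r) =
      crossScale g p * s ^ (if p then (N : ℤ) else -N) * F (a :: r) := by
  simp only [wordOp_cons, wordOp_nil, opAt_zero, pieceOp, cupOp_apply, opAt_cons, capOp_apply,
    crossOp_apply, cupCoef, capCoef, Bool.false_eq_true, if_false, one_mul]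
  have h : ∀ b : Fin N, (kap s b)⁻¹ * (crossScale g p * (if b = a then crossSame s p *
      (if b = b then F (b :: r) else 0) else (if b = a then F (b :: r) else 0) + crossStay s p b a *
        (if b = b then F (a :: r) else 0))) =
      crossScale g p * (((if b = a then crossSame s p * (kap s a)⁻¹ else 0) +
        (if b = a then 0 else crossStay s p b a * (kap s b)⁻¹)) * F (a :: r)) := by
    intro b
    by_cases e : b = a
    · subst e; simp; ring
    · simp [e]; ring
  simp only [if_true] at h ⊢
  rw [Finset.sum_congr rfl fun b _ => h b, ← Finset.mul_sum, ← Finset.sum_mul, mul_assoc,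
    Finset.sum_add_distrib, Finset.sum_ite_eq' Finset.univ a, if_pos (Finset.mem_univ a)]
  congr 2
  have hk : ∀ b : Fin N, (kap s b)⁻¹ = s ^ (2 * (b.val : ℤ) + 1 - N) := by
    intro b
    rw [kap, ← zpow_neg]
    congr 1
    ring
  cases p
  · have := sum_lt_sub (fun i : ℕ => s ^ (2 * (i : ℤ) - N)) a
    have e : ∀ b : Fin N, (if b = a then 0 else crossStay s false b a * (kap s b)⁻¹) =
        (if b < a then s ^ (2 * ((b : ℕ) : ℤ) - N) - s ^ (2 * ((b + 1 : ℕ) : ℤ) - N) else 0) := by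
      intro b
      rcases eq_or_ne b a with rfl | hne
      · simp
      rw [if_neg hne, crossStay]
      simp only [Bool.false_eq_true, if_false]
      split_ifs
      · rw [hk, show 2 * ((b + 1 : ℕ) : ℤ) - N = 2 * ((b : ℕ) : ℤ) + 1 - N + 1 by
          push_cast; ring, show 2 * ((b : ℕ) : ℤ) - N = 2 * ((b : ℕ) : ℤ) + 1 - N - 1 by ring,
          zpow_add_one₀ hs, zpow_sub_one₀ hs]
        ring
      · ring
    rw [Finset.sum_congr rfl fun b _ => e b, this, hk]
    simp only [crossSame, Bool.false_eq_true, if_false]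
    rw [show 2 * ((0 : ℕ) : ℤ) - N = -N by simp, show 2 * ((a : ℕ) : ℤ) - N =
      2 * ((a : ℕ) : ℤ) + 1 - N - 1 by ring, zpow_sub_one₀ hs]
    ring
  · have := sum_gt_sub (fun i : ℕ => s ^ (2 * (i : ℤ) - N)) a
    have e : ∀ b : Fin N, (if b = a then 0 else crossStay s true b a * (kap s b)⁻¹) =
        -(if a < b then s ^ (2 * ((b : ℕ) : ℤ) - N) - s ^ (2 * ((b + 1 : ℕ) : ℤ) - N) else 0) := by
      intro b
      rcases eq_or_ne b a with rfl | hne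
      · simp
      rw [if_neg hne, crossStay]
      simp only [if_true]
      split_ifs
      · rw [hk, show 2 * ((b + 1 : ℕ) : ℤ) - N = 2 * ((b : ℕ) : ℤ) + 1 - N + 1 by
          push_cast; ring, show 2 * ((b : ℕ) : ℤ) - N = 2 * ((b : ℕ) : ℤ) + 1 - N - 1 by ring,
          zpow_add_one₀ hs, zpow_sub_one₀ hs]
        ring
      · ring
    rw [Finset.sum_congr rfl fun b _ => e b, Finset.sum_neg_distrib, this, hk]
    simp only [crossSame, if_true]
    rw [show 2 * (N : ℤ) - N = N by ring, show 2 * ((a + 1 : ℕ) : ℤ) - N =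
      2 * ((a : ℕ) : ℤ) + 1 - N + 1 by push_cast; ring, zpow_add_one₀ hs]
    ring

/-! ### Crossings of strands of opposite directions -/

/-- The part of the matrix of `crossUD` on pairs of equal labels. -/
def matUD (N : ℕ) (s : ℂ) (p : Bool) : Matrix (Fin N) (Fin N) ℂ := fun a c =>
  kap s a * (kap s c)⁻¹ * if c = a then crossSame s p else crossStay s p c a

/-- The part of the matrix of `crossDU` on pairs of equal labels. -/
def matDU (N : ℕ) (s : ℂ) (p : Bool) : Matrix (Fin N) (Fin N) ℂ := fun a c =>
  if c = a then crossSame s p else crossStay s p a c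

lemma wordOp_crossUD (hs : s ≠ 0) (p : Bool) (F : List (Fin N) → ℂ) (a b : Fin N)
    (r : List (Fin N)) : wordOp N g s κ (crossUD 0 p) F (a :: b :: r) =
      crossScale g p * (if a = b then ∑ c, matUD N s p a c * F (c :: c :: r) else
        F (b :: a :: r)) := by
  simp only [crossUD, zero_add, wordOp_cons, wordOp_nil, opAt_zero, pieceOp, cupOp_apply,
    opAt_cons, capOp_apply, crossOp_apply, cupCoef, capCoef, Bool.false_eq_true, if_false, if_true]
  have hk := fun b : Fin N => kap_ne_zero (s := s) hs b
  by_cases h : a = b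
  · subst h
    rw [if_pos rfl, Finset.mul_sum]
    refine Finset.sum_congr rfl fun c _ => ?_
    unfold matUD
    by_cases e : c = a
    · subst e
      simp
      field_simp
    · simp [e]
      ring
  · rw [if_neg h, Finset.sum_eq_single b]
    · have := hk b
      simp [h, Ne.symm h]
      field_simp
    · intro c _ hc
      by_cases e : c = a
      · subst e; simp [h]
      · simp [e, hc, h]
    · simp

lemma wordOp_crossDU (p : Bool) (F : List (Fin N) → ℂ) (a b : Fin N)
    (r : List (Fin N)) : wordOp N g s κ (crossDU 0 p) F (a :: b :: r) =
      crossScale g p * (if a = b then ∑ c, matDU N s p a c * F (c :: c :: r) else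
        F (b :: a :: r)) := by
  simp only [crossDU, zero_add, wordOp_cons, wordOp_nil, opAt_zero, pieceOp, cupOp_apply,
    opAt_cons, capOp_apply, crossOp_apply, cupCoef, capCoef, Bool.false_eq_true, if_false, if_true,
    one_mul]
  by_cases h : a = b
  · subst h
    rw [if_pos rfl, Finset.mul_sum]
    refine Finset.sum_congr rfl fun c _ => ?_
    unfold matDU
    by_cases e : c = a
    · subst e
      simp
    · simp [e, Ne.symm e]
  · rw [if_neg h, Finset.sum_eq_single a]
    · simp [h, Ne.symm h]
    · intro c _ hc
      by_cases e : b = c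
      · subst e; simp [h]
      · simp [e, hc.symm, h]
    · simp

lemma kap_mul_inv (hs : s ≠ 0) (a c : Fin N) :
    kap s a * (kap s c)⁻¹ = s ^ (-(2 * (a.val : ℤ))) * s ^ (2 * (c.val : ℤ)) := by
  unfold kap
  rw [← zpow_neg, ← zpow_add₀ hs, ← zpow_add₀ hs]
  congr 1
  ring

lemma matUD_mul_matDU (hs : s ≠ 0) (p : Bool) : matUD N s p * matDU N s (!p) = 1 := by
  ext a d
  rw [Matrix.mul_apply, Matrix.one_apply]
  have h2 : ∀ c : Fin N, s ^ (2 * (c.val : ℤ) - 1) = s ^ (2 * (c.val : ℤ)) * s⁻¹ := fun c =>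
    zpow_sub_one₀ hs _
  have h3 : ∀ c : Fin N, s ^ (2 * ((c.val + 1 : ℕ) : ℤ) - 1) = s ^ (2 * (c.val : ℤ)) * s :=
    fun c => by rw [← zpow_add_one₀ hs]; congr 1; push_cast; ring
  have h4 : s ^ (-(2 * (a.val : ℤ))) * s ^ (2 * (a.val : ℤ)) = 1 := by
    rw [← zpow_add₀ hs]; simp
  cases p
  · have key : ∀ c, matUD N s false a c * matDU N s true c d =
        (if c = a then s⁻¹ * matDU N s true a d else 0) + s ^ (-(2 * (a.val : ℤ))) * (s - s⁻¹) *
          (if c < a then (if d.1 < c.1 then s ^ (2 * (c.val : ℤ) - 1) else 0) -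
            (if d.1 < c.1 + 1 then s ^ (2 * ((c.val + 1 : ℕ) : ℤ) - 1) else 0) else 0) := by
      intro c
      rw [matUD, kap_mul_inv hs, h2, h3]
      simp only [crossSame, crossStay, Bool.false_eq_true, if_false]
      rcases eq_or_ne c a with rfl | hne
      · rw [if_pos rfl, if_pos rfl, if_neg (lt_irrefl c), h4]
        ring
      · rw [if_neg hne, if_neg hne]
        split_ifs with l1 l2 l3 l3
        · have : matDU N s true c d = s - s⁻¹ := by
            rw [matDU, if_neg (by rintro rfl; exact lt_irrefl _ l2)]
            simp [crossStay, show d < c from l2]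
          rw [this]
          ring
        · omega
        · have : matDU N s true c d = s := by
            rw [matDU, if_pos (Fin.ext (by omega))]
            rfl
          rw [this]
          ring
        · have : matDU N s true c d = 0 := by
            rw [matDU, if_neg (by rintro rfl; omega)]
            simp [crossStay, show c ≤ d from Fin.le_def.2 (by omega)]
          rw [this]
          ring
        · ring
    change ∑ c, matUD N s false a c * matDU N s true c d = _
    rw [Finset.sum_congr rfl fun c _ => key c, Finset.sum_add_distrib, ← Finset.mul_sum,
      Finset.sum_ite_eq' Finset.univ a, if_pos (Finset.mem_univ a),
      sum_lt_sub (fun i => if d.1 < i then s ^ (2 * (i : ℤ) - 1) else 0), if_neg (by omega), h2]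
    rcases lt_trichotomy a d with hlt | rfl | hlt
    · rw [if_neg (by simpa using hlt.le), if_neg hlt.ne, matDU, if_neg hlt.ne']
      simp [crossStay, hlt.not_gt]
    · simp [matDU, crossSame, hs]
    · rw [if_pos (by simpa using hlt), if_neg hlt.ne', matDU, if_neg hlt.ne]
      simp only [crossStay, hlt, if_true]
      linear_combination (-(s - s⁻¹) * s⁻¹) * h4
  · have key : ∀ c, matUD N s true a c * matDU N s false c d =
        (if c = a then s * matDU N s false a d else 0) + s ^ (-(2 * (a.val : ℤ))) * (s - s⁻¹) *
          (if a < c then (if c.1 ≤ d.1 then s ^ (2 * (c.val : ℤ) - 1) else 0) -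
            (if c.1 + 1 ≤ d.1 then s ^ (2 * ((c.val + 1 : ℕ) : ℤ) - 1) else 0) else 0) := by
      intro c
      rw [matUD, kap_mul_inv hs, h2, h3]
      simp only [crossSame, crossStay, if_true]
      rcases eq_or_ne c a with rfl | hne
      · rw [if_pos rfl, if_pos rfl, if_neg (lt_irrefl c), h4]
        ring
      · rw [if_neg hne, if_neg hne]
        split_ifs with l1 l2 l3 l3
        · have : matDU N s false c d = s⁻¹ - s := by
            rw [matDU, if_neg (by rintro rfl; omega)]
            simp [crossStay, show c < d from l3]
          rw [this]
          ring
        · have : matDU N s false c d = s⁻¹ := by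
            rw [matDU, if_pos (Fin.ext (by omega))]
            rfl
          rw [this]
          ring
        · omega
        · have : matDU N s false c d = 0 := by
            rw [matDU, if_neg (by rintro rfl; omega)]
            simp [crossStay, show d ≤ c from Fin.le_def.2 (by omega)]
          rw [this]
          ring
        · ring
    change ∑ c, matUD N s true a c * matDU N s false c d = _
    rw [Finset.sum_congr rfl fun c _ => key c, Finset.sum_add_distrib, ← Finset.mul_sum,
      Finset.sum_ite_eq' Finset.univ a, if_pos (Finset.mem_univ a),
      sum_gt_sub (fun i => if i ≤ d.1 then s ^ (2 * (i : ℤ) - 1) else 0),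
      if_neg (c := N ≤ d.1) (by omega), h3]
    rcases lt_trichotomy a d with hlt | rfl | hlt
    · rw [if_pos (show a.1 + 1 ≤ d.1 from hlt), if_neg hlt.ne, matDU, if_neg hlt.ne']
      simp only [crossStay, hlt, if_true, Bool.false_eq_true, if_false]
      linear_combination ((s - s⁻¹) * s) * h4
    · simp [matDU, crossSame, hs]
    · rw [if_neg (show ¬ a.1 + 1 ≤ d.1 from fun h => hlt.not_gt h), if_neg hlt.ne', matDU,
        if_neg hlt.ne]
      simp [crossStay, hlt.not_gt]

lemma matDU_mul_matUD (hs : s ≠ 0) (p : Bool) : matDU N s p * matUD N s (!p) = 1 := by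
  have := matUD_mul_matDU (N := N) hs (!p)
  rw [Bool.not_not] at this
  exact mul_eq_one_comm.1 this

lemma sum_mul_of_mul_eq_one {A B : Matrix (Fin N) (Fin N) ℂ} (h : A * B = 1) (f : Fin N → ℂ)
    (a : Fin N) : ∑ c, A a c * ∑ d, B c d * f d = f a := by
  have : A.mulVec (B.mulVec f) a = f a := by rw [Matrix.mulVec_mulVec, h, Matrix.one_mulVec]
  exact this

lemma wordOp_reidemeister2UD (hg : g ≠ 0) (hs : s ≠ 0) (p : Bool) (F : List (Fin N) → ℂ)
    (a b : Fin N) (r : List (Fin N)) :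
    wordOp N g s κ (crossUD 0 p ++ crossDU 0 !p) F (a :: b :: r) = F (a :: b :: r) := by
  rw [wordOp_append, wordOp_crossUD κ hs]
  simp only [wordOp_crossDU, if_true]
  have h := crossScale_mul hg p
  by_cases e : a = b
  · subst e
    rw [if_pos rfl]
    simp only [mul_left_comm _ (crossScale g !p)]
    rw [← Finset.mul_sum, sum_mul_of_mul_eq_one (matUD_mul_matDU hs p) (fun c => F (c :: c :: r)),
      ← mul_assoc, h, one_mul]
  · rw [if_neg e, if_neg (Ne.symm e), ← mul_assoc, h, one_mul]

lemma wordOp_reidemeister2DU (hg : g ≠ 0) (hs : s ≠ 0) (p : Bool) (F : List (Fin N) → ℂ)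
    (a b : Fin N) (r : List (Fin N)) :
    wordOp N g s κ (crossDU 0 p ++ crossUD 0 !p) F (a :: b :: r) = F (a :: b :: r) := by
  rw [wordOp_append, wordOp_crossDU]
  simp only [wordOp_crossUD κ hs, if_true]
  have h := crossScale_mul hg p
  by_cases e : a = b
  · subst e
    rw [if_pos rfl]
    simp only [mul_left_comm _ (crossScale g !p)]
    rw [← Finset.mul_sum, sum_mul_of_mul_eq_one (matDU_mul_matUD hs p) (fun c => F (c :: c :: r)),
      ← mul_assoc, h, one_mul]
  · rw [if_neg e, if_neg (Ne.symm e), ← mul_assoc, h, one_mul]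

lemma sum_sum_ite (x y : Fin N) (A : ℂ) :
    ∑ c : Fin N, ∑ d : Fin N, (if c = x ∧ d = y then A else 0) = A := by
  rw [Finset.sum_eq_single x (fun c _ hc => by simp [hc]) (by simp),
    Finset.sum_eq_single y (fun d _ hd => by simp [hd]) (by simp), if_pos ⟨rfl, rfl⟩]

lemma wordOp_rotate (hs : s ≠ 0) (p : Bool) (F : List (Fin N) → ℂ) (x y : Fin N)
    (r : List (Fin N)) :
    wordOp N g s κ [(0, .cup false), (1, .cup false), (2, .cross p), (3, .cap true),
        (2, .cap true)] F (x :: y :: r) =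
      wordOp N g s κ [(2, .cup true), (3, .cup true), (2, .cross p), (1, .cap false),
        (0, .cap false)] F (x :: y :: r) := by
  simp only [wordOp_cons, wordOp_nil, opAt_zero, pieceOp, cupOp_apply,
    opAt_cons, capOp_apply, crossOp_apply, cupCoef, capCoef, Bool.false_eq_true, if_false, if_true,
    one_mul, Finset.mul_sum]
  have hx := kap_ne_zero hs x
  have hy := kap_ne_zero hs y
  by_cases h : x = y
  · subst h
    trans crossScale g p * (crossSame s p * F (x :: x :: r))
    · refine (Finset.sum_congr rfl fun c _ => Finset.sum_congr rfl fun d _ => ?_).trans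
        (sum_sum_ite x x _)
      by_cases e1 : c = x <;> by_cases e2 : d = x <;> by_cases e3 : d = c <;> simp_all
      field_simp
    · symm
      refine (Finset.sum_congr rfl fun c _ => Finset.sum_congr rfl fun d _ => ?_).trans
        (sum_sum_ite x x _)
      by_cases e1 : c = x <;> by_cases e2 : d = x <;> by_cases e3 : d = c <;> simp_all <;> grind
  · trans crossScale g p * F (y :: x :: r) + crossScale g p * (crossStay s p y x * F (x :: y :: r))
    · rw [← sum_sum_ite y x (crossScale g p * F (y :: x :: r)),
        ← sum_sum_ite x y (crossScale g p * (crossStay s p y x * F (x :: y :: r))),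
        ← Finset.sum_add_distrib]
      refine Finset.sum_congr rfl fun c _ => ?_
      rw [← Finset.sum_add_distrib]
      refine Finset.sum_congr rfl fun d _ => ?_
      by_cases e1 : c = x
      · subst e1
        by_cases e2 : d = y
        · subst e2
          simp [h, Ne.symm h]
          field_simp
        · by_cases e3 : d = c <;> simp [e2, e3, h]
      · by_cases e2 : c = y
        · subst e2
          by_cases e3 : d = x
          · subst e3
            simp [h, Ne.symm h]
            field_simp
          · by_cases e4 : d = c <;> simp [e1, e3, e4]
        · by_cases e4 : d = c <;> by_cases e5 : d = x <;>
            simp [e1, e2, e4, e5, Ne.symm e1]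
    · symm
      rw [add_comm, ← sum_sum_ite x y (crossScale g p * F (y :: x :: r)),
        ← sum_sum_ite y x (crossScale g p * (crossStay s p y x * F (x :: y :: r))),
        ← Finset.sum_add_distrib]
      refine Finset.sum_congr rfl fun c _ => ?_
      rw [← Finset.sum_add_distrib]
      refine Finset.sum_congr rfl fun d _ => ?_
      by_cases e1 : c = x
      · subst e1
        by_cases e2 : d = y
        · subst e2
          simp [h, Ne.symm h]
        · by_cases e3 : c = d <;> simp_all [Ne.symm e2]
      · by_cases e2 : c = y
        · subst e2
          by_cases e3 : d = x
          · subst e3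
            simp [h, Ne.symm h]
          · by_cases e4 : c = d <;> simp_all [Ne.symm e3]
        · by_cases e4 : c = d <;> by_cases e5 : y = d <;> simp_all [Ne.symm e1, Ne.symm e2]

end StateSumMoves

end

section

/-! ### Invariance of the state sums under the moves with coupons -/

section StateSumCoupons

variable {N : ℕ} {g s : ℂ}

lemma exists_eq_append_cons_cons {i : ℕ} {w : List (Fin N)} (h : i + 1 < w.length) :
    ∃ l a b r, w = l ++ a :: b :: r ∧ l.length = i :=
  ⟨w.take i, w[i], w[i + 1], w.drop (i + 2), by
    conv_lhs => rw [← List.take_append_drop i w]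
    rw [List.drop_eq_getElem_cons (by omega), List.drop_eq_getElem_cons (by omega)],
    by simp; omega⟩

lemma opAt_length (op : Module.End ℂ (List (Fin N) → ℂ)) (F : List (Fin N) → ℂ)
    (l w : List (Fin N)) : opAt l.length op F (l ++ w) = op (fun v => F (l ++ v)) w :=
  opAt_append op 0 F l w

lemma opAt_length_succ (op : Module.End ℂ (List (Fin N) → ℂ)) (F : List (Fin N) → ℂ)
    (l w : List (Fin N)) : opAt (l.length + 1) op F (l ++ w) = opAt 1 op (fun v => F (l ++ v)) w :=
  opAt_append op 1 F l w

lemma cross_congr (p : Bool) {i : ℕ} {F G : List (Fin N) → ℂ} {w : List (Fin N)}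
    (h : i + 1 < w.length) (hFG : ∀ v, v.length = w.length → F v = G v) :
    opAt i (crossOp N g s p) F w = opAt i (crossOp N g s p) G w := by
  have := (isLocal_opAt_crossOp g s p h).congr (F := F) (G := G) [] (by simpa using hFG)
  simpa using this

lemma cross_far (p p' : Bool) {i j : ℕ} (h : i + 2 ≤ j) (F : List (Fin N) → ℂ) {w : List (Fin N)}
    (hw : i + 1 < w.length) :
    opAt i (crossOp N g s p) (opAt j (crossOp N g s p') F) w =
      opAt j (crossOp N g s p') (opAt i (crossOp N g s p) F) w := by
  obtain ⟨l, a, b, r, rfl, rfl⟩ := exists_eq_append_cons_cons hw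
  obtain ⟨k, rfl⟩ := Nat.exists_eq_add_of_le h
  rw [add_assoc, opAt_length, opAt_append]
  have := (isLocal_crossOp g s p a b).comm (op' := crossOp N g s p') k (fun v => F (l ++ v)) r
  simp only [opAt_append, opAt_length]
  exact this

lemma cross_braid (hg : g ≠ 0) (hs : s ≠ 0) (p : Bool) {i : ℕ} (F : List (Fin N) → ℂ)
    {w : List (Fin N)} (hw : i + 2 < w.length) :
    opAt (i + 1) (crossOp N g s true) (opAt i (crossOp N g s p)
        (opAt (i + 1) (crossOp N g s p) F)) w =
      opAt i (crossOp N g s p) (opAt (i + 1) (crossOp N g s p)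
        (opAt i (crossOp N g s true) F)) w := by
  obtain ⟨l, a, b, r, rfl, rfl⟩ := exists_eq_append_cons_cons (show i + 1 < w.length by omega)
  rcases r with _ | ⟨c, r⟩
  · simp at hw
  simp only [opAt_length, opAt_length_succ]
  exact crossOp_braid hg hs p _ a b c r

lemma cross_sq (hg : g ≠ 0) (hs : s ≠ 0) {i : ℕ} (F : List (Fin N) → ℂ) {w : List (Fin N)}
    (hw : i + 1 < w.length) :
    opAt i (crossOp N g s true) (opAt i (crossOp N g s true) F) w =
      g⁻¹ * (s - s⁻¹) * opAt i (crossOp N g s true) F w + g⁻¹ ^ 2 * F w := by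
  obtain ⟨l, a, b, r, rfl, rfl⟩ := exists_eq_append_cons_cons hw
  simp only [opAt_length, crossOp_apply]
  rcases lt_trichotomy a b with hab | rfl | hab
  · simp [hab.ne, hab.ne', hab.not_gt, hab, crossStay, crossScale]
    ring
  · simp [crossSame, crossScale]
    field_simp
    ring
  · simp [hab.ne, hab.ne', hab.not_gt, hab, crossStay, crossScale]
    ring

/-- The operators of reduced words of the same permutation agree. -/
lemma braidOp_eq (hg : g ≠ 0) (hs : s ≠ 0) {π : Equiv.Perm (Fin N)}
    {u v : List {i : ℕ // i + 1 < N}} (hu : IsReduced π u) (hv : IsReduced π v)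
    (F : List (Fin N) → ℂ) {w : List (Fin N)} (hw : N ≤ w.length) :
    braidOp N g s (u.map Subtype.val) F w = braidOp N g s (v.map Subtype.val) F w := by
  refine IsReduced.rel (fun u v => ∀ w : List (Fin N), N ≤ w.length →
    braidOp N g s (u.map Subtype.val) F w = braidOp N g s (v.map Subtype.val) F w)
    (fun _ _ _ => rfl) (fun u v h w hw => (h w hw).symm)
    (fun u v t h h' w hw => (h w hw).trans (h' w hw)) (fun i u v h w hw => ?_)
    (fun i j u h w hw => ?_) (fun i j u h w hw => ?_) hu hv w hw
  · have := i.2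
    simp only [List.map_cons, braidOp_cons, Module.End.mul_apply]
    exact cross_congr true (by omega) fun v hv => h v (by omega)
  · have := i.2
    simp only [List.map_cons, braidOp_cons, Module.End.mul_apply]
    exact cross_far true true h _ (by omega)
  · have := j.2
    simp only [List.map_cons, braidOp_cons, Module.End.mul_apply, ← h]
    exact (cross_braid hg hs true _ (by omega)).symm

lemma braidOp_adjSwap (hg : g ≠ 0) (hs : s ≠ 0) {π : Equiv.Perm (Fin N)}
    {i : {i : ℕ // i + 1 < N}} (h : ¬ Descent π i) (F : List (Fin N) → ℂ) {w : List (Fin N)}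
    (hw : N ≤ w.length) :
    braidOp N g s ((redWord (adjSwap N i * π)).map Subtype.val) F w =
      opAt i.1 (crossOp N g s true) (braidOp N g s ((redWord π).map Subtype.val) F) w := by
  rw [braidOp_eq hg hs (isReduced_redWord _) ((isReduced_redWord π).cons h) F hw, List.map_cons,
    braidOp_cons, Module.End.mul_apply]

lemma antiOp_apply (F : List (Fin N) → ℂ) (w : List (Fin N)) :
    antiOp N g s F w = ∑ π : Equiv.Perm (Fin N), (-(g * s⁻¹)) ^ ell π *
      braidOp N g s ((redWord π).map Subtype.val) F w := by
  unfold antiOp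
  rw [LinearMap.sum_apply, Finset.sum_apply]
  rfl

lemma cross_antiOp (hg : g ≠ 0) (hs : s ≠ 0) (i : {i : ℕ // i + 1 < N}) (F : List (Fin N) → ℂ)
    {w : List (Fin N)} (hw : N ≤ w.length) :
    opAt i.1 (crossOp N g s true) (antiOp N g s F) w = -(g⁻¹ * s⁻¹) * antiOp N g s F w := by
  have hi : i.1 + 1 < w.length := i.2.trans_le hw
  have e : opAt i.1 (crossOp N g s true) (antiOp N g s F) w =
      ∑ π : Equiv.Perm (Fin N), (-(g * s⁻¹)) ^ ell π * opAt i.1 (crossOp N g s true)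
        (braidOp N g s ((redWord π).map Subtype.val) F) w := by
    unfold antiOp
    rw [LinearMap.sum_apply, map_sum, Finset.sum_apply]
    refine Finset.sum_congr rfl fun π _ => ?_
    rw [LinearMap.smul_apply, map_smul]
    rfl
  rw [e, antiOp_apply, ← sub_eq_zero, Finset.mul_sum, ← Finset.sum_sub_distrib]
  have key : ∀ π : Equiv.Perm (Fin N), ¬ Descent π i →
      ((-(g * s⁻¹)) ^ ell π * opAt i.1 (crossOp N g s true)
          (braidOp N g s ((redWord π).map Subtype.val) F) w -
        -(g⁻¹ * s⁻¹) * ((-(g * s⁻¹)) ^ ell π *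
          braidOp N g s ((redWord π).map Subtype.val) F w)) +
      ((-(g * s⁻¹)) ^ ell (adjSwap N i * π) * opAt i.1 (crossOp N g s true)
          (braidOp N g s ((redWord (adjSwap N i * π)).map Subtype.val) F) w -
        -(g⁻¹ * s⁻¹) * ((-(g * s⁻¹)) ^ ell (adjSwap N i * π) *
          braidOp N g s ((redWord (adjSwap N i * π)).map Subtype.val) F w)) = 0 := by
    intro π h
    rw [ell_adjSwap_mul h, cross_congr true hi fun v hv => braidOp_adjSwap hg hs h F
      (by rw [hv]; exact hw), cross_sq hg hs _ hi, braidOp_adjSwap hg hs h F hw, pow_succ]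
    field_simp
    ring
  refine Finset.sum_involution (fun π _ => adjSwap N i * π) (fun π _ => ?_) (fun π _ _ h => ?_)
    (fun π _ => Finset.mem_univ _) (fun π _ => adjSwap_mul_cancel i π)
  · by_cases h : Descent π i
    · have := key (adjSwap N i * π) (by rwa [descent_adjSwap_mul, not_not])
      rw [adjSwap_mul_cancel] at this
      rw [add_comm]
      exact this
    · exact key π h
  · have h1 := adjSwap_apply_left i
    rw [mul_eq_right.1 h, Equiv.Perm.one_apply] at h1
    simp at h1

/-- Eigenvectors of a crossing are antisymmetric. -/
lemma antisymm_of_eigen (hg : g ≠ 0) (hs : s ≠ 0) (hs2 : s * s + 1 ≠ 0) {F : List (Fin N) → ℂ}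
    {l r : List (Fin N)} (h : ∀ a b, opAt l.length (crossOp N g s true) F (l ++ a :: b :: r) =
      -(g⁻¹ * s⁻¹) * F (l ++ a :: b :: r)) :
    (∀ a, F (l ++ a :: a :: r) = 0) ∧
      ∀ a b, a < b → F (l ++ b :: a :: r) = -s⁻¹ * F (l ++ a :: b :: r) := by
  refine ⟨fun a => ?_, fun a b hab => ?_⟩
  · have := h a a
    rw [opAt_length, crossOp_apply, if_pos rfl] at this
    simp only [crossScale, crossSame] at this
    field_simp at this
    have h2 : (s * s + 1) * F (l ++ a :: a :: r) = 0 := by linear_combination this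
    exact (mul_eq_zero.1 h2).resolve_left hs2
  · have := h a b
    rw [opAt_length, crossOp_apply, if_neg hab.ne] at this
    simp only [crossScale, crossStay, if_true, if_neg hab.not_gt, zero_mul, add_zero] at this
    refine mul_left_cancel₀ (inv_ne_zero hg) ?_
    rw [this]
    ring

/-- Antisymmetric functions are eigenvectors of the crossings. -/
lemma eigen_of_antisymm (hs : s ≠ 0) {F : List (Fin N) → ℂ} {l r : List (Fin N)}
    (h0 : ∀ a, F (l ++ a :: a :: r) = 0)
    (h : ∀ a b, a < b → F (l ++ b :: a :: r) = -s⁻¹ * F (l ++ a :: b :: r)) (a b : Fin N) :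
    opAt l.length (crossOp N g s true) F (l ++ a :: b :: r) =
      -(g⁻¹ * s⁻¹) * F (l ++ a :: b :: r) := by
  rw [opAt_length, crossOp_apply]
  rcases lt_trichotomy a b with hab | rfl | hab
  · simp only [hab.ne, hab.not_gt, crossStay, crossScale, if_true, if_false, h a b hab]
    ring
  · simp [h0]
  · simp only [hab.ne', hab, crossStay, crossScale, if_true, if_false, h b a hab]
    field_simp
    ring

lemma antiOp_append (hg : g ≠ 0) (hs : s ≠ 0) (hs2 : s * s + 1 ≠ 0) (F : List (Fin N) → ℂ)
    {w : List (Fin N)} (hw : w.length = N) (r : List (Fin N)) :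
    antiOp N g s F (w ++ r) = antiSign (-s⁻¹) w * antiOp N g s F (List.finRange N ++ r) := by
  have key : ∀ p t : List (Fin N), (∀ a b : Fin N, (p ++ a :: b :: t).length = N) →
      (∀ a, antiOp N g s F (p ++ a :: a :: (t ++ r)) = 0) ∧ ∀ a b, a < b →
        antiOp N g s F (p ++ b :: a :: (t ++ r)) =
          -s⁻¹ * antiOp N g s F (p ++ a :: b :: (t ++ r)) := by
    intro p t h
    refine antisymm_of_eigen hg hs hs2 fun a b => ?_
    have hl := h a b
    simp only [List.length_append, List.length_cons] at hl
    exact cross_antiOp hg hs ⟨p.length, by omega⟩ F (by simp; omega)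
  refine eq_antiSign_mul (-s⁻¹) (fun w => antiOp N g s F (w ++ r)) (fun p t a b hl hab => ?_)
    (fun p t a hl => ?_) hw
  · have := (key p t fun a' b' => by simpa using hl).2 a b hab
    simpa using this
  · have := (key p t fun a' b' => by simpa using hl).1 a
    simpa using this

lemma cross_inOp (hs : s ≠ 0) {i : ℕ} (hi : i + 1 < N) (F : List (Fin N) → ℂ)
    {w : List (Fin N)} (hw : N ≤ w.length) :
    opAt i (crossOp N g s true) (inOp N s F) w = -(g⁻¹ * s⁻¹) * inOp N s F w := by
  obtain ⟨l, a, b, r, rfl, rfl⟩ := exists_eq_append_cons_cons (hi.trans_le hw)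
  obtain ⟨t, v, rfl, ht⟩ : ∃ t v, r = t ++ v ∧ l.length + 2 + t.length = N :=
    ⟨r.take (N - l.length - 2), r.drop (N - l.length - 2), by simp, by
      simp only [List.length_append, List.length_cons] at hw
      simp; omega⟩
  have e : ∀ a b : Fin N, l ++ a :: b :: (t ++ v) = (l ++ a :: b :: t) ++ v := by simp
  have hl : ∀ a b : Fin N, (l ++ a :: b :: t).length = N := by simp; omega
  refine eigen_of_antisymm hs (fun a => ?_) (fun a b hab => ?_) a b
  · rw [e, inOp_apply s F (hl a a), antiSign_repeat, zero_mul]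
  · rw [e, e, inOp_apply s F (hl b a), inOp_apply s F (hl a b), antiSign_swap _ _ _ hab, mul_assoc]

lemma braidOp_inOp (hs : s ≠ 0) (u : List {i : ℕ // i + 1 < N}) (F : List (Fin N) → ℂ)
    {w : List (Fin N)} (hw : N ≤ w.length) :
    braidOp N g s (u.map Subtype.val) (inOp N s F) w =
      (-(g⁻¹ * s⁻¹)) ^ u.length * inOp N s F w := by
  induction u generalizing w with
  | nil => simp [braidOp]
  | cons i u ih =>
    have hi : i.1 + 1 < w.length := i.2.trans_le hw
    rw [List.map_cons, braidOp_cons, Module.End.mul_apply, cross_congr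
      (G := (-(g⁻¹ * s⁻¹)) ^ u.length • inOp N s F) true hi fun v hv => ih (by omega), map_smul,
      Pi.smul_apply, smul_eq_mul, cross_inOp hs i.2 F hw, List.length_cons, pow_succ, mul_assoc]

lemma antiOp_inOp (hg : g ≠ 0) (hs : s ≠ 0) (F : List (Fin N) → ℂ) (r : List (Fin N)) :
    antiOp N g s (inOp N s F) (List.finRange N ++ r) =
      (∏ j ∈ Finset.range N, ∑ i ∈ Finset.range (j + 1), (s⁻¹ ^ 2) ^ i) * F r := by
  rw [antiOp_apply, ← sum_pow_ell, Finset.sum_mul]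
  refine Finset.sum_congr rfl fun π _ => ?_
  rw [braidOp_inOp hs _ _ (by simp), (isReduced_redWord π).length_eq, inOp_apply s F (by simp),
    antiSign_finRange, one_mul, ← mul_assoc, ← mul_pow]
  congr 2
  field_simp

/-! ### Passing strands over and under coupons -/

variable (κ : ℂ)

lemma pass_cons (m : ℕ) (p : Bool) : pass 0 (m + 1) p = (0, .cross p) :: sh 1 (pass 0 m p) := by
  simp only [pass, sh, List.range_succ_eq_map, List.map_cons, List.map_map, zero_add]
  congr 1
  refine List.map_congr_left fun i _ => ?_
  simp [add_comm]

lemma wordOp_sh_one (w : List Layer) (F : List (Fin N) → ℂ) (c : Fin N) (v : List (Fin N)) :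
    wordOp N g s κ (sh 1 w) F (c :: v) = wordOp N g s κ w (fun t => F (c :: t)) v :=
  wordOp_sh g s κ w F [c] v

lemma wordOp_pass_cons (m : ℕ) (p : Bool) (F : List (Fin N) → ℂ) (c b : Fin N)
    (v : List (Fin N)) :
    wordOp N g s κ (pass 0 (m + 1) p) F (c :: b :: v) = crossScale g p *
      (if c = b then crossSame s p * wordOp N g s κ (pass 0 m p) (fun t => F (c :: t)) (c :: v) else
        wordOp N g s κ (pass 0 m p) (fun t => F (b :: t)) (c :: v) +
          crossStay s p c b * wordOp N g s κ (pass 0 m p) (fun t => F (c :: t)) (b :: v)) := by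
  rw [pass_cons, wordOp_cons]
  change crossOp N g s p _ _ = _
  rw [crossOp_apply]
  simp only [wordOp_sh_one]

lemma wordOp_pass_congr (m : ℕ) (p : Bool) {F G : List (Fin N) → ℂ} {w : List (Fin N)}
    (hw : m + 1 ≤ w.length) (h : ∀ v, v.length = w.length → F v = G v) :
    wordOp N g s κ (pass 0 m p) F w = wordOp N g s κ (pass 0 m p) G w := by
  induction m generalizing F G w with
  | zero => exact h w rfl
  | succ m ih =>
    rw [pass_cons, wordOp_cons, wordOp_cons]
    refine cross_congr p (by omega) fun v hv => ?_
    rcases v with _ | ⟨c, v⟩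
    · simp at hv; omega
    · rw [wordOp_sh_one, wordOp_sh_one]
      simp only [List.length_cons] at hv
      exact ih (by omega) fun t ht => h _ (by simp; omega)

/-- A crossing commutes with a word to the right of it. -/
lemma cross_sh_two (p : Bool) (w : List Layer) (F : List (Fin N) → ℂ) (a b : Fin N)
    (r : List (Fin N)) :
    opAt 0 (crossOp N g s p) (wordOp N g s κ (sh 2 w) F) (a :: b :: r) =
      wordOp N g s κ (sh 2 w) (opAt 0 (crossOp N g s p) F) (a :: b :: r) := by
  obtain ⟨ι, S, t, c, hl, h⟩ := isLocal_crossOp g s p a b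
  have h1 := wordOp_sh g s κ w (opAt 0 (crossOp N g s p) F) [a, b] r
  have h2 := h (wordOp N g s κ (sh 2 w) F) r
  have e : (fun v => opAt 0 (crossOp N g s p) F ([a, b] ++ v)) =
      ∑ i ∈ S, c i • fun v => F (t i ++ v) := by
    ext v
    rw [opAt_zero, h, Finset.sum_apply]
    rfl
  rw [opAt_zero]
  refine h2.trans (Eq.trans ?_ h1.symm)
  rw [e, map_sum, Finset.sum_apply]
  refine Finset.sum_congr rfl fun i _ => ?_
  have := wordOp_sh g s κ w F (t i) r
  rw [hl] at this
  rw [this, map_smul, Pi.smul_apply, smul_eq_mul]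

lemma cross_pass (hg : g ≠ 0) (hs : s ≠ 0) (p : Bool) {m i : ℕ} (hi : i + 1 < m)
    (F : List (Fin N) → ℂ) {w : List (Fin N)} (hw : m + 1 ≤ w.length) :
    opAt (i + 1) (crossOp N g s true) (wordOp N g s κ (pass 0 m p) F) w =
      wordOp N g s κ (pass 0 m p) (opAt i (crossOp N g s true) F) w := by
  induction m generalizing i F w with
  | zero => omega
  | succ m ih =>
    rw [pass_cons]
    simp only [wordOp_cons, pieceOp]
    rcases i with _ | i
    · obtain ⟨m, rfl⟩ : ∃ k, m = k + 1 := ⟨m - 1, by omega⟩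
      have hsh : ∀ H : List (Fin N) → ℂ, ∀ v : List (Fin N), 1 < v.length →
          wordOp N g s κ (sh 1 (pass 0 (m + 1) p)) H v = opAt 1 (crossOp N g s p)
            (wordOp N g s κ (sh 2 (pass 0 m p)) H) v := by
        intro H v hv
        rw [pass_cons]
        have : sh 1 ((0, Piece.cross p) :: sh 1 (pass 0 m p)) =
            (1, Piece.cross p) :: sh 2 (pass 0 m p) := by
          simp [sh, ← add_assoc]
        rw [this, wordOp_cons]
        rfl
      rw [zero_add, cross_congr true (by omega) (G := opAt 0 (crossOp N g s p)
        (opAt 1 (crossOp N g s p) (wordOp N g s κ (sh 2 (pass 0 m p)) F))) fun v hv =>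
          cross_congr p (by omega) fun v' hv' => hsh F v' (by omega),
        cross_congr p (by omega) fun v hv => hsh _ v (by omega)]
      have := cross_braid hg hs p (i := 0) (wordOp N g s κ (sh 2 (pass 0 m p)) F) (w := w)
        (by omega)
      rw [zero_add] at this
      rw [this]
      refine cross_congr p (by omega) fun v hv => cross_congr p (by omega) fun v' hv' => ?_
      rcases v' with _ | ⟨a, _ | ⟨b, r⟩⟩
      · simp at hv'; omega
      · simp at hv'; omega
      · exact cross_sh_two κ true _ F a b r
    · rw [← cross_far p true (by omega) _ (by omega)]
      refine cross_congr p (by omega) fun v hv => ?_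
      rcases v with _ | ⟨c, v⟩
      · simp at hv; omega
      · rw [opAt_cons]
        simp only [wordOp_sh_one, opAt_cons]
        simp only [List.length_cons] at hv
        exact ih (by omega) _ (by omega)

/-- A strand passes freely if its label does not occur. -/
lemma wordOp_pass_of_notMem (p : Bool) {c : Fin N} {w : List (Fin N)} (hc : c ∉ w)
    (F : List (Fin N) → ℂ) (hF : ∀ v, c ∈ v.take w.length → F v = 0) (r : List (Fin N)) :
    wordOp N g s κ (pass 0 w.length p) F (c :: (w ++ r)) =
      crossScale g p ^ w.length * F (w ++ c :: r) := by
  induction w generalizing F with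
  | nil => simp [pass, wordOp_nil]
  | cons b w ih =>
    rw [List.mem_cons, not_or] at hc
    have h0 : (fun t => F (c :: t)) = 0 := funext fun t => hF _ (by simp)
    rw [List.length_cons, List.cons_append, wordOp_pass_cons, if_neg hc.1, h0, map_zero,
      Pi.zero_apply, mul_zero, add_zero, ih hc.2 _ fun v hv => hF _ (by simp [hv]), pow_succ']
    rw [mul_assoc]
    rfl

lemma wordOp_passIn (hg : g ≠ 0) (hs : s ≠ 0) (hs2 : s * s + 1 ≠ 0) (hgN : g ^ N = s) (p : Bool)
    (F : List (Fin N) → ℂ) (c : Fin N) {w : List (Fin N)} (hw : w.length = N)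
    (r : List (Fin N)) :
    wordOp N g s κ (pass 0 N p) (inOp N s F) (c :: (w ++ r)) =
      antiSign (-s⁻¹) w * F (c :: r) := by
  have key : ∀ l t : List (Fin N), (∀ a b : Fin N, (l ++ a :: b :: t).length = N) →
      (∀ a, wordOp N g s κ (pass 0 N p) (inOp N s F) (c :: l ++ a :: a :: (t ++ r)) = 0) ∧
        ∀ a b, a < b → wordOp N g s κ (pass 0 N p) (inOp N s F) (c :: l ++ b :: a :: (t ++ r)) =
          -s⁻¹ * wordOp N g s κ (pass 0 N p) (inOp N s F) (c :: l ++ a :: b :: (t ++ r)) := by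
    intro l t h
    refine antisymm_of_eigen hg hs hs2 fun a b => ?_
    have hl := h a b
    simp only [List.length_append, List.length_cons] at hl
    rw [List.length_cons, cross_pass κ hg hs p (by omega) _ (by simp; omega),
      wordOp_pass_congr κ N p (G := -(g⁻¹ * s⁻¹) • inOp N s F) (by simp; omega)
        (fun v hv => cross_inOp hs (by omega) F (by simp at hv; omega)), map_smul]
    rfl
  have hG : ∀ w : List (Fin N), w.length = N →
      wordOp N g s κ (pass 0 N p) (inOp N s F) (c :: (w ++ r)) = antiSign (-s⁻¹) w *
        wordOp N g s κ (pass 0 N p) (inOp N s F) (c :: (List.finRange N ++ r)) := by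
    intro w hw
    refine eq_antiSign_mul (-s⁻¹) (fun w => wordOp N g s κ (pass 0 N p) (inOp N s F)
      (c :: (w ++ r))) (fun l t a b hl hab => ?_) (fun l t a hl => ?_) hw
    · have := (key l t fun a' b' => by simpa using hl).2 a b hab
      simpa using this
    · have := (key l t fun a' b' => by simpa using hl).1 a
      simpa using this
  have hperm : (c :: (List.finRange N).erase c).Perm (List.finRange N) :=
    (List.perm_cons_erase (by simp)).symm
  obtain ⟨M, hM⟩ : ∃ M, N = M + 1 := ⟨N - 1, by have := c.2; omega⟩
  have hlen : ((List.finRange N).erase c).length = M := by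
    have := hperm.length_eq
    rw [List.length_cons, List.length_finRange] at this
    omega
  have hnot : c ∉ (List.finRange N).erase c :=
    (List.nodup_cons.1 (hperm.nodup_iff.2 (List.nodup_finRange N))).1
  have hlen' : (c :: (List.finRange N).erase c).length = N := by simpa using hperm.length_eq
  have h1 := hG _ hlen'
  have h2 : wordOp N g s κ (pass 0 N p) (inOp N s F) (c :: (c :: (List.finRange N).erase c ++ r)) =
      antiSign (-s⁻¹) (c :: (List.finRange N).erase c) * F (c :: r) := by
    have e : pass 0 N p = pass 0 (M + 1) p := by rw [← hM]
    rw [e, List.cons_append, wordOp_pass_cons, if_pos rfl, ← hlen,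
      wordOp_pass_of_notMem κ p hnot _ fun v hv => ?_]
    · have e2 : inOp N s F (c :: ((List.finRange N).erase c ++ c :: r)) =
          antiSign (-s⁻¹) (c :: (List.finRange N).erase c) * F (c :: r) :=
        inOp_apply s F hlen' (c :: r)
      rw [e2, ← mul_assoc, ← mul_assoc, hlen]
      have e3 : crossScale g p * crossSame s p * crossScale g p ^ M = 1 := by
        have : g ^ N = g ^ M * g := by rw [hM, pow_succ]
        cases p
        · simp only [crossScale, crossSame, ← hgN, this]
          field_simp
        · simp only [crossScale, crossSame, ← hgN, this, inv_pow]
          field_simp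
      rw [e3, one_mul]
    · change antiSign _ ((c :: v).take N) * _ = 0
      have e4 : (c :: v).take N = c :: v.take M := by
        conv_lhs => rw [show (c :: v).take N = (c :: v).take (M + 1) by rw [← hM]]
        rfl
      rw [hlen] at hv
      rw [e4, antiSign, if_neg, zero_mul]
      simp [hv]
  have h3 : antiSign (-s⁻¹) (c :: (List.finRange N).erase c) ≠ 0 := by
    rw [antiSign, if_pos (hperm.nodup_iff.2 (List.nodup_finRange N))]
    exact pow_ne_zero _ (neg_ne_zero.2 (inv_ne_zero hs))
  rw [hG w hw]
  rw [h2] at h1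
  rw [mul_left_cancel₀ h3 h1]

lemma braidOp_pass (hg : g ≠ 0) (hs : s ≠ 0) (p : Bool) (u : List {i : ℕ // i + 1 < N})
    (F : List (Fin N) → ℂ) (c : Fin N) {w : List (Fin N)} (hw : N ≤ w.length) :
    braidOp N g s (u.map Subtype.val) (fun v => wordOp N g s κ (pass 0 N p) F (c :: v)) w =
      wordOp N g s κ (pass 0 N p) (braidOp N g s (u.map Subtype.val) F) (c :: w) := by
  induction u generalizing w with
  | nil => rfl
  | cons i u ih =>
    have hi : i.1 + 1 < w.length := i.2.trans_le hw
    rw [List.map_cons, braidOp_cons, Module.End.mul_apply, Module.End.mul_apply,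
      cross_congr true hi fun v hv => ih (by omega), ← cross_pass κ hg hs p i.2 _ (by simpa using hw),
      opAt_cons]

lemma wordOp_passOut (hg : g ≠ 0) (hs : s ≠ 0) (hs2 : s * s + 1 ≠ 0) (hgN : g ^ N = s) (p : Bool)
    (F : List (Fin N) → ℂ) (c : Fin N) (r : List (Fin N)) :
    outOp N g s κ (fun v => wordOp N g s κ (pass 0 N p) F (c :: v)) r =
      outOp N g s κ F (c :: r) := by
  rw [outOp_apply, outOp_apply]
  congr 1
  have e : antiOp N g s (fun v => wordOp N g s κ (pass 0 N p) F (c :: v)) (List.finRange N ++ r) =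
      wordOp N g s κ (pass 0 N p) (antiOp N g s F) (c :: (List.finRange N ++ r)) := by
    unfold antiOp
    rw [LinearMap.sum_apply, LinearMap.sum_apply, map_sum, Finset.sum_apply, Finset.sum_apply]
    refine Finset.sum_congr rfl fun π _ => ?_
    rw [LinearMap.smul_apply, LinearMap.smul_apply, map_smul, Pi.smul_apply, Pi.smul_apply,
      braidOp_pass κ hg hs p _ F c (by simp)]
  rw [e, wordOp_pass_congr κ N p (G := inOp N s fun v => antiOp N g s F (List.finRange N ++ v))
    (by simp) fun v hv => ?_, wordOp_passIn κ hg hs hs2 hgN p _ c (by simp) r,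
    antiSign_finRange, one_mul]
  have hl : N ≤ v.length := by rw [hv]; simp; omega
  rw [← List.take_append_drop N v, antiOp_append hg hs hs2 F (by simpa using hl),
    inOp_apply s _ (by simpa using hl)]

end StateSumCoupons

end

section

/-! ### Invariance of the state sum -/

section StateSumInvariance

variable {N : ℕ} {g s : ℂ} (κ : ℂ)

lemma Leads.cons_length {x : Layer} {w : List Layer} {a b : List Bool} (h : Leads N (x :: w) a b) :
    ∃ c, x.1 + (x.2.bot N).length ≤ a.length ∧
      a.length + (x.2.top N).length = c.length + (x.2.bot N).length ∧ Leads N w c b := by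
  obtain ⟨c, h1, h2⟩ := h
  exact ⟨c, h1.length.1, h1.length.2, h2⟩

lemma exists_append_of_le_length {k m : ℕ} {v : List (Fin N)} (h : k + m ≤ v.length) :
    ∃ l t r : List (Fin N), v = l ++ (t ++ r) ∧ l.length = k ∧ t.length = m :=
  ⟨v.take k, (v.drop k).take m, (v.drop k).drop m, by simp, by simp; omega, by simp; omega⟩

lemma wordOp_far (k m : ℕ) (x y : Piece) (F : List (Fin N) → ℂ) {v : List (Fin N)}
    (hv : k + (x.bot N).length ≤ v.length) :
    wordOp N g s κ [(k, x), (k + (x.top N).length + m, y)] F v =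
      wordOp N g s κ [(k + (x.bot N).length + m, y), (k, x)] F v := by
  obtain ⟨l, t, r, rfl, rfl, ht⟩ := exists_append_of_le_length hv
  simp only [wordOp_cons, wordOp_nil]
  rw [opAt_length, add_assoc, add_assoc, opAt_append]
  simp only [opAt_append, opAt_length]
  rw [(isLocal_pieceOp g s κ x ht).comm, ht]

lemma wordOp_move (hg : g ≠ 0) (hs : s ≠ 0) (hs2 : s * s + 1 ≠ 0) (hgN : g ^ N = s)
    {f h : List Layer} (hm : Move N f h) {a b : List Bool} (hf : Leads N f a b)
    (hh : Leads N h a b) (F : List (Fin N) → ℂ) {v : List (Fin N)} (hv : v.length = a.length) :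
    wordOp N g s κ f F v = wordOp N g s κ h F v := by
  cases hm with
  | far k m x y =>
    obtain ⟨c, h1, -⟩ := hf.cons_length
    exact wordOp_far κ k m x y F (by simp only at h1; omega)
  | zigzag k e =>
    obtain ⟨c, h1, h2, h3⟩ := hf.cons_length
    obtain ⟨d, h4, h5, -⟩ := h3.cons_length
    simp only [Piece.bot, Piece.top, List.length_cons, List.length_nil] at h1 h2 h4 h5
    obtain ⟨l, t, r, rfl, rfl, ht⟩ := exists_append_of_le_length (N := N) (k := k) (m := 1)
      (v := v) (by omega)
    obtain ⟨x, rfl⟩ := List.length_eq_one_iff.1 ht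
    exact (wordOp_sh g s κ [(0, .cup e), (1, .cap !e)] F l ([x] ++ r)).trans
      (wordOp_zigzag κ hs e _ x r)
  | zagzig k e =>
    obtain ⟨c, h1, h2, h3⟩ := hf.cons_length
    simp only [Piece.bot, Piece.top, List.length_cons, List.length_nil] at h1 h2
    obtain ⟨l, t, r, rfl, rfl, ht⟩ := exists_append_of_le_length (N := N) (k := k) (m := 1)
      (v := v) (by omega)
    obtain ⟨x, rfl⟩ := List.length_eq_one_iff.1 ht
    exact (wordOp_sh g s κ [(1, .cup e), (0, .cap !e)] F l ([x] ++ r)).trans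
      (wordOp_zagzig κ hs e _ x r)
  | reidemeister2 k p =>
    obtain ⟨c, h1, -, -⟩ := hf.cons_length
    simp only [Piece.bot, List.length_cons, List.length_nil] at h1
    obtain ⟨l, t, r, rfl, rfl, ht⟩ := exists_append_of_le_length (N := N) (k := k) (m := 2)
      (v := v) (by omega)
    obtain ⟨x, y, rfl⟩ := List.length_eq_two.1 ht
    exact (wordOp_sh g s κ [(0, .cross p), (0, .cross !p)] F l ([x, y] ++ r)).trans
      (wordOp_reidemeister2 κ hg hs p _ x y r)
  | reidemeister2UD k p =>
    obtain ⟨c, h1, h2, h3⟩ := Leads.cons_length (x := (k, .cup false)) hf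
    obtain ⟨d, h4, h5, h6⟩ := Leads.cons_length (x := (k + 1, .cross p)) h3
    obtain ⟨d', h7, -, -⟩ := Leads.cons_length (x := (k + 2, .cap true)) h6
    simp only [Piece.bot, Piece.top, List.length_cons, List.length_nil] at h1 h2 h4 h5 h7
    obtain ⟨l, t, r, rfl, rfl, ht⟩ := exists_append_of_le_length (N := N) (k := k) (m := 2)
      (v := v) (by omega)
    obtain ⟨x, y, rfl⟩ := List.length_eq_two.1 ht
    exact (wordOp_sh g s κ (crossUD 0 p ++ crossDU 0 !p) F l ([x, y] ++ r)).trans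
      (wordOp_reidemeister2UD κ hg hs p _ x y r)
  | reidemeister2DU k p =>
    obtain ⟨c, h1, h2, h3⟩ := Leads.cons_length (x := (k + 2, .cup true)) hf
    simp only [Piece.bot, Piece.top, List.length_cons, List.length_nil] at h1 h2
    obtain ⟨l, t, r, rfl, rfl, ht⟩ := exists_append_of_le_length (N := N) (k := k) (m := 2)
      (v := v) (by omega)
    obtain ⟨x, y, rfl⟩ := List.length_eq_two.1 ht
    exact (wordOp_sh g s κ (crossDU 0 p ++ crossUD 0 !p) F l ([x, y] ++ r)).trans
      (wordOp_reidemeister2DU κ hg hs p _ x y r)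
  | reidemeister3 k =>
    obtain ⟨c, h1, h2, h3⟩ := hh.cons_length
    simp only [Piece.bot, List.length_cons, List.length_nil] at h1
    obtain ⟨l, t, r, rfl, rfl, ht⟩ := exists_append_of_le_length (N := N) (k := k) (m := 3)
      (v := v) (by omega)
    obtain ⟨x, y, z, rfl⟩ := List.length_eq_three.1 ht
    refine (wordOp_sh g s κ [(0, .cross true), (1, .cross true), (0, .cross true)] F l
      ([x, y, z] ++ r)).trans (Eq.trans ?_ (wordOp_sh g s κ
        [(1, .cross true), (0, .cross true), (1, .cross true)] F l ([x, y, z] ++ r)).symm)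
    exact (crossOp_braid hg hs true _ x y z r).symm
  | rotate k p =>
    obtain ⟨c, h1, h2, h3⟩ := hh.cons_length
    simp only [Piece.bot, List.length_nil] at h1
    obtain ⟨l, t, r, rfl, rfl, ht⟩ := exists_append_of_le_length (N := N) (k := k) (m := 2)
      (v := v) (by omega)
    obtain ⟨x, y, rfl⟩ := List.length_eq_two.1 ht
    refine (wordOp_sh g s κ [(0, .cup false), (1, .cup false), (2, .cross p), (3, .cap true),
        (2, .cap true)] F l ([x, y] ++ r)).trans (Eq.trans (wordOp_rotate κ hs p _ x y r)
      (wordOp_sh g s κ [(2, .cup true), (3, .cup true), (2, .cross p), (1, .cap false),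
        (0, .cap false)] F l ([x, y] ++ r)).symm)
  | passIn k p =>
    obtain ⟨c, h1, h2, h3⟩ := hh.cons_length
    simp only [Piece.bot, List.length_replicate] at h1
    obtain ⟨l, t, r, rfl, rfl, ht⟩ := exists_append_of_le_length (N := N) (k := k) (m := N + 1)
      (v := v) (by omega)
    obtain ⟨x, t, rfl⟩ := List.exists_cons_of_length_eq_add_one ht
    have e := wordOp_sh g s κ (pass 0 N p ++ [(0, .couponIn)]) F l (x :: (t ++ r))
    rw [sh_append, sh_pass, add_zero] at e
    refine e.trans (Eq.trans ?_ (wordOp_sh g s κ [(1, .couponIn)] F l (x :: (t ++ r))).symm)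
    have ht' : t.length = N := by simpa using ht
    rw [wordOp_append]
    refine (wordOp_passIn κ hg hs hs2 hgN p _ x ht' r).trans ?_
    exact (inOp_apply s (fun v => F (l ++ x :: v)) ht' r).symm
  | passOut k p =>
    obtain ⟨c, h1, h2, h3⟩ := hf.cons_length
    simp only [Piece.bot, List.length_nil] at h1
    obtain ⟨l, t, r, rfl, rfl, ht⟩ := exists_append_of_le_length (N := N) (k := k) (m := 1)
      (v := v) (by omega)
    obtain ⟨x, rfl⟩ := List.length_eq_one_iff.1 ht
    have e := wordOp_sh g s κ ([(1, .couponOut)] ++ pass 0 N p) F l ([x] ++ r)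
    rw [sh_append, sh_pass, add_zero] at e
    refine e.trans (Eq.trans ?_ (wordOp_sh g s κ [(0, .couponOut)] F l ([x] ++ r)).symm)
    rw [wordOp_append]
    exact wordOp_passOut κ hg hs hs2 hgN p (fun t => F (l ++ t)) x r

lemma wordOp_positiveBraid (u : List {i : ℕ // i + 1 < N}) (F : List (Fin N) → ℂ) :
    wordOp N g s κ (positiveBraid 0 u) F = braidOp N g s (u.map Subtype.val) F := by
  unfold wordOp braidOp positiveBraid
  rw [List.map_map, List.map_map]
  congr 3
  funext i
  simp [pieceOp]

lemma wordOp_couponInOut (hg : g ≠ 0) (hs : s ≠ 0) (hs2 : s * s + 1 ≠ 0)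
    {u : Equiv.Perm (Fin N) → List {i : ℕ // i + 1 < N}} (hu : ∀ π, IsReduced π (u π))
    (F : List (Fin N) → ℂ) {w : List (Fin N)} (hw : w.length = N) (r : List (Fin N)) :
    wordOp N g s κ [(0, .couponIn), (0, .couponOut)] F (w ++ r) = κ *
      ∑ π, (-(g * s⁻¹)) ^ (u π).length * wordOp N g s κ (positiveBraid 0 (u π)) F (w ++ r) := by
  have e : wordOp N g s κ [(0, .couponIn), (0, .couponOut)] F (w ++ r) =
      antiSign (-s⁻¹) w * (κ * antiOp N g s F (List.finRange N ++ r)) :=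
    inOp_apply s (outOp N g s κ F) hw r
  rw [e, mul_left_comm, ← antiOp_append hg hs hs2 F hw, antiOp_apply]
  congr 1
  refine Finset.sum_congr rfl fun π _ => ?_
  rw [wordOp_positiveBraid, (hu π).length_eq,
    braidOp_eq hg hs (isReduced_redWord π) (hu π) F (by simp [hw])]

lemma wordOp_couponOutIn (hg : g ≠ 0) (hs : s ≠ 0)
    (hκ : κ * ∏ j ∈ Finset.range N, ∑ i ∈ Finset.range (j + 1), (s⁻¹ ^ 2) ^ i = 1)
    (F : List (Fin N) → ℂ) (r : List (Fin N)) :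
    wordOp N g s κ [(0, .couponOut), (0, .couponIn)] F r = F r := by
  change κ * antiOp N g s (inOp N s F) (List.finRange N ++ r) = F r
  rw [antiOp_inOp hg hs, ← mul_assoc, hκ, one_mul]

/-- The state sum of a linear combination of diagrams. -/
def stateSum (g s κ : ℂ) (a b : List Bool) (F : List (Fin N) → ℂ) (v : List (Fin N)) :
    (Diagram N a b →₀ ℂ) →ₗ[ℂ] ℂ :=
  Finsupp.linearCombination ℂ fun f => wordOp N g s κ f.1 F v

lemma stateSum_diag (a b : List Bool) (F : List (Fin N) → ℂ) (v : List (Fin N))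
    (f : Diagram N a b) : stateSum g s κ a b F v (diag f) = wordOp N g s κ f.1 F v := by
  simp [stateSum]

lemma stateSum_stack {a b c d : List Bool} (F : List (Fin N) → ℂ) (v : List (Fin N))
    (f : Diagram N a b) (y : Diagram N b c →₀ ℂ) (h : Diagram N c d) :
    stateSum g s κ a d F v (stack N a c d (stack N a b c (diag f) y) (diag h)) =
      wordOp N g s κ f.1 (fun t => stateSum g s κ b c (wordOp N g s κ h.1 F) t y) v := by
  induction y using Finsupp.induction_linear with
  | zero =>
    simp only [map_zero, LinearMap.zero_apply]
    exact (congrFun (map_zero (wordOp N g s κ f.1)) v).symm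
  | add y y' h1 h2 =>
    simp only [map_add, LinearMap.add_apply, h1, h2]
    exact (congrFun (map_add (wordOp N g s κ f.1) _ _) v).symm
  | single e z =>
    rw [stack_single, stack_single, one_mul, mul_one]
    have e1 : (fun t => stateSum g s κ b c (wordOp N g s κ h.1 F) t (Finsupp.single e z)) =
        z • wordOp N g s κ e.1 (wordOp N g s κ h.1 F) := by
      ext t
      simp [stateSum]
    rw [e1, map_smul, ← wordOp_append, ← wordOp_append]
    simp [stateSum, Diagram.comp]

end StateSumInvariance

section StateSumScalars

variable {N K : ℕ} (hN : 2 ≤ N) (hK : 1 ≤ K)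

lemma qpow_frac_pow (hN : 2 ≤ N) : qpow N K (1 / (2 * N)) ^ N = qpow N K (1 / 2) := by
  have : (N : ℚ) ≠ 0 := by positivity
  rw [← qpow_natCast_mul]
  congr 1
  field_simp

lemma neg_qpow_eq (hN : 2 ≤ N) : -qpow N K ((1 - N) / (2 * N)) =
    -(qpow N K (1 / (2 * N)) * (qpow N K (1 / 2))⁻¹) := by
  have : (N : ℚ) ≠ 0 := by positivity
  rw [← qpow_neg, ← qpow_add]
  congr 2
  field_simp
  ring

lemma qpow_half_zpow (d : ℤ) : qpow N K (d / 2) = qpow N K (1 / 2) ^ d := by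
  obtain ⟨n, rfl | rfl⟩ := d.eq_nat_or_neg
  · rw [zpow_natCast, ← qpow_natCast_mul]
    congr 1
    push_cast
    ring
  · rw [zpow_neg, zpow_natCast, ← qpow_natCast_mul, ← qpow_neg]
    congr 1
    push_cast
    ring

lemma curl_scalar (hN : 2 ≤ N) (p : Bool) :
    qpow N K ((if p then 1 else -1) * (((N : ℚ) ^ 2 - 1) / (2 * N))) =
      crossScale (qpow N K (1 / (2 * N))) p * qpow N K (1 / 2) ^ (if p then (N : ℤ) else -N) := by
  have : (N : ℚ) ≠ 0 := by positivity
  cases p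
  · rw [if_neg (by simp), if_neg (by simp), crossScale, ← qpow_half_zpow, ← qpow_add]
    congr 1
    push_cast
    field_simp
    ring
  · rw [if_pos rfl, if_pos rfl, crossScale, ← qpow_half_zpow, ← qpow_neg, ← qpow_add]
    congr 1
    push_cast
    field_simp
    ring

include hN hK in
lemma qpow_half_sub_inv_ne : qpow N K (1 / 2) - (qpow N K (1 / 2))⁻¹ ≠ 0 := by
  intro h
  have h0 := qpow_ne_zero (N := N) (K := K) (1 / 2)
  refine qpow_one_ne_one hN hK ?_
  rw [← qpow_half_sq]
  field_simp at h
  linear_combination h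

include hN hK in
lemma qint_mul_eq (j : ℕ) : (qpow N K (1 / 2) - (qpow N K (1 / 2))⁻¹) * qint N K j =
    qpow N K (1 / 2) ^ (j : ℤ) - qpow N K (1 / 2) ^ (-j : ℤ) := by
  have h := qpow_half_sub_inv_ne hN hK
  unfold qint
  have e1 := qpow_half_zpow (N := N) (K := K) j
  have e2 := qpow_half_zpow (N := N) (K := K) (-j)
  push_cast at e1 e2
  rw [e1, e2, show (-1 / 2 : ℚ) = -(1 / 2) by norm_num, qpow_neg, mul_div_cancel₀ _ h]

include hN hK in
lemma sum_inv_sq_pow (j : ℕ) : ∑ i ∈ Finset.range (j + 1), ((qpow N K (1 / 2))⁻¹ ^ 2) ^ i =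
    (qpow N K (1 / 2))⁻¹ ^ j * qint N K (j + 1) := by
  have h0 := qpow_ne_zero (N := N) (K := K) (1 / 2)
  have h := qpow_half_sub_inv_ne hN hK
  refine mul_left_cancel₀ h ?_
  rw [mul_left_comm, qint_mul_eq hN hK]
  set s := qpow N K (1 / 2)
  have h2 := geom_sum_mul (s⁻¹ ^ 2) (j + 1)
  have e : s - s⁻¹ = -(s * (s⁻¹ ^ 2 - 1)) := by field_simp; ring
  rw [e, neg_mul, mul_assoc, mul_comm (s⁻¹ ^ 2 - 1), h2, zpow_neg, zpow_natCast, inv_pow, inv_pow,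
    inv_pow]
  field_simp
  ring

include hN hK in
lemma qfact_ne_zero : qfact N K N ≠ 0 := by
  refine Finset.prod_ne_zero_iff.2 fun j hj => ?_
  have hj := Finset.mem_range.1 hj
  rw [qint_eq_sin]
  have h1 := sin_theta_pos hN hK (j := j + 1) (by omega) (by omega)
  have h2 := sin_theta_pos hN hK (j := 1) (by omega) (by omega)
  rw [Nat.cast_one, one_mul] at h2
  exact_mod_cast (div_pos h1 h2).ne'

include hN hK in
lemma coupon_scalar : qpow N K ((N : ℚ) * (N - 1) / 4) / qfact N K N *
    ∏ j ∈ Finset.range N, ∑ i ∈ Finset.range (j + 1), ((qpow N K (1 / 2))⁻¹ ^ 2) ^ i = 1 := by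
  simp only [sum_inv_sq_pow hN hK]
  rw [Finset.prod_mul_distrib, Finset.prod_pow_eq_pow_sum]
  have h0 := qpow_ne_zero (N := N) (K := K) (1 / 2)
  have e : qpow N K ((N : ℚ) * (N - 1) / 4) =
      qpow N K (1 / 2) ^ (∑ j ∈ Finset.range N, j) := by
    rw [← qpow_natCast_mul]
    congr 1
    have h := Finset.sum_range_id_mul_two N
    have h' : ((∑ j ∈ Finset.range N, j : ℕ) : ℚ) * 2 = N * (N - 1) := by
      rw [← Nat.cast_pred (by omega)]
      exact_mod_cast h
    linear_combination h' / (-4)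
  have h1 := qfact_ne_zero hN hK
  change _ / _ * (_ * qfact N K N) = 1
  rw [e]
  rw [inv_pow]
  field_simp

include hN hK in
lemma stateSum_localRel {a b : List Bool} {y : Diagram N a b →₀ ℂ} (hy : LocalRel N K y)
    (F : List (Fin N) → ℂ) {v : List (Fin N)} (hv : v.length = a.length) :
    stateSum (qpow N K (1 / (2 * N))) (qpow N K (1 / 2))
      (qpow N K ((N : ℚ) * (N - 1) / 4) / qfact N K N) a b F v y = 0 := by
  have hg := qpow_ne_zero (N := N) (K := K) (1 / (2 * N))
  have hs := qpow_ne_zero (N := N) (K := K) (1 / 2)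
  have hs2 : qpow N K (1 / 2) * qpow N K (1 / 2) + 1 ≠ 0 := by
    rw [qpow_half_sq]; exact qpow_one_add_one_ne hN hK
  have hgN := qpow_frac_pow (K := K) hN
  cases hy with
  | move f h hm =>
    rw [map_sub, stateSum_diag, stateSum_diag,
      wordOp_move _ hg hs hs2 hgN hm f.2 h.2 F hv, sub_self]
  | skein k f h i hf hh hi =>
    have h1 := f.2
    rw [hf] at h1
    obtain ⟨c, h1, -, -⟩ := h1.cons_length
    simp only [Piece.bot, List.length_cons, List.length_nil] at h1
    obtain ⟨l, t, r, rfl, rfl, ht⟩ := exists_append_of_le_length (N := N) (k := k) (m := 2)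
      (v := v) (by omega)
    obtain ⟨x, z, rfl⟩ := List.length_eq_two.1 ht
    simp only [map_sub, map_smul, stateSum_diag, hf, hh, hi, smul_eq_mul]
    rw [show (-1 / 2 : ℚ) = -(1 / 2) by norm_num, qpow_neg, qpow_neg, sub_eq_zero]
    refine Eq.trans ?_ (wordOp_skein (qpow N K ((N : ℚ) * (N - 1) / 4) / qfact N K N) hg hs
      (fun t => F (l ++ t)) x z r)
    congr 2
    · exact wordOp_sh _ _ _ [(0, .cross true)] F l ([x, z] ++ r)
    · exact wordOp_sh _ _ _ [(0, .cross false)] F l ([x, z] ++ r)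
  | curlRight k p f h hf hh =>
    have h1 := f.2
    rw [hf] at h1
    obtain ⟨c, h1, -, -⟩ := h1.cons_length
    simp only [Piece.bot, List.length_nil] at h1
    obtain ⟨l, t, r, rfl, rfl, ht⟩ := exists_append_of_le_length (N := N) (k := k) (m := 1)
      (v := v) (by omega)
    obtain ⟨x, rfl⟩ := List.length_eq_one_iff.1 ht
    simp only [map_sub, map_smul, stateSum_diag, hf, hh, smul_eq_mul]
    rw [sub_eq_zero, curl_scalar hN]
    exact (wordOp_sh _ _ _ [(1, .cup true), (0, .cross p), (1, .cap true)] F l ([x] ++ r)).trans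
      (wordOp_curlRight _ hs p _ x r)
  | curlLeft k p f h hf hh =>
    have h1 := f.2
    rw [hf] at h1
    obtain ⟨c, h1, h2, h3⟩ := h1.cons_length
    obtain ⟨d, h4, h5, -⟩ := h3.cons_length
    simp only [Piece.bot, Piece.top, List.length_cons, List.length_nil] at h1 h2 h4 h5
    obtain ⟨l, t, r, rfl, rfl, ht⟩ := exists_append_of_le_length (N := N) (k := k) (m := 1)
      (v := v) (by omega)
    obtain ⟨x, rfl⟩ := List.length_eq_one_iff.1 ht
    simp only [map_sub, map_smul, stateSum_diag, hf, hh, smul_eq_mul]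
    rw [sub_eq_zero, curl_scalar hN]
    exact (wordOp_sh _ _ _ [(0, .cup false), (1, .cross p), (0, .cap false)] F l
      ([x] ++ r)).trans (wordOp_curlLeft _ hs p _ x r)
  | circle k e f h hf hh =>
    have h1 := f.2
    rw [hf] at h1
    obtain ⟨c, h1, -, -⟩ := h1.cons_length
    simp only [Piece.bot, List.length_nil] at h1
    obtain ⟨l, t, r, rfl, rfl, ht⟩ := exists_append_of_le_length (N := N) (k := k) (m := 0)
      (v := v) (by omega)
    simp only [map_sub, map_smul, stateSum_diag, hf, hh, smul_eq_mul]
    rw [sub_eq_zero]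
    refine mul_left_cancel₀ (qpow_half_sub_inv_ne hN hK) ?_
    rw [← mul_assoc, qint_mul_eq hN hK]
    refine Eq.trans ?_ (wordOp_circle (g := qpow N K (1 / (2 * N)))
      (qpow N K ((N : ℚ) * (N - 1) / 4) / qfact N K N) hs e (fun t => F (l ++ t)) (t ++ r))
    congr 1
    exact wordOp_sh _ _ _ [(0, .cup e), (0, .cap e)] F l (t ++ r)
  | couponInOut k u hu f h hf hh =>
    have h1 := f.2
    rw [hf] at h1
    obtain ⟨c, h1, -, -⟩ := h1.cons_length
    simp only [Piece.bot, List.length_replicate] at h1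
    obtain ⟨l, t, r, rfl, rfl, ht⟩ := exists_append_of_le_length (N := N) (k := k) (m := N)
      (v := v) (by omega)
    simp only [map_sub, map_smul, map_sum, stateSum_diag, hf, hh, smul_eq_mul]
    rw [sub_eq_zero, neg_qpow_eq hN]
    refine (wordOp_sh _ _ _ [(0, .couponIn), (0, .couponOut)] F l (t ++ r)).trans
      ((wordOp_couponInOut _ hg hs hs2 hu _ ht r).trans ?_)
    congr 1
    refine Finset.sum_congr rfl fun π _ => ?_
    rw [← wordOp_sh, sh_positiveBraid, add_zero]
  | couponOutIn k f h hf hh =>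
    have h1 := f.2
    rw [hf] at h1
    obtain ⟨c, h1, -, -⟩ := h1.cons_length
    simp only [Piece.bot, List.length_nil] at h1
    obtain ⟨l, t, r, rfl, rfl, ht⟩ := exists_append_of_le_length (N := N) (k := k) (m := 0)
      (v := v) (by omega)
    simp only [map_sub, stateSum_diag, hf, hh]
    rw [sub_eq_zero]
    exact (wordOp_sh _ _ _ [(0, .couponOut), (0, .couponIn)] F l (t ++ r)).trans
      (wordOp_couponOutIn _ hg hs (coupon_scalar hN hK) _ _)

include hN hK in
/-- The skein module of closed diagrams has a functional that takes the value `1` on the empty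
diagram. -/
theorem exists_skein_functional :
    ∃ φ : Skein N K [] [] →ₗ[ℂ] ℂ, φ (Skein.of K (Diagram.id N [])) = 1 := by
  have hker : relations N K [] [] ≤ LinearMap.ker (stateSum (qpow N K (1 / (2 * N)))
      (qpow N K (1 / 2)) (qpow N K ((N : ℚ) * (N - 1) / 4) / qfact N K N) [] []
      (fun _ : List (Fin N) => 1) []) := by
    refine Submodule.span_le.2 ?_
    rintro _ ⟨c, d, f, y, h, hy, rfl⟩
    rw [SetLike.mem_coe, LinearMap.mem_ker, stateSum_stack,
      word_congr _ _ _ f.2 (G := 0) rfl fun t ht => stateSum_localRel hN hK hy _ ht]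
    exact congrFun (map_zero (wordOp N _ _ _ f.1)) []
  refine ⟨(relations N K [] []).liftQ _ hker, ?_⟩
  change stateSum _ _ _ [] [] (fun _ : List (Fin N) => 1) [] (diag (Diagram.id N [])) = 1
  rw [stateSum_diag]
  rfl

end StateSumScalars

end

section

/-! ### The closure of braids -/

section Closure

variable {N K : ℕ}

/-- The product of a word in the generators. -/
def Hecke.word (N K : ℕ) {n : ℕ∞} (u : List (BraidGen n)) : Hecke N K n :=
  (u.map (Hecke.sigma N K)).prod

lemma Hecke.eq_of_word {n : ℕ∞} {M : Type*} [AddCommGroup M] [Module ℂ M]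
    (f g : Hecke N K n →ₗ[ℂ] M) (h : ∀ u, f (Hecke.word N K u) = g (Hecke.word N K u))
    (x : Hecke N K n) : f x = g x := by
  suffices H : ∀ u, f (Hecke.word N K u * x) = g (Hecke.word N K u * x) by
    simpa [Hecke.word] using H []
  induction x using Hecke.induction with
  | one => simpa using h
  | add x y hx hy => intro u; rw [mul_add, map_add, map_add, hx, hy]
  | smul c x hx => intro u; rw [mul_smul_comm, map_smul, map_smul, hx]
  | mul i x hx =>
    intro u
    have := hx (u ++ [i])
    simpa [Hecke.word, mul_assoc] using this

lemma Hecke.mapLE_word {n m : ℕ} (h : n ≤ m) (u : List (BraidGen n)) :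
    Hecke.mapLE N K h (Hecke.word N K u) = Hecke.word N K (u.map (BraidGen.castLE h)) := by
  simp [Hecke.word, map_list_prod, List.map_map, Function.comp_def, Hecke.mapLE_sigma]

/-- The diagram of a word in the generators. -/
def crossList {n : ℕ} (u : List (BraidGen n)) : List Layer :=
  (u.map fun i => (i.1, Piece.cross true)).reverse

lemma crossWord_crossList {n : ℕ} (u : List (BraidGen n)) : CrossWord n (crossList u) := by
  intro x hx
  obtain ⟨i, -, rfl⟩ := List.mem_map.1 (List.mem_reverse.1 hx)
  exact ⟨i.1, true, rfl, i.lt⟩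

lemma crossList_castLE {n m : ℕ} (h : n ≤ m) (u : List (BraidGen n)) :
    crossList (u.map (BraidGen.castLE h)) = crossList u := by
  simp [crossList, List.map_map, Function.comp_def, BraidGen.castLE]

lemma crossList_append {n : ℕ} (u v : List (BraidGen n)) :
    crossList (u ++ v) = crossList v ++ crossList u := by
  simp [crossList]

lemma toSkeinLin_word {n : ℕ} (u : List (BraidGen n)) :
    toSkeinLin N K n (Hecke.word N K u) = Skein.of K ⟨_, (crossWord_crossList u).leads⟩ := by
  induction u with
  | nil => exact toSkeinLin_one N K n
  | cons i u ih =>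
    have e : Hecke.word N K (i :: u) = Hecke.sigma N K i * Hecke.word N K u := by
      simp [Hecke.word]
    rw [e, toSkeinLin_mul, ih, toSkeinLin_sigma, Skein.of_comp]
    congr 1
    refine Subtype.ext ?_
    simp [Diagram.comp, crossing, crossList]

/-- The closure of an element of the Hecke algebra. -/
def heckeClosure (N K n : ℕ) : Hecke N K n →ₗ[ℂ] Skein N K [] [] where
  toFun x := skeinClosure (obj N K n) (toSkein N K n x)
  map_add' := map_add (skeinClosure (obj N K n) ∘ₗ (toSkein N K n).toLinearMap)
  map_smul' := map_smul (skeinClosure (obj N K n) ∘ₗ (toSkein N K n).toLinearMap)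

lemma leads_closure {n : ℕ} {y : List Layer} (hy : CrossWord n y) :
    Leads N (cups 0 (rep n) ++ y ++ caps 0 (rep n)) [] [] :=
  ((cupsDiagram N (rep n)).2.append (hy.leads' _)).append (capsDiagram N (rep n)).2

lemma heckeClosure_word {n : ℕ} (u : List (BraidGen n)) :
    heckeClosure N K n (Hecke.word N K u) =
      Skein.of K ⟨_, leads_closure (crossWord_crossList u)⟩ := by
  refine (congrArg (skeinClosure (obj N K n)) (toSkeinLin_word u)).trans ?_
  change (relations N K [] []).mkQ (stack N [] _ [] (stack N [] _ _ (diag (cupsDiagram N (rep n)))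
    (whiskerLin N _ _ _ (diag _))) (diag (capsDiagram N (rep n)))) = _
  rw [whiskerLin_single, stack_diag, stack_diag]
  rfl

lemma Skein.of_ctx {a b c d : List Bool} {A w v B : List Layer} {z : ℂ} (hA : Leads N A a c)
    {hw : Leads N w c d} {hv : Leads N v c d} (hB : Leads N B d b)
    (e : Skein.of K ⟨w, hw⟩ = z • Skein.of K ⟨v, hv⟩) :
    Skein.of K ⟨A ++ w ++ B, (hA.append hw).append hB⟩ =
      z • Skein.of K ⟨A ++ v ++ B, (hA.append hv).append hB⟩ := by
  have := congrArg (fun x => Skein.comp N K a d b (Skein.comp N K a c d (Skein.of K ⟨A, hA⟩) x)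
    (Skein.of K ⟨B, hB⟩)) e
  simp only [map_smul, LinearMap.smul_apply, Skein.of_comp] at this
  exact this

/-- A word of crossings moves past a piece to its right. -/
lemma Skein.of_comm {p : ℕ} {y : List Layer} (hy : CrossWord p y) (g : Piece) {A B : List Layer}
    {a b r : List Bool} (hA : Leads N A a (rep p ++ g.bot N ++ r))
    (h : Leads N (A ++ [(p, g)] ++ y ++ B) a b) (h' : Leads N (A ++ y ++ [(p, g)] ++ B) a b) :
    Skein.of K ⟨_, h⟩ = Skein.of K ⟨_, h'⟩ := by
  induction y generalizing A with
  | nil =>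
    congr 1
    exact Subtype.ext (by simp)
  | cons x y ih =>
    obtain ⟨i, e, rfl, hi⟩ := hy x (by simp)
    have hy' : CrossWord p y := fun z hz => hy z (by simp [hz])
    have hx : ∀ s, Leads N [(i, .cross e)] (rep p ++ s) (rep p ++ s) :=
      fun s => (leads_cross_rep e hi).whisker s
    have hA' : Leads N (A ++ [(i, .cross e)]) a (rep p ++ g.bot N ++ r) := by
      refine hA.append ?_
      rw [List.append_assoc]
      exact hx _
    have hg : Leads N [(p, g)] (rep p ++ g.bot N ++ r) (rep p ++ g.top N ++ r) := by
      have := Layer.leads_mk N (rep p) r g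
      rw [List.length_replicate] at this
      exact ⟨_, this, rfl⟩
    have hB : Leads N (y ++ B) (rep p ++ g.top N ++ r) b := by
      have h1 : Leads N ((A ++ [(p, g)]) ++ ([(i, .cross e)] ++ (y ++ B))) a b := by
        simpa using h
      obtain ⟨c, h2, h3⟩ := leads_append_iff.1 h1
      obtain rfl := h2.unique (hA.append hg)
      obtain ⟨d, h4, h5⟩ := leads_append_iff.1 h3
      have h6 := hx (g.top N ++ r)
      rw [← List.append_assoc] at h6
      obtain rfl := h4.unique h6
      exact h5
    have h1 : Leads N [(i, .cross e), (p, g)] (rep p ++ g.bot N ++ r) (rep p ++ g.top N ++ r) := by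
      refine Leads.append (w := [(i, .cross e)]) (b := rep p ++ g.bot N ++ r) ?_ hg
      rw [List.append_assoc]
      exact hx _
    have h2 : Leads N [(p, g), (i, .cross e)] (rep p ++ g.bot N ++ r) (rep p ++ g.top N ++ r) := by
      refine Leads.append (v := [(i, .cross e)]) hg ?_
      rw [List.append_assoc]
      exact hx _
    have hm : Move N [(i, .cross e), (p, g)] [(p, g), (i, .cross e)] := by
      have := Move.far (N := N) i (p - i - 2) (.cross e) g
      rwa [show i + ((Piece.cross e).top N).length + (p - i - 2) = p by simp [Piece.top]; omega,
        show i + ((Piece.cross e).bot N).length + (p - i - 2) = p by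
          simp [Piece.bot]; omega] at this
    have e1 := Skein.of_ctx (K := K) (z := 1) (hw := h1) (hv := h2) hA hB
      ((Skein.of_eq_of_move ⟨_, h1⟩ ⟨_, h2⟩ hm).trans (one_smul ℂ _).symm)
    have e2 := ih hy' hA' (by simpa using (hA.append h1).append hB) (by simpa using h')
    rw [one_smul] at e1
    refine Eq.trans ?_ ((e1.symm.trans ?_).trans (e2.trans ?_))
    all_goals
      congr 1
      exact Subtype.ext (by simp)

lemma caps_rep_succ (n : ℕ) : caps 0 (rep (n + 1)) = [(n, .cap true)] ++ caps 0 (rep n) := by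
  rw [rep_succ', caps_append]
  simp [caps]

lemma leads_cups_open (n : ℕ) (y : List Layer) (hy : CrossWord n y) :
    Leads N (cups 0 (rep n) ++ y) [] (rep n ++ dual (rep n)) :=
  (cupsDiagram N (rep n)).2.append (hy.leads' _)

/-- Closing an additional strand. -/
lemma heckeClosure_mapLE {n : ℕ} (x : Hecke N K n) :
    heckeClosure N K (n + 1) (Hecke.mapLE N K (Nat.le_succ n) x) =
      qint N K N • heckeClosure N K n x := by
  refine Hecke.eq_of_word (heckeClosure N K (n + 1) ∘ₗ (Hecke.mapLE N K _).toLinearMap)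
    (qint N K N • heckeClosure N K n) (fun u => ?_) x
  have hy := crossWord_crossList u
  rw [LinearMap.comp_apply, AlgHom.toLinearMap_apply, Hecke.mapLE_word, heckeClosure_word,
    LinearMap.smul_apply, heckeClosure_word]
  have hA := leads_cups_open (N := N) n _ (CrossWord.nil n)
  rw [List.append_nil] at hA
  have hcup := leads_cup (N := N) (rep n) (dual (rep n)) true
  have hcap := leads_cap (N := N) (rep n) (dual (rep n)) true
  rw [List.length_replicate] at hcup hcap
  have hcaps := (capsDiagram N (rep n)).2
  have h1 := ((leads_cups_open (N := N) n _ hy).append (hcup.append hcap)).append hcaps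
  have e1 := Skein.of_comm (K := K) hy (.cup true) (A := cups 0 (rep n))
    (B := [(n, .cap true)] ++ caps 0 (rep n)) (r := dual (rep n)) (a := []) (b := [])
    (by simpa [Piece.bot] using hA)
    (by
      have := leads_closure (N := N) (crossWord_crossList (u.map (BraidGen.castLE (Nat.le_succ n))))
      rw [cups_rep_succ, caps_rep_succ, zero_add, crossList_castLE] at this
      exact this) (by simpa [capsDiagram] using h1)
  have e2 := Skein.of_ctx (K := K) (leads_cups_open n _ hy) hcaps
    (Skein.of_circle (K := K) n true ⟨_, hcup.append hcap⟩ ⟨[], rfl⟩ rfl rfl)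
  refine Eq.trans ?_ (e1.trans (Eq.trans ?_ (e2.trans ?_)))
  · congr 1
    refine Subtype.ext ?_
    simp only [crossList_castLE, cups_rep_succ, caps_rep_succ, zero_add, List.append_assoc]
  · congr 1
    exact Subtype.ext (by simp [capsDiagram])
  · congr 2
    exact Subtype.ext (by simp [capsDiagram])

/-- Closing the last strand, if it has only one crossing. -/
lemma heckeClosure_last {n : ℕ} (a b : Hecke N K (n + 1 : ℕ)) :
    heckeClosure N K (n + 2) (Hecke.mapLE N K (Nat.le_succ _) a *
        Hecke.sigma N K (BraidGen.last n) * Hecke.mapLE N K (Nat.le_succ _) b) =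
      qpow N K (((N : ℚ) ^ 2 - 1) / (2 * N)) • heckeClosure N K (n + 1) (a * b) := by
  refine Hecke.eq_of_word (heckeClosure N K (n + 2) ∘ₗ LinearMap.mulRight ℂ
    (Hecke.mapLE N K (Nat.le_succ _) b) ∘ₗ LinearMap.mulRight ℂ (Hecke.sigma N K (BraidGen.last n))
      ∘ₗ (Hecke.mapLE N K _).toLinearMap) (qpow N K (((N : ℚ) ^ 2 - 1) / (2 * N)) •
        heckeClosure N K (n + 1) ∘ₗ LinearMap.mulRight ℂ b) (fun u => ?_) a
  refine Hecke.eq_of_word (heckeClosure N K (n + 2) ∘ₗ LinearMap.mulLeft ℂ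
    (Hecke.mapLE N K (Nat.le_succ _) (Hecke.word N K u) * Hecke.sigma N K (BraidGen.last n))
      ∘ₗ (Hecke.mapLE N K _).toLinearMap) (qpow N K (((N : ℚ) ^ 2 - 1) / (2 * N)) •
        heckeClosure N K (n + 1) ∘ₗ LinearMap.mulLeft ℂ (Hecke.word N K u)) (fun v => ?_) b
  have hu := crossWord_crossList u
  have hv := crossWord_crossList v
  simp only [LinearMap.comp_apply, LinearMap.smul_apply, AlgHom.toLinearMap_apply,
    LinearMap.mulLeft_apply, Hecke.mapLE_word]
  have e3 : Hecke.word N K (u.map (BraidGen.castLE (Nat.le_succ (n + 1)))) *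
      Hecke.sigma N K (BraidGen.last n) * Hecke.word N K (v.map (BraidGen.castLE (Nat.le_succ _))) =
      Hecke.word N K (u.map (BraidGen.castLE (Nat.le_succ _)) ++ [BraidGen.last n] ++
        v.map (BraidGen.castLE (Nat.le_succ _))) := by simp [Hecke.word, mul_assoc]
  have e4 : Hecke.word N K u * Hecke.word N K v = Hecke.word N K (u ++ v) := by simp [Hecke.word]
  have e5 : crossList (u.map (BraidGen.castLE (Nat.le_succ _)) ++ [BraidGen.last n] ++
        v.map (BraidGen.castLE (Nat.le_succ _))) =
      crossList v ++ [(n, .cross true)] ++ crossList u := by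
    rw [crossList_append, crossList_append, crossList_castLE, crossList_castLE, List.append_assoc]
    rfl
  rw [e3, e4, heckeClosure_word, heckeClosure_word]
  have hA := leads_cups_open (N := N) (n + 1) _ (CrossWord.nil (n + 1))
  rw [List.append_nil] at hA
  have hcup := leads_cup (N := N) (rep (n + 1)) (dual (rep (n + 1))) true
  have hcap := leads_cap (N := N) (rep (n + 1)) (dual (rep (n + 1))) true
  rw [List.length_replicate] at hcup hcap
  have hcross : Leads N [(n, .cross true)] (rep (n + 1) ++ true :: false :: dual (rep (n + 1)))
      (rep (n + 1) ++ true :: false :: dual (rep (n + 1))) := by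
    have := (leads_cross_rep (N := N) (i := n) (p := n + 2) true (by omega)).whisker
      (false :: dual (rep (n + 1)))
    rw [rep_succ' (n + 1)] at this
    simpa using this
  have hcaps := (capsDiagram N (rep (n + 1))).2
  have hcurl := (hcup.append hcross).append hcap
  have h0 : Leads N (cups 0 (rep (n + 1)) ++ [(n + 1, .cup true)] ++
      (crossList v ++ [(n, .cross true)] ++ crossList u) ++ ([(n + 1, .cap true)] ++
        caps 0 (rep (n + 1)))) [] [] := by
    have := leads_closure (N := N) (crossWord_crossList (u.map (BraidGen.castLE (Nat.le_succ _)) ++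
      [BraidGen.last n] ++ v.map (BraidGen.castLE (Nat.le_succ _))))
    rw [e5, cups_rep_succ, caps_rep_succ, zero_add] at this
    exact this
  have hv' := leads_cups_open (N := N) (n + 1) _ hv
  have h2 := ((hv'.append hcurl).append (hu.leads' _)).append hcaps
  have h1 := ((hv'.append (hcup.append hcross)).append ((hu.leads' _).append hcap)).append hcaps
  have e1 := Skein.of_comm (K := K) hv (.cup true) (A := cups 0 (rep (n + 1)))
    (B := [(n, .cross true)] ++ crossList u ++ [(n + 1, .cap true)] ++ caps 0 (rep (n + 1)))
    (r := dual (rep (n + 1))) (a := []) (b := [])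
    (by simpa [Piece.bot] using hA) (by simpa using h0) (by simpa [capsDiagram] using h1)
  have e2 := Skein.of_comm (K := K) hu (.cap true)
    (A := cups 0 (rep (n + 1)) ++ crossList v ++ [(n + 1, .cup true), (n, .cross true)])
    (B := caps 0 (rep (n + 1))) (r := dual (rep (n + 1))) (a := []) (b := [])
    (by simpa [Piece.bot] using hv'.append (hcup.append hcross))
    (by simpa [capsDiagram] using h2) (by simpa [capsDiagram] using h1)
  have e6 := Skein.of_ctx (K := K) hv' ((hu.leads' _).append hcaps)
    (Skein.of_curlRight (K := K) n true ⟨_, hcurl⟩ ⟨[], rfl⟩ rfl rfl)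
  rw [if_pos rfl, one_mul] at e6
  refine Eq.trans ?_ (e1.trans (Eq.trans ?_ (e2.symm.trans (Eq.trans ?_ (e6.trans ?_)))))
  · congr 1
    refine Subtype.ext ?_
    change cups 0 (rep (n + 2)) ++ crossList _ ++ caps 0 (rep (n + 2)) = _
    rw [e5, cups_rep_succ 0 (n + 1), caps_rep_succ (n + 1)]
    simp
  · congr 1
    exact Subtype.ext (by simp)
  · congr 1
    exact Subtype.ext (by simp [capsDiagram])
  · congr 2
    exact Subtype.ext (by simp [capsDiagram, crossList_append])

/-! ### Uniqueness of the Markov trace -/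

lemma Hecke.eq_algebraMap {n : ℕ} (hn : n ≤ 1) (x : Hecke N K n) : ∃ c : ℂ, x = c • 1 := by
  induction x using Hecke.induction with
  | one => exact ⟨1, (one_smul _ _).symm⟩
  | add x y hx hy =>
    obtain ⟨c, rfl⟩ := hx
    obtain ⟨d, rfl⟩ := hy
    exact ⟨c + d, (add_smul _ _ _).symm⟩
  | smul z x hx =>
    obtain ⟨c, rfl⟩ := hx
    exact ⟨z * c, (mul_smul _ _ _).symm⟩
  | mul i x hx => exact absurd i.lt (by omega)

/-- Two families of functionals on the Hecke algebras that behave in the same way when a strand is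
added agree. -/
lemma Hecke.eq_of_markov {M : Type*} [AddCommGroup M] [Module ℂ M]
    (φ ψ : ∀ n : ℕ, Hecke N K n →ₗ[ℂ] M) (y z : ℂ) (h0 : φ 0 1 = ψ 0 1)
    (hφ : ∀ n x, φ (n + 1) (Hecke.mapLE N K (Nat.le_succ n) x) = y • φ n x)
    (hψ : ∀ n x, ψ (n + 1) (Hecke.mapLE N K (Nat.le_succ n) x) = y • ψ n x)
    (hφ' : ∀ n a b, φ (n + 2) (Hecke.mapLE N K (Nat.le_succ _) a *
      Hecke.sigma N K (BraidGen.last n) * Hecke.mapLE N K (Nat.le_succ _) b) = z • φ (n + 1) (a * b))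
    (hψ' : ∀ n a b, ψ (n + 2) (Hecke.mapLE N K (Nat.le_succ _) a *
      Hecke.sigma N K (BraidGen.last n) * Hecke.mapLE N K (Nat.le_succ _) b) = z • ψ (n + 1) (a * b))
    (n : ℕ) : φ n = ψ n := by
  induction n with
  | zero =>
    ext x
    obtain ⟨c, rfl⟩ := Hecke.eq_algebraMap (by omega) x
    rw [map_smul, map_smul, h0]
  | succ n ih =>
    cases n with
    | zero =>
      ext x
      obtain ⟨c, rfl⟩ := Hecke.eq_algebraMap le_rfl x
      have h1 := hφ 0 1
      have h2 := hψ 0 1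
      rw [map_one] at h1 h2
      rw [map_smul, map_smul, h1, h2, h0]
    | succ n =>
      refine LinearMap.ext_on (Hecke.span_last N K n) ?_
      rintro _ (⟨a, rfl⟩ | ⟨a, b, rfl⟩)
      · rw [hφ, hψ, ih]
      · rw [hφ', hψ', ih]

/-- The value of a Markov trace on a generator. -/
def sigmaTrace (N K : ℕ) : ℂ :=
  (qpow N K ((N + 1) / (2 * N)))⁻¹ * (qpow N K 1 - (1 + qpow N K 1) * eta N K)

lemma IsMarkovTrace.last {Tr : Hecke N K ⊤ →ₗ[ℂ] ℂ} (h : IsMarkovTrace N K (eta N K) Tr)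
    (hq : qpow N K 1 + 1 ≠ 0) {n : ℕ} (a b : Hecke N K (n + 1 : ℕ)) :
    Tr (Hecke.incl N K (n + 2) (Hecke.mapLE N K (Nat.le_succ _) a *
        Hecke.sigma N K (BraidGen.last n) * Hecke.mapLE N K (Nat.le_succ _) b)) =
      sigmaTrace N K * Tr (Hecke.incl N K (n + 1) (a * b)) := by
  have hm := h.markov n (b * a)
  have e : ∀ x y, Hecke.incl N K (n + 2) (x * y) = Hecke.incl N K _ x * Hecke.incl N K _ y :=
    map_mul _
  rw [e, e, Hecke.incl_mapLE, Hecke.incl_mapLE, Hecke.incl_sigma, h.tracial,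
    ← mul_assoc, ← map_mul (Hecke.incl N K (n + 1)), Hecke.sigma_eq_e hq, mul_smul_comm, mul_sub, mul_smul_comm,
    mul_smul_comm, mul_one, map_smul, map_sub, map_smul, map_smul, smul_eq_mul, smul_eq_mul,
    smul_eq_mul]
  change _ * (_ - _ * Tr (Hecke.incl N K (n + 1) (b * a) * Hecke.e N K (BraidGen.top n))) = _
  rw [hm, map_mul (Hecke.incl N K (n + 1)) a b, h.tracial, ← map_mul (Hecke.incl N K (n + 1)), sigmaTrace]
  ring

lemma IsMarkovTrace.eq {Tr Tr' : Hecke N K ⊤ →ₗ[ℂ] ℂ} (h : IsMarkovTrace N K (eta N K) Tr)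
    (h' : IsMarkovTrace N K (eta N K) Tr') (hq : qpow N K 1 + 1 ≠ 0) : Tr' = Tr := by
  ext x
  obtain ⟨n, x, rfl⟩ := Hecke.exists_incl N K x
  refine congrArg (fun φ => φ x) (Hecke.eq_of_markov
    (fun n => Tr' ∘ₗ (Hecke.incl N K n).toLinearMap) (fun n => Tr ∘ₗ (Hecke.incl N K n).toLinearMap)
    1 (sigmaTrace N K) ?_ ?_ ?_ ?_ ?_ n)
  · simp [h.normalized, h'.normalized]
  · intro n x; simp [Hecke.incl_mapLE]
  · intro n x; simp [Hecke.incl_mapLE]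
  · exact fun n a b => h'.last hq a b
  · exact fun n a b => h.last hq a b

lemma qint_mul_sigmaTrace (hN : 2 ≤ N) (hK : 1 ≤ K) :
    qint N K N * sigmaTrace N K = qpow N K (((N : ℚ) ^ 2 - 1) / (2 * N)) := by
  have hN0 : (N : ℚ) ≠ 0 := by positivity
  have h1 : qpow N K (((N : ℚ) ^ 2 - 1) / (2 * N)) * qpow N K ((N + 1) / (2 * N)) =
      qpow N K (1 / 2) ^ (N + 1) := by
    rw [← qpow_add, ← qpow_natCast_mul]
    congr 1
    push_cast
    field_simp
    ring
  have h2 := qint_N_eq (N := N) (K := K) hN hK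
  have h3 := qint_N_ne_zero hN hK
  have h4 := qpow_one_ne_one hN hK
  have hs := qpow_ne_zero (N := N) (K := K) (1 / 2)
  have ht := qpow_ne_zero (N := N) (K := K) ((N + 1) / (2 * N))
  have hq := qpow_one_add_one_ne hN hK
  have h5 : 1 - qpow N K 1 ^ N ≠ 0 := by
    have : qpow N K 1 ^ N - 1 ≠ 0 := by
      rw [← h2]
      exact mul_ne_zero h3 (mul_ne_zero (pow_ne_zero _ hs) (sub_ne_zero.2 h4))
    rwa [← neg_sub, neg_ne_zero] at this
  rw [sigmaTrace, eta_eq, eq_comm, ← mul_left_inj' ht, h1]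
  rw [add_comm] at hq
  have e : qpow N K 1 - (1 + qpow N K 1) * ((qpow N K 1 - qpow N K 1 ^ N) /
      ((1 + qpow N K 1) * (1 - qpow N K 1 ^ N))) =
      qpow N K 1 ^ N * (1 - qpow N K 1) / (1 - qpow N K 1 ^ N) := by
    field_simp
    ring
  rw [e]
  have e' : qint N K N * ((qpow N K ((N + 1) / (2 * N)))⁻¹ *
      (qpow N K 1 ^ N * (1 - qpow N K 1) / (1 - qpow N K 1 ^ N))) * qpow N K ((N + 1) / (2 * N)) =
      qint N K N * (qpow N K 1 ^ N * (1 - qpow N K 1) / (1 - qpow N K 1 ^ N)) := by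
    rw [mul_comm (qpow N K ((N + 1) / (2 * N)))⁻¹, ← mul_assoc, inv_mul_cancel_right₀ ht]
  rw [e', eq_comm, mul_div_assoc', div_eq_iff h5]
  have h6 : qpow N K 1 ^ N = qpow N K (1 / 2) ^ (N - 1) * qpow N K (1 / 2) ^ (N + 1) := by
    rw [← qpow_half_sq, ← pow_add, ← pow_two, ← pow_mul]
    congr 1
    omega
  linear_combination (qint N K N * (1 - qpow N K 1)) * h6 - qpow N K (1 / 2) ^ (N + 1) * h2

/-- The closure of a braid is a multiple of its Markov trace. -/
lemma heckeClosure_eq (hN : 2 ≤ N) (hK : 1 ≤ K) {Tr : Hecke N K ⊤ →ₗ[ℂ] ℂ}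
    (h : IsMarkovTrace N K (eta N K) Tr) {n : ℕ} (x : Hecke N K n) :
    heckeClosure N K n x =
      (qint N K N ^ n * Tr (Hecke.incl N K n x)) • Skein.of K (Diagram.id N []) := by
  refine congrArg (fun φ => φ x) (Hecke.eq_of_markov (heckeClosure N K)
    (fun n => (qint N K N ^ n • Tr ∘ₗ (Hecke.incl N K n).toLinearMap).smulRight
      (Skein.of K (Diagram.id N []))) (qint N K N) (qpow N K (((N : ℚ) ^ 2 - 1) / (2 * N)))
    ?_ (fun _ => heckeClosure_mapLE) ?_ (fun _ => heckeClosure_last) ?_ n)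
  · have := heckeClosure_word (N := N) (K := K) (n := 0) []
    simp only [Hecke.word, List.map_nil, List.prod_nil] at this
    rw [this]
    simp [h.normalized]
    rfl
  · intro n x
    simp only [LinearMap.smulRight_apply, LinearMap.smul_apply, LinearMap.comp_apply,
      AlgHom.toLinearMap_apply, Hecke.incl_mapLE, smul_smul, smul_eq_mul]
    congr 1
    ring
  · intro n a b
    simp only [LinearMap.smulRight_apply, LinearMap.smul_apply, LinearMap.comp_apply,
      AlgHom.toLinearMap_apply, smul_smul, smul_eq_mul]
    rw [h.last (qpow_one_add_one_ne hN hK), ← qint_mul_sigmaTrace hN hK]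
    congr 1
    ring

end Closure

end

section

/-! ### The null ideal and the negligible skeins -/

section Null

variable {N K : ℕ}

lemma Hecke.adj_adj {n : ℕ∞} (x : Hecke N K n) : Hecke.adj (Hecke.adj x) = x := by
  induction x using Hecke.induction with
  | one => simp
  | add x y hx hy => rw [Hecke.adj_add, Hecke.adj_add, hx, hy]
  | smul c x hx => rw [Hecke.adj_smul, Hecke.adj_smul, hx, Complex.conj_conj]
  | mul i x hx =>
    rw [Hecke.adj_mul, Hecke.adj_mul, hx, Hecke.adj_sigma]
    congr 1
    have h1 := congrArg Hecke.adj (Hecke.sigma_mul_inv N K i)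
    rw [Hecke.adj_mul, Hecke.adj_sigma, Hecke.adj_one] at h1
    have h2 : Hecke.braid N K n (PresentedGroup.of i)⁻¹ * Hecke.sigma N K i = 1 := by
      rw [Hecke.sigma, ← map_mul, inv_mul_cancel, map_one]
    exact left_inv_eq_right_inv h1 h2

variable {Tr : Hecke N K ⊤ →ₗ[ℂ] ℂ}
  (hpos : ∀ x, 0 ≤ (Tr (Hecke.adj x * x)).re ∧ (Tr (Hecke.adj x * x)).im = 0)

include hpos in
/-- A form of the Cauchy–Schwarz inequality. -/
lemma mem_nullSet_iff {x : Hecke N K ⊤} : x ∈ nullSet Tr ↔ ∀ y, Tr (y * x) = 0 := by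
  refine ⟨fun hx y => ?_, fun h => h _⟩
  rw [← Hecke.adj_adj y]
  set v := Hecke.adj y
  have key : ∀ z : ℂ, z * Tr (Hecke.adj v * x) + (starRingEnd ℂ) z * Tr (Hecke.adj x * v) = 0 := by
    intro z
    have exp : ∀ t : ℝ, Tr (Hecke.adj (v + ((t : ℂ) * z) • x) * (v + ((t : ℂ) * z) • x)) =
        Tr (Hecke.adj v * v) + t * (z * Tr (Hecke.adj v * x) +
          (starRingEnd ℂ) z * Tr (Hecke.adj x * v)) := by
      intro t
      have hx' : Tr (Hecke.adj x * x) = 0 := hx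
      rw [Hecke.adj_add, Hecke.adj_smul, map_mul (starRingEnd ℂ), Complex.conj_ofReal]
      simp only [add_mul, mul_add, smul_mul_assoc, mul_smul_comm, map_add, map_smul, smul_eq_mul,
        hx']
      ring
    set w := z * Tr (Hecke.adj v * x) + (starRingEnd ℂ) z * Tr (Hecke.adj x * v)
    have him : w.im = 0 := by
      have h1 := (hpos (v + (((1 : ℝ) : ℂ) * z) • x)).2
      rw [exp] at h1
      simpa [(hpos v).2] using h1
    have hre : w.re = 0 := by
      by_contra hne
      have h1 := (hpos (v + (((-((Tr (Hecke.adj v * v)).re + 1) / w.re : ℝ) : ℂ) * z) • x)).1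
      rw [exp, Complex.add_re, Complex.re_ofReal_mul, div_mul_cancel₀ _ hne] at h1
      linarith
    exact Complex.ext hre him
  have h1 := key 1
  have h2 := key Complex.I
  rw [map_one, one_mul, one_mul] at h1
  rw [Complex.conj_I] at h2
  have h3 : 2 * Complex.I * Tr (Hecke.adj v * x) = 0 := by linear_combination Complex.I * h1 + h2
  simpa using h3

include hpos in
lemma coe_nullIdeal : (nullIdeal Tr : Set (Hecke N K ⊤)) = nullSet Tr := by
  refine Set.Subset.antisymm (fun x hx => ?_) Submodule.subset_span
  rw [mem_nullSet_iff hpos]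
  refine Submodule.span_induction (p := fun x _ => ∀ y, Tr (y * x) = 0) (fun x hx =>
    (mem_nullSet_iff hpos).1 hx) (by simp) (fun x y _ _ hx hy z => ?_) (fun h x _ hx z => ?_) hx
  · rw [mul_add, map_add, hx, hy, add_zero]
  · rw [smul_eq_mul, ← mul_assoc, hx]

lemma skein_id_ne_zero (hN : 2 ≤ N) (hK : 1 ≤ K) :
    (Skein.of K (Diagram.id N []) : Skein N K [] []) ≠ 0 := by
  obtain ⟨φ, hφ⟩ := exists_skein_functional hN hK
  intro h
  rw [h, map_zero] at hφ
  exact zero_ne_one hφ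

lemma toSkein_surjective (hN : 2 ≤ N) (n : ℕ) : Function.Surjective (toSkein N K n) :=
  toSkeinLin_surjective (by omega) n

lemma mem_negligible_iff_forall (hN : 2 ≤ N) (hK : 1 ≤ K) (hT : IsMarkovTrace N K (eta N K) Tr)
    {n : ℕ} (x : Hecke N K n) : toSkein N K n x ∈ negligible (obj N K n) (obj N K n) ↔
      ∀ y : Hecke N K n, Tr (Hecke.incl N K n y * Hecke.incl N K n x) = 0 := by
  have e : ∀ y, pairing (toSkein N K n x) (toSkein N K n y) = heckeClosure N K n (y * x) := by
    intro y
    change _ = skeinClosure (obj N K n) (toSkein N K n (y * x))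
    rw [map_mul]
    rfl
  have e2 : ∀ y, heckeClosure N K n (y * x) = 0 ↔
      Tr (Hecke.incl N K n y * Hecke.incl N K n x) = 0 := by
    intro y
    rw [heckeClosure_eq hN hK hT, smul_eq_zero_iff_left (skein_id_ne_zero hN hK), ← map_mul,
      mul_eq_zero_iff_left (pow_ne_zero _ (qint_N_ne_zero hN hK))]
  constructor
  · intro h y
    exact (e2 y).1 ((e y).symm.trans (h (toSkein N K n y)))
  · intro h g
    obtain ⟨y, rfl⟩ := toSkein_surjective hN n g
    exact (e y).trans ((e2 y).2 (h y))

include hpos in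
lemma mem_negligible_iff (hN : 2 ≤ N) (hK : 1 ≤ K) (hT : IsMarkovTrace N K (eta N K) Tr)
    {n : ℕ} (x : Hecke N K n) : toSkein N K n x ∈ negligible (obj N K n) (obj N K n) ↔
      Hecke.incl N K n x ∈ nullSet Tr := by
  rw [mem_negligible_iff_forall hN hK hT]
  refine ⟨fun h => ?_, fun h y => (mem_nullSet_iff hpos).1 h _⟩
  have := h (Hecke.adj x)
  rwa [Hecke.incl_adj] at this

include hpos in
lemma gnsRep_eq_zero_iff (hT : IsMarkovTrace N K (eta N K) Tr) {n : ℕ} (x : Hecke N K n) :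
    gnsRep Tr n x = 0 ↔ Hecke.incl N K n x ∈ nullSet Tr := by
  have hmem : ∀ y, (nullIdeal Tr).mkQ y = 0 ↔ y ∈ nullSet Tr := by
    intro y
    rw [← coe_nullIdeal hpos, SetLike.mem_coe, Submodule.mkQ_apply, Submodule.Quotient.mk_eq_zero]
  constructor
  · intro h
    have h1 := congrArg (fun f : Module.End ℂ (gnsSub Tr n) =>
      (f ⟨(nullIdeal Tr).mkQ (Hecke.incl N K n 1), 1, rfl⟩ : GNS Tr)) h
    have h2 : Hecke.incl N K n x • (nullIdeal Tr).mkQ (Hecke.incl N K n 1) = 0 := h1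
    rw [← map_smul, hmem, smul_eq_mul, map_one, mul_one] at h2
    exact h2
  · intro h
    refine LinearMap.ext fun v => Subtype.ext ?_
    obtain ⟨_, y, rfl⟩ := v
    change Hecke.incl N K n x • (nullIdeal Tr).mkQ (Hecke.incl N K n y) = 0
    rw [← map_smul, hmem, mem_nullSet_iff hpos]
    intro z
    rw [smul_eq_mul, ← mul_assoc, hT.tracial, ← mul_assoc]
    exact (mem_nullSet_iff hpos).1 h _

/-- An algebra homomorphism that vanishes on the kernel of a surjective one factors through it. -/
lemma exists_algHom_of_surjective {A B C : Type*} [Ring A] [Ring B] [Ring C] [Algebra ℂ A]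
    [Algebra ℂ B] [Algebra ℂ C] (f : A →ₐ[ℂ] B) (hf : Function.Surjective f) (g : A →ₐ[ℂ] C)
    (h : ∀ x, f x = 0 → g x = 0) : ∃ φ : B →ₐ[ℂ] C, ∀ x, φ (f x) = g x := by
  have key : ∀ x y, f x = f y → g x = g y := fun x y hxy => by
    rw [← sub_eq_zero, ← map_sub]
    exact h _ (by rw [map_sub, hxy, sub_self])
  choose σ hσ using hf
  refine ⟨AlgHom.ofLinearMap
    { toFun := fun b => g (σ b)
      map_add' := fun a b => by rw [← map_add]; exact key _ _ (by simp [hσ])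
      map_smul' := fun c a => by
        rw [RingHom.id_apply, ← map_smul]; exact key _ _ (by simp [hσ]) } ?_ ?_, fun x => ?_⟩
  · exact (key _ _ (by simp [hσ])).trans (map_one g)
  · intro a b
    exact (key _ _ (by simp [hσ])).trans (map_mul g _ _)
  · exact key _ _ (hσ _)

include hpos in
lemma exists_purified_hom (hN : 2 ≤ N) (hK : 1 ≤ K) (hT : IsMarkovTrace N K (eta N K) Tr) (n : ℕ) :
    ∃ Φ : Purified N K n →ₐ[ℂ] Module.End ℂ (gnsSub Tr n),
      ∀ x, Φ (purify N K n (toSkein N K n x)) = gnsRep Tr n x := by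
  obtain ⟨φ, hφ⟩ := exists_algHom_of_surjective (C := Module.End ℂ (gnsSub Tr n))
    (toSkein N K n) (toSkein_surjective hN n) (gnsRep Tr n) fun x hx => by
      rw [gnsRep_eq_zero_iff hpos hT, ← mem_negligible_iff hpos hN hK hT, hx]
      exact Submodule.zero_mem _
  refine ⟨RingQuot.liftAlgHom ℂ ⟨φ, fun f g h => ?_⟩, fun x => ?_⟩
  · obtain ⟨x, rfl⟩ := toSkein_surjective hN n f
    obtain ⟨y, rfl⟩ := toSkein_surjective hN n g
    rw [← map_sub, mem_negligible_iff hpos hN hK hT, ← gnsRep_eq_zero_iff hpos hT] at h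
    have h' := map_add (gnsRep Tr n) (x - y) y
    rw [sub_add_cancel, h, zero_add] at h'
    rw [hφ, hφ, h']
  · rw [← hφ]
    exact RingQuot.liftAlgHom_mkAlgHom_apply ..

include hpos in
lemma purify_eq_zero_iff (hN : 2 ≤ N) (hK : 1 ≤ K) (hT : IsMarkovTrace N K (eta N K) Tr) (n : ℕ)
    (f : SkeinAlg N K n) : purify N K n f = 0 ↔ f ∈ negligible (obj N K n) (obj N K n) := by
  constructor
  · intro h
    obtain ⟨Φ, hΦ⟩ := exists_purified_hom hpos hN hK hT n
    obtain ⟨x, rfl⟩ := toSkein_surjective hN n f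
    rw [mem_negligible_iff hpos hN hK hT, ← gnsRep_eq_zero_iff hpos hT, ← hΦ, h, map_zero]
  · intro h
    rw [← map_zero (purify N K n)]
    exact RingQuot.mkAlgHom_rel ℂ (by rwa [sub_zero])

lemma purify_toSkein_surjective (hN : 2 ≤ N) (n : ℕ) :
    Function.Surjective fun x => purify N K n (toSkein N K n x) :=
  (RingQuot.mkAlgHom_surjective ℂ _).comp (toSkein_surjective hN n)

include hpos in
lemma existsUnique_purified_equiv (hN : 2 ≤ N) (hK : 1 ≤ K) (hT : IsMarkovTrace N K (eta N K) Tr)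
    (n : ℕ) : ∃! Ψ : Purified N K n ≃ₐ[ℂ] (gnsRep Tr n).range,
      ∀ x : Hecke N K n,
        (Ψ (purify N K n (toSkein N K n x)) : Module.End ℂ (gnsSub Tr n)) = gnsRep Tr n x := by
  obtain ⟨Φ, hΦ⟩ := exists_purified_hom hpos hN hK hT n
  have hsurj := purify_toSkein_surjective (K := K) hN n
  have hmem : ∀ z, Φ z ∈ (gnsRep Tr n).range := by
    intro z
    obtain ⟨x, rfl⟩ := hsurj z
    exact ⟨x, (hΦ x).symm⟩
  have hbij : Function.Bijective (Φ.codRestrict (gnsRep Tr n).range hmem) := by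
    refine ⟨(injective_iff_map_eq_zero _).2 fun z hz => ?_, ?_⟩
    · obtain ⟨x, rfl⟩ := hsurj z
      have h1 : Φ (purify N K n (toSkein N K n x)) = 0 := congrArg Subtype.val hz
      rw [hΦ, gnsRep_eq_zero_iff hpos hT, ← mem_negligible_iff hpos hN hK hT] at h1
      exact (purify_eq_zero_iff hpos hN hK hT n _).2 h1
    · rintro ⟨_, x, rfl⟩
      exact ⟨purify N K n (toSkein N K n x), Subtype.ext (hΦ x)⟩
  refine ⟨AlgEquiv.ofBijective _ hbij, hΦ, fun Ψ hΨ => ?_⟩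
  ext1 z
  obtain ⟨x, rfl⟩ := hsurj z
  exact Subtype.ext ((hΨ x).trans (hΦ x).symm)

lemma exists_evaluation (hN : 2 ≤ N) (hK : 1 ≤ K) :
    ∃ ev : SkeinAlg N K 0 ≃ₐ[ℂ] ℂ, ∀ z : ℂ, ev (z • (1 : SkeinAlg N K 0)) = z := by
  have h1 : (1 : SkeinAlg N K 0) ≠ 0 := skein_id_ne_zero hN hK
  have hbij : Function.Bijective (Algebra.ofId ℂ (SkeinAlg N K 0)) := by
    refine ⟨(injective_iff_map_eq_zero _).2 fun z hz => ?_, fun f => ?_⟩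
    · rw [Algebra.ofId_apply, Algebra.algebraMap_eq_smul_one] at hz
      exact (smul_eq_zero.1 hz).resolve_right h1
    · obtain ⟨x, rfl⟩ := toSkein_surjective hN 0 f
      obtain ⟨c, rfl⟩ := Hecke.eq_algebraMap (by omega) x
      refine ⟨c, ?_⟩
      rw [map_smul, map_one, Algebra.ofId_apply, Algebra.algebraMap_eq_smul_one]
  refine ⟨(AlgEquiv.ofBijective _ hbij).symm, fun z => ?_⟩
  rw [AlgEquiv.symm_apply_eq]
  exact (Algebra.algebraMap_eq_smul_one z).symm

end Null

end

end SkeinSU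

end

theorem mainTheorem7 (N K : ℕ) (hN : 2 ≤ N) (hK : 1 ≤ K) :
    ∃ (Tr : Hecke N K ⊤ →ₗ[ℂ] ℂ) (ev : SkeinAlg N K 0 ≃ₐ[ℂ] ℂ),
      -- `Tr` is the unique Markov trace with parameter `η`, and it is a state
      IsMarkovTrace N K (eta N K) Tr ∧
      (∀ Tr' : Hecke N K ⊤ →ₗ[ℂ] ℂ, IsMarkovTrace N K (eta N K) Tr' → Tr' = Tr) ∧
      (∀ x : Hecke N K ⊤, 0 ≤ (Tr (Hecke.adj x * x)).re ∧ (Tr (Hecke.adj x * x)).im = 0) ∧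
      -- its null set is a left ideal
      (nullIdeal Tr : Set (Hecke N K ⊤)) = nullSet Tr ∧
      -- the normalized skein trace agrees with `Tr`
      (∀ (n : ℕ) (x : Hecke N K n),
        ev (skeinClosure (obj N K n) (toSkein N K n x)) =
          qint N K N ^ n * Tr (Hecke.incl N K n x)) ∧
      -- the negligible skeins are the elements of the null set
      (∀ (n : ℕ) (x : Hecke N K n),
        toSkein N K n x ∈ negligible (obj N K n) (obj N K n) ↔
          Hecke.incl N K n x ∈ nullSet Tr) ∧
      (∀ (n : ℕ) (f : SkeinAlg N K n),
        purify N K n f = 0 ↔ f ∈ negligible (obj N K n) (obj N K n)) ∧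
      -- the canonical isomorphism
      ∀ n : ℕ, ∃! Ψ : Purified N K n ≃ₐ[ℂ] (gnsRep Tr n).range,
        ∀ x : Hecke N K n,
          (Ψ (purify N K n (toSkein N K n x)) : Module.End ℂ (gnsSub Tr n)) = gnsRep Tr n x := by
  obtain ⟨Tr, hT, hpos⟩ := exists_markovTrace hN hK
  obtain ⟨ev, hev⟩ := exists_evaluation hN hK
  exact ⟨Tr, ev, hT, fun Tr' hT' => hT.eq hT' (qpow_one_add_one_ne hN hK), hpos, coe_nullIdeal hpos,
    fun n x => (congrArg ev (heckeClosure_eq hN hK hT x)).trans (hev _),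
    fun n x => mem_negligible_iff hpos hN hK hT x, purify_eq_zero_iff hpos hN hK hT,
    existsUnique_purified_equiv hpos hN hK hT⟩
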